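/- **Setting.** Let $0<\alpha\le 1$ and $1<\lambda\le\Lambda<\infty$. Let $T_a:[0,1]\to[0,1]$, $a\in[0,1]$, be maps with partition points $0=b_0(a)<b_1(a)<\dots<b_{p_0}(a)=1$ such that, on every $(b_{k-1}(a),b_k(a))$, $T_a$ is differentiable, $\lambda\le|T_a'|\le\Lambda$, and $T_a'$ is $\alpha$-Hölder with a constant independent of $a$ and $k$. Assume moreover: (i) each $b_k$ is Lipschitz on $[0,1]$; (ii) if $x\in[0,1]$ and $J\subset[0,1]$ is an interval with $b_k(a)\ne x$ for all $a\in J$ and all $k$, then $a\mapsto T_a(x)$ is $C^{1+\alpha}$ and $a\mapsto\partial_xT_a(x)$ is $\alpha$-Hölder on $J$, with constants independent of $x$ and $J$; and $x\mapsto\partial_aT_a(x)$ is $\alpha$-Hölder on each $(b_{k-1}(a),b_k(a))$, uniformly in $a$; each $T_a$ has exactly one absolutely continuous invariant probability $\mu_a$; write $h_a=d\mu_a/dx$ and $K(a)=\operatorname{supp}\mu_a$; (iii) $K(a)\setminus\{b_0(a),\dots,b_{p_0}(a)\}$ has exactly $p_1$ connected components for every $a\in[0,1]$, and their boundary points are $\alpha$-Hölder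 in $a$. Let $x_0:[0,1]\to[0,1]$ be $C^{1+\alpha}$ with $x_0(a)\in K(a)\setminus\{b_0(a),\dots,b_{p_0}(a)\}$ for all $a\in(0,1)$, and set $x_j(a)=T_a^j(x_0(a))$. For an interval $J\subset[0,1]$ let $\mathcal P_0|J=\{J\}$ and, for $j\ge1$, let $\mathcal P_j|J$ be the set of the maximal nonempty open intervals $\omega\subset J$ such that $x_i(a)\in K(a)\setminus\{b_0(a),\dots,b_{p_0}(a)\}$ for all $a\in\omega$ and $0\le i<j$; here maximal means that every open interval $\tilde\omega$ with $\omega\subsetneq\tilde\omega\subset J$ contains some $a$ with $x_i(a)\in\{b_0(a),\dots,b_{p_0}(a)\}$ for some $0\le i<j$. Fix $A>0$. For $\varphi\in L^1([0,1])$ let $\operatorname{osc}(\varphi,\delta,x)$ be the essential supremum minus the essential infimum of $\varphi$ on $(x-\delta,x+\delta)\cap[0,1]$, let $|\varphi|_\alpha=\sup_{0<\delta\le A}\delta^{-\alpha}\int_0^1\operatorname{osc}(\varphi,\delta,x)\,dx$ and $\|\varphi\|_\alpha=|\varphi|_\alpha+\|\varphi\|_{L^1}$, and let $V_\alpha=\{\varphi:|\varphi|_\alpha<\infty\}$.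 Let $\mathcal L_a\varphi(x)=\sum_{T_a(y)=x}\varphi(y)/|T_a'(y)|$, where partition points $y$ are left out. Assume: (I) The limits $x_j'(0+)=\lim_{a\to0+}x_j'(a)$ and $(T_0^j)'(x_0(0+))=\lim_{a\to0+}(T_a^j)'(x_0(a))$ exist for $j\ge1$, and there is $C\ge1$ such that $C^{-1}\le|x_j'(0+)/(T_0^j)'(x_0(0+))|\le C$ for all $j\ge1$; and for each $j\ge1$, for all sufficiently small $a>0$, none of the points $x_i(a)$, $0\le i<j$, is a partition point of $T_a$. (II) $T_0$ is topologically mixing on $K(0)$: for all open $U,V$ that meet $K(0)$ there is $N$ such that for every $n\ge N$ some $x\in U\cap K(0)$ has $T_0^n(x)\in V$ and $T_0^i(x)\notin\{b_0(0),\dots,b_{p_0}(0)\}$ for $0\le i<n$ (the values at partition points, which are immaterial, are disregarded). Further, there are $\epsilon>0$, $C\ge1$ and $0<\tilde\rho<1$ such that $\|\mathcal L_a^n\varphi\|_\alpha\le C\tilde\rho^n\|\varphi\|_\alpha+C\|\varphi\|_{L^1}$ for all $a\in[0,\epsilon]$, $n\ge1$, $\varphi\in V_\alpha$. (III) There is $\epsilon>0$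 such that for every $\delta>0$ there is a $C$ with $\sum_{\omega\in\mathcal P_n|[0,\epsilon]}1/\|x_n'|_\omega\|_\infty\le Ce^{n^{\delta}}$ for all $n\ge1$. For $\varphi\in V_\alpha$ let $\sigma_a(\varphi)\ge0$ be given by $$\sigma_a(\varphi)^2=\int\Big(\varphi-\int\varphi\,d\mu_a\Big)^2d\mu_a+2\sum_{i\ge1}\int\Big(\varphi-\int\varphi\,d\mu_a\Big)\Big(\varphi-\int\varphi\,d\mu_a\Big)\circ T_a^i\,d\mu_a .$$ Fix $\varphi\in V_\alpha$ with $\sigma_0(\varphi)>0$, and put $\xi_k(a)=\big(\varphi(x_k(a))-\int\varphi\,d\mu_a\big)/\sigma_a(\varphi)$. For $\epsilon>0$ call a pair $(\rho,\kappa)$ with $0<\rho<1$ and $\kappa>0$ *admissible on* $[0,\epsilon]$ if, with some constant $C$: - for all $a\in[0,\epsilon]$, $f\in V_\alpha$, $\psi\in L^1([0,1])$ and $n\ge1$, $\big|\int_0^1 f\cdot\psi\circ T_a^n\,dx-\int_0^1f\,dx\int\psi\,d\mu_a\big|\le C\|f\|_\alpha\|\psi\|_{L^1}\rho^n$; - $\|h_0-h_a\|_{L^1}\le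 Ca^\kappa$ for all $a\in[0,\epsilon]$; - $|\sigma_a(\varphi)-\sigma_{a'}(\varphi)|\le C|a-a'|^\kappa$ for all $a,a'\in[0,\epsilon]$. **Proposition 5.1.** There is $\epsilon_0\in(0,1]$ such that $\sigma_a(\varphi)>0$ for all $a\in[0,\epsilon_0]$, such that some pair $(\rho,\kappa)$ is admissible on $[0,\epsilon_0]$, and such that the following holds for every $0<\epsilon\le\epsilon_0$ and every pair $(\rho,\kappa)$ admissible on $[0,\epsilon]$. Let $$\lambda_0=\min\big(\lambda^{\min(\alpha/3,\kappa/2)},\rho^{-1/2}\big)$$ and let $\eta>0$ satisfy $(p_1\Lambda/\lambda)^\eta\le\lambda_0$. Then there is a constant $C$ such that for all integers $m\ge1$ and $1\le n\le\eta m/2$ the function $\big(\sum_{k=m}^{m+n-1}\xi_k\big)^2$ is integrable on $[0,\epsilon]$, $$\Big|\frac1\epsilon\int_0^\epsilon\Big(\sum_{k=m}^{m+n-1}\xi_k(a)\Big)^2da-n\Big|\le C,$$ and, for every integer $v\ge0$ with $|v-(m-m^{1/4})|<1$ and every $\omega\in\mathcal P_v|[0,\epsilon]$ with $\lambda_0^{-m^{1/4}}\le|x_v(\omega)|\le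 n^{-3/\alpha}$, $$\Big|\frac1{|\omega|}\int_\omega\Big(\sum_{k=m}^{m+n-1}\xi_k(a)\Big)^2da-n\Big|\le C .$$ -/

import Mathlib

open MeasureTheory Set Filter Topology
open scoped ENNReal

noncomputable section

/-! ### Absolutely continuous invariant probabilities -/

/-- `ν` is an absolutely continuous invariant probability (acip) of the interval map
`S : [0,1] → [0,1]` (only the values of `S` on `[0,1]` matter, since `ν` lives there). -/
structure IsAcip (S : ℝ → ℝ) (ν : Measure ℝ) : Prop where
  prob : IsProbabilityMeasure ν
  ac : ν ≪ volume.restrict (Icc (0 : ℝ) 1)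
  invariant : ∀ B : Set ℝ, MeasurableSet B → ν (S ⁻¹' B) = ν B

/-- The set of connected components of a set of reals. -/
def components (S : Set ℝ) : Set (Set ℝ) := (fun x => connectedComponentIn S x) '' S

/-! ### Piecewise expanding one-parameter families -/

/-- A one-parameter family `T a : [0,1] → [0,1]`, `a ∈ [0,1]`, of piecewise `C^{1+α}`,
uniformly expanding maps with partition points `0 = b 0 a < ... < b p₀ a = 1`, regular dependence
on the parameter, a unique acip `μ a` for every `a`, and `p₁` monotonicity intervals on the support
of `μ a`, whose boundary points are Hölder continuous in `a`.
The values of the functions outside of `[0,1]` are irrelevant. -/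
structure ExpandingFamily (α lam Lam : ℝ) (p₀ p₁ : ℕ) where
  /-- the map `x ↦ T a x` with parameter `a` -/
  T : ℝ → ℝ → ℝ
  /-- the partition point `b k a`, for `k ≤ p₀` -/
  b : ℕ → ℝ → ℝ
  /-- the acip of `T a` -/
  μ : ℝ → Measure ℝ
  α_pos : 0 < α
  α_le_one : α ≤ 1
  one_lt_lam : 1 < lam
  lam_le_Lam : lam ≤ Lam
  mapsTo : ∀ a ∈ Icc (0 : ℝ) 1, MapsTo (T a) (Icc 0 1) (Icc 0 1)
  b_zero : ∀ a ∈ Icc (0 : ℝ) 1, b 0 a = 0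
  b_last : ∀ a ∈ Icc (0 : ℝ) 1, b p₀ a = 1
  b_lt : ∀ a ∈ Icc (0 : ℝ) 1, ∀ k < p₀, b k a < b (k + 1) a
  /-- piecewise `C^{1+α}`, with uniform Hölder constants -/
  differentiable : ∀ a ∈ Icc (0 : ℝ) 1, ∀ k < p₀, ∀ x ∈ Ioo (b k a) (b (k + 1) a),
    DifferentiableAt ℝ (T a) x
  holder : ∃ C : ℝ, ∀ a ∈ Icc (0 : ℝ) 1, ∀ k < p₀,
    ∀ x ∈ Ioo (b k a) (b (k + 1) a), ∀ y ∈ Ioo (b k a) (b (k + 1) a),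
      |deriv (T a) x - deriv (T a) y| ≤ C * |x - y| ^ α
  /-- uniform expansion, and uniform bound of the derivative -/
  expanding : ∀ a ∈ Icc (0 : ℝ) 1, ∀ k < p₀, ∀ x ∈ Ioo (b k a) (b (k + 1) a),
    lam ≤ |deriv (T a) x| ∧ |deriv (T a) x| ≤ Lam
  /-- the partition points are Lipschitz in the parameter -/
  b_lipschitz : ∃ L : ℝ, ∀ k ≤ p₀, ∀ a ∈ Icc (0 : ℝ) 1, ∀ a' ∈ Icc (0 : ℝ) 1,
    |b k a - b k a'| ≤ L * |a - a'|
  /-- on parameter intervals `J` on which `x` is not a partition point, `a ↦ T a x` is `C^{1+α}` and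
  `a ↦ ∂ₓ T a x` is `α`-Hölder, with constants independent of `x` (and `J`) -/
  param_regular : ∃ C : ℝ, ∀ x ∈ Icc (0 : ℝ) 1, ∀ J : Set ℝ, J ⊆ Icc 0 1 → J.OrdConnected →
    (∀ a ∈ J, ∀ k ≤ p₀, b k a ≠ x) →
      (∀ a ∈ J, DifferentiableWithinAt ℝ (fun t => T t x) (Icc 0 1) a) ∧
      ∀ a ∈ J, ∀ a' ∈ J,
        |derivWithin (fun t => T t x) (Icc 0 1) a - derivWithin (fun t => T t x) (Icc 0 1) a'|
          ≤ C * |a - a'| ^ α ∧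
        |deriv (T a) x - deriv (T a') x| ≤ C * |a - a'| ^ α
  /-- `x ↦ ∂ₐ T a x` is `α`-Hölder on each monotonicity interval, uniformly in `a` -/
  param_deriv_holder : ∃ C : ℝ, ∀ a ∈ Icc (0 : ℝ) 1, ∀ k < p₀,
    ∀ x ∈ Ioo (b k a) (b (k + 1) a), ∀ y ∈ Ioo (b k a) (b (k + 1) a),
      |derivWithin (fun t => T t x) (Icc 0 1) a - derivWithin (fun t => T t y) (Icc 0 1) a|
        ≤ C * |x - y| ^ α
  /-- `μ a` is the one and only acip of `T a` -/
  acip : ∀ a ∈ Icc (0 : ℝ) 1, ∀ ν : Measure ℝ, IsAcip (T a) ν ↔ ν = μ a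
  /-- `supp (μ a)` minus the partition points has exactly `p₁` connected components, for every `a`,
  and their boundary points are `α`-Hölder in `a` -/
  support_regular : ∃ (l r : Fin p₁ → ℝ → ℝ) (C : ℝ),
    (∀ k, ∀ a ∈ Icc (0 : ℝ) 1, ∀ a' ∈ Icc (0 : ℝ) 1,
      |l k a - l k a'| ≤ C * |a - a'| ^ α ∧ |r k a - r k a'| ≤ C * |a - a'| ^ α) ∧
    ∀ a ∈ Icc (0 : ℝ) 1, ∃ D : Fin p₁ → Set ℝ, Function.Injective D ∧
      range D = components ((μ a).support \ {x | ∃ k ≤ p₀, x = b k a}) ∧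
      ∀ k, IsGLB (D k) (l k a) ∧ IsLUB (D k) (r k a)

/-! ### Functions of generalised bounded variation on `[0,1]` -/

/-- `osc(φ, δ, x)`: essential supremum minus essential infimum of `φ` on
`(x - δ, x + δ) ∩ [0,1]`, for `x ∈ [0,1]` and `δ > 0`. -/
def osc (φ : ℝ → ℝ) (δ x : ℝ) : ℝ≥0∞ :=
  (essSup (fun y => (φ y : EReal)) (volume.restrict (Ioo (x - δ) (x + δ) ∩ Icc 0 1)) -
    essInf (fun y => (φ y : EReal)) (volume.restrict (Ioo (x - δ) (x + δ) ∩ Icc 0 1))).toENNReal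

/-- The seminorm `|φ|_α = sup_{0 < δ ≤ A} δ^{-α} ∫₀¹ osc(φ, δ, x) dx`. -/
def gbvSeminorm (α A : ℝ) (φ : ℝ → ℝ) : ℝ≥0∞ :=
  ⨆ δ ∈ Ioc 0 A, ENNReal.ofReal (δ ^ (-α)) * ∫⁻ x in Icc 0 1, osc φ δ x

/-- The `L¹([0,1])` norm. -/
def l1Norm (φ : ℝ → ℝ) : ℝ≥0∞ := ∫⁻ x in Icc 0 1, ‖φ x‖ₑ

/-- The norm `‖φ‖_α = |φ|_α + ‖φ‖_{L¹}`. -/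
def gbvNorm (α A : ℝ) (φ : ℝ → ℝ) : ℝ≥0∞ := gbvSeminorm α A φ + l1Norm φ

/-- `φ` belongs to the space `V_α`. -/
def MemGBV (α A : ℝ) (φ : ℝ → ℝ) : Prop :=
  IntegrableOn φ (Icc 0 1) ∧ gbvSeminorm α A φ < ∞

namespace ExpandingFamily

variable {α lam Lam : ℝ} {p₀ p₁ : ℕ} (F : ExpandingFamily α lam Lam p₀ p₁)

/-- The set `{b_0(a), ..., b_{p₀}(a)}`. -/
def pts (a : ℝ) : Set ℝ := {x | ∃ k ≤ p₀, x = F.b k a}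

/-- `K(a) = supp μ_a`. -/
def K (a : ℝ) : Set ℝ := (F.μ a).support

/-- The density `h_a = dμ_a/dm`. -/
def density (a x : ℝ) : ℝ := ((F.μ a).rnDeriv volume x).toReal

/-- The transfer operator `L_a φ(x) = ∑_{T_a(y) = x} φ(y)/|T_a'(y)|`. The sum has at most `p₀` terms;
the (finitely many) partition points, where `T_a'` is not defined, are left out. -/
def transfer (a : ℝ) (φ : ℝ → ℝ) (x : ℝ) : ℝ :=
  ∑ᶠ y ∈ {y | y ∈ Icc (0 : ℝ) 1 ∧ y ∉ F.pts a ∧ F.T a y = x}, φ y / |deriv (F.T a) y|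

/-- `T_a` is topologically mixing on `K(a)`. The values of `T_a` at the partition points play no
role in the theory (they may be changed freely), so only orbits which avoid them are considered. -/
def Mixing (a : ℝ) : Prop :=
  ∀ U V : Set ℝ, IsOpen U → IsOpen V → (U ∩ F.K a).Nonempty → (V ∩ F.K a).Nonempty →
    ∃ N : ℕ, ∀ n ≥ N, ∃ x ∈ U ∩ F.K a,
      (∀ i < n, (F.T a)^[i] x ∉ F.pts a) ∧ (F.T a)^[n] x ∈ V

/-- The forward orbit `x_j(a) = T_a^j(x_0(a))`. -/
def orbit (x₀ : ℝ → ℝ) (j : ℕ) (a : ℝ) : ℝ := (F.T a)^[j] (x₀ a)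

/-- The partition `P_j|J` of a parameter interval `J`: `P_0|J = J`, and for `j ≥ 1` the maximal
(nonempty) open intervals `ω` in `J` with `x_i(a) ∈ K(a) \ {b_0(a), ..., b_{p₀}(a)}` for `a ∈ ω`,
`0 ≤ i < j`. -/
def paramPartition (x₀ : ℝ → ℝ) (J : Set ℝ) (j : ℕ) : Set (Set ℝ) :=
  {ω | (j = 0 ∧ ω = J) ∨
    (1 ≤ j ∧ (∃ c d : ℝ, c < d ∧ ω = Ioo c d) ∧ ω ⊆ J ∧
      (∀ i < j, ∀ a ∈ ω, F.orbit x₀ i a ∈ F.K a \ F.pts a) ∧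
      ∀ ω' : Set ℝ, (∃ c d : ℝ, c < d ∧ ω' = Ioo c d) → ω' ⊆ J → ω ⊂ ω' →
        ∃ a ∈ ω', ∃ i < j, F.orbit x₀ i a ∈ F.pts a)}

/-- `x₀ : [0,1] → [0,1]` is `C^{1+α}`, and `x₀(a) ∈ K(a) \ {b_0(a), ..., b_{p₀}(a)}` for
`a ∈ (0,1)`. -/
structure IsStartingPoint (x₀ : ℝ → ℝ) : Prop where
  mapsTo : MapsTo x₀ (Icc 0 1) (Icc 0 1)
  differentiable : DifferentiableOn ℝ x₀ (Icc 0 1)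
  holder : ∃ C : ℝ, ∀ a ∈ Icc (0 : ℝ) 1, ∀ a' ∈ Icc (0 : ℝ) 1,
    |derivWithin x₀ (Icc 0 1) a - derivWithin x₀ (Icc 0 1) a'| ≤ C * |a - a'| ^ α
  mem : ∀ a ∈ Ioo (0 : ℝ) 1, x₀ a ∈ F.K a \ F.pts a

/-- Condition (I), transversality: `x_j'(0+)` and `(T_0^j)'(x_0(0+))`, the limits of `x_j'(a)` and of
`(T_a^j)'(x_0(a))` as `a → 0+`, exist and are comparable uniformly in `j ≥ 1`, and for each `j` the
points `x_i(a)`, `i < j`, are no partition points for all small `a > 0`. -/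
def Transversal (x₀ : ℝ → ℝ) : Prop :=
  (∃ C : ℝ, 1 ≤ C ∧ ∀ j : ℕ, 1 ≤ j → ∃ s t : ℝ,
    Tendsto (fun a => deriv (F.orbit x₀ j) a) (𝓝[>] 0) (𝓝 s) ∧
    Tendsto (fun a => deriv ((F.T a)^[j]) (x₀ a)) (𝓝[>] 0) (𝓝 t) ∧
    1 / C ≤ |s / t| ∧ |s / t| ≤ C) ∧
  ∀ j : ℕ, 1 ≤ j → ∀ᶠ a in 𝓝[>] (0 : ℝ), ∀ i < j, F.orbit x₀ i a ∉ F.pts a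

/-- Condition (II): `T_0` is mixing, and the Lasota-Yorke inequality in `V_α` holds with uniform
constants for small `a`. -/
def UniformLasotaYorke (A : ℝ) : Prop :=
  F.Mixing 0 ∧
  ∃ ε C r : ℝ, 0 < ε ∧ ε ≤ 1 ∧ 1 ≤ C ∧ 0 < r ∧ r < 1 ∧
    ∀ a ∈ Icc 0 ε, ∀ n : ℕ, 1 ≤ n → ∀ φ : ℝ → ℝ, MemGBV α A φ →
      gbvNorm α A ((F.transfer a)^[n] φ) ≤
        ENNReal.ofReal (C * r ^ n) * gbvNorm α A φ + ENNReal.ofReal C * l1Norm φ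

/-- Condition (III): `∑_{ω ∈ P_n|[0,ε]} 1/‖x_n|_ω'‖_∞` grows subexponentially, slower than
`exp(n^δ)` for every `δ > 0`. -/
def SmallImageControl (x₀ : ℝ → ℝ) : Prop :=
  ∃ ε : ℝ, 0 < ε ∧ ε ≤ 1 ∧ ∀ δ : ℝ, 0 < δ → ∃ C : ℝ, ∀ n : ℕ, 1 ≤ n →
    ∑' ω : F.paramPartition x₀ (Icc 0 ε) n,
      (⨆ a ∈ (ω : Set ℝ), ENNReal.ofReal |deriv (F.orbit x₀ n) a|)⁻¹
        ≤ ENNReal.ofReal (C * Real.exp ((n : ℝ) ^ δ))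

/-- `∫ φ dμ_a`. -/
def mean (φ : ℝ → ℝ) (a : ℝ) : ℝ := ∫ x, φ x ∂(F.μ a)

/-- `σ_a(φ)`, where `σ_a(φ)² = ∫ (φ - ∫ φ dμ_a)² dμ_a
+ 2 ∑_{i > 0} ∫ (φ - ∫ φ dμ_a) ((φ - ∫ φ dμ_a) ∘ T_a^i) dμ_a`. -/
def sigma (φ : ℝ → ℝ) (a : ℝ) : ℝ :=
  Real.sqrt ((∫ x, (φ x - F.mean φ a) ^ 2 ∂(F.μ a)) +
    2 * ∑' i : ℕ, ∫ x, (φ x - F.mean φ a) * (φ ((F.T a)^[i + 1] x) - F.mean φ a) ∂(F.μ a))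

/-- `ξ_k(a) = (φ(x_k(a)) - ∫ φ dμ_a)/σ_a(φ)`. -/
def xi (x₀ φ : ℝ → ℝ) (k : ℕ) (a : ℝ) : ℝ :=
  (φ (F.orbit x₀ k a) - F.mean φ a) / F.sigma φ a

/-- Correlations decay exponentially with rate `ρ`, uniformly for `a ∈ [0,ε]`. -/
def UniformDecay (A ε ρ : ℝ) : Prop :=
  ∃ C : ℝ, 1 ≤ C ∧ ∀ a ∈ Icc 0 ε, ∀ φ ψ : ℝ → ℝ, MemGBV α A φ → IntegrableOn ψ (Icc 0 1) →
    ∀ n : ℕ, 1 ≤ n →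
      |(∫ x in Icc 0 1, φ x * ψ ((F.T a)^[n] x)) - (∫ x in Icc 0 1, φ x) * ∫ x, ψ x ∂(F.μ a)| ≤
        C * (gbvNorm α A φ).toReal * (l1Norm ψ).toReal * ρ ^ n

/-- The constants `ρ ∈ (0,1)` and `κ > 0` entering the statement, for parameters in `[0,ε]`: `ρ` is
a rate of uniform decay of correlations, `κ` an exponent with `‖h_0 - h_a‖_{L¹} = O(a^κ)` for which
`a ↦ σ_a(φ)` is `κ`-Hölder. -/
structure AdmissibleRates (A : ℝ) (φ : ℝ → ℝ) (ε ρ κ : ℝ) : Prop where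
  ρ_pos : 0 < ρ
  ρ_lt_one : ρ < 1
  κ_pos : 0 < κ
  decay : F.UniformDecay A ε ρ
  density : ∃ C : ℝ, ∀ a ∈ Icc 0 ε, ∫ x in Icc 0 1, |F.density 0 x - F.density a x| ≤ C * a ^ κ
  sigma : ∃ C : ℝ, ∀ a ∈ Icc 0 ε, ∀ a' ∈ Icc 0 ε,
    |F.sigma φ a - F.sigma φ a'| ≤ C * |a - a'| ^ κ

end ExpandingFamily

/-- `λ₀ = min(λ^{min(α/3, κ/2)}, ρ^{-1/2})`. -/
def lamZero (α lam ρ κ : ℝ) : ℝ := min (lam ^ min (α / 3) (κ / 2)) (ρ ^ (-(1 / 2) : ℝ))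

end

/-! ### Functions of generalised bounded variation -/

/-- Lebesgue measure on the unit interval. -/
noncomputable abbrev leb : Measure ℝ := volume.restrict (Icc (0 : ℝ) 1)

/-- The points of `[0,1]` at which `φ` lies between its essential bounds on every window. -/
def regPts (φ : ℝ → ℝ) : Set ℝ :=
  {y | y ∈ Icc (0 : ℝ) 1 ∧ ∀ x δ : ℝ, y ∈ Ioo (x - δ) (x + δ) →
    essInf (fun y => (φ y : EReal)) (volume.restrict (Ioo (x - δ) (x + δ) ∩ Icc 0 1)) ≤ φ y ∧
    (φ y : EReal) ≤ essSup (fun y => (φ y : EReal))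
      (volume.restrict (Ioo (x - δ) (x + δ) ∩ Icc 0 1))}

lemma ae_mem_regPts (φ : ℝ → ℝ) : ∀ᵐ y ∂leb, y ∈ regPts φ := by
  have key : ∀ p q : ℚ, ∀ᵐ y ∂leb, y ∈ Ioo (p : ℝ) q →
      essInf (fun y => (φ y : EReal)) (volume.restrict (Ioo (p : ℝ) q ∩ Icc 0 1)) ≤ φ y ∧
      (φ y : EReal) ≤ essSup (fun y => (φ y : EReal))
        (volume.restrict (Ioo (p : ℝ) q ∩ Icc 0 1)) := by
    intro p q
    have h1 := ae_essInf_le (f := fun y => (φ y : EReal))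
      (μ := volume.restrict (Ioo (p : ℝ) q ∩ Icc 0 1))
    have h2 := ae_le_essSup (f := fun y => (φ y : EReal))
      (μ := volume.restrict (Ioo (p : ℝ) q ∩ Icc 0 1))
    rw [ae_restrict_iff' (measurableSet_Ioo.inter measurableSet_Icc)] at h1 h2
    rw [ae_restrict_iff' measurableSet_Icc]
    filter_upwards [h1, h2] with y h1 h2 hy hy'
    exact ⟨h1 ⟨hy', hy⟩, h2 ⟨hy', hy⟩⟩
  have key2 : ∀ᵐ y ∂leb, ∀ p q : ℚ, y ∈ Ioo (p : ℝ) q →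
      essInf (fun y => (φ y : EReal)) (volume.restrict (Ioo (p : ℝ) q ∩ Icc 0 1)) ≤ φ y ∧
      (φ y : EReal) ≤ essSup (fun y => (φ y : EReal))
        (volume.restrict (Ioo (p : ℝ) q ∩ Icc 0 1)) := by
    rw [ae_all_iff]; intro p; rw [ae_all_iff]; exact key p
  filter_upwards [key2, ae_restrict_mem measurableSet_Icc] with y hy hy01
  refine ⟨hy01, fun x δ hyx => ?_⟩
  obtain ⟨p, hp1, hp2⟩ := exists_rat_btwn hyx.1
  obtain ⟨q, hq1, hq2⟩ := exists_rat_btwn hyx.2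
  obtain ⟨h1, h2⟩ := hy p q ⟨hp2, hq1⟩
  have hle : volume.restrict (Ioo (p : ℝ) q ∩ Icc 0 1) ≤
      volume.restrict (Ioo (x - δ) (x + δ) ∩ Icc 0 1) :=
    Measure.restrict_mono (inter_subset_inter_left _ (Ioo_subset_Ioo hp1.le hq2.le)) le_rfl
  exact ⟨(essInf_antitone_measure hle.absolutelyContinuous).trans h1,
    h2.trans (essSup_mono_measure' hle)⟩

lemma enorm_sub_le_osc {φ : ℝ → ℝ} {x δ y y' : ℝ} (hy : y ∈ regPts φ) (hy' : y' ∈ regPts φ)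
    (h : y ∈ Ioo (x - δ) (x + δ)) (h' : y' ∈ Ioo (x - δ) (x + δ)) :
    ‖φ y - φ y'‖ₑ ≤ osc φ δ x := by
  wlog hle : φ y' ≤ φ y generalizing y y'
  · have := this hy' hy h' h (le_of_not_ge hle)
    rwa [← enorm_neg, neg_sub]
  rw [Real.enorm_eq_ofReal (by linarith)]
  have : ((φ y : EReal) - φ y') ≤ _ := EReal.sub_le_sub (hy.2 x δ h).2 (hy'.2 x δ h').1
  have h2 := EReal.toENNReal_le_toENNReal this
  rwa [← EReal.coe_sub, EReal.toENNReal_of_ne_top (EReal.coe_ne_top _), EReal.toReal_coe] at h2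

lemma window_pos {x δ : ℝ} (hx : x ∈ Icc (0 : ℝ) 1) (hδ : 0 < δ) :
    0 < volume (Ioo (x - δ) (x + δ) ∩ Icc (0 : ℝ) 1) := by
  obtain ⟨h0, h1⟩ := hx
  have : Ioo (max (x - δ) 0) (min (x + δ) 1) ⊆ Ioo (x - δ) (x + δ) ∩ Icc (0 : ℝ) 1 := by
    intro z hz
    simp only [mem_Ioo, max_lt_iff, lt_min_iff] at hz
    exact ⟨⟨hz.1.1, hz.2.1⟩, hz.1.2.le, hz.2.2.le⟩
  refine lt_of_lt_of_le ?_ (measure_mono this)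
  rw [Real.volume_Ioo, ENNReal.ofReal_pos]
  rcases le_total (x - δ) 0 with h | h <;> rcases le_total (x + δ) 1 with h' | h' <;>
    simp [h, h'] <;> linarith

lemma osc_le {φ : ℝ → ℝ} {x δ : ℝ} {c : ℝ≥0∞} {E : Set ℝ} (hx : x ∈ Icc (0 : ℝ) 1) (hδ : 0 < δ)
    (hE : ∀ᵐ y ∂leb, y ∈ E)
    (h : ∀ y ∈ E, y ∈ Ioo (x - δ) (x + δ) → ∀ y' ∈ E, y' ∈ Ioo (x - δ) (x + δ) →
      ‖φ y - φ y'‖ₑ ≤ c) : osc φ δ x ≤ c := by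
  rcases eq_or_ne c ∞ with rfl | hc
  · exact le_top
  set W := Ioo (x - δ) (x + δ) ∩ Icc (0 : ℝ) 1 with hW
  have hWm : MeasurableSet W := measurableSet_Ioo.inter measurableSet_Icc
  have hEW : ∀ᵐ y ∂(volume.restrict W), y ∈ E ∩ Ioo (x - δ) (x + δ) := by
    have h1 : ∀ᵐ y ∂(volume.restrict W), y ∈ E :=
      ae_mono (Measure.restrict_mono inter_subset_right le_rfl) hE
    filter_upwards [h1, ae_restrict_mem hWm] with y hy hyW using ⟨hy, hyW.1⟩
  have hne : (volume.restrict W) ≠ 0 := by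
    rw [Ne, Measure.restrict_eq_zero]; exact (window_pos hx hδ).ne'
  have : NeBot (ae (volume.restrict W)) := ae_neBot.2 hne
  obtain ⟨y0, hy0⟩ := hEW.exists
  have hc' : ∀ y ∈ E ∩ Ioo (x - δ) (x + δ), ∀ y' ∈ E ∩ Ioo (x - δ) (x + δ),
      φ y - φ y' ≤ c.toReal := by
    intro y hy y' hy'
    have h1 := ENNReal.toReal_mono hc (h y hy.1 hy.2 y' hy'.1 hy'.2)
    rw [toReal_enorm, Real.norm_eq_abs] at h1
    exact (le_abs_self _).trans h1
  set S := φ '' (E ∩ Ioo (x - δ) (x + δ)) with hS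
  have hSne : S.Nonempty := ⟨_, mem_image_of_mem _ hy0⟩
  have hSa : BddAbove S := ⟨φ y0 + c.toReal, by
    rintro _ ⟨y, hy, rfl⟩; linarith [hc' y hy y0 hy0]⟩
  have hSb : BddBelow S := ⟨φ y0 - c.toReal, by
    rintro _ ⟨y, hy, rfl⟩; linarith [hc' y0 hy0 y hy]⟩
  have hU : essSup (fun y => (φ y : EReal)) (volume.restrict W) ≤ ((sSup S : ℝ) : EReal) := by
    refine essSup_le_of_ae_le _ ?_
    filter_upwards [hEW] with y hy
    exact EReal.coe_le_coe_iff.2 (le_csSup hSa (mem_image_of_mem _ hy))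
  have hL : ((sInf S : ℝ) : EReal) ≤ essInf (fun y => (φ y : EReal)) (volume.restrict W) := by
    refine le_essInf_of_ae_le _ ?_
    filter_upwards [hEW] with y hy
    exact EReal.coe_le_coe_iff.2 (csInf_le hSb (mem_image_of_mem _ hy))
  have hd : sSup S - sInf S ≤ c.toReal := by
    have : sSup S ≤ sInf S + c.toReal := by
      apply csSup_le hSne
      rintro _ ⟨y, hy, rfl⟩
      have : φ y - c.toReal ≤ sInf S := by
        apply le_csInf hSne
        rintro _ ⟨y', hy', rfl⟩
        linarith [hc' y hy y' hy']
      linarith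
    linarith
  have h3 := EReal.toENNReal_le_toENNReal (EReal.sub_le_sub hU hL)
  rw [← EReal.coe_sub, EReal.toENNReal_of_ne_top (EReal.coe_ne_top _), EReal.toReal_coe] at h3
  refine h3.trans ?_
  rw [← ENNReal.ofReal_toReal hc]
  exact ENNReal.ofReal_le_ofReal hd

/-- A lower semicontinuous version of the oscillation. -/
noncomputable def oscReg (φ : ℝ → ℝ) (δ x : ℝ) : ℝ≥0∞ :=
  ⨆ y ∈ regPts φ, ⨆ y' ∈ regPts φ,
    (Ioo (y - δ) (y + δ) ∩ Ioo (y' - δ) (y' + δ)).indicator (fun _ => ‖φ y - φ y'‖ₑ) x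

lemma measurable_oscReg (φ : ℝ → ℝ) (δ : ℝ) : Measurable (oscReg φ δ) := by
  apply LowerSemicontinuous.measurable
  refine lowerSemicontinuous_biSup fun y _ => lowerSemicontinuous_biSup fun y' _ => ?_
  exact (isOpen_Ioo.inter isOpen_Ioo).lowerSemicontinuous_indicator zero_le

lemma osc_eq_oscReg {φ : ℝ → ℝ} {δ x : ℝ} (hx : x ∈ Icc (0 : ℝ) 1) (hδ : 0 < δ) :
    osc φ δ x = oscReg φ δ x := by
  apply le_antisymm
  · refine osc_le hx hδ (ae_mem_regPts φ) fun y hy hyx y' hy' hyx' => ?_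
    refine le_trans ?_ (le_iSup₂_of_le y hy (le_iSup₂_of_le y' hy' le_rfl))
    rw [indicator_of_mem]
    simp only [mem_inter_iff, mem_Ioo] at *
    exact ⟨⟨by linarith, by linarith⟩, by linarith, by linarith⟩
  · refine iSup₂_le fun y hy => iSup₂_le fun y' hy' => ?_
    by_cases h : x ∈ (Ioo (y - δ) (y + δ) ∩ Ioo (y' - δ) (y' + δ))
    · rw [indicator_of_mem h]
      simp only [mem_inter_iff, mem_Ioo] at h
      exact enorm_sub_le_osc hy hy' ⟨by linarith, by linarith⟩ ⟨by linarith, by linarith⟩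
    · rw [indicator_of_notMem h]; exact zero_le

lemma osc_ae_eq (φ : ℝ → ℝ) {δ : ℝ} (hδ : 0 < δ) : osc φ δ =ᵐ[leb] oscReg φ δ := by
  filter_upwards [ae_restrict_mem measurableSet_Icc] with x hx using osc_eq_oscReg hx hδ

lemma aemeasurable_osc (φ : ℝ → ℝ) {δ : ℝ} (hδ : 0 < δ) : AEMeasurable (osc φ δ) leb :=
  ⟨_, measurable_oscReg φ δ, osc_ae_eq φ hδ⟩

lemma osc_congr {φ ψ : ℝ → ℝ} (h : φ =ᵐ[leb] ψ) (δ x : ℝ) : osc φ δ x = osc ψ δ x := by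
  have : (fun y => (φ y : EReal)) =ᵐ[volume.restrict (Ioo (x - δ) (x + δ) ∩ Icc 0 1)]
      fun y => (ψ y : EReal) := by
    have := ae_mono (Measure.restrict_mono (μ := volume) (s := Ioo (x - δ) (x + δ) ∩ Icc 0 1)
      inter_subset_right le_rfl) h
    filter_upwards [this] with y hy
    rw [hy]
  rw [osc, osc, essSup_congr_ae this, essInf_congr_ae this]

section Norms

variable {α A : ℝ}

/-- The `V_α` norm as a real number. -/
noncomputable def nrm (α A : ℝ) (φ : ℝ → ℝ) : ℝ := (gbvNorm α A φ).toReal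

/-- The `L¹([0,1])` norm as a real number. -/
noncomputable def l1 (φ : ℝ → ℝ) : ℝ := ∫ x in Icc (0 : ℝ) 1, |φ x|

lemma l1_nonneg (φ : ℝ → ℝ) : 0 ≤ l1 φ := integral_nonneg fun _ => abs_nonneg _

lemma nrm_nonneg (φ : ℝ → ℝ) : 0 ≤ nrm α A φ := ENNReal.toReal_nonneg

lemma l1Norm_eq {φ : ℝ → ℝ} (h : IntegrableOn φ (Icc 0 1)) : l1Norm φ = ENNReal.ofReal (l1 φ) := by
  rw [l1, ofReal_integral_eq_lintegral_ofReal h.abs (Eventually.of_forall fun _ => abs_nonneg _)]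
  simp only [l1Norm, Real.enorm_eq_ofReal_abs]

lemma gbvNorm_lt_top {φ : ℝ → ℝ} (h : MemGBV α A φ) : gbvNorm α A φ < ∞ := by
  rw [gbvNorm, l1Norm_eq h.1]
  exact ENNReal.add_lt_top.2 ⟨h.2, ENNReal.ofReal_lt_top⟩

lemma nrm_eq {φ : ℝ → ℝ} (h : MemGBV α A φ) : nrm α A φ = (gbvSeminorm α A φ).toReal + l1 φ := by
  rw [nrm, gbvNorm, l1Norm_eq h.1, ENNReal.toReal_add h.2.ne ENNReal.ofReal_ne_top,
    ENNReal.toReal_ofReal (l1_nonneg φ)]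

lemma l1_le_nrm {φ : ℝ → ℝ} (h : MemGBV α A φ) : l1 φ ≤ nrm α A φ := by
  rw [nrm_eq h]; linarith [ENNReal.toReal_nonneg (a := gbvSeminorm α A φ)]

lemma lintegral_osc_le_seminorm (φ : ℝ → ℝ) {δ : ℝ} (hδ : δ ∈ Ioc 0 A) :
    ∫⁻ x in Icc 0 1, osc φ δ x ≤ ENNReal.ofReal (δ ^ α) * gbvSeminorm α A φ := by
  have h1 : ENNReal.ofReal (δ ^ (-α)) * ∫⁻ x in Icc 0 1, osc φ δ x ≤ gbvSeminorm α A φ :=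
    le_iSup₂_of_le δ hδ le_rfl
  have h2 := mul_le_mul_right h1 (ENNReal.ofReal (δ ^ α))
  have hpos := hδ.1
  rwa [← mul_assoc, ← ENNReal.ofReal_mul (Real.rpow_nonneg hpos.le _), ← Real.rpow_add hpos,
    add_neg_cancel, Real.rpow_zero, ENNReal.ofReal_one, one_mul] at h2

lemma lintegral_osc_le {φ : ℝ → ℝ} (hφ : MemGBV α A φ) {δ : ℝ} (hδ : δ ∈ Ioc 0 A) :
    ∫⁻ x in Icc 0 1, osc φ δ x ≤ ENNReal.ofReal (δ ^ α * nrm α A φ) := by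
  refine (lintegral_osc_le_seminorm (α := α) φ hδ).trans ?_
  rw [ENNReal.ofReal_mul (Real.rpow_nonneg hδ.1.le _)]
  gcongr
  rw [nrm, ENNReal.ofReal_toReal (gbvNorm_lt_top hφ).ne]
  exact le_self_add

lemma memGBV_of_osc {φ : ℝ → ℝ} (hi : IntegrableOn φ (Icc 0 1)) {S : ℝ} (hS : 0 ≤ S)
    (h : ∀ δ ∈ Ioc 0 A, ∫⁻ x in Icc 0 1, osc φ δ x ≤ ENNReal.ofReal (δ ^ α * S)) :
    MemGBV α A φ ∧ nrm α A φ ≤ S + l1 φ := by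
  have h1 : gbvSeminorm α A φ ≤ ENNReal.ofReal S := by
    refine iSup₂_le fun δ hδ => ?_
    have h2 := mul_le_mul_right (h δ hδ) (ENNReal.ofReal (δ ^ (-α)))
    rwa [← ENNReal.ofReal_mul (Real.rpow_nonneg hδ.1.le _), ← mul_assoc, ← Real.rpow_add hδ.1,
      neg_add_cancel, Real.rpow_zero, one_mul] at h2
  have hm : MemGBV α A φ := ⟨hi, h1.trans_lt ENNReal.ofReal_lt_top⟩
  refine ⟨hm, ?_⟩
  rw [nrm_eq hm]
  have := ENNReal.toReal_mono ENNReal.ofReal_ne_top h1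
  rw [ENNReal.toReal_ofReal hS] at this
  linarith

/-- A pointwise comparison of oscillations gives a comparison of seminorms. -/
lemma gbvSeminorm_le_of_osc {φ ψ χ : ℝ → ℝ} {c d : ℝ≥0∞} (hc : c ≠ ∞) (hd : d ≠ ∞)
    (h : ∀ δ > 0, ∀ x ∈ Icc (0 : ℝ) 1, osc χ δ x ≤ c * osc φ δ x + d * osc ψ δ x) :
    gbvSeminorm α A χ ≤ c * gbvSeminorm α A φ + d * gbvSeminorm α A ψ := by
  refine iSup₂_le fun δ hδ => ?_
  have h1 : ∫⁻ x in Icc 0 1, osc χ δ x ≤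
      c * (∫⁻ x in Icc 0 1, osc φ δ x) + d * ∫⁻ x in Icc 0 1, osc ψ δ x := by
    rw [← lintegral_const_mul' _ _ hc, ← lintegral_const_mul' _ _ hd,
      ← lintegral_add_left' ((aemeasurable_osc φ hδ.1).const_mul _)]
    exact setLIntegral_mono' measurableSet_Icc fun x hx => h δ hδ.1 x hx
  have hφ : ENNReal.ofReal (δ ^ (-α)) * ∫⁻ x in Icc 0 1, osc φ δ x ≤ gbvSeminorm α A φ :=
    le_iSup₂_of_le δ hδ le_rfl
  have hψ : ENNReal.ofReal (δ ^ (-α)) * ∫⁻ x in Icc 0 1, osc ψ δ x ≤ gbvSeminorm α A ψ :=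
    le_iSup₂_of_le δ hδ le_rfl
  calc ENNReal.ofReal (δ ^ (-α)) * ∫⁻ x in Icc 0 1, osc χ δ x
      ≤ ENNReal.ofReal (δ ^ (-α)) *
        (c * (∫⁻ x in Icc 0 1, osc φ δ x) + d * ∫⁻ x in Icc 0 1, osc ψ δ x) := by gcongr
    _ = c * (ENNReal.ofReal (δ ^ (-α)) * ∫⁻ x in Icc 0 1, osc φ δ x) +
        d * (ENNReal.ofReal (δ ^ (-α)) * ∫⁻ x in Icc 0 1, osc ψ δ x) := by ring
    _ ≤ _ := by gcongr

lemma memGBV_and_toReal_le {φ ψ χ : ℝ → ℝ} (hφ : MemGBV α A φ) (hψ : MemGBV α A ψ)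
    (hχ : IntegrableOn χ (Icc 0 1)) {c d : ℝ} (hc : 0 ≤ c) (hd : 0 ≤ d)
    (h : ∀ δ > 0, ∀ x ∈ Icc (0 : ℝ) 1,
      osc χ δ x ≤ ENNReal.ofReal c * osc φ δ x + ENNReal.ofReal d * osc ψ δ x) :
    MemGBV α A χ ∧ (gbvSeminorm α A χ).toReal ≤
      c * (gbvSeminorm α A φ).toReal + d * (gbvSeminorm α A ψ).toReal := by
  have h1 := gbvSeminorm_le_of_osc (α := α) (A := A) ENNReal.ofReal_ne_top ENNReal.ofReal_ne_top h
  have h2 : ENNReal.ofReal c * gbvSeminorm α A φ ≠ ∞ :=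
    ENNReal.mul_ne_top ENNReal.ofReal_ne_top hφ.2.ne
  have h3 : ENNReal.ofReal d * gbvSeminorm α A ψ ≠ ∞ :=
    ENNReal.mul_ne_top ENNReal.ofReal_ne_top hψ.2.ne
  have h4 : ENNReal.ofReal c * gbvSeminorm α A φ + ENNReal.ofReal d * gbvSeminorm α A ψ ≠ ∞ :=
    ENNReal.add_ne_top.2 ⟨h2, h3⟩
  refine ⟨⟨hχ, lt_of_le_of_lt h1 h4.lt_top⟩, ?_⟩
  have := ENNReal.toReal_mono h4 h1
  rwa [ENNReal.toReal_add h2 h3, ENNReal.toReal_mul, ENNReal.toReal_mul, ENNReal.toReal_ofReal hc,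
    ENNReal.toReal_ofReal hd] at this

lemma MemGBV.congr {φ ψ : ℝ → ℝ} (hφ : MemGBV α A φ) (h : φ =ᵐ[leb] ψ) : MemGBV α A ψ := by
  refine ⟨Integrable.congr hφ.1 h, ?_⟩
  have : gbvSeminorm α A ψ = gbvSeminorm α A φ := by
    simp only [gbvSeminorm, osc_congr h]
  rw [this]; exact hφ.2

lemma l1_congr {φ ψ : ℝ → ℝ} (h : φ =ᵐ[leb] ψ) : l1 φ = l1 ψ :=
  integral_congr_ae (h.mono fun x hx => by simp only [hx])

lemma nrm_congr {φ ψ : ℝ → ℝ} (h : φ =ᵐ[leb] ψ) : nrm α A φ = nrm α A ψ := by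
  have h1 : gbvSeminorm α A ψ = gbvSeminorm α A φ := by
    simp only [gbvSeminorm, osc_congr h]
  have h2 : l1Norm φ = l1Norm ψ := lintegral_congr_ae (h.mono fun x hx => by simp only [hx])
  rw [nrm, nrm, gbvNorm, gbvNorm, h1, h2]

lemma abs_le_ofReal_enorm {x : ℝ} {c : ℝ≥0∞} : ENNReal.ofReal |x| ≤ c ↔ ‖x‖ₑ ≤ c := by
  rw [Real.enorm_eq_ofReal_abs]

/-- Linear combinations of functions of generalised bounded variation. -/
lemma MemGBV.lin {φ ψ : ℝ → ℝ} (hφ : MemGBV α A φ) (hψ : MemGBV α A ψ) (c d : ℝ) :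
    MemGBV α A (fun x => c * φ x + d * ψ x) ∧
      nrm α A (fun x => c * φ x + d * ψ x) ≤ |c| * nrm α A φ + |d| * nrm α A ψ := by
  have hi : IntegrableOn (fun x => c * φ x + d * ψ x) (Icc 0 1) :=
    (Integrable.const_mul hφ.1 c).add (Integrable.const_mul hψ.1 d)
  obtain ⟨h1, h2⟩ := memGBV_and_toReal_le hφ hψ hi (abs_nonneg c) (abs_nonneg d) (by
    intro δ hδ x hx
    refine osc_le hx hδ ((ae_mem_regPts φ).and (ae_mem_regPts ψ)) ?_
    rintro y ⟨hy1, hy2⟩ hyx y' ⟨hy1', hy2'⟩ hyx'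
    have e : c * φ y + d * ψ y - (c * φ y' + d * ψ y') = c * (φ y - φ y') + d * (ψ y - ψ y') := by
      ring
    rw [e]
    refine (enorm_add_le _ _).trans ?_
    rw [enorm_mul, enorm_mul, Real.enorm_eq_ofReal_abs c, Real.enorm_eq_ofReal_abs d]
    gcongr
    · exact enorm_sub_le_osc hy1 hy1' hyx hyx'
    · exact enorm_sub_le_osc hy2 hy2' hyx hyx')
  refine ⟨h1, ?_⟩
  rw [nrm_eq h1, nrm_eq hφ, nrm_eq hψ]
  have h3 : l1 (fun x => c * φ x + d * ψ x) ≤ |c| * l1 φ + |d| * l1 ψ := by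
    rw [l1, l1, l1, ← integral_const_mul, ← integral_const_mul,
      ← integral_add (Integrable.const_mul hφ.1.abs _) (Integrable.const_mul hψ.1.abs _)]
    refine integral_mono hi.abs
      ((Integrable.const_mul hφ.1.abs _).add (Integrable.const_mul hψ.1.abs _)) fun x => ?_
    simp only [← abs_mul]
    exact abs_add_le _ _
  linarith

lemma MemGBV.sub {φ ψ : ℝ → ℝ} (hφ : MemGBV α A φ) (hψ : MemGBV α A ψ) :
    MemGBV α A (fun x => φ x - ψ x) := by
  have := (hφ.lin hψ 1 (-1)).1
  convert this using 2; ring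

lemma nrm_sub_le {φ ψ : ℝ → ℝ} (hφ : MemGBV α A φ) (hψ : MemGBV α A ψ) :
    nrm α A (fun x => φ x - ψ x) ≤ nrm α A φ + nrm α A ψ := by
  have := (hφ.lin hψ 1 (-1)).2
  simp only [abs_one, abs_neg, one_mul, neg_mul] at this
  simpa only [sub_eq_add_neg] using this

lemma MemGBV.const_mul {φ : ℝ → ℝ} (hφ : MemGBV α A φ) (c : ℝ) :
    MemGBV α A (fun x => c * φ x) ∧ nrm α A (fun x => c * φ x) ≤ |c| * nrm α A φ := by
  have := hφ.lin hφ c 0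
  simpa using this

/-- Postcomposition with a 1-Lipschitz function fixing `0`. -/
lemma MemGBV.lipschitz_comp {φ : ℝ → ℝ} (hφ : MemGBV α A φ) {g : ℝ → ℝ}
    (hg : LipschitzWith 1 g) (h0 : g 0 = 0) :
    MemGBV α A (fun x => g (φ x)) ∧ nrm α A (fun x => g (φ x)) ≤ nrm α A φ := by
  have hb : ∀ x, ‖g (φ x)‖ ≤ ‖φ x‖ := fun x => by
    have := hg.dist_le_mul (φ x) 0
    simpa [h0] using this
  have hi : IntegrableOn (fun x => g (φ x)) (Icc 0 1) :=
    Integrable.mono hφ.1 (hg.continuous.comp_aestronglyMeasurable hφ.1.aestronglyMeasurable)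
      (Eventually.of_forall hb)
  obtain ⟨h1, h2⟩ := memGBV_and_toReal_le hφ hφ hi zero_le_one le_rfl (by
    intro δ hδ x hx
    refine osc_le hx hδ (ae_mem_regPts φ) fun y hy hyx y' hy' hyx' => ?_
    simp only [ENNReal.ofReal_one, one_mul, ENNReal.ofReal_zero, zero_mul, add_zero]
    refine le_trans ?_ (enorm_sub_le_osc hy hy' hyx hyx')
    rw [Real.enorm_eq_ofReal_abs, Real.enorm_eq_ofReal_abs]
    refine ENNReal.ofReal_le_ofReal ?_
    have := hg.dist_le_mul (φ y) (φ y')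
    simpa [Real.dist_eq] using this)
  refine ⟨h1, ?_⟩
  rw [nrm_eq h1, nrm_eq hφ]
  have h3 : l1 (fun x => g (φ x)) ≤ l1 φ := integral_mono hi.abs hφ.1.abs hb
  linarith

lemma MemGBV.mul_bdd {φ ψ : ℝ → ℝ} (hφ : MemGBV α A φ) (hψ : MemGBV α A ψ) {c d : ℝ}
    (hc0 : 0 ≤ c) (hd0 : 0 ≤ d)
    (hc : ∀ᵐ x ∂leb, |ψ x| ≤ c) (hd : ∀ᵐ x ∂leb, |φ x| ≤ d) :
    MemGBV α A (fun x => φ x * ψ x) ∧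
      nrm α A (fun x => φ x * ψ x) ≤ c * nrm α A φ + d * nrm α A ψ := by
  have hi : IntegrableOn (fun x => φ x * ψ x) (Icc 0 1) :=
    Integrable.mul_bdd (c := c) hφ.1 hψ.1.aestronglyMeasurable hc
  obtain ⟨h1, h2⟩ := memGBV_and_toReal_le hφ hψ hi hc0 hd0 (by
    intro δ hδ x hx
    refine osc_le hx hδ (((ae_mem_regPts φ).and (ae_mem_regPts ψ)).and (hc.and hd)) ?_
    rintro y ⟨⟨hy1, hy2⟩, hyc, -⟩ hyx y' ⟨⟨hy1', hy2'⟩, -, hyd⟩ hyx'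
    have e : φ y * ψ y - φ y' * ψ y' = ψ y * (φ y - φ y') + φ y' * (ψ y - ψ y') := by ring
    rw [e]
    refine (enorm_add_le _ _).trans ?_
    rw [enorm_mul, enorm_mul, Real.enorm_eq_ofReal_abs (ψ y), Real.enorm_eq_ofReal_abs (φ y')]
    gcongr
    · exact enorm_sub_le_osc hy1 hy1' hyx hyx'
    · exact enorm_sub_le_osc hy2 hy2' hyx hyx')
  refine ⟨h1, ?_⟩
  rw [nrm_eq h1, nrm_eq hφ, nrm_eq hψ]
  have h3 : l1 (fun x => φ x * ψ x) ≤ c * l1 φ := by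
    rw [l1, l1, ← integral_const_mul]
    refine integral_mono_ae hi.abs (Integrable.const_mul hφ.1.abs _) ?_
    filter_upwards [hc] with x hx
    rw [abs_mul, mul_comm]
    exact mul_le_mul_of_nonneg_right hx (abs_nonneg _)
  have := mul_nonneg hd0 (l1_nonneg ψ)
  linarith

end Norms

section Sup

variable {α A : ℝ}

/-- The constant of the embedding `V_α ⊆ L^∞`. -/
noncomputable def supConst (A : ℝ) : ℝ := 2 / min A (1 / 2)

lemma supConst_pos (hA : 0 < A) : 0 < supConst A := by
  unfold supConst; positivity

lemma ofReal_le_volume_window {y δ : ℝ} (hy : y ∈ Icc (0 : ℝ) 1) (hδ : δ ≤ 1 / 2) :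
    ENNReal.ofReal δ ≤ volume (Ioo (y - δ) (y + δ) ∩ Icc (0 : ℝ) 1) := by
  rcases le_or_gt δ 0 with h0 | h0
  · simp [ENNReal.ofReal_eq_zero.2 h0]
  rcases le_total y (1 / 2) with h | h
  · have : Ioo y (y + δ) ⊆ Ioo (y - δ) (y + δ) ∩ Icc (0 : ℝ) 1 := fun z hz =>
      ⟨⟨by linarith [hz.1], hz.2⟩, by linarith [hz.1, hy.1], by linarith [hz.2]⟩
    refine le_trans ?_ (measure_mono this)
    rw [Real.volume_Ioo]; exact ENNReal.ofReal_le_ofReal (by linarith)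
  · have : Ioo (y - δ) y ⊆ Ioo (y - δ) (y + δ) ∩ Icc (0 : ℝ) 1 := fun z hz =>
      ⟨⟨hz.1, by linarith [hz.2]⟩, by linarith [hz.1], by linarith [hz.2, hy.2]⟩
    refine le_trans ?_ (measure_mono this)
    rw [Real.volume_Ioo]; exact ENNReal.ofReal_le_ofReal (by linarith)

lemma MemGBV.ae_abs_le (hA : 0 < A) (hα : 0 ≤ α) {φ : ℝ → ℝ} (hφ : MemGBV α A φ) :
    ∀ᵐ y ∂leb, |φ y| ≤ supConst A * nrm α A φ := by
  set δ := min A (1 / 2) with hδ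
  have hδ0 : 0 < δ := by positivity
  have hδA : δ ∈ Ioc 0 A := ⟨hδ0, min_le_left _ _⟩
  have hδ2 : δ ≤ 1 / 2 := min_le_right _ _
  filter_upwards [ae_mem_regPts φ] with y hy
  set W := Ioo (y - δ) (y + δ) ∩ Icc (0 : ℝ) 1 with hW
  have hWm : MeasurableSet W := measurableSet_Ioo.inter measurableSet_Icc
  have h1 : ∫⁻ _ in W, ‖φ y‖ₑ ≤ ∫⁻ x in W, (‖φ x‖ₑ + osc φ δ x) := by
    refine lintegral_mono_ae ?_
    have h2 := ae_mono (Measure.restrict_mono (μ := volume) (s := W) inter_subset_right le_rfl)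
      (ae_mem_regPts φ)
    filter_upwards [h2, ae_restrict_mem hWm] with x hx hxW
    have h3 : ‖φ y - φ x‖ₑ ≤ osc φ δ x := by
      refine enorm_sub_le_osc hy hx ⟨?_, ?_⟩ ⟨?_, ?_⟩ <;> linarith [hxW.1.1, hxW.1.2]
    calc ‖φ y‖ₑ = ‖φ x + (φ y - φ x)‖ₑ := by congr 1; ring
      _ ≤ ‖φ x‖ₑ + ‖φ y - φ x‖ₑ := enorm_add_le _ _
      _ ≤ _ := by gcongr
  have h4 : ∫⁻ x in W, (‖φ x‖ₑ + osc φ δ x) ≤ ENNReal.ofReal (2 * nrm α A φ) := by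
    calc ∫⁻ x in W, (‖φ x‖ₑ + osc φ δ x)
        ≤ ∫⁻ x in Icc 0 1, (‖φ x‖ₑ + osc φ δ x) := lintegral_mono_set inter_subset_right
      _ = l1Norm φ + ∫⁻ x in Icc 0 1, osc φ δ x := by
          rw [lintegral_add_right' _ (aemeasurable_osc φ hδ0)]; rfl
      _ ≤ ENNReal.ofReal (nrm α A φ) + ENNReal.ofReal (δ ^ α * nrm α A φ) := by
          gcongr
          · rw [l1Norm_eq hφ.1]; exact ENNReal.ofReal_le_ofReal (l1_le_nrm hφ)
          · exact lintegral_osc_le hφ hδA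
      _ ≤ ENNReal.ofReal (2 * nrm α A φ) := by
          rw [← ENNReal.ofReal_add (nrm_nonneg φ)
            (mul_nonneg (Real.rpow_nonneg hδ0.le _) (nrm_nonneg φ))]
          refine ENNReal.ofReal_le_ofReal ?_
          have : δ ^ α ≤ 1 := Real.rpow_le_one hδ0.le (by linarith) hα
          nlinarith [nrm_nonneg (α := α) (A := A) φ]
  rw [lintegral_const, Measure.restrict_apply_univ, Real.enorm_eq_ofReal_abs] at h1
  have h5 : ENNReal.ofReal |φ y| * ENNReal.ofReal δ ≤ ENNReal.ofReal (2 * nrm α A φ) :=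
    le_trans (by gcongr; exact ofReal_le_volume_window hy.1 hδ2) (h1.trans h4)
  rw [← ENNReal.ofReal_mul (abs_nonneg _),
    ENNReal.ofReal_le_ofReal_iff (mul_nonneg zero_le_two (nrm_nonneg φ))] at h5
  rw [supConst, ← hδ, div_mul_eq_mul_div, le_div_iff₀ hδ0]
  exact h5

/-- A function whose integral over `S` beats its oscillation is bounded below on some window. -/
lemma exists_window_lt {f : ℝ → ℝ} (hf : MemGBV α A f) {S : Set ℝ} (hS : MeasurableSet S)
    (hS1 : S ⊆ Icc 0 1) {s δ : ℝ} (hs : 0 ≤ s) (hδ : δ ∈ Ioc 0 A)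
    (h : s + δ ^ α * nrm α A f < ∫ x in S, f x) :
    ∃ x ∈ S, ∀ᵐ y ∂leb, y ∈ Ioo (x - δ) (x + δ) → s < f y := by
  have hSle : volume.restrict S ≤ leb := Measure.restrict_mono hS1 le_rfl
  have hex : ∃ x ∈ S ∩ regPts f, ENNReal.ofReal s + osc f δ x < ENNReal.ofReal (f x) := by
    by_contra! hcon
    have h1 : ∫⁻ x in S, ENNReal.ofReal (f x) ≤ ∫⁻ x in S, (ENNReal.ofReal s + osc f δ x) := by
      refine lintegral_mono_ae ?_
      filter_upwards [ae_mono hSle (ae_mem_regPts f), ae_restrict_mem hS] with x hx hxS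
      exact hcon x ⟨hxS, hx⟩
    have h2 : ∫⁻ x in S, (ENNReal.ofReal s + osc f δ x) ≤
        ENNReal.ofReal (s + δ ^ α * nrm α A f) := by
      refine (lintegral_mono_set hS1).trans ?_
      rw [lintegral_add_left measurable_const, ENNReal.ofReal_add hs
        (mul_nonneg (Real.rpow_nonneg hδ.1.le _) (nrm_nonneg f))]
      gcongr
      · simp
      · exact lintegral_osc_le hf hδ
    have h3 : ENNReal.ofReal (∫ x in S, f x) ≤ ∫⁻ x in S, ENNReal.ofReal (f x) := by
      have hfS : Integrable f (volume.restrict S) := IntegrableOn.mono_set hf.1 hS1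
      rw [integral_eq_lintegral_pos_part_sub_lintegral_neg_part hfS]
      refine (ENNReal.ofReal_le_ofReal (sub_le_self _ ENNReal.toReal_nonneg)).trans ?_
      exact ENNReal.ofReal_toReal_le
    have h4 := h3.trans (h1.trans h2)
    rw [ENNReal.ofReal_le_ofReal_iff (add_nonneg hs
      (mul_nonneg (Real.rpow_nonneg hδ.1.le _) (nrm_nonneg f)))] at h4
    linarith
  obtain ⟨x, ⟨hxS, hxr⟩, hx⟩ := hex
  refine ⟨x, hxS, ?_⟩
  filter_upwards [ae_mem_regPts f] with y hy hyx
  have h5 := enorm_sub_le_osc hxr hy ⟨by linarith [hδ.1], by linarith [hδ.1]⟩ hyx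
  rw [Real.enorm_eq_ofReal_abs] at h5
  have h6 : ENNReal.ofReal (s + |f x - f y|) < ENNReal.ofReal (f x) := by
    rw [ENNReal.ofReal_add hs (abs_nonneg _)]
    exact lt_of_le_of_lt (by gcongr) hx
  have h7 := ENNReal.ofReal_lt_ofReal_iff'.1 h6
  linarith [le_abs_self (f x - f y), h7.1]

/-- Hölder functions on an interval, extended by zero, have generalised bounded variation. -/
lemma memGBV_of_holder (hα : 0 < α) (hα1 : α ≤ 1) (hA : 0 < A) {w : ℝ → ℝ} {I : Set ℝ}
    (hI : I.OrdConnected) (hI1 : I ⊆ Icc 0 1) (hw0 : ∀ y ∉ I, w y = 0)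
    (hwi : IntegrableOn w (Icc 0 1)) {H M : ℝ} (hH : 0 ≤ H) (hM : ∀ y, |w y| ≤ M)
    (hw : ∀ y ∈ I, ∀ y' ∈ I, |w y - w y'| ≤ H * |y - y'| ^ α) :
    MemGBV α A w ∧ nrm α A w ≤ (4 * A ^ (1 - α) + 5) * (H + M) := by
  have hM0 : 0 ≤ M := (abs_nonneg _).trans (hM 0)
  have hAp : 0 ≤ A ^ (1 - α) := Real.rpow_nonneg hA.le _
  set c := sInf I
  set d := sSup I
  have hbb : BddBelow I := ⟨0, fun y hy => (hI1 hy).1⟩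
  have hba : BddAbove I := ⟨1, fun y hy => (hI1 hy).2⟩
  have hmem : ∀ y ∈ I, ∀ y' ∉ I, ∀ x δ : ℝ, y ∈ Ioo (x - δ) (x + δ) → y' ∈ Ioo (x - δ) (x + δ) →
      x ∈ Icc (c - δ) (c + δ) ∪ Icc (d - δ) (d + δ) := by
    intro y hy y' hy' x δ h h'
    rcases lt_or_ge y y' with hlt | hge
    · have h1 : d ≤ y' := by
        refine csSup_le ⟨y, hy⟩ fun z hz => ?_
        by_contra! hcon
        exact hy' (hI.out hy hz ⟨hlt.le, hcon.le⟩)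
      have h2 : y ≤ d := le_csSup hba hy
      right; constructor <;> linarith [h.1, h.2, h'.1, h'.2]
    · have h1 : y' ≤ c := by
        refine le_csInf ⟨y, hy⟩ fun z hz => ?_
        by_contra! hcon
        exact hy' (hI.out hz hy ⟨hcon.le, hge⟩)
      have h2 : c ≤ y := csInf_le hbb hy
      left; constructor <;> linarith [h.1, h.2, h'.1, h'.2]
  have hosc : ∀ δ ∈ Ioc 0 A, ∀ x ∈ Icc (0 : ℝ) 1, osc w δ x ≤ ENNReal.ofReal (H * (2 * δ) ^ α) +
      (Icc (c - δ) (c + δ) ∪ Icc (d - δ) (d + δ)).indicator (fun _ => ENNReal.ofReal M) x := by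
    intro δ hδ x hx
    refine osc_le hx hδ.1 (E := univ) (Eventually.of_forall fun _ => mem_univ _) ?_
    intro y _ hyx y' _ hyx'
    rw [Real.enorm_eq_ofReal_abs]
    by_cases hy : y ∈ I <;> by_cases hy' : y' ∈ I
    · refine le_trans (ENNReal.ofReal_le_ofReal ?_) le_self_add
      refine (hw y hy y' hy').trans ?_
      gcongr
      rw [abs_le]; constructor <;> linarith [hyx.1, hyx.2, hyx'.1, hyx'.2]
    · rw [indicator_of_mem (hmem y hy y' hy' x δ hyx hyx'), hw0 y' hy', sub_zero]
      exact le_trans (ENNReal.ofReal_le_ofReal (hM y)) le_add_self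
    · rw [indicator_of_mem (hmem y' hy' y hy x δ hyx' hyx), hw0 y hy, zero_sub, abs_neg]
      exact le_trans (ENNReal.ofReal_le_ofReal (hM y')) le_add_self
    · rw [hw0 y hy, hw0 y' hy']; simp
  have hint : ∀ δ ∈ Ioc 0 A, ∫⁻ x in Icc 0 1, osc w δ x ≤
      ENNReal.ofReal (δ ^ α * (2 * H + 4 * A ^ (1 - α) * M)) := by
    intro δ hδ
    have hδ0 := hδ.1
    refine (setLIntegral_mono' measurableSet_Icc (hosc δ hδ)).trans ?_
    rw [lintegral_add_left measurable_const, lintegral_const, Measure.restrict_apply_univ,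
      Real.volume_Icc, lintegral_indicator (measurableSet_Icc.union measurableSet_Icc),
      lintegral_const]
    have h1 : ((volume.restrict (Icc (0 : ℝ) 1)).restrict
        (Icc (c - δ) (c + δ) ∪ Icc (d - δ) (d + δ))) univ ≤ ENNReal.ofReal (4 * δ) := by
      rw [Measure.restrict_apply_univ]
      refine (Measure.restrict_apply_le _ _).trans ((measure_union_le _ _).trans ?_)
      rw [Real.volume_Icc, Real.volume_Icc, ← ENNReal.ofReal_add (by linarith) (by linarith)]
      exact ENNReal.ofReal_le_ofReal (by linarith)
    calc _ ≤ ENNReal.ofReal (H * (2 * δ) ^ α) * ENNReal.ofReal (1 - 0) +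
          ENNReal.ofReal M * ENNReal.ofReal (4 * δ) := by gcongr
      _ = ENNReal.ofReal (H * (2 * δ) ^ α + M * (4 * δ)) := by
          rw [sub_zero, ENNReal.ofReal_one, mul_one, ← ENNReal.ofReal_mul hM0,
            ← ENNReal.ofReal_add (by positivity) (by positivity)]
      _ ≤ _ := by
          refine ENNReal.ofReal_le_ofReal ?_
          have e1 : (2 * δ) ^ α ≤ 2 * δ ^ α := by
            rw [Real.mul_rpow zero_le_two hδ0.le]
            gcongr
            calc (2 : ℝ) ^ α ≤ 2 ^ (1 : ℝ) := Real.rpow_le_rpow_of_exponent_le (by norm_num) hα1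
              _ = 2 := Real.rpow_one 2
          have e2 : δ ≤ δ ^ α * A ^ (1 - α) := by
            calc δ = δ ^ α * δ ^ (1 - α) := by
                  rw [← Real.rpow_add hδ0, add_sub_cancel, Real.rpow_one]
              _ ≤ _ := by gcongr; exact hδ.2
          calc H * (2 * δ) ^ α + M * (4 * δ) ≤ H * (2 * δ ^ α) + M * (4 * (δ ^ α * A ^ (1 - α))) := by
                gcongr
            _ = _ := by ring
  obtain ⟨h1, h2⟩ := memGBV_of_osc hwi (by positivity) hint
  refine ⟨h1, h2.trans ?_⟩
  have h3 : l1 w ≤ M := by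
    calc l1 w ≤ ∫ _ in Icc (0 : ℝ) 1, M := by
          refine integral_mono hwi.abs (by simp) fun x => hM x
      _ = M := by simp
  nlinarith

lemma memGBV_indicator (hα : 0 < α) (hα1 : α ≤ 1) (hA : 0 < A) {I : Set ℝ}
    (hI : I.OrdConnected) (hI1 : I ⊆ Icc 0 1) :
    MemGBV α A (I.indicator 1) ∧ nrm α A (I.indicator 1) ≤ 4 * A ^ (1 - α) + 5 := by
  have := memGBV_of_holder (w := I.indicator 1) (H := 0) (M := 1) hα hα1 hA hI hI1
    (fun y hy => indicator_of_notMem hy _)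
    ((integrable_const (1 : ℝ)).indicator hI.measurableSet) le_rfl
    (fun y => by by_cases hy : y ∈ I <;> simp [hy])
    (fun y hy y' hy' => by simp [hy, hy'])
  simpa using this

/-! ### Averages over a grid -/

/-- The `i`-th cell of the grid of mesh `1/N`. -/
def cell (N i : ℕ) : Set ℝ := Ico ((i : ℝ) / N) ((i + 1 : ℝ) / N)

lemma measurableSet_cell (N i : ℕ) : MeasurableSet (cell N i) := measurableSet_Ico

lemma cell_subset {N i : ℕ} (hi : i < N) : cell N i ⊆ Icc 0 1 := by
  intro x hx
  have hN : (0 : ℝ) < N := by exact_mod_cast (Nat.zero_le i).trans_lt hi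
  have : (i + 1 : ℝ) ≤ N := by exact_mod_cast hi
  refine ⟨le_trans (by positivity) hx.1, hx.2.le.trans ?_⟩
  rw [div_le_one hN]; exact this

lemma volume_cell {N : ℕ} (i : ℕ) : volume (cell N i) = ENNReal.ofReal (1 / N) := by
  rw [cell, Real.volume_Ico]; congr 1; ring

lemma exists_cell {N : ℕ} (hN : 0 < N) {x : ℝ} (hx : x ∈ Ico (0 : ℝ) 1) :
    ∃ i < N, x ∈ cell N i := by
  have hN' : (0 : ℝ) < N := by exact_mod_cast hN
  refine ⟨⌊N * x⌋₊, ?_, ?_, ?_⟩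
  · rw [Nat.floor_lt (mul_nonneg hN'.le hx.1)]
    nlinarith [hx.2]
  · rw [div_le_iff₀ hN', mul_comm x]
    exact Nat.floor_le (mul_nonneg hN'.le hx.1)
  · rw [lt_div_iff₀ hN', mul_comm x]
    exact Nat.lt_floor_add_one _

lemma cell_disjoint {N i j : ℕ} (hN : 0 < N) {x : ℝ} (hi : x ∈ cell N i) (hj : x ∈ cell N j) :
    i = j := by
  have hN' : (0 : ℝ) < N := by exact_mod_cast hN
  have h1 := (div_lt_div_iff_of_pos_right hN').1 (hi.1.trans_lt hj.2)
  have h2 := (div_lt_div_iff_of_pos_right hN').1 (hj.1.trans_lt hi.2)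
  have h3 : i < j + 1 := by exact_mod_cast h1
  have h4 : j < i + 1 := by exact_mod_cast h2
  omega

/-- The average of `g` over the cells of the grid of mesh `1/N`. -/
noncomputable def stepAvg (N : ℕ) (g : ℝ → ℝ) (x : ℝ) : ℝ :=
  ∑ i ∈ Finset.range N, (cell N i).indicator (fun _ => N * ∫ y in cell N i, g y) x

lemma stepAvg_eq {N i : ℕ} (hi : i < N) {x : ℝ} (hx : x ∈ cell N i) (g : ℝ → ℝ) :
    stepAvg N g x = N * ∫ y in cell N i, g y := by
  rw [stepAvg, Finset.sum_eq_single i]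
  · rw [indicator_of_mem hx]
  · intro j _ hji
    exact indicator_of_notMem (fun h => hji (cell_disjoint (by omega) h hx)) _
  · intro h; exact absurd (Finset.mem_range.2 hi) h

lemma integrable_stepAvg (N : ℕ) (g : ℝ → ℝ) : IntegrableOn (stepAvg N g) (Icc 0 1) := by
  refine integrable_finsetSum _ fun i _ => ?_
  exact (integrable_const _).indicator (measurableSet_cell N i)

lemma l1_stepAvg_le {N : ℕ} (hN : 0 < N) (g : ℝ → ℝ) :
    l1 (stepAvg N g) ≤ ∑ i ∈ Finset.range N, |∫ y in cell N i, g y| := by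
  have hN' : (0 : ℝ) < N := by exact_mod_cast hN
  have h1 : ∀ i ∈ Finset.range N, Integrable (fun x =>
      (cell N i).indicator (fun _ => |N * ∫ y in cell N i, g y|) x) leb := fun i _ =>
    (integrable_const _).indicator (measurableSet_cell N i)
  calc l1 (stepAvg N g) ≤ ∫ x in Icc (0 : ℝ) 1, ∑ i ∈ Finset.range N,
        (cell N i).indicator (fun _ => |N * ∫ y in cell N i, g y|) x := by
        refine integral_mono (integrable_stepAvg N g).abs (integrable_finsetSum _ h1) fun x => ?_
        refine (Finset.abs_sum_le_sum_abs _ _).trans (Finset.sum_le_sum fun i _ => ?_)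
        by_cases hx : x ∈ cell N i <;> simp [hx]
    _ = ∑ i ∈ Finset.range N, |∫ y in cell N i, g y| := by
        rw [integral_finsetSum _ h1]
        refine Finset.sum_congr rfl fun i hi => ?_
        rw [integral_indicator (measurableSet_cell N i), Measure.restrict_restrict
          (measurableSet_cell N i), inter_eq_left.2 (cell_subset (Finset.mem_range.1 hi)),
          setIntegral_const, measureReal_def, volume_cell, ENNReal.toReal_ofReal (by positivity),
          smul_eq_mul, abs_mul, abs_of_pos hN']
        field_simp

lemma l1_sub_stepAvg_le {g : ℝ → ℝ} (hg : MemGBV α A g) {N : ℕ} {δ : ℝ} (hN : 0 < N)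
    (hδ : δ ∈ Ioc 0 A) (hNδ : 1 / (N : ℝ) < δ) :
    l1 (fun x => g x - stepAvg N g x) ≤ δ ^ α * nrm α A g := by
  have hN' : (0 : ℝ) < N := by exact_mod_cast hN
  have hi : IntegrableOn (fun x => g x - stepAvg N g x) (Icc 0 1) :=
    Integrable.sub hg.1 (integrable_stepAvg N g)
  have h0 : 0 ≤ δ ^ α * nrm α A g := mul_nonneg (Real.rpow_nonneg hδ.1.le _) (nrm_nonneg g)
  rw [← ENNReal.ofReal_le_ofReal_iff h0, ← l1Norm_eq hi]
  refine le_trans (lintegral_mono_ae ?_) (lintegral_osc_le hg hδ)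
  have hne1 : ∀ᵐ x ∂leb, x ≠ (1 : ℝ) := by
    rw [ae_iff]; simp
  filter_upwards [ae_mem_regPts g, hne1] with x hx hx1
  obtain ⟨i, hiN, hxi⟩ := exists_cell hN ⟨hx.1.1, lt_of_le_of_ne hx.1.2 hx1⟩
  rw [stepAvg_eq hiN hxi]
  have hvol : (volume (cell N i)).toReal = 1 / N := by
    rw [volume_cell, ENNReal.toReal_ofReal (by positivity)]
  have hgi : IntegrableOn g (cell N i) := IntegrableOn.mono_set hg.1 (cell_subset hiN)
  have hfin : volume (cell N i) ≠ ∞ := by rw [volume_cell]; exact ENNReal.ofReal_ne_top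
  have e : g x - N * ∫ y in cell N i, g y = N * ∫ y in cell N i, (g x - g y) := by
    rw [integral_sub (integrableOn_const (C := g x) hfin) hgi, setIntegral_const, measureReal_def, hvol,
      smul_eq_mul]
    field_simp
  rw [e, enorm_mul]
  have h1 : ‖∫ y in cell N i, (g x - g y)‖ₑ ≤ osc g δ x * ENNReal.ofReal (1 / N) := by
    refine (enorm_integral_le_lintegral_enorm _).trans ?_
    rw [← volume_cell i, ← setLIntegral_const]
    refine lintegral_mono_ae ?_
    filter_upwards [ae_mono (Measure.restrict_mono (cell_subset hiN) le_rfl) (ae_mem_regPts g),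
      ae_restrict_mem (measurableSet_cell N i)] with y hy hyi
    have h2 : (i + 1 : ℝ) / N = i / N + 1 / N := by ring
    have h3 := hyi.2; have h4 := hxi.2; have h5 := hyi.1; have h6 := hxi.1
    rw [h2] at h3 h4
    refine enorm_sub_le_osc hx hy ⟨?_, ?_⟩ ⟨?_, ?_⟩ <;> linarith
  calc ‖(N : ℝ)‖ₑ * ‖∫ y in cell N i, (g x - g y)‖ₑ
      ≤ ‖(N : ℝ)‖ₑ * (osc g δ x * ENNReal.ofReal (1 / N)) := by gcongr
    _ = osc g δ x := by
        rw [Real.enorm_eq_ofReal hN'.le, mul_left_comm, ← ENNReal.ofReal_mul hN'.le,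
          mul_one_div_cancel hN'.ne', ENNReal.ofReal_one, mul_one]

lemma l1_add_le {f g : ℝ → ℝ} (hf : IntegrableOn f (Icc 0 1)) (hg : IntegrableOn g (Icc 0 1)) :
    l1 (fun x => f x + g x) ≤ l1 f + l1 g := by
  rw [l1, l1, l1, ← integral_add hf.abs hg.abs]
  exact integral_mono (Integrable.add hf hg).abs (hf.abs.add hg.abs) fun x => abs_add_le _ _

lemma l1_sub_le {f g : ℝ → ℝ} (hf : IntegrableOn f (Icc 0 1)) (hg : IntegrableOn g (Icc 0 1)) :
    l1 (fun x => f x - g x) ≤ l1 f + l1 g := by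
  rw [l1, l1, l1, ← integral_add hf.abs hg.abs]
  exact integral_mono (Integrable.sub hf hg).abs (hf.abs.add hg.abs) fun x => abs_sub _ _

/-- The `L¹` norm is controlled by the averages over a fine grid. -/
lemma l1_le_sum_cell {g : ℝ → ℝ} (hg : MemGBV α A g) {N : ℕ} {δ : ℝ} (hN : 0 < N)
    (hδ : δ ∈ Ioc 0 A) (hNδ : 1 / (N : ℝ) < δ) :
    l1 g ≤ (∑ i ∈ Finset.range N, |∫ y in cell N i, g y|) + δ ^ α * nrm α A g := by
  have h1 := l1_add_le (g := fun x => g x - stepAvg N g x) (integrable_stepAvg N g)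
    (Integrable.sub hg.1 (integrable_stepAvg N g))
  simp only [add_sub_cancel] at h1
  have h2 : l1 (fun x => g x) = l1 g := rfl
  linarith [l1_stepAvg_le hN g, l1_sub_stepAvg_le hg hN hδ hNδ]

end Sup

namespace ExpandingFamily

variable {α lam Lam : ℝ} {p₀ p₁ : ℕ} (F : ExpandingFamily α lam Lam p₀ p₁) {a : ℝ}

/-! ### Branches -/

/-- The `k`-th monotonicity interval of `T a`. -/
def branch (k : ℕ) (a : ℝ) : Set ℝ := Ioo (F.b k a) (F.b (k + 1) a)

include F in
lemma lam_pos : 0 < lam := zero_lt_one.trans F.one_lt_lam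

include F in
lemma Lam_pos : 0 < Lam := F.lam_pos.trans_le F.lam_le_Lam

lemma b_lt_of_lt (ha : a ∈ Icc (0 : ℝ) 1) {i j : ℕ} (hij : i < j) (hj : j ≤ p₀) :
    F.b i a < F.b j a := by
  induction j, hij using Nat.le_induction with
  | base => exact F.b_lt a ha i (by omega)
  | succ k hk ih => exact (ih (by omega)).trans (F.b_lt a ha k (by omega))

lemma b_le_of_le (ha : a ∈ Icc (0 : ℝ) 1) {i j : ℕ} (hij : i ≤ j) (hj : j ≤ p₀) :
    F.b i a ≤ F.b j a := by
  rcases hij.lt_or_eq with h | rfl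
  · exact (F.b_lt_of_lt ha h hj).le
  · exact le_rfl

lemma b_mem (ha : a ∈ Icc (0 : ℝ) 1) {k : ℕ} (hk : k ≤ p₀) : F.b k a ∈ Icc (0 : ℝ) 1 := by
  constructor
  · rw [← F.b_zero a ha]; exact F.b_le_of_le ha (Nat.zero_le k) hk
  · rw [← F.b_last a ha]; exact F.b_le_of_le ha hk le_rfl

lemma branch_subset_Ioo (ha : a ∈ Icc (0 : ℝ) 1) {k : ℕ} (hk : k < p₀) :
    F.branch k a ⊆ Ioo 0 1 :=
  Ioo_subset_Ioo (F.b_mem ha hk.le).1 (F.b_mem ha hk).2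

lemma branch_subset (ha : a ∈ Icc (0 : ℝ) 1) {k : ℕ} (hk : k < p₀) :
    F.branch k a ⊆ Icc 0 1 := (F.branch_subset_Ioo ha hk).trans Ioo_subset_Icc_self

lemma measurableSet_branch (k : ℕ) : MeasurableSet (F.branch k a) := measurableSet_Ioo

lemma notMem_pts_of_mem_branch (ha : a ∈ Icc (0 : ℝ) 1) {k : ℕ} (hk : k < p₀) {x : ℝ}
    (hx : x ∈ F.branch k a) : x ∉ F.pts a := by
  rintro ⟨j, hj, rfl⟩
  rcases Nat.lt_or_ge k j with h | h
  · exact absurd hx.2 (not_lt.2 (F.b_le_of_le ha h hj))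
  · exact absurd hx.1 (not_lt.2 (F.b_le_of_le ha h hk.le))

lemma exists_mem_branch (ha : a ∈ Icc (0 : ℝ) 1) {x : ℝ} (hx : x ∈ Icc (0 : ℝ) 1)
    (hp : x ∉ F.pts a) : ∃ k < p₀, x ∈ F.branch k a := by
  have hne : ∀ k ≤ p₀, x ≠ F.b k a := fun k hk h => hp ⟨k, hk, h⟩
  have key : ∀ j ≤ p₀, x < F.b j a → ∃ k < p₀, x ∈ F.branch k a := by
    intro j
    induction j with
    | zero => intro h0 h; rw [F.b_zero a ha] at h; exact absurd hx.1 (not_le.2 h)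
    | succ j ih =>
      intro hj h
      rcases lt_or_gt_of_ne (hne j (by omega)) with h1 | h1
      · exact ih (by omega) h1
      · exact ⟨j, by omega, h1, h⟩
  refine key p₀ le_rfl (lt_of_le_of_ne ?_ (hne p₀ le_rfl))
  rw [F.b_last a ha]; exact hx.2

lemma branch_unique (ha : a ∈ Icc (0 : ℝ) 1) {j k : ℕ} (hj : j < p₀) (hk : k < p₀) {x : ℝ}
    (hxj : x ∈ F.branch j a) (hxk : x ∈ F.branch k a) : j = k := by
  by_contra hne
  rcases Nat.lt_or_gt_of_ne hne with h | h
  · have := F.b_le_of_le ha (i := j + 1) (j := k) h hk.le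
    linarith [hxj.2, hxk.1]
  · have := F.b_le_of_le ha (i := k + 1) (j := j) h hj.le
    linarith [hxk.2, hxj.1]

lemma pts_finite (a : ℝ) : (F.pts a).Finite := by
  have : F.pts a = (fun k => F.b k a) '' (Finset.range (p₀ + 1)) := by
    ext x
    simp only [pts, mem_ofPred_eq, Finset.coe_range, mem_image, mem_Iio, Nat.lt_succ_iff]
    exact ⟨fun ⟨k, hk, h⟩ => ⟨k, hk, h.symm⟩, fun ⟨k, hk, h⟩ => ⟨k, hk, h.symm⟩⟩
  rw [this]
  exact (Finset.finite_toSet _).image _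

lemma volume_pts (a : ℝ) : volume (F.pts a) = 0 := (F.pts_finite a).measure_zero _

lemma ae_notMem_pts (a : ℝ) : ∀ᵐ x ∂leb, x ∉ F.pts a :=
  ae_mono Measure.restrict_le_self (measure_eq_zero_iff_ae_notMem.1 (F.volume_pts a))

lemma hasDerivAt_T (ha : a ∈ Icc (0 : ℝ) 1) {k : ℕ} (hk : k < p₀) {x : ℝ}
    (hx : x ∈ F.branch k a) : HasDerivAt (F.T a) (deriv (F.T a) x) x :=
  (F.differentiable a ha k hk x hx).hasDerivAt

lemma continuousOn_branch (ha : a ∈ Icc (0 : ℝ) 1) {k : ℕ} (hk : k < p₀) :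
    ContinuousOn (F.T a) (F.branch k a) := fun _ hx =>
  (F.hasDerivAt_T ha hk hx).continuousAt.continuousWithinAt

lemma continuousAt_T (ha : a ∈ Icc (0 : ℝ) 1) {x : ℝ} (hx : x ∈ Icc (0 : ℝ) 1)
    (hp : x ∉ F.pts a) : ContinuousAt (F.T a) x := by
  obtain ⟨k, hk, hxk⟩ := F.exists_mem_branch ha hx hp
  exact (F.hasDerivAt_T ha hk hxk).continuousAt

lemma exists_slope (ha : a ∈ Icc (0 : ℝ) 1) {k : ℕ} (hk : k < p₀) {x y : ℝ}
    (hx : x ∈ F.branch k a) (hy : y ∈ F.branch k a) :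
    ∃ z ∈ F.branch k a, |z - y| ≤ |x - y| ∧ F.T a x - F.T a y = deriv (F.T a) z * (x - y) := by
  rcases lt_trichotomy x y with h | rfl | h
  · have hsub : Icc x y ⊆ F.branch k a := fun z hz => ⟨hx.1.trans_le hz.1, hz.2.trans_lt hy.2⟩
    obtain ⟨z, hz, e⟩ := exists_deriv_eq_slope (F.T a) h ((F.continuousOn_branch ha hk).mono hsub)
      fun z hz => (F.hasDerivAt_T ha hk (hsub (Ioo_subset_Icc_self hz))).differentiableAt
        |>.differentiableWithinAt
    refine ⟨z, hsub (Ioo_subset_Icc_self hz), ?_, ?_⟩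
    · rw [abs_of_neg (by linarith [hz.2]), abs_of_neg (by linarith)]; linarith [hz.1]
    · rw [e]; field_simp [(sub_pos.2 h).ne']; ring
  · exact ⟨x, hx, by simp, by ring⟩
  · have hsub : Icc y x ⊆ F.branch k a := fun z hz => ⟨hy.1.trans_le hz.1, hz.2.trans_lt hx.2⟩
    obtain ⟨z, hz, e⟩ := exists_deriv_eq_slope (F.T a) h ((F.continuousOn_branch ha hk).mono hsub)
      fun z hz => (F.hasDerivAt_T ha hk (hsub (Ioo_subset_Icc_self hz))).differentiableAt
        |>.differentiableWithinAt
    refine ⟨z, hsub (Ioo_subset_Icc_self hz), ?_, ?_⟩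
    · rw [abs_of_pos (by linarith [hz.1]), abs_of_pos (by linarith)]; linarith [hz.2]
    · rw [e]; field_simp [(sub_pos.2 h).ne']

lemma lam_mul_abs_sub_le (ha : a ∈ Icc (0 : ℝ) 1) {k : ℕ} (hk : k < p₀) {x y : ℝ}
    (hx : x ∈ F.branch k a) (hy : y ∈ F.branch k a) :
    lam * |x - y| ≤ |F.T a x - F.T a y| := by
  obtain ⟨z, hz, -, e⟩ := F.exists_slope ha hk hx hy
  rw [e, abs_mul]
  exact mul_le_mul_of_nonneg_right (F.expanding a ha k hk z hz).1 (abs_nonneg _)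

lemma abs_sub_le_Lam (ha : a ∈ Icc (0 : ℝ) 1) {k : ℕ} (hk : k < p₀) {x y : ℝ}
    (hx : x ∈ F.branch k a) (hy : y ∈ F.branch k a) :
    |F.T a x - F.T a y| ≤ Lam * |x - y| := by
  obtain ⟨z, hz, -, e⟩ := F.exists_slope ha hk hx hy
  rw [e, abs_mul]
  exact mul_le_mul_of_nonneg_right (F.expanding a ha k hk z hz).2 (abs_nonneg _)

lemma injOn_branch (ha : a ∈ Icc (0 : ℝ) 1) {k : ℕ} (hk : k < p₀) :
    InjOn (F.T a) (F.branch k a) := by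
  intro x hx y hy h
  have h1 := F.lam_mul_abs_sub_le ha hk hx hy
  rw [h, sub_self, abs_zero] at h1
  have h2 : |x - y| ≤ 0 := by
    have := F.lam_pos; nlinarith [abs_nonneg (x - y)]
  exact sub_eq_zero.1 (abs_nonpos_iff.1 h2)

lemma abs_deriv_pos (ha : a ∈ Icc (0 : ℝ) 1) {k : ℕ} (hk : k < p₀) {x : ℝ}
    (hx : x ∈ F.branch k a) : 0 < |deriv (F.T a) x| :=
  F.lam_pos.trans_le (F.expanding a ha k hk x hx).1

/-! ### Decomposition into branches -/

lemma restrict_biUnion_branch (ha : a ∈ Icc (0 : ℝ) 1) :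
    volume.restrict (⋃ k ∈ Finset.range p₀, F.branch k a) = leb := by
  refine Measure.restrict_congr_set ?_
  refine eventuallyLE_antisymm_iff.2 ⟨?_, ?_⟩
  · refine LE.le.eventuallyLE ?_
    exact iUnion₂_subset fun k hk => F.branch_subset ha (Finset.mem_range.1 hk)
  · filter_upwards [measure_eq_zero_iff_ae_notMem.1 (F.volume_pts a)] with x hx hx01
    obtain ⟨k, hk, hxk⟩ := F.exists_mem_branch ha hx01 hx
    exact mem_biUnion (Finset.mem_coe.2 (Finset.mem_range.2 hk)) hxk

lemma pairwiseDisjoint_branch (ha : a ∈ Icc (0 : ℝ) 1) :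
    (Finset.range p₀ : Set ℕ).Pairwise (Function.onFun Disjoint fun k => F.branch k a) := by
  intro i hi j hj hij
  refine Set.disjoint_left.2 fun x hxi hxj => hij ?_
  simp only [Finset.coe_range, mem_Iio] at hi hj
  exact F.branch_unique ha hi hj hxi hxj

lemma integrableOn_iff_branch (ha : a ∈ Icc (0 : ℝ) 1) {f : ℝ → ℝ} :
    IntegrableOn f (Icc 0 1) ↔ ∀ k < p₀, IntegrableOn f (F.branch k a) := by
  have h : IntegrableOn f (Icc 0 1) ↔ IntegrableOn f (⋃ k ∈ Finset.range p₀, F.branch k a) := by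
    rw [IntegrableOn, IntegrableOn, F.restrict_biUnion_branch ha]
  rw [h, integrableOn_finset_iUnion]
  simp

lemma setIntegral_eq_sum_branch (ha : a ∈ Icc (0 : ℝ) 1) {f : ℝ → ℝ}
    (hf : IntegrableOn f (Icc 0 1)) :
    ∫ x in Icc (0 : ℝ) 1, f x = ∑ k ∈ Finset.range p₀, ∫ x in F.branch k a, f x := by
  have h : ∫ x in Icc (0 : ℝ) 1, f x = ∫ x in ⋃ k ∈ Finset.range p₀, F.branch k a, f x := by
    rw [F.restrict_biUnion_branch ha]
  rw [h]
  exact integral_biUnion_finset _ (fun k _ => F.measurableSet_branch k)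
    (F.pairwiseDisjoint_branch ha) fun k hk => (F.integrableOn_iff_branch ha).1 hf k
      (Finset.mem_range.1 hk)

lemma volume_preimage_branch_le (ha : a ∈ Icc (0 : ℝ) 1) {k : ℕ} (hk : k < p₀) {E : Set ℝ}
    (hE : MeasurableSet E) :
    volume (F.branch k a ∩ F.T a ⁻¹' E) ≤ ENNReal.ofReal (1 / lam) * volume E := by
  have hm : MeasurableSet (F.branch k a ∩ F.T a ⁻¹' E) := by
    classical
    have h := (F.continuousOn_branch ha hk).measurable_piecewise (g := fun _ => (0 : ℝ))
      continuousOn_const (F.measurableSet_branch k)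
    convert (F.measurableSet_branch (a := a) k).inter (h hE) using 1
    ext x
    simp only [mem_inter_iff, mem_preimage]
    refine and_congr_right fun hx => ?_
    rw [Set.piecewise_eq_of_mem _ _ _ hx]
  have h1 := lintegral_image_eq_lintegral_abs_deriv_mul hm
    (fun x hx => (F.hasDerivAt_T ha hk hx.1).hasDerivWithinAt)
    ((F.injOn_branch ha hk).mono inter_subset_left) (fun _ => 1)
  simp only [mul_one, lintegral_const, one_mul, Measure.restrict_apply_univ] at h1
  have h2 : ENNReal.ofReal lam * volume (F.branch k a ∩ F.T a ⁻¹' E) ≤ volume E := by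
    calc ENNReal.ofReal lam * volume (F.branch k a ∩ F.T a ⁻¹' E)
        = ∫⁻ _ in F.branch k a ∩ F.T a ⁻¹' E, ENNReal.ofReal lam := by rw [setLIntegral_const]
      _ ≤ ∫⁻ x in F.branch k a ∩ F.T a ⁻¹' E, ENNReal.ofReal |deriv (F.T a) x| :=
          setLIntegral_mono' hm fun x hx =>
            ENNReal.ofReal_le_ofReal (F.expanding a ha k hk x hx.1).1
      _ = volume (F.T a '' (F.branch k a ∩ F.T a ⁻¹' E)) := h1.symm
      _ ≤ volume E := measure_mono (image_subset_iff.2 inter_subset_right)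
  calc volume (F.branch k a ∩ F.T a ⁻¹' E)
      = ENNReal.ofReal (1 / lam) * (ENNReal.ofReal lam * volume (F.branch k a ∩ F.T a ⁻¹' E)) := by
        rw [← mul_assoc, ← ENNReal.ofReal_mul (by have := F.lam_pos; positivity),
          one_div_mul_cancel F.lam_pos.ne', ENNReal.ofReal_one, one_mul]
    _ ≤ _ := by gcongr

lemma volume_preimage_le (ha : a ∈ Icc (0 : ℝ) 1) (E : Set ℝ) :
    volume (Icc (0 : ℝ) 1 ∩ F.T a ⁻¹' E) ≤ ENNReal.ofReal (p₀ / lam) * volume E := by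
  have h1 : Icc (0 : ℝ) 1 ∩ F.T a ⁻¹' E ⊆ F.pts a ∪
      ⋃ k ∈ Finset.range p₀, (F.branch k a ∩ F.T a ⁻¹' toMeasurable volume E) := by
    rintro x ⟨hx, hxE⟩
    by_cases hp : x ∈ F.pts a
    · exact Or.inl hp
    · obtain ⟨k, hk, hxk⟩ := F.exists_mem_branch ha hx hp
      exact Or.inr (mem_biUnion (Finset.mem_coe.2 (Finset.mem_range.2 hk))
        ⟨hxk, subset_toMeasurable _ _ hxE⟩)
  calc volume (Icc (0 : ℝ) 1 ∩ F.T a ⁻¹' E) ≤ volume (F.pts a) + volume (⋃ k ∈ Finset.range p₀,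
        (F.branch k a ∩ F.T a ⁻¹' toMeasurable volume E)) :=
        (measure_mono h1).trans (measure_union_le _ _)
    _ ≤ ∑ k ∈ Finset.range p₀, volume (F.branch k a ∩ F.T a ⁻¹' toMeasurable volume E) := by
        rw [F.volume_pts, zero_add]; exact measure_biUnion_finset_le _ _
    _ ≤ ∑ k ∈ Finset.range p₀, ENNReal.ofReal (1 / lam) * volume E := by
        refine Finset.sum_le_sum fun k hk => ?_
        rw [← measure_toMeasurable E]
        exact F.volume_preimage_branch_le ha (Finset.mem_range.1 hk) (measurableSet_toMeasurable _ _)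
    _ = _ := by
        rw [Finset.sum_const, Finset.card_range, nsmul_eq_mul, ← mul_assoc,
          ← ENNReal.ofReal_natCast, ← ENNReal.ofReal_mul (Nat.cast_nonneg _)]
        congr 2; ring

lemma aemeasurable_T (ha : a ∈ Icc (0 : ℝ) 1) : AEMeasurable (F.T a) leb := by
  rw [← F.restrict_biUnion_branch ha]
  refine ContinuousOn.aemeasurable ?_
    (Finset.measurableSet_biUnion _ fun k _ => F.measurableSet_branch k)
  intro x hx
  simp only [mem_iUnion, Finset.mem_range] at hx
  obtain ⟨k, hk, hxk⟩ := hx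
  exact (F.hasDerivAt_T ha hk hxk).continuousAt.continuousWithinAt

lemma ae_comp_T (ha : a ∈ Icc (0 : ℝ) 1) {P : ℝ → Prop} (h : ∀ᵐ y ∂leb, P y) :
    ∀ᵐ x ∂leb, P (F.T a x) := by
  rw [ae_restrict_iff' measurableSet_Icc] at h
  rw [ae_restrict_iff' measurableSet_Icc]
  rw [ae_iff] at h ⊢
  refine measure_mono_null ?_ (le_antisymm ((F.volume_preimage_le ha _).trans
    (by rw [h, mul_zero])) zero_le)
  intro x hx
  simp only [mem_ofPred_eq, Classical.not_imp] at hx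
  refine ⟨hx.1, ?_⟩
  simp only [mem_preimage, mem_ofPred_eq, Classical.not_imp]
  exact ⟨F.mapsTo a ha hx.1, hx.2⟩

lemma ae_comp_iterate (ha : a ∈ Icc (0 : ℝ) 1) {P : ℝ → Prop} (h : ∀ᵐ y ∂leb, P y) (n : ℕ) :
    ∀ᵐ x ∂leb, P ((F.T a)^[n] x) := by
  induction n generalizing P with
  | zero => exact h
  | succ n ih =>
    simp only [Function.iterate_succ_apply']
    exact ih (F.ae_comp_T ha h)

lemma map_T_ac (ha : a ∈ Icc (0 : ℝ) 1) : leb.map (F.T a) ≪ leb := by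
  refine Measure.AbsolutelyContinuous.mk fun s hs h => ?_
  rw [Measure.map_apply_of_aemeasurable (F.aemeasurable_T ha) hs]
  exact measure_eq_zero_iff_ae_notMem.2
    (F.ae_comp_T ha (P := fun y => y ∉ s) (measure_eq_zero_iff_ae_notMem.1 h))

lemma aesm_comp_T (ha : a ∈ Icc (0 : ℝ) 1) {f : ℝ → ℝ} (hf : AEStronglyMeasurable f leb) :
    AEStronglyMeasurable (fun x => f (F.T a x)) leb :=
  (hf.mono_ac (F.map_T_ac ha)).comp_aemeasurable (F.aemeasurable_T ha)

lemma aesm_comp_iterate (ha : a ∈ Icc (0 : ℝ) 1) {f : ℝ → ℝ} (hf : AEStronglyMeasurable f leb)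
    (n : ℕ) : AEStronglyMeasurable (fun x => f ((F.T a)^[n] x)) leb := by
  induction n generalizing f with
  | zero => exact hf
  | succ n ih =>
    simp only [Function.iterate_succ_apply']
    exact ih (F.aesm_comp_T ha hf)

lemma integrable_comp_T (ha : a ∈ Icc (0 : ℝ) 1) {f : ℝ → ℝ} (hf : IntegrableOn f (Icc 0 1)) :
    IntegrableOn (fun x => f (F.T a x)) (Icc 0 1) := by
  refine (F.integrableOn_iff_branch ha).2 fun k hk => ?_
  have himg : F.T a '' F.branch k a ⊆ Icc 0 1 := by
    rintro _ ⟨x, hx, rfl⟩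
    exact F.mapsTo a ha (F.branch_subset ha hk hx)
  have h1 := (integrableOn_image_iff_integrableOn_abs_deriv_smul (F.measurableSet_branch k)
    (fun x hx => (F.hasDerivAt_T ha hk hx).hasDerivWithinAt) (F.injOn_branch ha hk) f).1
    (hf.mono_set himg)
  have h2 : AEStronglyMeasurable (fun x => f (F.T a x)) (volume.restrict (F.branch k a)) :=
    (F.aesm_comp_T ha hf.aestronglyMeasurable).mono_measure
      (Measure.restrict_mono (F.branch_subset ha hk) le_rfl)
  refine Integrable.mono h1 h2 ?_
  filter_upwards [ae_restrict_mem (F.measurableSet_branch k)] with x hx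
  rw [norm_smul, Real.norm_eq_abs |deriv (F.T a) x|, abs_abs]
  have := (F.expanding a ha k hk x hx).1
  have h3 := F.one_lt_lam
  nlinarith [norm_nonneg (f (F.T a x))]

lemma integrable_comp_iterate (ha : a ∈ Icc (0 : ℝ) 1) {f : ℝ → ℝ}
    (hf : IntegrableOn f (Icc 0 1)) (n : ℕ) :
    IntegrableOn (fun x => f ((F.T a)^[n] x)) (Icc 0 1) := by
  induction n generalizing f with
  | zero => exact hf
  | succ n ih =>
    simp only [Function.iterate_succ_apply']
    exact ih (F.integrable_comp_T ha hf)

/-! ### The transfer operator -/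

/-- The contribution of the `k`-th branch to the transfer operator. -/
noncomputable def transferBranch (k : ℕ) (a : ℝ) (φ : ℝ → ℝ) (x : ℝ) : ℝ :=
  φ (Function.invFunOn (F.T a) (F.branch k a) x) /
    |deriv (F.T a) (Function.invFunOn (F.T a) (F.branch k a) x)|

lemma transfer_eq_sum (ha : a ∈ Icc (0 : ℝ) 1) (φ : ℝ → ℝ) (x : ℝ) :
    F.transfer a φ x = ∑ k ∈ Finset.range p₀,
      (F.T a '' F.branch k a).indicator (F.transferBranch k a φ) x := by
  have hset : {y | y ∈ Icc (0 : ℝ) 1 ∧ y ∉ F.pts a ∧ F.T a y = x} =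
      ⋃ k ∈ (Finset.range p₀ : Set ℕ), {y | y ∈ F.branch k a ∧ F.T a y = x} := by
    ext y
    simp only [mem_ofPred_eq, Finset.coe_range, mem_Iio, mem_iUnion, exists_prop]
    constructor
    · rintro ⟨h1, h2, h3⟩
      obtain ⟨k, hk, hyk⟩ := F.exists_mem_branch ha h1 h2
      exact ⟨k, hk, hyk, h3⟩
    · rintro ⟨k, hk, hyk, h3⟩
      exact ⟨F.branch_subset ha hk hyk, F.notMem_pts_of_mem_branch ha hk hyk, h3⟩
  have hsub : ∀ k < p₀, {y | y ∈ F.branch k a ∧ F.T a y = x}.Subsingleton := by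
    intro k hk y hy z hz
    exact F.injOn_branch ha hk hy.1 hz.1 (hy.2.trans hz.2.symm)
  rw [transfer, hset, finsum_mem_biUnion, finsum_mem_coe_finset]
  · refine Finset.sum_congr rfl fun k hk => ?_
    by_cases hx : x ∈ F.T a '' F.branch k a
    · rw [indicator_of_mem hx, transferBranch]
      have hx' : ∃ y ∈ F.branch k a, F.T a y = x := hx
      have h1 := Function.invFunOn_mem hx'
      have h2 := Function.invFunOn_eq hx'
      have : {y | y ∈ F.branch k a ∧ F.T a y = x} =
          {Function.invFunOn (F.T a) (F.branch k a) x} :=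
        (hsub k (Finset.mem_range.1 hk)).eq_singleton_of_mem ⟨h1, h2⟩
      rw [this, finsum_mem_singleton]
    · rw [indicator_of_notMem hx]
      have : {y | y ∈ F.branch k a ∧ F.T a y = x} = ∅ := by
        ext y; simp only [mem_ofPred_eq, mem_empty_iff_false, iff_false]
        rintro ⟨h1, h2⟩; exact hx ⟨y, h1, h2⟩
      rw [this, finsum_mem_empty]
  · intro i hi j hj hij
    refine Set.disjoint_left.2 fun y hyi hyj => hij ?_
    simp only [Finset.coe_range, mem_Iio] at hi hj
    exact F.branch_unique ha hi hj hyi.1 hyj.1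
  · exact Finset.finite_toSet _
  · intro k hk
    simp only [Finset.coe_range, mem_Iio] at hk
    exact (hsub k hk).finite

lemma transferBranch_apply (ha : a ∈ Icc (0 : ℝ) 1) {k : ℕ} (hk : k < p₀) {y : ℝ}
    (hy : y ∈ F.branch k a) (φ : ℝ → ℝ) :
    F.transferBranch k a φ (F.T a y) = φ y / |deriv (F.T a) y| := by
  have : Function.invFunOn (F.T a) (F.branch k a) (F.T a y) = y :=
    (F.injOn_branch ha hk).leftInvOn_invFunOn hy
  rw [transferBranch, this]

lemma measurableSet_image_branch (ha : a ∈ Icc (0 : ℝ) 1) {k : ℕ} (hk : k < p₀) :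
    MeasurableSet (F.T a '' F.branch k a) :=
  (F.measurableSet_branch k).image_of_continuousOn_injOn (F.continuousOn_branch ha hk)
    (F.injOn_branch ha hk)

lemma image_branch_subset (ha : a ∈ Icc (0 : ℝ) 1) {k : ℕ} (hk : k < p₀) :
    F.T a '' F.branch k a ⊆ Icc 0 1 := by
  rintro _ ⟨x, hx, rfl⟩
  exact F.mapsTo a ha (F.branch_subset ha hk hx)

lemma transfer_dual (ha : a ∈ Icc (0 : ℝ) 1) {φ ψ : ℝ → ℝ}
    (h : IntegrableOn (fun y => φ y * ψ (F.T a y)) (Icc 0 1)) :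
    IntegrableOn (fun x => F.transfer a φ x * ψ x) (Icc 0 1) ∧
      ∫ x in Icc (0 : ℝ) 1, F.transfer a φ x * ψ x =
        ∫ y in Icc (0 : ℝ) 1, φ y * ψ (F.T a y) := by
  have hEq : ∀ k < p₀, ∀ y ∈ F.branch k a,
      |deriv (F.T a) y| • (F.transferBranch k a φ (F.T a y) * ψ (F.T a y)) =
        φ y * ψ (F.T a y) := by
    intro k hk y hy
    rw [F.transferBranch_apply ha hk hy, smul_eq_mul]
    have := (F.abs_deriv_pos ha hk hy).ne'
    field_simp
  have hI : ∀ k < p₀, IntegrableOn (fun x => F.transferBranch k a φ x * ψ x)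
      (F.T a '' F.branch k a) := by
    intro k hk
    rw [integrableOn_image_iff_integrableOn_abs_deriv_smul (F.measurableSet_branch k)
      (fun x hx => (F.hasDerivAt_T ha hk hx).hasDerivWithinAt) (F.injOn_branch ha hk)]
    exact ((F.integrableOn_iff_branch ha).1 h k hk).congr_fun
      (fun y hy => (hEq k hk y hy).symm) (F.measurableSet_branch k)
  have hsum : ∀ x, F.transfer a φ x * ψ x = ∑ k ∈ Finset.range p₀,
      (F.T a '' F.branch k a).indicator (fun x => F.transferBranch k a φ x * ψ x) x := by
    intro x
    rw [F.transfer_eq_sum ha, Finset.sum_mul]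
    refine Finset.sum_congr rfl fun k _ => ?_
    by_cases hx : x ∈ F.T a '' F.branch k a
    · rw [indicator_of_mem hx, indicator_of_mem hx]
    · rw [indicator_of_notMem hx, indicator_of_notMem hx, zero_mul]
  have hI2 : ∀ k ∈ Finset.range p₀, Integrable (fun x =>
      (F.T a '' F.branch k a).indicator (fun x => F.transferBranch k a φ x * ψ x) x) leb := by
    intro k hk
    have hk' := Finset.mem_range.1 hk
    exact ((integrable_indicator_iff (F.measurableSet_image_branch ha hk')).2
      (hI k hk')).mono_measure Measure.restrict_le_self
  simp only [hsum]
  refine ⟨integrable_finsetSum _ hI2, ?_⟩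
  rw [integral_finsetSum _ hI2, F.setIntegral_eq_sum_branch ha h]
  refine Finset.sum_congr rfl fun k hk => ?_
  have hk' := Finset.mem_range.1 hk
  rw [integral_indicator (F.measurableSet_image_branch ha hk'), Measure.restrict_restrict
    (F.measurableSet_image_branch ha hk'), inter_eq_left.2 (F.image_branch_subset ha hk'),
    integral_image_eq_integral_abs_deriv_smul (F.measurableSet_branch k)
      (fun x hx => (F.hasDerivAt_T ha hk' hx).hasDerivWithinAt) (F.injOn_branch ha hk')]
  exact setIntegral_congr_fun (F.measurableSet_branch k) (hEq k hk')

end ExpandingFamily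

namespace ExpandingFamily

variable {α lam Lam : ℝ} {p₀ p₁ : ℕ} (F : ExpandingFamily α lam Lam p₀ p₁) {a : ℝ}

lemma transfer_lin (ha : a ∈ Icc (0 : ℝ) 1) (φ ψ : ℝ → ℝ) (c d : ℝ) :
    F.transfer a (fun x => c * φ x + d * ψ x) =
      fun x => c * F.transfer a φ x + d * F.transfer a ψ x := by
  funext x
  simp only [F.transfer_eq_sum ha, Finset.mul_sum, ← Finset.sum_add_distrib]
  refine Finset.sum_congr rfl fun k _ => ?_
  by_cases hx : x ∈ F.T a '' F.branch k a
  · simp only [indicator_of_mem hx, transferBranch]; ring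
  · simp only [indicator_of_notMem hx]; ring

lemma transfer_sub (ha : a ∈ Icc (0 : ℝ) 1) (φ ψ : ℝ → ℝ) :
    F.transfer a (fun x => φ x - ψ x) = fun x => F.transfer a φ x - F.transfer a ψ x := by
  have := F.transfer_lin ha φ ψ 1 (-1)
  simpa only [one_mul, neg_mul, ← sub_eq_add_neg] using this

lemma iterate_transfer_lin (ha : a ∈ Icc (0 : ℝ) 1) (φ ψ : ℝ → ℝ) (c d : ℝ) (n : ℕ) :
    (F.transfer a)^[n] (fun x => c * φ x + d * ψ x) =
      fun x => c * (F.transfer a)^[n] φ x + d * (F.transfer a)^[n] ψ x := by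
  induction n with
  | zero => rfl
  | succ n ih => simp only [Function.iterate_succ_apply', ih, F.transfer_lin ha]

lemma iterate_transfer_sub (ha : a ∈ Icc (0 : ℝ) 1) (φ ψ : ℝ → ℝ) (n : ℕ) :
    (F.transfer a)^[n] (fun x => φ x - ψ x) =
      fun x => (F.transfer a)^[n] φ x - (F.transfer a)^[n] ψ x := by
  have := F.iterate_transfer_lin ha φ ψ 1 (-1) n
  simpa only [one_mul, neg_mul, ← sub_eq_add_neg] using this

lemma transfer_nonneg (ha : a ∈ Icc (0 : ℝ) 1) {φ : ℝ → ℝ} (h : ∀ x, 0 ≤ φ x) (x : ℝ) :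
    0 ≤ F.transfer a φ x := by
  rw [F.transfer_eq_sum ha]
  exact Finset.sum_nonneg fun k _ => indicator_nonneg (fun y _ => div_nonneg (h _) (abs_nonneg _)) _

lemma iterate_transfer_nonneg (ha : a ∈ Icc (0 : ℝ) 1) {φ : ℝ → ℝ} (h : ∀ x, 0 ≤ φ x) (n : ℕ)
    (x : ℝ) : 0 ≤ (F.transfer a)^[n] φ x := by
  induction n generalizing x with
  | zero => exact h x
  | succ n ih => rw [Function.iterate_succ_apply']; exact F.transfer_nonneg ha ih x

lemma transfer_mono (ha : a ∈ Icc (0 : ℝ) 1) {φ ψ : ℝ → ℝ} (h : ∀ x, φ x ≤ ψ x) (x : ℝ) :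
    F.transfer a φ x ≤ F.transfer a ψ x := by
  have := F.transfer_nonneg ha (φ := fun x => ψ x - φ x) (fun x => sub_nonneg.2 (h x)) x
  rw [F.transfer_sub ha] at this
  linarith

lemma abs_transfer_le (ha : a ∈ Icc (0 : ℝ) 1) (φ : ℝ → ℝ) (x : ℝ) :
    |F.transfer a φ x| ≤ F.transfer a (fun y => |φ y|) x := by
  rw [F.transfer_eq_sum ha, F.transfer_eq_sum ha]
  refine (Finset.abs_sum_le_sum_abs _ _).trans (Finset.sum_le_sum fun k _ => ?_)
  by_cases hx : x ∈ F.T a '' F.branch k a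
  · simp only [indicator_of_mem hx, transferBranch, abs_div, abs_abs, le_refl]
  · simp only [indicator_of_notMem hx, abs_zero, le_refl]

lemma iterate_dual (ha : a ∈ Icc (0 : ℝ) 1) {φ ψ : ℝ → ℝ} (n : ℕ)
    (h : IntegrableOn (fun y => φ y * ψ ((F.T a)^[n] y)) (Icc 0 1)) :
    IntegrableOn (fun x => (F.transfer a)^[n] φ x * ψ x) (Icc 0 1) ∧
      ∫ x in Icc (0 : ℝ) 1, (F.transfer a)^[n] φ x * ψ x =
        ∫ y in Icc (0 : ℝ) 1, φ y * ψ ((F.T a)^[n] y) := by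
  induction n generalizing φ with
  | zero => exact ⟨h, rfl⟩
  | succ n ih =>
    simp only [Function.iterate_succ_apply] at h ⊢
    obtain ⟨h1, h2⟩ := F.transfer_dual ha (ψ := fun y => ψ ((F.T a)^[n] y)) h
    obtain ⟨h3, h4⟩ := ih h1
    exact ⟨h3, h4.trans h2⟩

lemma iterate_dual_of_bdd (ha : a ∈ Icc (0 : ℝ) 1) {φ ψ : ℝ → ℝ} (n : ℕ)
    (hφ : IntegrableOn φ (Icc 0 1)) (hψ : AEStronglyMeasurable ψ leb) {c : ℝ}
    (hc : ∀ᵐ x ∂leb, |ψ x| ≤ c) :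
    ∫ x in Icc (0 : ℝ) 1, (F.transfer a)^[n] φ x * ψ x =
      ∫ y in Icc (0 : ℝ) 1, φ y * ψ ((F.T a)^[n] y) :=
  (F.iterate_dual ha n (Integrable.mul_bdd (c := c) hφ (F.aesm_comp_iterate ha hψ n)
    (F.ae_comp_iterate ha (P := fun x => |ψ x| ≤ c) hc n))).2

lemma integrable_iterate_transfer (ha : a ∈ Icc (0 : ℝ) 1) {φ : ℝ → ℝ}
    (hφ : IntegrableOn φ (Icc 0 1)) (n : ℕ) :
    IntegrableOn ((F.transfer a)^[n] φ) (Icc 0 1) := by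
  have := (F.iterate_dual ha (φ := φ) (ψ := fun _ => 1) n (by simpa using hφ)).1
  simpa using this

lemma integral_iterate_transfer (ha : a ∈ Icc (0 : ℝ) 1) {φ : ℝ → ℝ}
    (hφ : IntegrableOn φ (Icc 0 1)) (n : ℕ) :
    ∫ x in Icc (0 : ℝ) 1, (F.transfer a)^[n] φ x = ∫ x in Icc (0 : ℝ) 1, φ x := by
  have := (F.iterate_dual ha (φ := φ) (ψ := fun _ => 1) n (by simpa using hφ)).2
  simpa using this

lemma integrable_transfer (ha : a ∈ Icc (0 : ℝ) 1) {φ : ℝ → ℝ}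
    (hφ : IntegrableOn φ (Icc 0 1)) : IntegrableOn (F.transfer a φ) (Icc 0 1) :=
  F.integrable_iterate_transfer ha hφ 1

lemma l1_transfer_le (ha : a ∈ Icc (0 : ℝ) 1) {φ : ℝ → ℝ} (hφ : IntegrableOn φ (Icc 0 1)) :
    l1 (F.transfer a φ) ≤ l1 φ := by
  calc l1 (F.transfer a φ) ≤ ∫ x in Icc (0 : ℝ) 1, F.transfer a (fun y => |φ y|) x :=
        integral_mono (F.integrable_transfer ha hφ).abs (F.integrable_transfer ha hφ.abs)
          (F.abs_transfer_le ha φ)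
    _ = l1 φ := F.integral_iterate_transfer ha hφ.abs 1

lemma l1_iterate_transfer_le (ha : a ∈ Icc (0 : ℝ) 1) {φ : ℝ → ℝ}
    (hφ : IntegrableOn φ (Icc 0 1)) (n : ℕ) : l1 ((F.transfer a)^[n] φ) ≤ l1 φ := by
  induction n with
  | zero => exact le_rfl
  | succ n ih =>
    rw [Function.iterate_succ_apply']
    exact (F.l1_transfer_le ha (F.integrable_iterate_transfer ha hφ n)).trans ih

lemma iterate_transfer_congr (ha : a ∈ Icc (0 : ℝ) 1) {φ ψ : ℝ → ℝ}
    (hφ : IntegrableOn φ (Icc 0 1)) (h : φ =ᵐ[leb] ψ) (n : ℕ) :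
    (F.transfer a)^[n] φ =ᵐ[leb] (F.transfer a)^[n] ψ := by
  have hψ : IntegrableOn ψ (Icc 0 1) := Integrable.congr hφ h
  have h1 := F.l1_iterate_transfer_le ha (Integrable.sub hφ hψ) n
  have h2 : l1 (φ - ψ) = 0 := by
    rw [l1, integral_eq_zero_iff_of_nonneg (fun x => abs_nonneg _) (Integrable.sub hφ hψ).abs]
    filter_upwards [h] with x hx
    simp [hx]
  rw [h2] at h1
  have h3 : l1 ((F.transfer a)^[n] (φ - ψ)) = 0 := le_antisymm h1 (l1_nonneg _)
  rw [l1, integral_eq_zero_iff_of_nonneg (fun x => abs_nonneg _)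
    (F.integrable_iterate_transfer ha (Integrable.sub hφ hψ) n).abs] at h3
  filter_upwards [h3] with x hx
  have e : (φ - ψ) = fun x => φ x - ψ x := rfl
  rw [e, F.iterate_transfer_sub ha] at hx
  exact sub_eq_zero.1 (abs_eq_zero.1 hx)

/-! ### Absolutely continuous invariant measures and their supports -/

lemma isAcip_of_density (ha : a ∈ Icc (0 : ℝ) 1) {h : ℝ → ℝ} (hi : IntegrableOn h (Icc 0 1))
    (h0 : ∀ᵐ x ∂leb, 0 ≤ h x) (h1 : ∫ x in Icc (0 : ℝ) 1, h x = 1)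
    (hinv : F.transfer a h =ᵐ[leb] h) :
    IsAcip (F.T a) (leb.withDensity fun x => ENNReal.ofReal (h x)) := by
  have hset : ∀ s : Set ℝ, NullMeasurableSet s leb →
      (leb.withDensity fun x => ENNReal.ofReal (h x)) s =
        ENNReal.ofReal (∫ x in Icc (0 : ℝ) 1, h x * s.indicator 1 x) := by
    intro s hs
    rw [withDensity_apply₀ _ hs, ← ofReal_integral_eq_lintegral_ofReal
      (Integrable.mono_measure hi Measure.restrict_le_self)
      (ae_mono Measure.restrict_le_self h0), ← integral_indicator₀ hs]
    congr 2
    funext x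
    by_cases hx : x ∈ s <;> simp [hx]
  refine ⟨⟨?_⟩, withDensity_absolutelyContinuous _ _, fun B hB => ?_⟩
  · rw [hset univ MeasurableSet.univ.nullMeasurableSet]
    simp [h1]
  · have hpre : NullMeasurableSet (F.T a ⁻¹' B) leb := (F.aemeasurable_T ha).nullMeasurable hB
    rw [hset _ hpre, hset _ hB.nullMeasurableSet]
    congr 1
    have h2 := F.iterate_dual_of_bdd ha (ψ := B.indicator 1) (c := 1) 1 hi
      ((measurable_one.indicator hB).aestronglyMeasurable)
      (Eventually.of_forall fun x => by by_cases hx : x ∈ B <;> simp [hx])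
    simp only [Function.iterate_one] at h2
    have h3 : ∫ x in Icc (0 : ℝ) 1, F.transfer a h x * B.indicator 1 x =
        ∫ x in Icc (0 : ℝ) 1, h x * B.indicator 1 x :=
      integral_congr_ae (hinv.mono fun x hx => by simp only [hx])
    rw [← h3, h2]
    rfl

lemma isAcip_μ (ha : a ∈ Icc (0 : ℝ) 1) : IsAcip (F.T a) (F.μ a) := (F.acip a ha _).2 rfl

lemma isClosed_K (a : ℝ) : IsClosed (F.K a) := Measure.isClosed_support

lemma K_subset (ha : a ∈ Icc (0 : ℝ) 1) : F.K a ⊆ Icc 0 1 :=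
  Measure.support_subset_of_isClosed isClosed_Icc
    ((F.isAcip_μ ha).ac.ae_le (ae_restrict_mem measurableSet_Icc))

lemma μ_compl_K (a : ℝ) : F.μ a (F.K a)ᶜ = 0 := Measure.measure_compl_support

lemma mapsTo_K (ha : a ∈ Icc (0 : ℝ) 1) {x : ℝ} (hx : x ∈ F.K a) (hp : x ∉ F.pts a) :
    F.T a x ∈ F.K a := by
  rw [K, Measure.mem_support_iff_forall] at hx ⊢
  intro U hU
  obtain ⟨V, hVU, hV, hxV⟩ := mem_nhds_iff.1 hU
  have hxI : x ∈ Icc (0 : ℝ) 1 :=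
    F.K_subset ha ((Measure.mem_support_iff_forall _).2 hx)
  have h1 := hx _ ((F.continuousAt_T ha hxI hp).preimage_mem_nhds (hV.mem_nhds hxV))
  rw [(F.isAcip_μ ha).invariant V hV.measurableSet] at h1
  exact h1.trans_le (measure_mono hVU)

lemma volume_K_pos (ha : a ∈ Icc (0 : ℝ) 1) : 0 < volume (F.K a) := by
  rw [pos_iff_ne_zero]
  intro h
  have h1 : F.μ a (F.K a) = 0 := (F.isAcip_μ ha).ac
    (le_antisymm ((Measure.restrict_apply_le _ _).trans h.le) zero_le)
  have := (F.isAcip_μ ha).prob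
  have h2 : F.μ a univ ≤ 0 := by
    rw [← union_compl_self (F.K a)]
    refine (measure_union_le _ _).trans ?_
    rw [h1, F.μ_compl_K, add_zero]
  rw [measure_univ] at h2
  exact absurd h2 (by simp)

include F in
/-- The support has at least `lam` monotonicity intervals. -/
lemma lam_le_card : lam ≤ p₁ := by
  have ha : (0 : ℝ) ∈ Icc (0 : ℝ) 1 := by simp
  obtain ⟨l, r, C, -, h⟩ := F.support_regular
  obtain ⟨D, -, hD, -⟩ := h 0 ha
  set S : Set ℝ := (F.μ 0).support \ {x | ∃ k ≤ p₀, x = F.b k 0} with hS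
  have hDk : ∀ k, ∃ x ∈ S, D k = connectedComponentIn S x := by
    intro k
    have : D k ∈ components S := hD ▸ mem_range_self k
    obtain ⟨x, hx, e⟩ := this
    exact ⟨x, hx, e.symm⟩
  have hDS : ∀ k, D k ⊆ S := fun k => by
    obtain ⟨x, hx, e⟩ := hDk k
    rw [e]; exact connectedComponentIn_subset S x
  have hDo : ∀ k, (D k).OrdConnected := fun k => by
    obtain ⟨x, hx, e⟩ := hDk k
    rw [e]; exact isPreconnected_connectedComponentIn.ordConnected
  have hcov : S ⊆ ⋃ k, D k := by
    intro x hx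
    have : connectedComponentIn S x ∈ range D := hD ▸ mem_image_of_mem _ hx
    obtain ⟨k, hk⟩ := this
    exact mem_iUnion.2 ⟨k, hk ▸ mem_connectedComponentIn hx⟩
  have hbr : ∀ k, ∃ j < p₀, D k ⊆ F.branch j 0 := by
    intro k
    obtain ⟨x, hx, e⟩ := hDk k
    have hxD : x ∈ D k := e ▸ mem_connectedComponentIn hx
    obtain ⟨j, hj, hxj⟩ := F.exists_mem_branch ha (F.K_subset ha hx.1) hx.2
    refine ⟨j, hj, fun y hy => ⟨?_, ?_⟩⟩
    · by_contra! hcon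
      exact (hDS k ((hDo k).out hy hxD ⟨hcon, hxj.1.le⟩)).2 ⟨j, hj.le, rfl⟩
    · by_contra! hcon
      exact (hDS k ((hDo k).out hxD hy ⟨hxj.2.le, hcon⟩)).2 ⟨j + 1, hj, rfl⟩
  have hvol : ∀ k, ENNReal.ofReal lam * volume (D k) ≤ volume (F.K 0) := by
    intro k
    obtain ⟨j, hj, hsub⟩ := hbr k
    have h1 := lintegral_image_eq_lintegral_abs_deriv_mul (hDo k).measurableSet
      (fun x hx => (F.hasDerivAt_T ha hj (hsub hx)).hasDerivWithinAt)
      ((F.injOn_branch ha hj).mono hsub) (fun _ => 1)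
    simp only [mul_one, lintegral_const, one_mul, Measure.restrict_apply_univ] at h1
    calc ENNReal.ofReal lam * volume (D k) = ∫⁻ _ in D k, ENNReal.ofReal lam := by
          rw [setLIntegral_const]
      _ ≤ ∫⁻ x in D k, ENNReal.ofReal |deriv (F.T 0) x| :=
          setLIntegral_mono' (hDo k).measurableSet fun x hx =>
            ENNReal.ofReal_le_ofReal (F.expanding 0 ha j hj x (hsub hx)).1
      _ = volume (F.T 0 '' D k) := h1.symm
      _ ≤ volume (F.K 0) := measure_mono (image_subset_iff.2 fun x hx =>
          F.mapsTo_K ha (hDS k hx).1 (hDS k hx).2)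
  have hK : volume (F.K 0) ≤ ∑ k, volume (D k) := by
    calc volume (F.K 0) ≤ volume (F.pts 0) + volume S := by
          refine (measure_mono ?_).trans (measure_union_le _ _)
          intro x hx
          by_cases hp : x ∈ F.pts 0
          · exact Or.inl hp
          · exact Or.inr ⟨hx, hp⟩
      _ ≤ ∑ k, volume (D k) := by
          rw [F.volume_pts, zero_add]
          exact (measure_mono hcov).trans (measure_iUnion_fintype_le _ _)
  have hKfin : volume (F.K 0) ≠ ∞ :=
    ((measure_mono (F.K_subset ha)).trans_lt (by simp)).ne
  have h2 : ENNReal.ofReal lam * volume (F.K 0) ≤ p₁ * volume (F.K 0) := by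
    calc ENNReal.ofReal lam * volume (F.K 0) ≤ ENNReal.ofReal lam * ∑ k, volume (D k) := by gcongr
      _ = ∑ k, ENNReal.ofReal lam * volume (D k) := by rw [Finset.mul_sum]
      _ ≤ ∑ _k : Fin p₁, volume (F.K 0) := Finset.sum_le_sum fun k _ => hvol k
      _ = _ := by simp
  have h3 := (ENNReal.mul_le_mul_iff_left (F.volume_K_pos ha).ne' hKfin).1 h2
  rw [← ENNReal.ofReal_natCast, ENNReal.ofReal_le_ofReal_iff (Nat.cast_nonneg _)] at h3
  exact h3

end ExpandingFamily

namespace ExpandingFamily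

variable {α lam Lam : ℝ} {p₀ p₁ : ℕ} (F : ExpandingFamily α lam Lam p₀ p₁) {a : ℝ}

/-! ### Regularity in the parameter -/

/-- The parameter derivative `∂ₐ T a x`. -/
noncomputable def pd (x a : ℝ) : ℝ := derivWithin (fun t => F.T t x) (Icc 0 1) a

lemma exists_lipschitz_b : ∃ L : ℝ, 0 < L ∧ ∀ k ≤ p₀, ∀ a ∈ Icc (0 : ℝ) 1, ∀ a' ∈ Icc (0 : ℝ) 1,
    |F.b k a - F.b k a'| ≤ L * |a - a'| := by
  obtain ⟨L, hL⟩ := F.b_lipschitz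
  refine ⟨|L| + 1, by positivity, fun k hk a ha a' ha' => (hL k hk a ha a' ha').trans ?_⟩
  gcongr
  linarith [le_abs_self L]

lemma continuousOn_b {k : ℕ} (hk : k ≤ p₀) : ContinuousOn (F.b k) (Icc 0 1) := by
  obtain ⟨L, hL0, hL⟩ := F.exists_lipschitz_b
  exact (LipschitzOnWith.of_dist_le_mul (K := L.toNNReal) fun x hx y hy => by
    rw [Real.coe_toNNReal L hL0.le]
    exact hL k hk x hx y hy).continuousOn

lemma exists_branch_length : ∃ l : ℝ, 0 < l ∧ ∀ a ∈ Icc (0 : ℝ) 1, ∀ k < p₀,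
    l ≤ F.b (k + 1) a - F.b k a := by
  have key : ∀ n ≤ p₀, ∃ l : ℝ, 0 < l ∧ ∀ a ∈ Icc (0 : ℝ) 1, ∀ k < n,
      l ≤ F.b (k + 1) a - F.b k a := by
    intro n
    induction n with
    | zero => intro _; exact ⟨1, one_pos, fun _ _ k hk => absurd hk (Nat.not_lt_zero k)⟩
    | succ n ih =>
      intro hn
      obtain ⟨l, hl, h⟩ := ih (by omega)
      obtain ⟨x, hx, hmin⟩ := isCompact_Icc.exists_isMinOn (nonempty_Icc.2 (zero_le_one' ℝ))
        ((F.continuousOn_b (k := n + 1) hn).sub (F.continuousOn_b (k := n) (by omega)))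
      refine ⟨min l (F.b (n + 1) x - F.b n x), lt_min hl (sub_pos.2 (F.b_lt x hx n hn)), ?_⟩
      intro a ha k hk
      rcases Nat.lt_succ_iff_lt_or_eq.1 hk with h1 | rfl
      · exact (min_le_left _ _).trans (h a ha k h1)
      · exact (min_le_right _ _).trans (hmin ha)
  exact key p₀ le_rfl

lemma abs_sub_le_of_mem_uIcc {a a' t : ℝ} (ht : t ∈ uIcc a a') : |t - a| ≤ |a - a'| := by
  rw [abs_sub_comm a a']
  exact abs_sub_left_of_mem_uIcc ht

lemma uIcc_subset_unit {a a' : ℝ} (ha : a ∈ Icc (0 : ℝ) 1) (ha' : a' ∈ Icc (0 : ℝ) 1) :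
    uIcc a a' ⊆ Icc 0 1 := ordConnected_Icc.uIcc_subset ha ha'

/-- A point of a branch can be moved slightly so that it stays in the branch for all parameters
of a short interval. -/
lemma exists_shift {L l : ℝ} (hL0 : 0 < L)
    (hL : ∀ k ≤ p₀, ∀ a ∈ Icc (0 : ℝ) 1, ∀ a' ∈ Icc (0 : ℝ) 1, |F.b k a - F.b k a'| ≤ L * |a - a'|)
    (hl : ∀ a ∈ Icc (0 : ℝ) 1, ∀ k < p₀, l ≤ F.b (k + 1) a - F.b k a)
    {a a' : ℝ} (ha : a ∈ Icc (0 : ℝ) 1) (ha' : a' ∈ Icc (0 : ℝ) 1) (hs : 4 * L * |a - a'| < l)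
    {k : ℕ} (hk : k < p₀) {x : ℝ} (hx : x ∈ F.branch k a) :
    ∃ y, |y - x| ≤ 2 * L * |a - a'| ∧ ∀ t ∈ uIcc a a', y ∈ F.branch k t := by
  rcases eq_or_ne a a' with rfl | hne
  · exact ⟨x, by simp, fun t ht => by rw [uIcc_self, mem_singleton_iff] at ht; rwa [ht]⟩
  have hs0 : 0 < |a - a'| := abs_pos.2 (sub_ne_zero.2 hne)
  have hLs : 0 < L * |a - a'| := mul_pos hL0 hs0
  set c := F.b k a + 2 * L * |a - a'| with hc
  set d := F.b (k + 1) a - 2 * L * |a - a'| with hd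
  have hcd : c < d := by linarith [hl a ha k hk]
  refine ⟨max c (min x d), ?_, fun t ht => ?_⟩
  · have hx1 := hx.1; have hx2 := hx.2
    rw [abs_le]
    rcases le_total x d with h1 | h1
    · rw [min_eq_left h1]
      rcases le_total c x with h2 | h2
      · rw [max_eq_right h2]; constructor <;> linarith
      · rw [max_eq_left h2]; constructor <;> linarith
    · rw [min_eq_right h1, max_eq_right hcd.le]; constructor <;> linarith
  · have ht01 := uIcc_subset_unit ha ha' ht
    have h1 : |t - a| ≤ |a - a'| := abs_sub_le_of_mem_uIcc ht
    have hb1 := (abs_le.1 (hL k hk.le t ht01 a ha)).2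
    have hb2 := (abs_le.1 (hL (k + 1) hk t ht01 a ha)).1
    have h2 : L * |t - a| ≤ L * |a - a'| := by gcongr
    constructor
    · refine lt_of_lt_of_le ?_ (le_max_left _ _); linarith
    · refine max_lt ?_ (lt_of_le_of_lt (min_le_right _ _) ?_) <;> linarith

lemma ne_b_of_mem_branch {t : ℝ} (ht : t ∈ Icc (0 : ℝ) 1) {k : ℕ} (hk : k < p₀) {y : ℝ}
    (hy : y ∈ F.branch k t) : ∀ j ≤ p₀, F.b j t ≠ y := fun j hj h =>
  F.notMem_pts_of_mem_branch ht hk hy ⟨j, hj, h.symm⟩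

lemma differentiableWithinAt_param (ha : a ∈ Icc (0 : ℝ) 1) {x : ℝ} (hx : x ∈ Icc (0 : ℝ) 1)
    (hp : ∀ j ≤ p₀, F.b j a ≠ x) : DifferentiableWithinAt ℝ (fun t => F.T t x) (Icc 0 1) a := by
  obtain ⟨C, hC⟩ := F.param_regular
  refine (hC x hx {a} (singleton_subset_iff.2 ha) ordConnected_singleton ?_).1 a rfl
  rintro _ rfl
  exact hp

/-- The parameter derivative is bounded. -/
lemma exists_pd_bound : ∃ B : ℝ, 0 < B ∧ ∀ a ∈ Icc (0 : ℝ) 1, ∀ k < p₀, ∀ x ∈ F.branch k a,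
    |F.pd x a| ≤ B := by
  obtain ⟨L, hL0, hL⟩ := F.exists_lipschitz_b
  obtain ⟨l, hl0, hl⟩ := F.exists_branch_length
  obtain ⟨C, hC⟩ := F.param_regular
  obtain ⟨C', hC'⟩ := F.param_deriv_holder
  set τ := min (l / (4 * L)) (1 / 2) with hτ
  have hτ0 : 0 < τ := by positivity
  have hτL : L * τ ≤ l / 4 := by
    calc L * τ ≤ L * (l / (4 * L)) := by gcongr; exact min_le_left _ _
      _ = l / 4 := by field_simp
  have hτ1 : τ ≤ 1 / 2 := min_le_right _ _
  refine ⟨1 / τ + |C| + |C'|, by positivity, fun a ha k hk x hx => ?_⟩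
  set x' := (F.b k a + F.b (k + 1) a) / 2 with hx'
  have hxa : x' ∈ F.branch k a := by
    have := F.b_lt a ha k hk
    constructor <;> linarith
  have hx01 := F.branch_subset ha hk hxa
  obtain ⟨c, d, hcd, hac, hsub⟩ : ∃ c d : ℝ, d - c = τ ∧ a ∈ Icc c d ∧ Icc c d ⊆ Icc 0 1 := by
    rcases le_total a (1 / 2) with h | h
    · exact ⟨a, a + τ, by ring, ⟨le_rfl, by linarith⟩, Icc_subset_Icc ha.1 (by linarith)⟩
    · exact ⟨a - τ, a, by ring, ⟨by linarith, le_rfl⟩, Icc_subset_Icc (by linarith) ha.2⟩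
  have hne : ∀ t ∈ Icc c d, ∀ j ≤ p₀, F.b j t ≠ x' := by
    intro t ht
    refine F.ne_b_of_mem_branch (hsub ht) hk ?_
    have h1 : |t - a| ≤ τ := by
      rw [abs_le]; constructor <;> linarith [ht.1, ht.2, hac.1, hac.2]
    have h2 : L * |t - a| ≤ L * τ := by gcongr
    have h3 := (abs_le.1 (hL k hk.le t (hsub ht) a ha)).2
    have h4 := (abs_le.1 (hL (k + 1) hk t (hsub ht) a ha)).1
    have h5 := hl a ha k hk
    constructor <;> linarith
  obtain ⟨hd, hH⟩ := hC x' hx01 (Icc c d) hsub ordConnected_Icc hne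
  obtain ⟨t, ht, e⟩ := exists_deriv_eq_slope (fun t => F.T t x') (by linarith : c < d)
    (fun t ht => ((hd t ht).mono hsub).continuousWithinAt) (fun t ht => by
      have h1 : Icc (0 : ℝ) 1 ∈ 𝓝 t := mem_of_superset (Icc_mem_nhds ht.1 ht.2) hsub
      exact ((hd t (Ioo_subset_Icc_self ht)).differentiableAt h1).differentiableWithinAt)
  have ht' := Ioo_subset_Icc_self ht
  have h1 : Icc (0 : ℝ) 1 ∈ 𝓝 t := mem_of_superset (Icc_mem_nhds ht.1 ht.2) hsub
  have h2 : |F.pd x' t| ≤ 1 / τ := by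
    rw [pd, derivWithin_of_mem_nhds h1, e, hcd, abs_div, abs_of_pos hτ0]
    gcongr
    have m1 := F.mapsTo d (hsub (right_mem_Icc.2 (by linarith))) hx01
    have m2 := F.mapsTo c (hsub (left_mem_Icc.2 (by linarith))) hx01
    rw [abs_le]; constructor <;> linarith [m1.1, m1.2, m2.1, m2.2]
  have h3 : |F.pd x' a - F.pd x' t| ≤ |C| := by
    refine ((hH a hac t ht').1).trans ?_
    have h6 : |a - t| ≤ 1 := by
      rw [abs_le]; constructor <;> linarith [ht'.1, ht'.2, hac.1, hac.2]
    calc C * |a - t| ^ α ≤ |C| * 1 := by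
          gcongr
          · exact le_abs_self C
          · exact Real.rpow_le_one (abs_nonneg _) h6 F.α_pos.le
      _ = |C| := mul_one _
  have h4 : |F.pd x a - F.pd x' a| ≤ |C'| := by
    refine (hC' a ha k hk x hx x' hxa).trans ?_
    have m1 := F.branch_subset ha hk hx
    have h6 : |x - x'| ≤ 1 := by
      rw [abs_le]; constructor <;> linarith [m1.1, m1.2, hx01.1, hx01.2]
    calc C' * |x - x'| ^ α ≤ |C'| * 1 := by
          gcongr
          · exact le_abs_self C'
          · exact Real.rpow_le_one (abs_nonneg _) h6 F.α_pos.le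
      _ = |C'| := mul_one _
  have e1 : F.pd x a = F.pd x' t + (F.pd x' a - F.pd x' t) + (F.pd x a - F.pd x' a) := by ring
  rw [e1]
  refine (abs_add_le _ _).trans ?_
  linarith [abs_add_le (F.pd x' t) (F.pd x' a - F.pd x' t)]

/-- `T a x` is Lipschitz in `a` as long as `x` is no partition point. -/
lemma abs_T_sub_le {B : ℝ} (hB : ∀ a ∈ Icc (0 : ℝ) 1, ∀ k < p₀, ∀ x ∈ F.branch k a, |F.pd x a| ≤ B)
    {a a' : ℝ} (ha : a ∈ Icc (0 : ℝ) 1) (ha' : a' ∈ Icc (0 : ℝ) 1) {x : ℝ}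
    (hx : x ∈ Icc (0 : ℝ) 1) (hp : ∀ t ∈ uIcc a a', x ∉ F.pts t) :
    |F.T a x - F.T a' x| ≤ B * |a - a'| := by
  have hsub := uIcc_subset_unit ha ha'
  refine (convex_uIcc a a').norm_image_sub_le_of_norm_hasDerivWithin_le
    (f := fun t => F.T t x) (f' := fun t => F.pd x t) (x := a') (y := a) (fun t ht => ?_)
    (fun t ht => ?_) right_mem_uIcc left_mem_uIcc
  · have hne : ∀ j ≤ p₀, F.b j t ≠ x := fun j hj h => hp t ht ⟨j, hj, h.symm⟩
    exact (F.differentiableWithinAt_param (hsub ht) hx hne).hasDerivWithinAt.mono hsub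
  · obtain ⟨k, hk, hxk⟩ := F.exists_mem_branch (hsub ht) hx (hp t ht)
    exact hB t (hsub ht) k hk x hxk

/-- `∂ₓ T` and `∂ₐ T` are jointly Hölder continuous on each branch. -/
lemma exists_joint_holder : ∃ C : ℝ, 0 < C ∧ ∀ a ∈ Icc (0 : ℝ) 1, ∀ a' ∈ Icc (0 : ℝ) 1, ∀ k < p₀,
    ∀ x ∈ F.branch k a, ∀ x' ∈ F.branch k a',
      |deriv (F.T a) x - deriv (F.T a') x'| ≤ C * (|x - x'| ^ α + |a - a'| ^ α) ∧
      |F.pd x a - F.pd x' a'| ≤ C * (|x - x'| ^ α + |a - a'| ^ α) := by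
  obtain ⟨L, hL0, hL⟩ := F.exists_lipschitz_b
  obtain ⟨l, hl0, hl⟩ := F.exists_branch_length
  obtain ⟨C₀, hC₀⟩ := F.holder
  obtain ⟨C₁, hC₁⟩ := F.param_regular
  obtain ⟨C₂, hC₂⟩ := F.param_deriv_holder
  obtain ⟨B, hB0, hB⟩ := F.exists_pd_bound
  have hα := F.α_pos
  have hα1 := F.α_le_one
  have hLam := F.Lam_pos
  set D := |C₀| + |C₁| + |C₂| with hD
  set Q := (l / (4 * L)) ^ α with hQ
  have hQ0 : 0 < Q := by positivity
  have hD0 : 0 ≤ D := by positivity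
  set M := (2 * L) ^ α with hM
  have hM0 : 0 ≤ M := by positivity
  refine ⟨(2 * Lam + 2 * B) / Q + D * (2 * M + 2), by positivity, ?_⟩
  intro a ha a' ha' k hk x hx x' hx'
  set s := |a - a'| with hs
  have hs0 : 0 ≤ s := abs_nonneg _
  have hE0 : 0 ≤ |x - x'| ^ α := by positivity
  have hs0' : 0 ≤ s ^ α := by positivity
  rcases lt_or_ge (4 * L * s) l with hsl | hsl
  · obtain ⟨y, hyx, hy⟩ := F.exists_shift hL0 hL hl ha ha' hsl hk hx
    have hya := hy a left_mem_uIcc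
    have hya' := hy a' right_mem_uIcc
    have hr := hC₁ y (F.branch_subset ha hk hya) (uIcc a a') (uIcc_subset_unit ha ha')
      ordConnected_uIcc fun t ht => F.ne_b_of_mem_branch (uIcc_subset_unit ha ha' ht) hk (hy t ht)
    obtain ⟨hr1, hr2⟩ := hr.2 a left_mem_uIcc a' right_mem_uIcc
    have hp1 : |x - y| ^ α ≤ M * s ^ α := by
      rw [hM, ← Real.mul_rpow (by positivity) hs0, abs_sub_comm]
      gcongr
    have hp2 : |y - x'| ^ α ≤ M * s ^ α + |x - x'| ^ α := by
      calc |y - x'| ^ α ≤ (2 * L * s + |x - x'|) ^ α := by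
            gcongr
            calc |y - x'| = |(y - x) + (x - x')| := by ring_nf
              _ ≤ |y - x| + |x - x'| := abs_add_le _ _
              _ ≤ _ := by gcongr
        _ ≤ (2 * L * s) ^ α + |x - x'| ^ α :=
            Real.rpow_add_le_add_rpow (by positivity) (abs_nonneg _) hα.le hα1
        _ = _ := by rw [Real.mul_rpow (by positivity) hs0]
    have hfin : ∀ u v w z : ℝ, |u - v| ≤ D * |x - y| ^ α → |v - w| ≤ D * s ^ α →
        |w - z| ≤ D * |y - x'| ^ α → |u - z| ≤
        ((2 * Lam + 2 * B) / Q + D * (2 * M + 2)) * (|x - x'| ^ α + s ^ α) := by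
      intro u v w z h1 h2 h3
      have e : u - z = (u - v) + (v - w) + (w - z) := by ring
      have h4 : |u - z| ≤ |u - v| + |v - w| + |w - z| := by
        rw [e]; exact (abs_add_le _ _).trans (by gcongr; exact abs_add_le _ _)
      have h5 : D * |x - y| ^ α ≤ D * (M * s ^ α) := by gcongr
      have h6 : D * |y - x'| ^ α ≤ D * (M * s ^ α + |x - x'| ^ α) := by gcongr
      have h7 : 0 ≤ (2 * Lam + 2 * B) / Q * (|x - x'| ^ α + s ^ α) := by positivity
      have h8 : 0 ≤ D * M * |x - x'| ^ α := by positivity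
      have h9 : 0 ≤ D * |x - x'| ^ α := by positivity
      have h10 : 0 ≤ D * s ^ α := by positivity
      nlinarith
    have hup : ∀ C X : ℝ, |C| ≤ D → 0 ≤ X → C * X ≤ D * X := fun C X hC hX =>
      mul_le_mul_of_nonneg_right ((le_abs_self C).trans hC) hX
    have hD1 : |C₀| ≤ D := by rw [hD]; linarith [abs_nonneg C₁, abs_nonneg C₂]
    have hD2 : |C₁| ≤ D := by rw [hD]; linarith [abs_nonneg C₀, abs_nonneg C₂]
    have hD3 : |C₂| ≤ D := by rw [hD]; linarith [abs_nonneg C₁, abs_nonneg C₀]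
    constructor
    · exact hfin _ (deriv (F.T a) y) (deriv (F.T a') y) _
        ((hC₀ a ha k hk x hx y hya).trans (hup _ _ hD1 (by positivity)))
        (hr2.trans (hup _ _ hD2 hs0'))
        ((hC₀ a' ha' k hk y hya' x' hx').trans (hup _ _ hD1 (by positivity)))
    · exact hfin _ (F.pd y a) (F.pd y a') _
        ((hC₂ a ha k hk x hx y hya).trans (hup _ _ hD3 (by positivity)))
        (hr1.trans (hup _ _ hD2 hs0'))
        ((hC₂ a' ha' k hk y hya' x' hx').trans (hup _ _ hD3 (by positivity)))
  · have h1 : Q ≤ s ^ α := by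
      rw [hQ]; gcongr
      rw [div_le_iff₀ (by positivity)]; linarith
    have h2 : 2 * Lam + 2 * B ≤ ((2 * Lam + 2 * B) / Q + D * (2 * M + 2)) * (|x - x'| ^ α + s ^ α) := by
      calc 2 * Lam + 2 * B = (2 * Lam + 2 * B) / Q * Q := by field_simp
        _ ≤ ((2 * Lam + 2 * B) / Q + D * (2 * M + 2)) * (|x - x'| ^ α + s ^ α) := by
          have : Q ≤ |x - x'| ^ α + s ^ α := by linarith
          have h3 : 0 ≤ D * (2 * M + 2) := by positivity
          gcongr
          linarith
    have e1 := (F.expanding a ha k hk x hx).2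
    have e2 := (F.expanding a' ha' k hk x' hx').2
    have e3 := hB a ha k hk x hx
    have e4 := hB a' ha' k hk x' hx'
    constructor
    · refine (abs_sub _ _).trans (le_trans ?_ h2); linarith
    · refine (abs_sub _ _).trans (le_trans ?_ h2); linarith

lemma eventually_mem_branch {a : ℝ} (ha : a ∈ Ioo (0 : ℝ) 1) {k : ℕ} (hk : k < p₀) {y : ℝ → ℝ}
    (hy : ContinuousAt y a) (hya : y a ∈ F.branch k a) : ∀ᶠ t in 𝓝 a, y t ∈ F.branch k t := by
  have hn : Icc (0 : ℝ) 1 ∈ 𝓝 a := Icc_mem_nhds ha.1 ha.2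
  have h1 := ((F.continuousOn_b hk.le).continuousAt hn).eventually_lt hy hya.1
  have h2 := hy.eventually_lt ((F.continuousOn_b (k := k + 1) hk).continuousAt hn) hya.2
  filter_upwards [h1, h2] with t h1 h2 using ⟨h1, h2⟩

/-- Chain rule for `t ↦ T t (y t)`. -/
lemma hasDerivAt_comp_param {a : ℝ} (ha : a ∈ Ioo (0 : ℝ) 1) {k : ℕ} (hk : k < p₀) {y : ℝ → ℝ}
    {y' : ℝ} (hy : HasDerivAt y y' a) (hya : y a ∈ F.branch k a) :
    HasDerivAt (fun t => F.T t (y t)) (F.pd (y a) a + deriv (F.T a) (y a) * y') a := by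
  have haI := Ioo_subset_Icc_self ha
  have hn : Icc (0 : ℝ) 1 ∈ 𝓝 a := Icc_mem_nhds ha.1 ha.2
  obtain ⟨C, hC0, hC⟩ := F.exists_joint_holder
  have g1 : HasDerivAt (fun t => F.T t (y a)) (F.pd (y a) a) a :=
    (F.differentiableWithinAt_param haI (F.branch_subset haI hk hya)
      (F.ne_b_of_mem_branch haI hk hya)).hasDerivWithinAt.hasDerivAt hn
  set q := deriv (F.T a) (y a) with hq
  have hrem : (fun t => F.T t (y t) - F.T t (y a) - q * (y t - y a)) =o[𝓝 a] fun t => t - a := by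
    have hbd : ∀ᶠ t in 𝓝 a, ‖F.T t (y t) - F.T t (y a) - q * (y t - y a)‖ ≤
        ‖C * (|y t - y a| ^ α + |t - a| ^ α) * (y t - y a)‖ := by
      filter_upwards [F.eventually_mem_branch ha hk hy.continuousAt hya,
        F.eventually_mem_branch ha hk (y := fun _ => y a) continuousAt_const hya, hn]
        with t h1 h2 ht
      obtain ⟨z, hz, hzy, e⟩ := F.exists_slope ht hk h1 h2
      rw [e, ← sub_mul, norm_mul, norm_mul]
      gcongr
      have := (hC t ht a haI k hk z hz (y a) hya).1
      rw [Real.norm_eq_abs, Real.norm_eq_abs]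
      refine (this.trans ?_).trans (le_abs_self _)
      have := F.α_pos
      gcongr
    refine (Asymptotics.IsBigO.of_bound' hbd).trans_isLittleO ?_
    have h0 : Tendsto (fun t => C * (|y t - y a| ^ α + |t - a| ^ α)) (𝓝 a) (𝓝 0) := by
      have h1 : Tendsto (fun t => |y t - y a| ^ α) (𝓝 a) (𝓝 0) := by
        have h3 : Tendsto (fun t => |y t - y a|) (𝓝 a) (𝓝 0) := by
          have := (hy.continuousAt.tendsto.sub_const (y a)).abs
          simpa using this
        have := h3.rpow_const (p := α) (Or.inr F.α_pos.le)
        rwa [Real.zero_rpow F.α_pos.ne'] at this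
      have h2 : Tendsto (fun t => |t - a| ^ α) (𝓝 a) (𝓝 0) := by
        have h3 : Tendsto (fun t : ℝ => |t - a|) (𝓝 a) (𝓝 0) := by
          have := ((continuousAt_id (x := a)).tendsto.sub_const a).abs
          simpa using this
        have := h3.rpow_const (p := α) (Or.inr F.α_pos.le)
        rwa [Real.zero_rpow F.α_pos.ne'] at this
      simpa using (h1.add h2).const_mul C
    have h4 := ((Asymptotics.isLittleO_one_iff ℝ).2 h0).mul_isBigO hy.isBigO_sub
    simpa only [one_mul] using h4
  have g2 : HasDerivAt (fun t => F.T t (y t) - F.T t (y a) - q * (y t - y a)) 0 a := by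
    rw [hasDerivAt_iff_isLittleO]
    simpa using hrem
  have g3 := (g2.add g1).add ((hy.sub_const (y a)).const_mul q)
  have e1 : (fun t => F.T t (y t)) = ((fun t => F.T t (y t) - F.T t (y a) - q * (y t - y a)) +
      fun t => F.T t (y a)) + fun t => q * (y t - y a) := by
    funext t; simp only [Pi.add_apply]; ring
  rw [e1]
  exact g3.congr_deriv (by rw [zero_add])

/-- A continuous path which avoids the partition points stays in one branch. -/
lemma mem_branch_of_path {ω : Set ℝ} (hω : IsPreconnected ω) (hω1 : ω ⊆ Icc 0 1) {y : ℝ → ℝ}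
    (hy : ContinuousOn y ω) (hp : ∀ t ∈ ω, y t ∉ F.pts t) {a : ℝ} (ha : a ∈ ω) {k : ℕ}
    (hk : k < p₀) (hya : y a ∈ F.branch k a) {t : ℝ} (ht : t ∈ ω) : y t ∈ F.branch k t := by
  have h1 := hy.sub ((F.continuousOn_b hk.le).mono hω1)
  have h2 := ((F.continuousOn_b (k := k + 1) hk).mono hω1).sub hy
  constructor
  · by_contra! hcon
    obtain ⟨s, hs, e⟩ := hω.intermediate_value ht ha h1
      (⟨sub_nonpos.2 hcon, (sub_pos.2 hya.1).le⟩ : (0 : ℝ) ∈ Icc _ _)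
    exact hp s hs ⟨k, hk.le, sub_eq_zero.1 e⟩
  · by_contra! hcon
    obtain ⟨s, hs, e⟩ := hω.intermediate_value ht ha h2
      (⟨sub_nonpos.2 hcon, (sub_pos.2 hya.2).le⟩ : (0 : ℝ) ∈ Icc _ _)
    exact hp s hs ⟨k + 1, hk, (sub_eq_zero.1 e).symm⟩

end ExpandingFamily

/-- A bounded function which vanishes off a small set has a small integral. -/
lemma abs_setIntegral_le_of_small {f : ℝ → ℝ} {Z : Set ℝ} {M d : ℝ} (hM0 : 0 ≤ M)
    (hM : ∀ᵐ x ∂leb, |f x| ≤ M) (hd : 0 ≤ d)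
    (hZ : ∀ᵐ x ∂leb, f x ≠ 0 → x ∈ Z) (hvol : volume Z ≤ ENNReal.ofReal d) :
    |∫ x in Icc (0 : ℝ) 1, f x| ≤ M * d := by
  rw [← ENNReal.ofReal_le_ofReal_iff (mul_nonneg hM0 hd), ← Real.enorm_eq_ofReal_abs]
  refine (enorm_integral_le_lintegral_enorm _).trans ?_
  calc ∫⁻ x in Icc (0 : ℝ) 1, ‖f x‖ₑ
      ≤ ∫⁻ x in Icc (0 : ℝ) 1, (toMeasurable volume Z).indicator (fun _ => ENNReal.ofReal M) x := by
        refine lintegral_mono_ae ?_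
        filter_upwards [hM, hZ] with x h1 h2
        by_cases h0 : f x = 0
        · simp [h0]
        · rw [indicator_of_mem (subset_toMeasurable _ _ (h2 h0)), Real.enorm_eq_ofReal_abs]
          exact ENNReal.ofReal_le_ofReal h1
    _ ≤ ∫⁻ x, (toMeasurable volume Z).indicator (fun _ => ENNReal.ofReal M) x :=
        setLIntegral_le_lintegral _ _
    _ = ENNReal.ofReal M * volume Z := by
        rw [lintegral_indicator (measurableSet_toMeasurable _ _), setLIntegral_const,
          measure_toMeasurable]
    _ ≤ ENNReal.ofReal (M * d) := by
        rw [ENNReal.ofReal_mul hM0]; gcongr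

namespace ExpandingFamily

variable {α lam Lam : ℝ} {p₀ p₁ : ℕ} (F : ExpandingFamily α lam Lam p₀ p₁) {a : ℝ}

/-- The uniform Lasota-Yorke inequality in terms of the real-valued norms. -/
structure LasotaYorke (A ε C r : ℝ) : Prop where
  A_pos : 0 < A
  ε_pos : 0 < ε
  ε_le_one : ε ≤ 1
  one_le_C : 1 ≤ C
  r_pos : 0 < r
  r_lt_one : r < 1
  bound : ∀ a ∈ Icc 0 ε, ∀ φ : ℝ → ℝ, MemGBV α A φ → ∀ n : ℕ,
    MemGBV α A ((F.transfer a)^[n] φ) ∧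
      nrm α A ((F.transfer a)^[n] φ) ≤ C * r ^ n * nrm α A φ + C * l1 φ

variable {F}

lemma UniformLasotaYorke.exists_lasotaYorke {A : ℝ} (hA : 0 < A) (h : F.UniformLasotaYorke A) :
    ∃ ε C r : ℝ, F.LasotaYorke A ε C r := by
  obtain ⟨-, ε, C, r, hε, hε1, hC, hr, hr1, h⟩ := h
  refine ⟨ε, C, r, hA, hε, hε1, hC, hr, hr1, fun a ha φ hφ n => ?_⟩
  have ha1 : a ∈ Icc (0 : ℝ) 1 := ⟨ha.1, ha.2.trans hε1⟩
  rcases Nat.eq_zero_or_pos n with rfl | hn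
  · refine ⟨hφ, ?_⟩
    simp only [Function.iterate_zero, id, pow_zero, mul_one]
    nlinarith [nrm_nonneg (α := α) (A := A) φ, l1_nonneg φ]
  · have h1 := h a ha n hn φ hφ
    have h2 : ENNReal.ofReal (C * r ^ n) * gbvNorm α A φ ≠ ∞ :=
      ENNReal.mul_ne_top ENNReal.ofReal_ne_top (gbvNorm_lt_top hφ).ne
    have h3 : ENNReal.ofReal C * l1Norm φ ≠ ∞ := by
      rw [l1Norm_eq hφ.1]; exact ENNReal.mul_ne_top ENNReal.ofReal_ne_top ENNReal.ofReal_ne_top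
    have h4 := ENNReal.add_ne_top.2 ⟨h2, h3⟩
    have hlt : gbvNorm α A ((F.transfer a)^[n] φ) < ∞ := h1.trans_lt h4.lt_top
    refine ⟨⟨F.integrable_iterate_transfer ha1 hφ.1 n, lt_of_le_of_lt le_self_add hlt⟩, ?_⟩
    have h5 := ENNReal.toReal_mono h4 h1
    rw [ENNReal.toReal_add h2 h3, ENNReal.toReal_mul, ENNReal.toReal_mul, l1Norm_eq hφ.1,
      ENNReal.toReal_ofReal (l1_nonneg φ), ENNReal.toReal_ofReal (by positivity),
      ENNReal.toReal_ofReal (by positivity)] at h5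
    exact h5

namespace LasotaYorke

variable {A ε C r : ℝ} (H : F.LasotaYorke A ε C r)
include H

lemma C_pos : 0 < C := zero_lt_one.trans_le H.one_le_C

lemma mem_unit (ha : a ∈ Icc 0 ε) : a ∈ Icc (0 : ℝ) 1 := ⟨ha.1, ha.2.trans H.ε_le_one⟩

lemma zero_mem : (0 : ℝ) ∈ Icc 0 ε := ⟨le_rfl, H.ε_pos.le⟩

lemma mem {φ : ℝ → ℝ} (ha : a ∈ Icc 0 ε) (hφ : MemGBV α A φ) (n : ℕ) :
    MemGBV α A ((F.transfer a)^[n] φ) := (H.bound a ha φ hφ n).1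

lemma nrm_iterate_le {φ : ℝ → ℝ} (ha : a ∈ Icc 0 ε) (hφ : MemGBV α A φ) (n : ℕ) :
    nrm α A ((F.transfer a)^[n] φ) ≤ 2 * C * nrm α A φ := by
  refine ((H.bound a ha φ hφ n).2).trans ?_
  have h1 : r ^ n ≤ 1 := pow_le_one₀ H.r_pos.le H.r_lt_one.le
  have h2 := l1_le_nrm hφ
  have h3 := nrm_nonneg (α := α) (A := A) φ
  have hC := H.C_pos
  have h4 : C * r ^ n * nrm α A φ ≤ C * 1 * nrm α A φ := by gcongr
  have h5 : C * l1 φ ≤ C * nrm α A φ := by gcongr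
  linarith

/-- Closeness of the transfer operators for close parameters, from `V_α` to `L¹`. -/
lemma exists_l1_transfer_sub_le : ∃ D : ℝ, 0 < D ∧ ∀ a ∈ Icc 0 ε, ∀ a' ∈ Icc 0 ε,
    ∀ φ : ℝ → ℝ, MemGBV α A φ →
      l1 (fun x => F.transfer a φ x - F.transfer a' φ x) ≤
        D * |a - a'| ^ (α / 2) * nrm α A φ := by
  obtain ⟨L, hL0, hL⟩ := F.exists_lipschitz_b
  obtain ⟨B, hB0, hB⟩ := F.exists_pd_bound
  have hA := H.A_pos
  have hα := F.α_pos
  have hα1 := F.α_le_one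
  have hC := H.C_pos
  have hlam := F.lam_pos
  have hS := supConst_pos hA
  set E := (p₀ + 1 : ℝ) * (2 * L) + p₀ / lam * (4 * B) with hE
  have hE0 : 0 ≤ E := by positivity
  set Q := (A ^ 2) ^ (α / 2) with hQ
  have hQ0 : 0 < Q := by positivity
  refine ⟨2 * (supConst A * E) + 4 * C + 2 / Q, by positivity, ?_⟩
  intro a ha a' ha' φ hφ
  have ha1 := H.mem_unit ha
  have ha1' := H.mem_unit ha'
  set s := |a - a'| with hs
  have hs0 : 0 ≤ s := abs_nonneg _
  have hnn := nrm_nonneg (α := α) (A := A) φ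
  have hi := F.integrable_transfer ha1 hφ.1
  have hi' := F.integrable_transfer ha1' hφ.1
  rcases hs0.eq_or_lt with h0 | hspos
  · have : a = a' := by
      have : |a - a'| = 0 := h0.symm
      exact sub_eq_zero.1 (abs_eq_zero.1 this)
    subst this
    have : l1 (fun x => F.transfer a φ x - F.transfer a φ x) = 0 := by simp [l1]
    rw [this]; positivity
  have hspow : 0 ≤ s ^ (α / 2) := by positivity
  rcases lt_or_ge (A ^ 2) s with hbig | hsmall
  · have h1 : Q ≤ s ^ (α / 2) := by rw [hQ]; gcongr
    calc l1 (fun x => F.transfer a φ x - F.transfer a' φ x)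
        ≤ l1 (F.transfer a φ) + l1 (F.transfer a' φ) := l1_sub_le hi hi'
      _ ≤ l1 φ + l1 φ := add_le_add (F.l1_transfer_le ha1 hφ.1) (F.l1_transfer_le ha1' hφ.1)
      _ ≤ 2 * nrm α A φ := by linarith [l1_le_nrm hφ]
      _ = 2 / Q * Q * nrm α A φ := by field_simp
      _ ≤ (2 * (supConst A * E) + 4 * C + 2 / Q) * s ^ (α / 2) * nrm α A φ := by
          gcongr
          have : 0 ≤ 2 * (supConst A * E) + 4 * C := by positivity
          linarith
  have hs1 : s ≤ 1 := by
    rw [hs, abs_le]; constructor <;> linarith [ha1.1, ha1.2, ha1'.1, ha1'.2]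
  set δ := s ^ (1 / 2 : ℝ) with hδ
  have hδ0 : 0 < δ := by positivity
  have hδA : δ ≤ A := by
    calc δ ≤ (A ^ 2) ^ (1 / 2 : ℝ) := by rw [hδ]; gcongr
      _ = A := by rw [← Real.sqrt_eq_rpow, Real.sqrt_sq hA.le]
  have hδδ : δ * δ = s := by
    rw [hδ, ← Real.rpow_add hspos]; norm_num
  have hδ1 : δ ≤ 1 := by nlinarith
  set N := ⌊1 / δ⌋₊ + 1 with hN
  have hN1 : 1 / δ < N := by rw [hN]; push_cast; exact Nat.lt_floor_add_one _
  have hN2 : (N : ℝ) ≤ 2 / δ := by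
    have h1 : (⌊1 / δ⌋₊ : ℝ) ≤ 1 / δ := Nat.floor_le (by positivity)
    have h2 : 1 ≤ 1 / δ := by rw [le_div_iff₀ hδ0]; linarith
    have h3 : 2 / δ = 1 / δ + 1 / δ := by ring
    rw [hN, h3]; push_cast; linarith
  have hNδ : 1 / (N : ℝ) < δ := by
    rw [one_div]; rw [one_div] at hN1
    exact inv_lt_of_inv_lt₀ hδ0 hN1
  set g := fun x => F.transfer a φ x - F.transfer a' φ x with hg
  have hm := H.mem ha hφ 1
  have hm' := H.mem ha' hφ 1
  simp only [Function.iterate_one] at hm hm'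
  have hgm : MemGBV α A g := hm.sub hm'
  have hgn : nrm α A g ≤ 4 * C * nrm α A φ := by
    have h1 := H.nrm_iterate_le ha hφ 1
    have h2 := H.nrm_iterate_le ha' hφ 1
    simp only [Function.iterate_one] at h1 h2
    linarith [nrm_sub_le hm hm']
  have hM := hφ.ae_abs_le hA hα.le
  set M := supConst A * nrm α A φ with hMdef
  have hM0 : 0 ≤ M := by positivity
  have hcell : ∀ i < N, |∫ x in cell N i, g x| ≤ M * (E * s) := by
    intro i hi
    set u : ℝ := (i : ℝ) / N
    set w : ℝ := (i + 1 : ℝ) / N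
    have hJ : cell N i = Ico u w := rfl
    have hψ : AEStronglyMeasurable ((cell N i).indicator (1 : ℝ → ℝ)) leb :=
      (measurable_one.indicator (measurableSet_cell N i)).aestronglyMeasurable
    have hψ1 : ∀ᵐ x ∂leb, |(cell N i).indicator (1 : ℝ → ℝ) x| ≤ 1 :=
      Eventually.of_forall fun x => by by_cases hx : x ∈ cell N i <;> simp [hx]
    have hd := F.iterate_dual_of_bdd ha1 1 hφ.1 hψ hψ1
    have hd' := F.iterate_dual_of_bdd ha1' 1 hφ.1 hψ hψ1
    simp only [Function.iterate_one] at hd hd'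
    have hIcell : ∀ f : ℝ → ℝ, ∫ x in cell N i, f x =
        ∫ x in Icc (0 : ℝ) 1, f x * (cell N i).indicator (1 : ℝ → ℝ) x := by
      intro f
      rw [← inter_eq_left.2 (cell_subset hi), ← Measure.restrict_restrict (measurableSet_cell N i),
        ← integral_indicator (measurableSet_cell N i), inter_eq_left.2 (cell_subset hi)]
      congr 1; funext x
      by_cases hx : x ∈ cell N i <;> simp [hx]
    have hI1 : IntegrableOn (fun y => φ y * (cell N i).indicator (1 : ℝ → ℝ) (F.T a y))
        (Icc 0 1) := Integrable.mul_bdd (c := 1) hφ.1 (F.aesm_comp_T ha1 hψ)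
          (F.ae_comp_T ha1 (P := fun x => |(cell N i).indicator (1 : ℝ → ℝ) x| ≤ 1) hψ1)
    have hI2 : IntegrableOn (fun y => φ y * (cell N i).indicator (1 : ℝ → ℝ) (F.T a' y))
        (Icc 0 1) := Integrable.mul_bdd (c := 1) hφ.1 (F.aesm_comp_T ha1' hψ)
          (F.ae_comp_T ha1' (P := fun x => |(cell N i).indicator (1 : ℝ → ℝ) x| ≤ 1) hψ1)
    have hdiff : ∫ x in cell N i, g x = ∫ y in Icc (0 : ℝ) 1,
        φ y * ((cell N i).indicator (1 : ℝ → ℝ) (F.T a y) -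
          (cell N i).indicator (1 : ℝ → ℝ) (F.T a' y)) := by
      have e : ∫ x in cell N i, g x =
          (∫ x in cell N i, F.transfer a φ x) - ∫ x in cell N i, F.transfer a' φ x :=
        integral_sub (IntegrableOn.mono_set hm.1 (cell_subset hi))
          (IntegrableOn.mono_set hm'.1 (cell_subset hi))
      rw [e, hIcell, hIcell, hd, hd', ← integral_sub hI1 hI2]
      congr 1; funext y; ring
    rw [hdiff]
    set Z : Set ℝ := (⋃ k ∈ Finset.range (p₀ + 1), Icc (F.b k a - L * s) (F.b k a + L * s)) ∪
      (Icc 0 1 ∩ F.T a ⁻¹' (Icc (u - B * s) (u + B * s) ∪ Icc (w - B * s) (w + B * s))) with hZ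
    refine abs_setIntegral_le_of_small (Z := Z) hM0 ?_ (by positivity) ?_ ?_
    · filter_upwards [hM] with y hy
      rw [abs_mul]
      calc |φ y| * _ ≤ M * 1 := by
            gcongr
            by_cases h1 : F.T a y ∈ cell N i <;> by_cases h2 : F.T a' y ∈ cell N i <;>
              simp [h1, h2]
        _ = M := mul_one M
    · filter_upwards [ae_restrict_mem measurableSet_Icc] with y hy hne
      by_contra hyZ
      simp only [hZ, mem_union, mem_iUnion, Finset.mem_range, not_or, not_exists, mem_inter_iff,
        mem_preimage, not_and, mem_Icc, not_le, Nat.lt_succ_iff] at hyZ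
      obtain ⟨hy1, hy2⟩ := hyZ
      have hTT : |F.T a y - F.T a' y| ≤ B * s := by
        refine F.abs_T_sub_le hB ha1 ha1' hy fun t ht => ?_
        rintro ⟨k, hk, e⟩
        have ht1 := abs_sub_le_of_mem_uIcc ht
        have h1 := abs_le.1 (hL k hk t (uIcc_subset_unit ha1 ha1' ht) a ha1)
        have h2 : L * |t - a| ≤ L * s := by gcongr
        have h3 := hy1 k hk (by linarith [h1.1])
        linarith [h1.2]
      obtain ⟨hu, hw⟩ := hy2 hy
      rw [abs_le] at hTT
      refine hne ?_
      have hiff : F.T a y ∈ cell N i ↔ F.T a' y ∈ cell N i := by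
        rw [hJ, mem_Ico, mem_Ico]
        constructor
        · rintro ⟨h1, h2⟩
          constructor
          · by_contra! hc
            have := hu (by linarith [mul_nonneg hB0.le hs0])
            linarith
          · by_contra! hc
            have := hw (by linarith)
            linarith [mul_nonneg hB0.le hs0]
        · rintro ⟨h1, h2⟩
          constructor
          · by_contra! hc
            have := hu (by linarith)
            linarith [mul_nonneg hB0.le hs0]
          · by_contra! hc
            have := hw (by linarith [mul_nonneg hB0.le hs0])
            linarith
      by_cases h1 : F.T a y ∈ cell N i
      · simp [h1, hiff.1 h1]
      · have h2 : F.T a' y ∉ cell N i := fun h => h1 (hiff.2 h)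
        simp [h1, h2]
    · calc volume Z ≤ (∑ k ∈ Finset.range (p₀ + 1),
            volume (Icc (F.b k a - L * s) (F.b k a + L * s))) +
            ENNReal.ofReal (p₀ / lam) *
              volume (Icc (u - B * s) (u + B * s) ∪ Icc (w - B * s) (w + B * s)) := by
            refine (measure_union_le _ _).trans (add_le_add (measure_biUnion_finset_le _ _) ?_)
            exact F.volume_preimage_le ha1 _
        _ ≤ (∑ _k ∈ Finset.range (p₀ + 1), ENNReal.ofReal (2 * L * s)) +
            ENNReal.ofReal (p₀ / lam) * ENNReal.ofReal (4 * B * s) := by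
            gcongr
            · rw [Real.volume_Icc]; exact ENNReal.ofReal_le_ofReal (by linarith)
            · refine (measure_union_le _ _).trans ?_
              rw [Real.volume_Icc, Real.volume_Icc, ← ENNReal.ofReal_add
                (by linarith [mul_nonneg hB0.le hs0]) (by linarith [mul_nonneg hB0.le hs0])]
              exact ENNReal.ofReal_le_ofReal (by linarith)
        _ = ENNReal.ofReal (E * s) := by
            rw [Finset.sum_const, Finset.card_range, nsmul_eq_mul, ← ENNReal.ofReal_natCast,
              ← ENNReal.ofReal_mul (Nat.cast_nonneg _), ← ENNReal.ofReal_mul (by positivity),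
              ← ENNReal.ofReal_add (by positivity) (by positivity)]
            congr 1; rw [hE]; push_cast; ring
  have h1 := l1_le_sum_cell hgm (Nat.succ_pos _) ⟨hδ0, hδA⟩ hNδ
  have h2 : (∑ i ∈ Finset.range N, |∫ y in cell N i, g y|) ≤ N * (M * (E * s)) := by
    calc _ ≤ ∑ _i ∈ Finset.range N, M * (E * s) :=
          Finset.sum_le_sum fun i hi => hcell i (Finset.mem_range.1 hi)
      _ = _ := by rw [Finset.sum_const, Finset.card_range, nsmul_eq_mul]
  have h3 : δ ^ α = s ^ (α / 2) := by
    rw [hδ, ← Real.rpow_mul hs0]; congr 1; ring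
  have h4 : δ ≤ s ^ (α / 2) := by
    rw [← h3]
    calc δ = δ ^ (1 : ℝ) := (Real.rpow_one δ).symm
      _ ≤ δ ^ α := Real.rpow_le_rpow_of_exponent_ge hδ0 hδ1 hα1
  have h5 : (N : ℝ) * (M * (E * s)) ≤ 2 * (M * E) * s ^ (α / 2) := by
    calc (N : ℝ) * (M * (E * s)) ≤ 2 / δ * (M * (E * s)) := by gcongr
      _ = 2 * (M * E) * δ := by rw [← hδδ]; field_simp
      _ ≤ _ := by gcongr
  have h6 : δ ^ α * nrm α A g ≤ s ^ (α / 2) * (4 * C * nrm α A φ) := by rw [h3]; gcongr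
  have h7 : 0 ≤ 2 / Q * s ^ (α / 2) * nrm α A φ := by positivity
  have h8 : 2 * (M * E) * s ^ (α / 2) = 2 * (supConst A * E) * s ^ (α / 2) * nrm α A φ := by
    rw [hMdef]; ring
  calc l1 g ≤ 2 * (supConst A * E) * s ^ (α / 2) * nrm α A φ +
        s ^ (α / 2) * (4 * C * nrm α A φ) + 2 / Q * s ^ (α / 2) * nrm α A φ := by linarith
    _ = _ := by ring

lemma exists_l1_iterate_sub_le : ∃ D : ℝ, 0 < D ∧ ∀ a ∈ Icc 0 ε, ∀ a' ∈ Icc 0 ε,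
    ∀ φ : ℝ → ℝ, MemGBV α A φ → ∀ n : ℕ,
      l1 (fun x => (F.transfer a)^[n] φ x - (F.transfer a')^[n] φ x) ≤
        n * (D * |a - a'| ^ (α / 2) * nrm α A φ) := by
  obtain ⟨D, hD0, hD⟩ := H.exists_l1_transfer_sub_le
  have hC := H.C_pos
  refine ⟨D * (2 * C), by positivity, fun a ha a' ha' φ hφ n => ?_⟩
  have ha1 := H.mem_unit ha
  have ha1' := H.mem_unit ha'
  induction n with
  | zero => simp [l1]
  | succ n ih =>
    have hi := F.integrable_iterate_transfer ha1 hφ.1 n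
    have hi' := F.integrable_iterate_transfer ha1' hφ.1 n
    have e : (fun x => (F.transfer a)^[n + 1] φ x - (F.transfer a')^[n + 1] φ x) = fun x =>
        F.transfer a (fun x => (F.transfer a)^[n] φ x - (F.transfer a')^[n] φ x) x +
        (F.transfer a ((F.transfer a')^[n] φ) x - F.transfer a' ((F.transfer a')^[n] φ) x) := by
      funext x
      rw [F.transfer_sub ha1, Function.iterate_succ_apply', Function.iterate_succ_apply']
      ring
    rw [e]
    refine (l1_add_le (F.integrable_transfer ha1 (Integrable.sub hi hi'))
      (Integrable.sub (F.integrable_transfer ha1 hi') (F.integrable_transfer ha1' hi'))).trans ?_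
    have h1 := (F.l1_transfer_le ha1 (Integrable.sub hi hi')).trans ih
    have h2 := hD a ha a' ha' _ (H.mem ha' hφ n)
    have h3 : D * |a - a'| ^ (α / 2) * nrm α A ((F.transfer a')^[n] φ) ≤
        D * |a - a'| ^ (α / 2) * (2 * C * nrm α A φ) := by
      gcongr; exact H.nrm_iterate_le ha' hφ n
    push_cast
    have h4 : (n + 1 : ℝ) * (D * (2 * C) * |a - a'| ^ (α / 2) * nrm α A φ) =
      n * (D * (2 * C) * |a - a'| ^ (α / 2) * nrm α A φ) +
        D * |a - a'| ^ (α / 2) * (2 * C * nrm α A φ) := by ring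
    rw [h4]
    exact add_le_add h1 (h2.trans h3)

end LasotaYorke

end ExpandingFamily

/-! ### Compactness in `L¹` -/

lemma abs_setIntegral_le_l1 {f : ℝ → ℝ} (hf : IntegrableOn f (Icc 0 1)) {S : Set ℝ}
    (hS : S ⊆ Icc 0 1) : |∫ x in S, f x| ≤ l1 f :=
  (abs_integral_le_integral_abs).trans
    (setIntegral_mono_set hf.abs (Eventually.of_forall fun _ => abs_nonneg _)
      (LE.le.eventuallyLE hS))

lemma l1_sub_comm (f g : ℝ → ℝ) : l1 (fun x => f x - g x) = l1 (fun x => g x - f x) := by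
  simp only [l1, abs_sub_comm]

lemma ae_eq_of_l1_eq_zero {f g : ℝ → ℝ} (hf : IntegrableOn f (Icc 0 1))
    (hg : IntegrableOn g (Icc 0 1)) (h : l1 (fun x => f x - g x) = 0) : f =ᵐ[leb] g := by
  have h' : ∫ x in Icc (0 : ℝ) 1, |(f - g) x| = 0 := h
  rw [integral_eq_zero_iff_of_nonneg (fun x => abs_nonneg _) (Integrable.sub hf hg).abs] at h'
  filter_upwards [h'] with x hx
  exact sub_eq_zero.1 (abs_eq_zero.1 hx)

/-- `V_α` is closed under `L¹` limits of bounded sequences. -/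
lemma memGBV_of_l1_limit {α A : ℝ} {f : ℕ → ℝ → ℝ} {h : ℝ → ℝ} {R : ℝ}
    (hf : ∀ n, MemGBV α A (f n)) (hR : ∀ n, nrm α A (f n) ≤ R) (hh : IntegrableOn h (Icc 0 1))
    (hlim : Tendsto (fun n => l1 (fun x => f n x - h x)) atTop (𝓝 0)) :
    MemGBV α A h ∧ nrm α A h ≤ R + l1 h := by
  have hR0 : 0 ≤ R := (nrm_nonneg _).trans (hR 0)
  have he : ∀ n, eLpNorm (f n - h) 1 leb = ENNReal.ofReal (l1 fun x => f n x - h x) := by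
    intro n
    rw [eLpNorm_one_eq_lintegral_enorm]
    exact l1Norm_eq (φ := fun x => f n x - h x) (Integrable.sub (hf n).1 hh)
  have hm : TendstoInMeasure leb f atTop h := by
    refine tendstoInMeasure_of_tendsto_eLpNorm one_ne_zero
      (fun n => (hf n).1.aestronglyMeasurable) hh.aestronglyMeasurable ?_
    simp only [he]
    simpa using ENNReal.tendsto_ofReal hlim
  obtain ⟨ns, -, hns⟩ := hm.exists_seq_tendsto_ae
  refine memGBV_of_osc hh hR0 fun δ hδ => ?_
  have hE : ∀ᵐ y ∂leb, y ∈ {y | (∀ n, y ∈ regPts (f (ns n))) ∧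
      Tendsto (fun n => f (ns n) y) atTop (𝓝 (h y))} := by
    filter_upwards [ae_all_iff.2 fun n => ae_mem_regPts (f (ns n)), hns] with y h1 h2
    exact ⟨h1, h2⟩
  calc ∫⁻ x in Icc (0 : ℝ) 1, osc h δ x
      ≤ ∫⁻ x in Icc (0 : ℝ) 1, liminf (fun n => osc (f (ns n)) δ x) atTop := by
        refine setLIntegral_mono' measurableSet_Icc fun x hx => ?_
        refine osc_le hx hδ.1 hE fun y hy hyw y' hy' hyw' => ?_
        have h1 : Tendsto (fun n => ‖f (ns n) y - f (ns n) y'‖ₑ) atTop (𝓝 ‖h y - h y'‖ₑ) :=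
          (hy.2.sub hy'.2).enorm
        rw [← h1.liminf_eq]
        exact liminf_le_liminf (Eventually.of_forall fun n =>
          enorm_sub_le_osc (hy.1 n) (hy'.1 n) hyw hyw')
    _ ≤ liminf (fun n => ∫⁻ x in Icc (0 : ℝ) 1, osc (f (ns n)) δ x) atTop :=
        lintegral_liminf_le' fun n => aemeasurable_osc _ hδ.1
    _ ≤ liminf (fun _ : ℕ => ENNReal.ofReal (δ ^ α * R)) atTop :=
        liminf_le_liminf (Eventually.of_forall fun n => (lintegral_osc_le (hf _) hδ).trans
          (ENNReal.ofReal_le_ofReal (mul_le_mul_of_nonneg_left (hR _)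
            (Real.rpow_nonneg hδ.1.le _))))
    _ = _ := liminf_const _

/-- Bounded sequences of `V_α` are relatively compact in `L¹`. -/
lemma exists_l1_convergent_subseq {α A : ℝ} (hα : 0 < α) (hA : 0 < A) {f : ℕ → ℝ → ℝ} {R : ℝ}
    (hf : ∀ n, MemGBV α A (f n)) (hR : ∀ n, nrm α A (f n) ≤ R) :
    ∃ (g : ℝ → ℝ) (ns : ℕ → ℕ), StrictMono ns ∧ IntegrableOn g (Icc 0 1) ∧
      Tendsto (fun n => l1 (fun x => f (ns n) x - g x)) atTop (𝓝 0) := by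
  have hR0 : 0 ≤ R := (nrm_nonneg _).trans (hR 0)
  have hfi : ∀ n, Integrable (f n) leb := fun n => (hf n).1
  set u : ℕ → Lp ℝ 1 leb := fun n => Integrable.toL1 (f n) (hfi n) with hu
  have hdist : ∀ n m, dist (u n) (u m) = l1 (fun x => f n x - f m x) := by
    intro n m
    rw [dist_eq_norm, hu]
    simp only
    rw [← Integrable.toL1_sub, L1.norm_of_fun_eq_integral_norm]
    rfl
  have htb : TotallyBounded (range u) := by
    refine Metric.totallyBounded_of_finite_discretization fun e he => ?_
    obtain ⟨δ, hδ0, hδA, hδ⟩ : ∃ δ : ℝ, 0 < δ ∧ δ ≤ A ∧ δ ^ α * (2 * R) < e / 2 := by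
      have h1 : Tendsto (fun δ : ℝ => δ ^ α * (2 * R)) (𝓝[>] 0) (𝓝 0) := by
        have h2 : Tendsto (fun δ : ℝ => δ ^ α) (𝓝[>] 0) (𝓝 0) := by
          have := (Real.continuousAt_rpow_const 0 α (Or.inr hα.le)).tendsto
          rw [Real.zero_rpow hα.ne'] at this
          exact this.mono_left nhdsWithin_le_nhds
        simpa using h2.mul_const (2 * R)
      have h3 := h1.eventually (gt_mem_nhds (half_pos he))
      obtain ⟨δ, h4, h5⟩ := (h3.and (Ioc_mem_nhdsGT hA)).exists
      exact ⟨δ, h5.1, h5.2, h4⟩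
    obtain ⟨N, hN⟩ := exists_nat_one_div_lt hδ0
    have hN0 : (0 : ℝ) < (N + 1 : ℕ) := by positivity
    set c : ℕ → Fin (N + 1) → ℝ := fun n i =>
      (∫ x in cell (N + 1) i, f n x) * ((N + 1 : ℕ) * (4 / e)) with hc
    obtain ⟨m, hm⟩ := exists_nat_gt (R * ((N + 1 : ℕ) * (4 / e)) + 1)
    have hcb : ∀ n i, |c n i| ≤ m - 1 := by
      intro n i
      rw [hc]
      simp only [abs_mul]
      rw [abs_of_pos hN0, abs_of_pos (by positivity : 0 < 4 / e)]
      have h1 := (abs_setIntegral_le_l1 (hf n).1 (cell_subset i.2)).trans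
        ((l1_le_nrm (hf n)).trans (hR n))
      have h2 := mul_le_mul_of_nonneg_right h1 (by positivity : 0 ≤ ((N + 1 : ℕ) * (4 / e)))
      linarith
    have hmem : ∀ n, (fun i => ⌊c n i⌋) ∈
        Set.Icc (fun _ : Fin (N + 1) => (-m : ℤ)) (fun _ => (m : ℤ)) := by
      intro n
      rw [mem_Icc, Pi.le_def, Pi.le_def]
      refine ⟨fun i => ?_, fun i => ?_⟩
      · have := abs_le.1 (hcb n i)
        rw [Int.le_floor]; push_cast; linarith
      · have := abs_le.1 (hcb n i)
        have h2 : (⌊c n i⌋ : ℝ) ≤ m := (Int.floor_le _).trans (by linarith)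
        exact_mod_cast h2
    refine ⟨Set.Icc (fun _ : Fin (N + 1) => (-m : ℤ)) (fun _ => (m : ℤ)), inferInstance,
      fun x => ⟨_, hmem (Classical.choose x.2)⟩, fun x y hxy => ?_⟩
    set n := Classical.choose x.2 with hn
    set k := Classical.choose y.2 with hk
    have hx : u n = x := Classical.choose_spec x.2
    have hy : u k = y := Classical.choose_spec y.2
    rw [← hx, ← hy, hdist]
    have hfl : ∀ i, ⌊c n i⌋ = ⌊c k i⌋ := fun i => congrFun (Subtype.ext_iff.1 hxy) i
    have hmd := (hf n).sub (hf k)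
    have h1 := l1_le_sum_cell hmd (Nat.succ_pos N) ⟨hδ0, hδA⟩ (by push_cast; exact hN)
    have h2 : nrm α A (fun x => f n x - f k x) ≤ 2 * R := by
      linarith [nrm_sub_le (hf n) (hf k), hR n, hR k]
    have h3 : ∀ i ∈ Finset.range (N + 1), |∫ y in cell (N + 1) i, (f n y - f k y)| ≤
        e / 4 / (N + 1 : ℕ) := by
      intro i hi
      have hi' := Finset.mem_range.1 hi
      have h4 := Int.abs_sub_lt_one_of_floor_eq_floor (hfl ⟨i, hi'⟩)
      rw [integral_sub ((hf n).1.mono_set (cell_subset hi')) ((hf k).1.mono_set (cell_subset hi'))]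
      rw [hc] at h4
      simp only [← sub_mul, abs_mul] at h4
      rw [abs_of_pos hN0, abs_of_pos (by positivity : 0 < 4 / e)] at h4
      rw [le_div_iff₀ hN0]
      have h5 : |(∫ x in cell (N + 1) i, f n x) - ∫ x in cell (N + 1) i, f k x| *
        (((N + 1 : ℕ) : ℝ) * (4 / e)) = (|(∫ x in cell (N + 1) i, f n x) -
          ∫ x in cell (N + 1) i, f k x| * ((N + 1 : ℕ) : ℝ)) / (e / 4) := by field_simp
      rw [h5, div_lt_one (by positivity)] at h4
      exact h4.le
    have h6 := Finset.sum_le_sum h3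
    rw [Finset.sum_const, Finset.card_range, nsmul_eq_mul, mul_div_cancel₀ _ hN0.ne'] at h6
    have h7 : δ ^ α * nrm α A (fun x => f n x - f k x) ≤ δ ^ α * (2 * R) := by gcongr
    linarith
  have hcomp : IsCompact (closure (range u)) :=
    htb.closure.isCompact_of_isClosed isClosed_closure
  obtain ⟨g, -, ns, hns, hlim⟩ := hcomp.tendsto_subseq
    (x := u) fun n => subset_closure (mem_range_self n)
  refine ⟨g, ns, hns, L1.integrable_coeFn g, ?_⟩
  rw [tendsto_iff_dist_tendsto_zero] at hlim
  refine hlim.congr fun n => ?_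
  rw [dist_eq_norm, Function.comp, L1.norm_eq_integral_norm, l1]
  refine integral_congr_ae ?_
  filter_upwards [Lp.coeFn_sub (u (ns n)) g, Integrable.coeFn_toL1 (hfi (ns n))] with x h1 h2
  rw [h1, Pi.sub_apply, h2]
  rfl

namespace ExpandingFamily

variable {α lam Lam : ℝ} {p₀ p₁ : ℕ} {F : ExpandingFamily α lam Lam p₀ p₁} {a : ℝ}

namespace LasotaYorke

variable {A ε C r : ℝ} (H : F.LasotaYorke A ε C r)
include H

/-- Cesàro limits of `L^n f` are invariant. -/
lemma exists_invariant_density (ha : a ∈ Icc 0 ε) {f : ℝ → ℝ} (hf : MemGBV α A f)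
    (hf0 : ∀ x, 0 ≤ f x) :
    ∃ h : ℝ → ℝ, MemGBV α A h ∧ nrm α A h ≤ 2 * C * nrm α A f + l1 h ∧ (∀ᵐ x ∂leb, 0 ≤ h x) ∧
      ∫ x in Icc (0 : ℝ) 1, h x = ∫ x in Icc (0 : ℝ) 1, f x ∧ F.transfer a h =ᵐ[leb] h ∧
      ∀ S ⊆ Icc (0 : ℝ) 1, (∀ n, ∫ x in S, (F.transfer a)^[n] f x = 0) → ∫ x in S, h x = 0 := by
  have ha1 := H.mem_unit ha
  have hC := H.C_pos
  have hfn := nrm_nonneg (α := α) (A := A) f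
  have hLi := fun n => F.integrable_iterate_transfer ha1 hf.1 n
  set S : ℕ → ℝ → ℝ := fun n x => ∑ j ∈ Finset.range n, (F.transfer a)^[j] f x with hS
  have hSm : ∀ n, MemGBV α A (S (n + 1)) ∧ nrm α A (S (n + 1)) ≤ (n + 1) * (2 * C * nrm α A f) := by
    intro n
    induction n with
    | zero =>
      have e : S 1 = f := by funext x; simp [hS]
      rw [e]
      refine ⟨hf, ?_⟩
      have := H.nrm_iterate_le ha hf 0
      simpa using this
    | succ n ih =>
      have e : S (n + 1 + 1) = fun x => 1 * S (n + 1) x + 1 * (F.transfer a)^[n + 1] f x := by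
        funext x; simp only [hS, one_mul]; rw [Finset.sum_range_succ]
      rw [e]
      obtain ⟨h1, h2⟩ := ih.1.lin (H.mem ha hf (n + 1)) 1 1
      refine ⟨h1, h2.trans ?_⟩
      have := H.nrm_iterate_le ha hf (n + 1)
      push_cast
      rw [abs_one]
      linarith [ih.2]
  set Ces : ℕ → ℝ → ℝ := fun n x => (1 / (n + 1 : ℝ)) * S (n + 1) x with hCes
  have hCm : ∀ n, MemGBV α A (Ces n) ∧ nrm α A (Ces n) ≤ 2 * C * nrm α A f := by
    intro n
    obtain ⟨h1, h2⟩ := (hSm n).1.const_mul (1 / (n + 1 : ℝ))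
    refine ⟨h1, h2.trans ?_⟩
    rw [abs_of_pos (by positivity)]
    calc 1 / (n + 1 : ℝ) * nrm α A (S (n + 1)) ≤ 1 / (n + 1 : ℝ) * ((n + 1) * (2 * C * nrm α A f)) := by
          gcongr; exact (hSm n).2
      _ = _ := by field_simp
  have hC0 : ∀ n x, 0 ≤ Ces n x := fun n x => mul_nonneg (by positivity)
    (Finset.sum_nonneg fun j _ => F.iterate_transfer_nonneg ha1 hf0 j x)
  have hCint : ∀ T ⊆ Icc (0 : ℝ) 1, ∀ n, ∫ x in T, Ces n x =
      (1 / (n + 1 : ℝ)) * ∑ j ∈ Finset.range (n + 1), ∫ x in T, (F.transfer a)^[j] f x := by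
    intro T hT n
    rw [← integral_finsetSum _ fun j _ => IntegrableOn.mono_set (hLi j) hT, ← integral_const_mul]
  have hCdiff : ∀ n, l1 (fun x => F.transfer a (Ces n) x - Ces n x) ≤ 2 * l1 f / (n + 1) := by
    intro n
    have e1 : ∀ m, F.transfer a (S m) = fun x => ∑ j ∈ Finset.range m, (F.transfer a)^[j + 1] f x := by
      intro m
      induction m with
      | zero =>
        funext x
        simp only [hS, Finset.range_zero, Finset.sum_empty]
        have := congrFun (F.transfer_lin ha1 f f 0 0) x
        simpa using this
      | succ m ih =>
        have e : S (m + 1) = fun x => 1 * S m x + 1 * (F.transfer a)^[m] f x := by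
          funext x; simp only [hS, one_mul]; rw [Finset.sum_range_succ]
        rw [e, F.transfer_lin ha1, ih]
        funext x
        rw [Finset.sum_range_succ, Function.iterate_succ_apply', one_mul, one_mul]
    have e2 : (fun x => F.transfer a (Ces n) x - Ces n x) =
        fun x => (1 / (n + 1 : ℝ)) * ((F.transfer a)^[n + 1] f x - f x) := by
      funext x
      have e3 : Ces n = fun x => (1 / (n + 1 : ℝ)) * S (n + 1) x + 0 * S (n + 1) x := by
        funext x; simp [hCes]
      have e4 : F.transfer a (Ces n) x = (1 / (n + 1 : ℝ)) * F.transfer a (S (n + 1)) x := by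
        rw [e3, F.transfer_lin ha1]; ring
      rw [e4, e1]
      simp only [hCes, hS]
      rw [← mul_sub, Finset.sum_range_succ' (fun j => (F.transfer a)^[j] f x),
        Finset.sum_range_succ (fun j => (F.transfer a)^[j + 1] f x)]
      simp
    have e5 : l1 (fun x => (1 / (n + 1 : ℝ)) * ((F.transfer a)^[n + 1] f x - f x)) =
        (1 / (n + 1 : ℝ)) * l1 (fun x => (F.transfer a)^[n + 1] f x - f x) := by
      rw [l1, l1, ← integral_const_mul]
      congr 1; funext x
      rw [abs_mul, abs_of_pos (by positivity : (0 : ℝ) < 1 / (n + 1 : ℝ))]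
    rw [e2, e5, div_mul_eq_mul_div, one_mul]
    gcongr
    linarith [l1_sub_le (hLi (n + 1)) hf.1, F.l1_iterate_transfer_le ha1 hf.1 (n + 1)]
  obtain ⟨h, ns, hns, hhi, hlim⟩ := exists_l1_convergent_subseq F.α_pos H.A_pos
    (fun n => (hCm n).1) (fun n => (hCm n).2)
  have hsetlim : ∀ T ⊆ Icc (0 : ℝ) 1,
      Tendsto (fun n => ∫ x in T, Ces (ns n) x) atTop (𝓝 (∫ x in T, h x)) := by
    intro T hT
    rw [tendsto_iff_dist_tendsto_zero]
    refine squeeze_zero (fun _ => dist_nonneg) (fun n => ?_) hlim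
    rw [Real.dist_eq, ← integral_sub (IntegrableOn.mono_set (hCm _).1.1 hT)
      (IntegrableOn.mono_set hhi hT)]
    exact abs_setIntegral_le_l1 (Integrable.sub (hCm _).1.1 hhi) hT
  have hint : ∀ n, ∫ x in Icc (0 : ℝ) 1, Ces n x = ∫ x in Icc (0 : ℝ) 1, f x := by
    intro n
    rw [hCint _ Subset.rfl]
    simp only [F.integral_iterate_transfer ha1 hf.1, Finset.sum_const, Finset.card_range,
      nsmul_eq_mul]
    push_cast; field_simp
  have hhint : ∫ x in Icc (0 : ℝ) 1, h x = ∫ x in Icc (0 : ℝ) 1, f x := by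
    have h1 := hsetlim _ Subset.rfl
    simp only [hint] at h1
    exact tendsto_nhds_unique h1 tendsto_const_nhds
  obtain ⟨hhm, hhn⟩ := memGBV_of_l1_limit (fun n => (hCm (ns n)).1) (fun n => (hCm (ns n)).2) hhi
    hlim
  refine ⟨h, hhm, hhn, ?_, hhint, ?_, ?_⟩
  · have h1 : l1 h ≤ ∫ x in Icc (0 : ℝ) 1, f x := by
      have h2 : Tendsto (fun n => (∫ x in Icc (0 : ℝ) 1, f x) +
          l1 (fun x => Ces (ns n) x - h x)) atTop (𝓝 ((∫ x in Icc (0 : ℝ) 1, f x) + 0)) :=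
        hlim.const_add _
      rw [add_zero] at h2
      refine ge_of_tendsto' h2 fun n => ?_
      have h3 := l1_sub_le (hCm (ns n)).1.1 (Integrable.sub (hCm (ns n)).1.1 hhi)
      simp only [Pi.sub_apply, sub_sub_cancel] at h3
      have h4 : l1 (Ces (ns n)) = ∫ x in Icc (0 : ℝ) 1, f x := by
        rw [← hint (ns n), l1]
        congr 1; funext x; exact abs_of_nonneg (hC0 _ x)
      rw [h4] at h3
      exact h3
    have h5 : ∫ x in Icc (0 : ℝ) 1, (|h x| - h x) = 0 := by
      refine le_antisymm ?_ (integral_nonneg fun x => sub_nonneg.2 (le_abs_self _))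
      rw [integral_sub hhi.abs hhi, hhint]
      rw [l1] at h1; linarith
    rw [integral_eq_zero_iff_of_nonneg (fun x => sub_nonneg.2 (le_abs_self _))
      (Integrable.sub hhi.abs hhi)] at h5
    filter_upwards [h5] with x hx
    have : |h x| = h x := sub_eq_zero.1 hx
    rw [← this]; exact abs_nonneg _
  · refine ae_eq_of_l1_eq_zero (F.integrable_transfer ha1 hhi) hhi ?_
    refine le_antisymm ?_ (l1_nonneg _)
    have h1 : Tendsto (fun n => 2 * l1 (fun x => Ces (ns n) x - h x) + 2 * l1 f / (ns n + 1 : ℝ))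
        atTop (𝓝 (2 * 0 + 0)) := by
      refine (hlim.const_mul 2).add ?_
      have h2 : Tendsto (fun n : ℕ => 2 * l1 f / (n + 1 : ℝ)) atTop (𝓝 0) :=
        tendsto_const_nhds.div_atTop (tendsto_natCast_atTop_atTop.atTop_add tendsto_const_nhds)
      exact h2.comp hns.tendsto_atTop
    simp only [mul_zero, add_zero] at h1
    refine ge_of_tendsto' h1 fun n => ?_
    set c := Ces (ns n)
    have hc := (hCm (ns n)).1.1
    have e : (fun x => F.transfer a h x - h x) = fun x =>
        (F.transfer a (fun x => h x - c x) x + (F.transfer a c x - c x)) + (c x - h x) := by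
      funext x; rw [F.transfer_sub ha1]; ring
    have i1 := F.integrable_transfer ha1 (Integrable.sub hhi hc)
    have i2 := Integrable.sub (F.integrable_transfer ha1 hc) hc
    rw [e]
    have h3 := l1_add_le (f := fun x => F.transfer a (fun x => h x - c x) x +
      (F.transfer a c x - c x)) (g := fun x => c x - h x) (Integrable.add i1 i2)
      (Integrable.sub hc hhi)
    have h4 := l1_add_le (f := fun x => F.transfer a (fun x => h x - c x) x)
      (g := fun x => F.transfer a c x - c x) i1 i2
    have h5 := F.l1_transfer_le ha1 (φ := fun x => h x - c x) (Integrable.sub hhi hc)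
    rw [l1_sub_comm h c] at h5
    have h6 := hCdiff (ns n)
    linarith
  · intro T hT h0
    have h1 := hsetlim T hT
    simp only [hCint T hT, h0, Finset.sum_const_zero, mul_zero] at h1
    exact tendsto_nhds_unique h1 tendsto_const_nhds

/-- Every nonzero nonnegative function eventually charges the support of the acip. -/
lemma exists_integral_K_pos (ha : a ∈ Icc 0 ε) {f : ℝ → ℝ} (hf : MemGBV α A f)
    (hf0 : ∀ x, 0 ≤ f x) (hpos : 0 < ∫ x in Icc (0 : ℝ) 1, f x) :
    ∃ n, 0 < ∫ x in F.K a, (F.transfer a)^[n] f x := by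
  have ha1 := H.mem_unit ha
  by_contra! hcon
  obtain ⟨h, ⟨hi, -⟩, -, h0, hint, hinv, hS⟩ := H.exists_invariant_density ha hf hf0
  have hK := hS _ (F.K_subset ha1) fun n => le_antisymm (hcon n)
    (integral_nonneg fun x => F.iterate_transfer_nonneg ha1 hf0 n x)
  set s := ∫ x in Icc (0 : ℝ) 1, f x with hs
  set g : ℝ → ℝ := fun x => s⁻¹ * h x with hg
  have hgt : F.transfer a g =ᵐ[leb] g := by
    have e : F.transfer a g = fun x => s⁻¹ * F.transfer a h x := by
      have := F.transfer_lin ha1 h h s⁻¹ 0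
      simpa using this
    rw [e]
    filter_upwards [hinv] with x hx
    rw [hx]
  have hacip := F.isAcip_of_density ha1 (Integrable.const_mul hi s⁻¹)
    (by filter_upwards [h0] with x hx; exact mul_nonneg (inv_nonneg.2 hpos.le) hx)
    (by rw [integral_const_mul, hint, inv_mul_cancel₀ hpos.ne']) hgt
  have hμ := (F.acip a ha1 _).1 hacip
  have h1 : F.μ a (F.K a) = 0 := by
    rw [← hμ, withDensity_apply _ (F.isClosed_K a).measurableSet]
    rw [Measure.restrict_restrict (F.isClosed_K a).measurableSet,
      inter_eq_left.2 (F.K_subset ha1)]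
    have hiK : IntegrableOn g (F.K a) := IntegrableOn.mono_set (Integrable.const_mul hi s⁻¹)
      (F.K_subset ha1)
    rw [← ofReal_integral_eq_lintegral_ofReal hiK]
    · rw [integral_const_mul, hK, mul_zero, ENNReal.ofReal_zero]
    · have := ae_mono (Measure.restrict_mono (F.K_subset ha1) le_rfl) h0
      filter_upwards [this] with x hx
      exact mul_nonneg (inv_nonneg.2 hpos.le) hx
  have := (F.isAcip_μ ha1).prob
  have h2 : F.μ a univ ≤ 0 := by
    rw [← union_compl_self (F.K a)]
    refine (measure_union_le _ _).trans ?_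
    rw [h1, F.μ_compl_K, add_zero]
  rw [measure_univ] at h2
  exact absurd h2 (by simp)

end LasotaYorke

end ExpandingFamily

/-! ### Overlap of densities and contraction -/

/-- The mass common to two functions. -/
noncomputable def overlap (f g : ℝ → ℝ) : ℝ := ∫ x in Icc (0 : ℝ) 1, min (f x) (g x)

lemma integrable_min {f g : ℝ → ℝ} (hf : IntegrableOn f (Icc 0 1)) (hg : IntegrableOn g (Icc 0 1)) :
    IntegrableOn (fun x => min (f x) (g x)) (Icc 0 1) := Integrable.inf hf hg

lemma l1_sub_eq_overlap {f g : ℝ → ℝ} (hf : IntegrableOn f (Icc 0 1))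
    (hg : IntegrableOn g (Icc 0 1)) :
    l1 (fun x => f x - g x) =
      (∫ x in Icc (0 : ℝ) 1, f x) + (∫ x in Icc (0 : ℝ) 1, g x) - 2 * overlap f g := by
  have hm := integrable_min hf hg
  have e := integral_sub (Integrable.add hf hg) (Integrable.const_mul hm 2)
  have e' := integral_add hf hg
  simp only [Pi.add_apply] at e e'
  rw [l1, overlap, ← integral_const_mul, ← e', ← e]
  congr 1; funext x
  rcases le_total (f x) (g x) with h | h
  · rw [min_eq_left h, abs_of_nonpos (by linarith)]; ring
  · rw [min_eq_right h, abs_of_nonneg (by linarith)]; ring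

/-- A small scale, at which functions with norm at most `R` oscillate by less than `s`. -/
lemma exists_scale {α A R s : ℝ} (hα : 0 < α) (hA : 0 < A) (hs : 0 < s) :
    ∃ δ ∈ Ioc 0 A, δ ^ α * R < s := by
  have h1 : Tendsto (fun δ : ℝ => δ ^ α * R) (𝓝[>] 0) (𝓝 0) := by
    have h2 : Tendsto (fun δ : ℝ => δ ^ α) (𝓝[>] 0) (𝓝 0) := by
      have := (Real.continuousAt_rpow_const 0 α (Or.inr hα.le)).tendsto
      rw [Real.zero_rpow hα.ne'] at this
      exact this.mono_left nhdsWithin_le_nhds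
    simpa using h2.mul_const R
  obtain ⟨δ, h4, h5⟩ := ((h1.eventually (gt_mem_nhds hs)).and (Ioc_mem_nhdsGT hA)).exists
  exact ⟨δ, h5, h4⟩

namespace ExpandingFamily

variable {α lam Lam : ℝ} {p₀ p₁ : ℕ} {F : ExpandingFamily α lam Lam p₀ p₁} {a : ℝ}

lemma overlap_transfer_le (ha : a ∈ Icc (0 : ℝ) 1) {f g : ℝ → ℝ} (hf : IntegrableOn f (Icc 0 1))
    (hg : IntegrableOn g (Icc 0 1)) :
    overlap f g ≤ overlap (F.transfer a f) (F.transfer a g) := by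
  have hm := integrable_min hf hg
  have h1 := F.integral_iterate_transfer ha hm 1
  simp only [Function.iterate_one] at h1
  rw [overlap, ← h1]
  exact integral_mono (F.integrable_transfer ha hm)
    (integrable_min (F.integrable_transfer ha hf) (F.integrable_transfer ha hg))
    fun x => le_min (F.transfer_mono ha (fun y => min_le_left _ _) x)
      (F.transfer_mono ha (fun y => min_le_right _ _) x)

lemma overlap_iterate_mono (ha : a ∈ Icc (0 : ℝ) 1) {f g : ℝ → ℝ} (hf : IntegrableOn f (Icc 0 1))
    (hg : IntegrableOn g (Icc 0 1)) :
    Monotone fun n => overlap ((F.transfer a)^[n] f) ((F.transfer a)^[n] g) := by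
  refine monotone_nat_of_le_succ fun n => ?_
  rw [Function.iterate_succ_apply', Function.iterate_succ_apply']
  exact overlap_transfer_le ha (F.integrable_iterate_transfer ha hf n)
    (F.integrable_iterate_transfer ha hg n)

lemma iterate_transfer_mono (ha : a ∈ Icc (0 : ℝ) 1) {f g : ℝ → ℝ} (h : ∀ x, f x ≤ g x) (n : ℕ)
    (x : ℝ) : (F.transfer a)^[n] f x ≤ (F.transfer a)^[n] g x := by
  induction n generalizing x with
  | zero => exact h x
  | succ n ih =>
    rw [Function.iterate_succ_apply', Function.iterate_succ_apply']
    exact F.transfer_mono ha ih x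

lemma iterate_transfer_ae_mono (ha : a ∈ Icc (0 : ℝ) 1) {f g : ℝ → ℝ}
    (hf : IntegrableOn f (Icc 0 1)) (h : f ≤ᵐ[leb] g) (n : ℕ) : (F.transfer a)^[n] f ≤ᵐ[leb] (F.transfer a)^[n] g := by
  have h1 : f =ᵐ[leb] fun x => min (f x) (g x) := by
    filter_upwards [h] with x hx using (min_eq_left hx).symm
  filter_upwards [F.iterate_transfer_congr ha hf h1 n] with x hx
  rw [hx]
  exact iterate_transfer_mono ha (fun y => min_le_right _ _) n x

lemma indicator_setIntegral {S : Set ℝ} (hS : MeasurableSet S) (f : ℝ → ℝ) :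
    ∫ x in Icc (0 : ℝ) 1, f x * S.indicator 1 x = ∫ x in Icc 0 1 ∩ S, f x := by
  rw [← setIntegral_indicator hS]
  congr 1; funext x
  by_cases hx : x ∈ S <;> simp [hx]

lemma setIntegral_iterate_transfer (ha : a ∈ Icc (0 : ℝ) 1) {f : ℝ → ℝ}
    (hf : IntegrableOn f (Icc 0 1)) {S : Set ℝ} (hS : MeasurableSet S) (n : ℕ) :
    ∫ x in Icc 0 1 ∩ S, (F.transfer a)^[n] f x =
      ∫ x in Icc (0 : ℝ) 1, f x * S.indicator 1 ((F.T a)^[n] x) := by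
  rw [← indicator_setIntegral hS]
  refine F.iterate_dual_of_bdd ha n hf (measurable_one.indicator hS).aestronglyMeasurable
    (c := 1) (Eventually.of_forall fun x => ?_)
  by_cases hx : x ∈ S <;> simp [hx]

lemma integrable_mul_indicator_comp (ha : a ∈ Icc (0 : ℝ) 1) {f : ℝ → ℝ}
    (hf : IntegrableOn f (Icc 0 1)) {S : Set ℝ} (hS : MeasurableSet S) (n : ℕ) :
    IntegrableOn (fun x => f x * S.indicator (1 : ℝ → ℝ) ((F.T a)^[n] x)) (Icc 0 1) := by
  refine Integrable.mul_bdd (c := 1) hf (F.aesm_comp_iterate ha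
    (measurable_one.indicator hS).aestronglyMeasurable n) (Eventually.of_forall fun x => ?_)
  by_cases hx : (F.T a)^[n] x ∈ S <;> simp [hx]

lemma setIntegral_K_mono (ha : a ∈ Icc (0 : ℝ) 1) {f : ℝ → ℝ} (hf : IntegrableOn f (Icc 0 1))
    (hf0 : ∀ x, 0 ≤ f x) : Monotone fun n => ∫ x in F.K a, (F.transfer a)^[n] f x := by
  refine monotone_nat_of_le_succ fun n => ?_
  have hK := (F.isClosed_K a).measurableSet
  have hi := F.integrable_iterate_transfer ha hf n
  have e := setIntegral_iterate_transfer (F := F) ha hi hK 1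
  rw [inter_eq_right.2 (F.K_subset ha), Function.iterate_one] at e
  have e' := indicator_setIntegral hK ((F.transfer a)^[n] f)
  rw [inter_eq_right.2 (F.K_subset ha)] at e'
  rw [Function.iterate_succ_apply', e, ← e']
  refine integral_mono_ae (Integrable.mul_bdd (c := 1) hi
    (measurable_one.indicator hK).aestronglyMeasurable (Eventually.of_forall fun x => ?_))
    (integrable_mul_indicator_comp ha hi hK 1) ?_
  · by_cases hx : x ∈ F.K a <;> simp [hx]
  · filter_upwards [F.ae_notMem_pts a] with x hx
    have h0 := F.iterate_transfer_nonneg ha hf0 n x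
    by_cases h : x ∈ F.K a
    · simp [h, F.mapsTo_K ha h hx]
    · simp only [h, not_false_eq_true, indicator_of_notMem, mul_zero]
      exact mul_nonneg h0 (indicator_nonneg (fun _ _ => zero_le_one) _)

lemma continuousAt_iterate_T (ha : a ∈ Icc (0 : ℝ) 1) {x : ℝ} (hx : x ∈ Icc (0 : ℝ) 1) {n : ℕ}
    (hp : ∀ i < n, (F.T a)^[i] x ∉ F.pts a) : ContinuousAt (F.T a)^[n] x := by
  induction n with
  | zero => exact continuousAt_id
  | succ n ih =>
    rw [Function.iterate_succ']
    exact ContinuousAt.comp (F.continuousAt_T ha ((F.mapsTo a ha).iterate n hx)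
      (hp n (Nat.lt_succ_self n))) (ih fun i hi => hp i (hi.trans (Nat.lt_succ_self n)))

namespace LasotaYorke

variable {A ε C r : ℝ} (H : F.LasotaYorke A ε C r)
include H

/-- The iterates of a nonzero nonnegative function are eventually bounded below on a window of
fixed size around some point of the support of the acip. -/
lemma exists_window (ha : a ∈ Icc 0 ε) {f : ℝ → ℝ} (hf : MemGBV α A f) (hf0 : ∀ x, 0 ≤ f x)
    (hpos : 0 < ∫ x in Icc (0 : ℝ) 1, f x) :
    ∃ s > 0, ∃ δ > 0, ∃ n₀ : ℕ, ∀ n ≥ n₀, ∃ x ∈ F.K a, ∀ᵐ y ∂leb, y ∈ Ioo (x - δ) (x + δ) →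
      s < (F.transfer a)^[n] f y := by
  have ha1 := H.mem_unit ha
  obtain ⟨n₀, h0⟩ := H.exists_integral_K_pos ha hf hf0 hpos
  set s := ∫ x in F.K a, (F.transfer a)^[n₀] f x
  obtain ⟨δ, hδ, hδs⟩ := exists_scale (R := 2 * C * nrm α A f) F.α_pos H.A_pos (half_pos h0)
  refine ⟨s / 2, half_pos h0, δ, hδ.1, n₀, fun n hn => ?_⟩
  refine exists_window_lt (H.mem ha hf n) (F.isClosed_K a).measurableSet (F.K_subset ha1)
    (half_pos h0).le hδ ?_
  have h1 : s ≤ ∫ x in F.K a, (F.transfer a)^[n] f x := setIntegral_K_mono ha1 hf.1 hf0 hn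
  have h2 : δ ^ α * nrm α A ((F.transfer a)^[n] f) ≤ δ ^ α * (2 * C * nrm α A f) := by
    have := hδ.1
    gcongr; exact H.nrm_iterate_le ha hf n
  linarith

lemma exists_overlap_pos (hmix : F.Mixing 0) {f g : ℝ → ℝ} (hf : MemGBV α A f)
    (hg : MemGBV α A g) (hf0 : ∀ x, 0 ≤ f x) (hg0 : ∀ x, 0 ≤ g x)
    (hfp : 0 < ∫ x in Icc (0 : ℝ) 1, f x) (hgp : 0 < ∫ x in Icc (0 : ℝ) 1, g x) :
    ∃ n, 0 < overlap ((F.transfer 0)^[n] f) ((F.transfer 0)^[n] g) := by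
  have h0 := H.zero_mem
  have ha1 := H.mem_unit h0
  obtain ⟨s, hs, δ, hδ, n₀, hw⟩ := H.exists_window h0 hf hf0 hfp
  obtain ⟨s', hs', δ', hδ', n₀', hw'⟩ := H.exists_window h0 hg hg0 hgp
  set n₁ := max n₀ n₀' with hn₁
  obtain ⟨x, hxK, hx⟩ := hw n₁ (le_max_left _ _)
  have hKc : IsCompact (F.K 0) := isCompact_Icc.of_isClosed_subset (F.isClosed_K 0) (F.K_subset ha1)
  obtain ⟨t, htK, htf, htc⟩ := hKc.finite_cover_balls (half_pos hδ')
  have hN : ∀ z ∈ t, ∃ N : ℕ, ∀ n ≥ N, ∃ p ∈ Ioo (x - δ) (x + δ) ∩ F.K 0,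
      (∀ i < n, (F.T 0)^[i] p ∉ F.pts 0) ∧ (F.T 0)^[n] p ∈ Metric.ball z (δ' / 2) := fun z hz =>
    hmix _ _ isOpen_Ioo Metric.isOpen_ball ⟨x, ⟨by linarith, by linarith⟩, hxK⟩
      ⟨z, Metric.mem_ball_self (half_pos hδ'), htK hz⟩
  choose! Nf hNf using hN
  obtain ⟨N, hNN⟩ : ∃ N, ∀ z ∈ t, Nf z ≤ N := by
    obtain ⟨N, hN⟩ := (htf.image Nf).bddAbove
    exact ⟨N, fun z hz => hN (mem_image_of_mem _ hz)⟩
  obtain ⟨x', hxK', hx'⟩ := hw' (N + 1 + n₁) (le_trans (le_max_right n₀ n₀') (Nat.le_add_left _ _))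
  obtain ⟨z, hzt, hxz⟩ := mem_iUnion₂.1 (htc hxK')
  obtain ⟨p, ⟨hpU, hpK⟩, hpp, hpV⟩ := hNf z hzt (N + 1) ((hNN z hzt).trans (Nat.le_succ N))
  have hVsub : Metric.ball z (δ' / 2) ⊆ Ioo (x' - δ') (x' + δ') := by
    intro y hy
    rw [Real.ball_eq_Ioo] at hy hxz
    constructor <;> linarith [hy.1, hy.2, hxz.1, hxz.2]
  have hp1 := F.K_subset ha1 hpK
  have hcont := continuousAt_iterate_T (F := F) ha1 hp1 hpp
  have hnhds : Ioo (x - δ) (x + δ) ∩ (F.T 0)^[N + 1] ⁻¹' Metric.ball z (δ' / 2) ∈ 𝓝 p :=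
    inter_mem (isOpen_Ioo.mem_nhds hpU) (hcont.preimage_mem_nhds (Metric.isOpen_ball.mem_nhds hpV))
  obtain ⟨e, he, hesub⟩ := Metric.mem_nhds_iff.1 hnhds
  rw [Real.ball_eq_Ioo] at hesub
  refine ⟨N + 1 + n₁, ?_⟩
  set u := (F.transfer 0)^[n₁] f with hu
  set w := (F.transfer 0)^[N + 1 + n₁] g with hwdef
  have eU : (F.transfer 0)^[N + 1 + n₁] f = (F.transfer 0)^[N + 1] u := by
    rw [hu, ← Function.iterate_add_apply]
  rw [eU]
  have hui := F.integrable_iterate_transfer ha1 hf.1 n₁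
  have hu0 := F.iterate_transfer_nonneg ha1 hf0 n₁
  have hLi := F.integrable_iterate_transfer ha1 hui (N + 1)
  have hL0 := F.iterate_transfer_nonneg ha1 hu0 (N + 1)
  have hwi := F.integrable_iterate_transfer ha1 hg.1 (N + 1 + n₁)
  have hw0 := F.iterate_transfer_nonneg ha1 hg0 (N + 1 + n₁)
  have hmin0 : ∀ y, 0 ≤ min ((F.transfer 0)^[N + 1] u y) (w y) := fun y => le_min (hL0 y) (hw0 y)
  refine lt_of_le_of_ne (integral_nonneg hmin0) fun h => ?_
  have h1 := (integral_eq_zero_iff_of_nonneg hmin0 (integrable_min hLi hwi)).1 h.symm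
  have hVm : MeasurableSet (Metric.ball z (δ' / 2)) := measurableSet_ball
  have h2 : ∫ y in Icc 0 1 ∩ Metric.ball z (δ' / 2), (F.transfer 0)^[N + 1] u y = 0 := by
    rw [← indicator_setIntegral hVm]
    refine (integral_congr_ae ?_).trans (integral_zero _ _)
    filter_upwards [h1, hx'] with y h3 h4
    by_cases hy : y ∈ Metric.ball z (δ' / 2)
    · have h5 := hs'.trans (h4 (hVsub hy))
      simp only [Pi.zero_apply] at h3
      have : (F.transfer 0)^[N + 1] u y = 0 := by
        rcases min_choice ((F.transfer 0)^[N + 1] u y) (w y) with h6 | h6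
        · rw [← h6]; exact h3
        · rw [h6] at h3; exact absurd h3 h5.ne'
      simp [this]
    · simp [hy]
  rw [setIntegral_iterate_transfer ha1 hui hVm] at h2
  have hind : ∀ y, 0 ≤ (Metric.ball z (δ' / 2)).indicator (1 : ℝ → ℝ) ((F.T 0)^[N + 1] y) :=
    fun y => indicator_nonneg (fun _ _ => zero_le_one) _
  have h3 := (integral_eq_zero_iff_of_nonneg (fun y => mul_nonneg (hu0 y) (hind y))
    (integrable_mul_indicator_comp ha1 hui hVm _)).1 h2
  have h4 : ∀ᵐ y ∂leb, y ∉ Ioo (p - e) (p + e) := by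
    filter_upwards [h3, hx] with y h5 h6 hy
    have h7 := hesub hy
    have h8 := h6 h7.1
    have h9 : (F.T 0)^[N + 1] y ∈ Metric.ball z (δ' / 2) := h7.2
    simp only [h9, indicator_of_mem, Pi.one_apply, mul_one, Pi.zero_apply] at h5
    linarith
  have h5 := window_pos hp1 he
  rw [ae_iff] at h4
  simp only [not_not] at h4
  have h6 : leb (Ioo (p - e) (p + e)) = 0 := h4
  rw [leb, Measure.restrict_apply measurableSet_Ioo] at h6
  exact h5.ne' h6

/-- Uniform overlap of the iterates of densities with bounded norm. -/
lemma exists_uniform_overlap (hmix : F.Mixing 0) (R : ℝ) :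
    ∃ c > 0, ∃ n₀ : ℕ, ∀ n ≥ n₀, ∀ f g : ℝ → ℝ, MemGBV α A f → MemGBV α A g →
      (∀ x, 0 ≤ f x) → (∀ x, 0 ≤ g x) →
      ∫ x in Icc (0 : ℝ) 1, f x = 1 → ∫ x in Icc (0 : ℝ) 1, g x = 1 →
      nrm α A f ≤ R → nrm α A g ≤ R →
      c ≤ overlap ((F.transfer 0)^[n] f) ((F.transfer 0)^[n] g) := by
  have h0 := H.zero_mem
  have ha1 := H.mem_unit h0
  obtain ⟨δ, hδ, hδs⟩ := exists_scale (R := R) F.α_pos H.A_pos (half_pos zero_lt_one)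
  obtain ⟨N, hN⟩ := exists_nat_one_div_lt hδ.1
  set e : ℕ → ℝ → ℝ := fun i x => (1 / 2) * (cell (N + 1) i).indicator 1 x with he
  have hem : ∀ i < N + 1, MemGBV α A (e i) := fun i hi =>
    ((memGBV_indicator F.α_pos F.α_le_one H.A_pos (ordConnected_Ico : (cell (N + 1) i).OrdConnected)
      (cell_subset hi)).1.const_mul _).1
  have he0 : ∀ i x, 0 ≤ e i x := fun i x =>
    mul_nonneg (by norm_num) (indicator_nonneg (fun _ _ => zero_le_one) _)
  have hep : ∀ i < N + 1, 0 < ∫ x in Icc (0 : ℝ) 1, e i x := by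
    intro i hi
    have e1 := indicator_setIntegral (measurableSet_cell (N + 1) i) fun _ => 1 / 2
    simp only [he]
    rw [e1, inter_eq_right.2 (cell_subset hi), setIntegral_const, Measure.real, volume_cell,
      ENNReal.toReal_ofReal (by positivity), smul_eq_mul]
    positivity
  have key : ∀ q : ℕ × ℕ, q ∈ Finset.range (N + 1) ×ˢ Finset.range (N + 1) →
      ∃ n, 0 < overlap ((F.transfer 0)^[n] (e q.1)) ((F.transfer 0)^[n] (e q.2)) := by
    intro q hq
    simp only [Finset.mem_product, Finset.mem_range] at hq
    exact H.exists_overlap_pos hmix (hem _ hq.1) (hem _ hq.2) (he0 _) (he0 _) (hep _ hq.1)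
      (hep _ hq.2)
  choose! m hm using key
  set Q := Finset.range (N + 1) ×ˢ Finset.range (N + 1) with hQ
  have hQne : Q.Nonempty := ⟨(0, 0), by simp [hQ]⟩
  set val : ℕ × ℕ → ℝ := fun q =>
    overlap ((F.transfer 0)^[m q] (e q.1)) ((F.transfer 0)^[m q] (e q.2)) with hval
  refine ⟨Q.inf' hQne val, (Finset.lt_inf'_iff hQne).2 hm, Q.sup m, ?_⟩
  intro n hn f g hf hg hf0 hg0 hf1 hg1 hfR hgR
  have hcell : ∀ f : ℝ → ℝ, MemGBV α A f → (∀ x, 0 ≤ f x) → ∫ x in Icc (0 : ℝ) 1, f x = 1 →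
      nrm α A f ≤ R → ∃ i < N + 1, e i ≤ᵐ[leb] f := by
    intro f hf hf0 hf1 hfR
    have h1 : ∫ x in Ico (0 : ℝ) 1, f x = 1 := by
      rw [← integral_Icc_eq_integral_Ico]; exact hf1
    have h2 : δ ^ α * nrm α A f ≤ δ ^ α * R := by
      have := hδ.1
      gcongr
    obtain ⟨x, hx, hxw⟩ := exists_window_lt (s := 1 / 2) hf measurableSet_Ico Ico_subset_Icc_self
      (by norm_num) hδ (by rw [h1]; linarith)
    obtain ⟨i, hi, hxi⟩ := exists_cell (Nat.succ_pos N) hx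
    refine ⟨i, hi, ?_⟩
    filter_upwards [hxw] with y hy
    by_cases hyi : y ∈ cell (N + 1) i
    · simp only [he, hyi, indicator_of_mem, Pi.one_apply, mul_one]
      refine (hy ?_).le
      have e1 : ((i + 1 : ℝ) / (N + 1 : ℕ)) = (i : ℝ) / (N + 1 : ℕ) + 1 / (N + 1) := by
        push_cast; ring
      rw [cell, e1, mem_Ico] at hyi hxi
      constructor <;> linarith [hyi.1, hyi.2, hxi.1, hxi.2]
    · simp only [he, hyi, not_false_eq_true, indicator_of_notMem, mul_zero]
      exact hf0 y
  obtain ⟨i, hi, hfi⟩ := hcell f hf hf0 hf1 hfR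
  obtain ⟨j, hj, hgj⟩ := hcell g hg hg0 hg1 hgR
  have hq : (i, j) ∈ Q := by simp [hQ, hi, hj]
  refine (Finset.inf'_le val hq).trans ?_
  refine (overlap_iterate_mono ha1 (hem i hi).1 (hem j hj).1
    ((Finset.le_sup (f := m) hq).trans hn)).trans ?_
  refine integral_mono_ae (integrable_min (F.integrable_iterate_transfer ha1 (hem i hi).1 n)
    (F.integrable_iterate_transfer ha1 (hem j hj).1 n))
    (integrable_min (F.integrable_iterate_transfer ha1 hf.1 n)
      (F.integrable_iterate_transfer ha1 hg.1 n)) ?_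
  filter_upwards [iterate_transfer_ae_mono ha1 (hem i hi).1 hfi n,
    iterate_transfer_ae_mono ha1 (hem j hj).1 hgj n] with x h1 h2
  exact min_le_min h1 h2

end LasotaYorke

end ExpandingFamily

namespace ExpandingFamily

variable {α lam Lam : ℝ} {p₀ p₁ : ℕ} {F : ExpandingFamily α lam Lam p₀ p₁} {a : ℝ}

/-- Uniform exponential contraction of the transfer operators on functions with integral zero. -/
structure SpectralGap (F : ExpandingFamily α lam Lam p₀ p₁) (A ε C r D ρ : ℝ) : Prop extends
    F.LasotaYorke A ε C r where
  one_le_D : 1 ≤ D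
  ρ_pos : 0 < ρ
  ρ_lt_one : ρ < 1
  gap : ∀ a ∈ Icc 0 ε, ∀ φ : ℝ → ℝ, MemGBV α A φ → ∫ x in Icc (0 : ℝ) 1, φ x = 0 → ∀ n : ℕ,
    nrm α A ((F.transfer a)^[n] φ) ≤ D * ρ ^ n * nrm α A φ

namespace LasotaYorke

variable {A ε C r : ℝ} (H : F.LasotaYorke A ε C r)
include H

lemma mono {ε' : ℝ} (h0 : 0 < ε') (h : ε' ≤ ε) : F.LasotaYorke A ε' C r :=
  ⟨H.A_pos, h0, h.trans H.ε_le_one, H.one_le_C, H.r_pos, H.r_lt_one,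
    fun a ha => H.bound a ⟨ha.1, ha.2.trans h⟩⟩

/-- Contraction in `L¹` for functions with integral zero which are not too irregular. -/
lemma exists_l1_contraction (hmix : F.Mixing 0) (R : ℝ) :
    ∃ c > 0, c ≤ 1 ∧ ∃ n₀ : ℕ, ∀ n ≥ n₀, ∀ φ : ℝ → ℝ, MemGBV α A φ →
      ∫ x in Icc (0 : ℝ) 1, φ x = 0 → nrm α A φ ≤ R * l1 φ →
      l1 ((F.transfer 0)^[n] φ) ≤ (1 - c) * l1 φ := by
  obtain ⟨c, hc, n₀, hn₀⟩ := H.exists_uniform_overlap hmix (2 * R)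
  refine ⟨min c 1, by positivity, min_le_right _ _, n₀, fun n hn φ hφ hφ0 hR => ?_⟩
  have ha1 := H.mem_unit H.zero_mem
  rcases (l1_nonneg φ).eq_or_lt with h0 | hpos
  · have := F.l1_iterate_transfer_le ha1 hφ.1 n
    rw [← h0] at this ⊢; linarith
  set q := 2 / l1 φ with hq
  have hq0 : 0 < q := by positivity
  have hl1 : LipschitzWith 1 fun x : ℝ => max x 0 := LipschitzWith.id.max_const 0
  have hl2 : LipschitzWith 1 fun x : ℝ => max (-x) 0 := LipschitzWith.id.neg.max_const 0
  obtain ⟨hp, hpn⟩ := hφ.lipschitz_comp hl1 (by simp)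
  obtain ⟨hm, hmn⟩ := hφ.lipschitz_comp hl2 (by simp)
  set f : ℝ → ℝ := fun x => q * max (φ x) 0 with hf
  set g : ℝ → ℝ := fun x => q * max (-φ x) 0 with hg
  have hf0 : ∀ x, 0 ≤ f x := fun x => mul_nonneg hq0.le (le_max_right _ _)
  have hg0 : ∀ x, 0 ≤ g x := fun x => mul_nonneg hq0.le (le_max_right _ _)
  obtain ⟨hfm, hfn⟩ := hp.const_mul q
  obtain ⟨hgm, hgn⟩ := hm.const_mul q
  have hip : (∫ x in Icc (0 : ℝ) 1, max (φ x) 0) - ∫ x in Icc (0 : ℝ) 1, max (-φ x) 0 = 0 := by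
    rw [← integral_sub hp.1 hm.1]
    refine (integral_congr_ae (Eventually.of_forall fun x => ?_)).trans hφ0
    rcases le_total (φ x) 0 with h | h
    · rw [max_eq_right h, max_eq_left (by linarith)]; ring
    · rw [max_eq_left h, max_eq_right (by linarith)]; ring
  have hia : (∫ x in Icc (0 : ℝ) 1, max (φ x) 0) + ∫ x in Icc (0 : ℝ) 1, max (-φ x) 0 = l1 φ := by
    rw [← integral_add hp.1 hm.1, l1]
    congr 1; funext x
    rcases le_total (φ x) 0 with h | h
    · rw [max_eq_right h, max_eq_left (by linarith), abs_of_nonpos h]; ring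
    · rw [max_eq_left h, max_eq_right (by linarith), abs_of_nonneg h]; ring
  have hf1 : ∫ x in Icc (0 : ℝ) 1, f x = 1 := by
    have : ∫ x in Icc (0 : ℝ) 1, max (φ x) 0 = l1 φ / 2 := by linarith
    rw [hf, integral_const_mul, this, hq]; field_simp
  have hg1 : ∫ x in Icc (0 : ℝ) 1, g x = 1 := by
    have : ∫ x in Icc (0 : ℝ) 1, max (-φ x) 0 = l1 φ / 2 := by linarith
    rw [hg, integral_const_mul, this, hq]; field_simp
  have hqR : |q| * nrm α A φ ≤ 2 * R := by
    rw [abs_of_pos hq0, hq]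
    calc 2 / l1 φ * nrm α A φ ≤ 2 / l1 φ * (R * l1 φ) := by gcongr
      _ = 2 * R := by field_simp
  have hov := hn₀ n hn f g hfm hgm hf0 hg0 hf1 hg1
    (hfn.trans ((mul_le_mul_of_nonneg_left hpn (abs_nonneg _)).trans hqR))
    (hgn.trans ((mul_le_mul_of_nonneg_left hmn (abs_nonneg _)).trans hqR))
  have hfi := F.integrable_iterate_transfer ha1 hfm.1 n
  have hgi := F.integrable_iterate_transfer ha1 hgm.1 n
  have h1 := l1_sub_eq_overlap hfi hgi
  rw [F.integral_iterate_transfer ha1 hfm.1, F.integral_iterate_transfer ha1 hgm.1, hf1, hg1] at h1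
  have e : (F.transfer 0)^[n] φ = fun x =>
      (l1 φ / 2) * ((F.transfer 0)^[n] f x - (F.transfer 0)^[n] g x) := by
    have e1 : φ = fun x => (l1 φ / 2) * f x + (-(l1 φ / 2)) * g x := by
      funext x
      simp only [hf, hg, hq]
      rcases le_total (φ x) 0 with h | h
      · rw [max_eq_right h, max_eq_left (by linarith)]; field_simp; ring
      · rw [max_eq_left h, max_eq_right (by linarith)]; field_simp; ring
    conv_lhs => rw [e1]
    rw [F.iterate_transfer_lin ha1]
    funext x; ring
  have e2 : l1 ((F.transfer 0)^[n] φ) =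
      l1 φ / 2 * l1 (fun x => (F.transfer 0)^[n] f x - (F.transfer 0)^[n] g x) := by
    rw [e, l1]
    simp only [abs_mul]
    rw [integral_const_mul, abs_of_pos (half_pos hpos)]
    rfl
  rw [e2, h1]
  have h2 := min_le_left c 1
  nlinarith

lemma exists_contraction_step (hmix : F.Mixing 0) :
    ∃ ε' B γ : ℝ, ∃ n : ℕ, 0 < ε' ∧ ε' ≤ ε ∧ 0 < B ∧ 0 < γ ∧ γ < 1 ∧ 0 < n ∧
      ∀ a ∈ Icc 0 ε', ∀ φ : ℝ → ℝ, MemGBV α A φ → ∫ x in Icc (0 : ℝ) 1, φ x = 0 →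
        nrm α A ((F.transfer a)^[n] φ) + B * l1 ((F.transfer a)^[n] φ) ≤
          γ * (nrm α A φ + B * l1 φ) := by
  have hC := H.C_pos
  have hα := F.α_pos
  obtain ⟨c, hc, hc1, n₀, hn₀⟩ := H.exists_l1_contraction hmix (4 * C)
  obtain ⟨D, hD, hDle⟩ := H.exists_l1_iterate_sub_le
  have hr : Tendsto (fun n : ℕ => C * r ^ n) atTop (𝓝 (C * 0)) :=
    (tendsto_pow_atTop_nhds_zero_of_lt_one H.r_pos.le H.r_lt_one).const_mul C
  rw [mul_zero] at hr
  obtain ⟨n, hnr, hn⟩ := ((hr.eventually (gt_mem_nhds (by norm_num : (0 : ℝ) < 1 / 4))).and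
    (eventually_ge_atTop (max n₀ 1))).exists
  set B := 4 * C / c with hB
  have hB0 : 0 < B := by positivity
  obtain ⟨δ, hδ, hδs⟩ := exists_scale (α := α / 2) (R := B * (n * D)) (half_pos hα) H.ε_pos
    (by norm_num : (0 : ℝ) < 1 / 4)
  refine ⟨δ, B, 1 - c / 4, n, hδ.1, hδ.2, hB0, by linarith, by linarith,
    lt_of_lt_of_le one_pos ((le_max_right n₀ 1).trans hn), ?_⟩
  intro a ha φ hφ hφ0
  have ha' : a ∈ Icc 0 ε := ⟨ha.1, ha.2.trans hδ.2⟩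
  have ha1 := H.mem_unit ha'
  have h01 := H.mem_unit H.zero_mem
  have hnn := nrm_nonneg (α := α) (A := A) φ
  have hln := l1_nonneg φ
  have h1 : nrm α A ((F.transfer a)^[n] φ) ≤ 1 / 4 * nrm α A φ + C * l1 φ := by
    refine (H.bound a ha' φ hφ n).2.trans ?_
    have := mul_le_mul_of_nonneg_right hnr.le hnn
    linarith
  rcases le_or_gt (nrm α A φ) (4 * C * l1 φ) with hcase | hcase
  · have h2 := hn₀ n ((le_max_left _ _).trans hn) φ hφ hφ0 hcase
    have h3 := hDle a ha' 0 H.zero_mem φ hφ n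
    rw [sub_zero, abs_of_nonneg ha.1] at h3
    have h4 : l1 ((F.transfer a)^[n] φ) ≤
        (1 - c) * l1 φ + n * (D * a ^ (α / 2) * nrm α A φ) := by
      have e : (F.transfer a)^[n] φ = fun x =>
          (F.transfer 0)^[n] φ x + ((F.transfer a)^[n] φ x - (F.transfer 0)^[n] φ x) := by
        funext x; ring
      have := l1_add_le (g := fun x => (F.transfer a)^[n] φ x - (F.transfer 0)^[n] φ x)
        (F.integrable_iterate_transfer h01 hφ.1 n) (Integrable.sub (F.integrable_iterate_transfer ha1 hφ.1 n)
          (F.integrable_iterate_transfer h01 hφ.1 n))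
      rw [← e] at this
      linarith
    have h5 : a ^ (α / 2) ≤ δ ^ (α / 2) := Real.rpow_le_rpow ha.1 ha.2 (half_pos hα).le
    have h6 : B * (n * (D * a ^ (α / 2) * nrm α A φ)) ≤ 1 / 4 * nrm α A φ := by
      calc B * (n * (D * a ^ (α / 2) * nrm α A φ))
          = a ^ (α / 2) * (B * (n * D)) * nrm α A φ := by ring
        _ ≤ δ ^ (α / 2) * (B * (n * D)) * nrm α A φ := by gcongr
        _ ≤ _ := by gcongr
    have h7 : C = B * c / 4 := by rw [hB]; field_simp
    have h8 := mul_le_mul_of_nonneg_left h4 hB0.le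
    have h9 : C * l1 φ = B * c / 4 * l1 φ := by rw [← h7]
    have h10 : 0 ≤ B * l1 φ * c := by positivity
    nlinarith
  · have h2 := F.l1_iterate_transfer_le ha1 hφ.1 n
    have h3 := mul_le_mul_of_nonneg_left h2 hB0.le
    have h5 : c / 4 * (B * l1 φ) ≤ 1 / 4 * nrm α A φ := by
      have : c / 4 * (B * l1 φ) = 1 / 4 * (4 * C * l1 φ) := by rw [hB]; field_simp
      linarith
    nlinarith

lemma exists_spectralGap (hmix : F.Mixing 0) :
    ∃ ε' D ρ : ℝ, F.SpectralGap A ε' C r D ρ := by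
  obtain ⟨ε', B, γ, m, hε', hle, hB, hγ, hγ1, hm, hstep⟩ := H.exists_contraction_step hmix
  have hC := H.C_pos
  have hm' : (m : ℝ) ≠ 0 := by exact_mod_cast hm.ne'
  set ρ := γ ^ (1 / m : ℝ) with hρ
  have hρ0 : 0 < ρ := by positivity
  have hρm : ρ ^ m = γ := by
    rw [hρ, ← Real.rpow_natCast, ← Real.rpow_mul hγ.le, one_div, inv_mul_cancel₀ hm',
      Real.rpow_one]
  have hρ1 : ρ < 1 := Real.rpow_lt_one hγ.le hγ1 (by positivity)
  refine ⟨ε', max 1 (2 * C * (1 + B) / γ), ρ, H.mono hε' hle, le_max_left _ _, hρ0, hρ1, ?_⟩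
  intro a ha φ hφ hφ0 n
  have ha' : a ∈ Icc 0 ε := ⟨ha.1, ha.2.trans hle⟩
  have ha1 := H.mem_unit ha'
  have hnn := nrm_nonneg (α := α) (A := A) φ
  have hit : ∀ k : ℕ, nrm α A ((F.transfer a)^[k * m] φ) + B * l1 ((F.transfer a)^[k * m] φ) ≤
      γ ^ k * (nrm α A φ + B * l1 φ) := by
    intro k
    induction k with
    | zero => simp
    | succ k ih =>
      have e : (F.transfer a)^[(k + 1) * m] φ = (F.transfer a)^[m] ((F.transfer a)^[k * m] φ) := by
        rw [← Function.iterate_add_apply]; congr 2; ring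
      rw [e]
      refine (hstep a ha _ (H.mem ha' hφ _)
        (by rw [F.integral_iterate_transfer ha1 hφ.1]; exact hφ0)).trans ?_
      rw [pow_succ']
      have := mul_le_mul_of_nonneg_left ih hγ.le
      linarith
  set k := n / m with hk
  have hn : n = n % m + k * m := by rw [hk, mul_comm]; exact (Nat.mod_add_div n m).symm
  have e : (F.transfer a)^[n] φ = (F.transfer a)^[n % m] ((F.transfer a)^[k * m] φ) := by
    rw [← Function.iterate_add_apply, ← hn]
  have h1 : nrm α A ((F.transfer a)^[k * m] φ) ≤ γ ^ k * ((1 + B) * nrm α A φ) := by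
    have h2 := hit k
    have h3 := mul_nonneg hB.le (l1_nonneg ((F.transfer a)^[k * m] φ))
    have h4 : γ ^ k * (nrm α A φ + B * l1 φ) ≤ γ ^ k * ((1 + B) * nrm α A φ) := by
      gcongr
      have := mul_le_mul_of_nonneg_left (l1_le_nrm hφ) hB.le
      linarith
    linarith
  have hγk : γ ^ k ≤ ρ ^ n / γ := by
    rw [le_div_iff₀ hγ, ← pow_succ, ← hρm, ← pow_mul]
    refine pow_le_pow_of_le_one hρ0.le hρ1.le ?_
    have := Nat.mod_lt n hm
    rw [mul_add, mul_comm m k, mul_one]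
    omega
  calc nrm α A ((F.transfer a)^[n] φ)
      ≤ 2 * C * nrm α A ((F.transfer a)^[k * m] φ) := by
        rw [e]; exact H.nrm_iterate_le ha' (H.mem ha' hφ _) _
    _ ≤ 2 * C * (γ ^ k * ((1 + B) * nrm α A φ)) := by gcongr
    _ ≤ 2 * C * (ρ ^ n / γ * ((1 + B) * nrm α A φ)) := by gcongr
    _ = 2 * C * (1 + B) / γ * ρ ^ n * nrm α A φ := by ring
    _ ≤ _ := by gcongr; exact le_max_right _ _

end LasotaYorke

end ExpandingFamily

/-- The constant function `1` on the unit interval. -/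
noncomputable def unitFn : ℝ → ℝ := (Icc (0 : ℝ) 1).indicator 1

lemma unitFn_ae_eq : unitFn =ᵐ[leb] fun _ => (1 : ℝ) := by
  filter_upwards [ae_restrict_mem measurableSet_Icc] with x hx
  simp [unitFn, hx]

lemma unitFn_nonneg (x : ℝ) : 0 ≤ unitFn x := indicator_nonneg (fun _ _ => zero_le_one) x

lemma integral_unitFn : ∫ x in Icc (0 : ℝ) 1, unitFn x = 1 := by
  rw [integral_congr_ae unitFn_ae_eq]; simp

lemma memGBV_unitFn {α A : ℝ} (hα : 0 < α) (hα1 : α ≤ 1) (hA : 0 < A) : MemGBV α A unitFn :=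
  (memGBV_indicator hα hα1 hA ordConnected_Icc Subset.rfl).1

lemma MemGBV.sub_const {α A : ℝ} (hα : 0 < α) (hα1 : α ≤ 1) (hA : 0 < A) {φ : ℝ → ℝ}
    (hφ : MemGBV α A φ) (c : ℝ) : MemGBV α A (fun x => φ x - c) ∧
      nrm α A (fun x => φ x - c) ≤ nrm α A φ + |c| * nrm α A unitFn := by
  have h1 := hφ.lin (memGBV_unitFn hα hα1 hA) 1 (-c)
  have e : (fun x => 1 * φ x + -c * unitFn x) =ᵐ[leb] fun x => φ x - c := by
    filter_upwards [unitFn_ae_eq] with x hx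
    rw [hx]; ring
  refine ⟨h1.1.congr e, ?_⟩
  rw [← nrm_congr e]
  simpa using h1.2

/-- Optimisation over `n` of a bound by an exponential and a polynomial in `n`. -/
lemma exists_bound_of_exp_poly {ρ β : ℝ} (hρ : 0 < ρ) (hρ1 : ρ < 1) (hβ : 0 < β) :
    ∃ c > 0, ∀ s ∈ Icc (0 : ℝ) 1, ∀ d E : ℝ, 0 ≤ E →
      (∀ n : ℕ, 1 ≤ n → d ≤ E * (ρ ^ n + n ^ 2 * s ^ β)) → d ≤ E * (c * s ^ (β / 2)) := by
  have hlim := tendsto_pow_const_mul_const_pow_of_abs_lt_one 2 (abs_lt.2 ⟨by linarith, hρ1⟩)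
  obtain ⟨M, hM⟩ := hlim.bddAbove_range
  have hM' : ∀ n : ℕ, (n : ℝ) ^ 2 * ρ ^ n ≤ M := fun n => hM (mem_range_self n)
  have hM0 : 0 ≤ M := by simpa using hM' 0
  refine ⟨M + 4, by linarith, fun s hs d E hE h => ?_⟩
  rcases hs.1.eq_or_lt with h0 | hpos
  · rw [← h0, Real.zero_rpow (half_pos hβ).ne', mul_zero, mul_zero]
    have h1 : Tendsto (fun n : ℕ => E * ρ ^ n) atTop (𝓝 (E * 0)) :=
      (tendsto_pow_atTop_nhds_zero_of_lt_one hρ.le hρ1).const_mul E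
    rw [mul_zero] at h1
    refine ge_of_tendsto h1 ?_
    filter_upwards [eventually_ge_atTop 1] with n hn
    have := h n hn
    rwa [← h0, Real.zero_rpow hβ.ne', mul_zero, add_zero] at this
  set x := s ^ (-(β / 4)) with hx
  have hx1 : 1 ≤ x := Real.one_le_rpow_of_pos_of_le_one_of_nonpos hpos hs.2 (by linarith)
  set n := ⌈x⌉₊ with hn
  have hxn : x ≤ n := Nat.le_ceil x
  have hnx : (n : ℝ) ≤ 2 * x := by
    have := (Nat.ceil_lt_add_one (by linarith : 0 ≤ x)).le
    linarith
  have hn1 : 1 ≤ n := by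
    have : (1 : ℝ) ≤ n := hx1.trans hxn
    exact_mod_cast this
  have hx2 : x ^ 2 * s ^ (β / 2) = 1 := by
    rw [hx, ← Real.rpow_natCast, ← Real.rpow_mul hpos.le, ← Real.rpow_add hpos]
    norm_num; ring_nf; simp
  have hss : s ^ β = s ^ (β / 2) * s ^ (β / 2) := by
    rw [← Real.rpow_add hpos]; congr 1; ring
  set t := s ^ (β / 2) with ht
  have ht0 : 0 < t := by positivity
  refine (h n hn1).trans (mul_le_mul_of_nonneg_left ?_ hE)
  have h1 : ρ ^ n ≤ M * t := by
    have h2 : x ^ 2 * ρ ^ n ≤ M := by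
      refine le_trans ?_ (hM' n)
      gcongr
    calc ρ ^ n = (x ^ 2 * t) * ρ ^ n := by rw [hx2, one_mul]
      _ = (x ^ 2 * ρ ^ n) * t := by ring
      _ ≤ M * t := by gcongr
  have h3 : (n : ℝ) ^ 2 * s ^ β ≤ 4 * t := by
    calc (n : ℝ) ^ 2 * s ^ β ≤ (2 * x) ^ 2 * (t * t) := by rw [hss]; gcongr
      _ = 4 * (x ^ 2 * t) * t := by ring
      _ = 4 * t := by rw [hx2]; ring
  linarith

lemma abs_sqrt_sub_sqrt_le (x y : ℝ) : |√x - √y| ≤ √|x - y| := by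
  have key : ∀ x y : ℝ, √x ≤ √y + √|x - y| := by
    intro x y
    rcases le_total y 0 with hy | hy
    · rw [Real.sqrt_eq_zero_of_nonpos hy, zero_add]
      exact Real.sqrt_le_sqrt (le_trans (by linarith) (le_abs_self _))
    · rw [Real.sqrt_le_left (by positivity)]
      have h1 := Real.sq_sqrt hy
      have h2 := Real.sq_sqrt (abs_nonneg (x - y))
      nlinarith [Real.sqrt_nonneg y, Real.sqrt_nonneg |x - y|, le_abs_self (x - y),
        mul_nonneg (Real.sqrt_nonneg y) (Real.sqrt_nonneg |x - y|)]
  rw [abs_le]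
  have h1 := key x y
  have h2 := key y x
  rw [abs_sub_comm] at h2
  constructor <;> linarith

lemma abs_integral_mul_le {f ψ : ℝ → ℝ} {c : ℝ} (hf : IntegrableOn f (Icc 0 1))
    (hc : ∀ᵐ x ∂leb, |ψ x| ≤ c) : |∫ x in Icc (0 : ℝ) 1, f x * ψ x| ≤ c * l1 f := by
  refine abs_integral_le_integral_abs.trans ?_
  rw [l1, ← integral_const_mul]
  by_cases hi : Integrable (fun x => |f x * ψ x|) leb
  · refine integral_mono_ae hi (Integrable.const_mul (Integrable.abs hf) c) ?_
    filter_upwards [hc] with x hx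
    rw [abs_mul, mul_comm]
    exact mul_le_mul_of_nonneg_right hx (abs_nonneg _)
  · rw [integral_undef hi, integral_const_mul]
    have hc0 : 0 ≤ c := by
      by_contra! hneg
      have h1 : ∀ᵐ x ∂leb, False := by
        filter_upwards [hc] with x hx
        linarith [abs_nonneg (ψ x)]
      simp only [eventually_false_iff_eq_bot, ae_eq_bot] at h1
      simp [leb, Measure.restrict_eq_zero] at h1
    exact mul_nonneg hc0 (l1_nonneg f)

namespace ExpandingFamily

variable {α lam Lam : ℝ} {p₀ p₁ : ℕ} {F : ExpandingFamily α lam Lam p₀ p₁} {a : ℝ}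

lemma density_nonneg (a x : ℝ) : 0 ≤ F.density a x := ENNReal.toReal_nonneg

lemma measurable_density (a : ℝ) : Measurable (F.density a) :=
  (Measure.measurable_rnDeriv _ _).ennreal_toReal

lemma μ_eq (ha : a ∈ Icc (0 : ℝ) 1) :
    F.μ a = leb.withDensity fun x => ENNReal.ofReal (F.density a x) := by
  have h := F.isAcip_μ ha
  have := h.prob
  have hac : F.μ a ≪ volume := h.ac.trans Measure.absolutelyContinuous_restrict
  have h1 : volume.withDensity ((F.μ a).rnDeriv volume) = F.μ a :=
    Measure.withDensity_rnDeriv_eq _ _ hac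
  have h2 : volume.withDensity (fun x => ENNReal.ofReal (F.density a x)) = F.μ a := by
    refine Eq.trans (withDensity_congr_ae ?_) h1
    filter_upwards [(F.μ a).rnDeriv_lt_top volume] with x hx
    exact ENNReal.ofReal_toReal hx.ne
  have h3 : (F.μ a).restrict (Icc 0 1) = F.μ a :=
    Measure.restrict_eq_self_of_ae_mem (h.ac.ae_le (ae_restrict_mem measurableSet_Icc))
  rw [leb, ← restrict_withDensity measurableSet_Icc, h2, h3]

lemma integral_μ (ha : a ∈ Icc (0 : ℝ) 1) (ψ : ℝ → ℝ) :
    ∫ x, ψ x ∂(F.μ a) = ∫ x in Icc (0 : ℝ) 1, F.density a x * ψ x := by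
  rw [F.μ_eq ha, integral_withDensity_eq_integral_toReal_smul
    (F.measurable_density a).ennreal_ofReal (Eventually.of_forall fun x => ENNReal.ofReal_lt_top)]
  simp only [ENNReal.toReal_ofReal (F.density_nonneg a _), smul_eq_mul]

lemma density_ae_eq (ha : a ∈ Icc (0 : ℝ) 1) {h : ℝ → ℝ} (hi : IntegrableOn h (Icc 0 1))
    (h0 : ∀ᵐ x ∂leb, 0 ≤ h x) (hμ : F.μ a = leb.withDensity fun x => ENNReal.ofReal (h x)) :
    h =ᵐ[leb] F.density a := by
  have h1 := Measure.rnDeriv_withDensity₀ leb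
    (f := fun x => ENNReal.ofReal (h x)) hi.aestronglyMeasurable.aemeasurable.ennreal_ofReal
  have h2 := Measure.rnDeriv_withDensity₀ leb
    (f := fun x => ENNReal.ofReal (F.density a x)) (F.measurable_density a).ennreal_ofReal.aemeasurable
  rw [← hμ] at h1
  rw [← F.μ_eq ha] at h2
  filter_upwards [h1, h2, h0] with x h3 h4 h5
  have h6 := h3.symm.trans h4
  exact (ENNReal.ofReal_eq_ofReal_iff h5 (F.density_nonneg a x)).1 h6

/-- The mean of a bounded function under the acip is bounded. -/
lemma abs_mean_le (ha : a ∈ Icc (0 : ℝ) 1) {φ : ℝ → ℝ} {M : ℝ}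
    (hM : ∀ᵐ x ∂leb, |φ x| ≤ M) : |F.mean φ a| ≤ M := by
  have h := F.isAcip_μ ha
  have := h.prob
  have hM' : ∀ᵐ x ∂(F.μ a), ‖φ x‖ ≤ M := h.ac.ae_le hM
  have h1 := norm_integral_le_of_norm_le_const hM'
  rw [Measure.real, measure_univ, ENNReal.toReal_one, mul_one] at h1
  exact h1

namespace LasotaYorke

variable {A ε C r : ℝ} (H : F.LasotaYorke A ε C r)
include H

/-- The invariant densities form a bounded subset of `V_α`. -/
lemma exists_density_bound : ∃ R > 0, ∀ a ∈ Icc 0 ε, MemGBV α A (F.density a) ∧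
    nrm α A (F.density a) ≤ R ∧ ∫ x in Icc (0 : ℝ) 1, F.density a x = 1 ∧
    ∀ n, (F.transfer a)^[n] (F.density a) =ᵐ[leb] F.density a := by
  have hC := H.C_pos
  have hun := nrm_nonneg (α := α) (A := A) unitFn
  refine ⟨2 * C * nrm α A unitFn + 1, by positivity, fun a ha => ?_⟩
  have ha1 := H.mem_unit ha
  obtain ⟨h, hm, hn, h0, hint, hinv, -⟩ := H.exists_invariant_density ha
    (memGBV_unitFn F.α_pos F.α_le_one H.A_pos) unitFn_nonneg
  rw [integral_unitFn] at hint
  have hμ := ((F.acip a ha1 _).1 (F.isAcip_of_density ha1 hm.1 h0 hint hinv)).symm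
  have e := F.density_ae_eq ha1 hm.1 h0 hμ
  have hl1 : l1 h = 1 := by
    rw [← hint, l1]
    refine integral_congr_ae ?_
    filter_upwards [h0] with x hx using abs_of_nonneg hx
  have hmd := hm.congr e
  have h1 : F.transfer a (F.density a) =ᵐ[leb] F.density a := by
    have h2 := F.iterate_transfer_congr ha1 hm.1 e 1
    exact h2.symm.trans (hinv.trans e)
  refine ⟨hmd, by rw [← nrm_congr e]; linarith, by rw [← integral_congr_ae e, hint], fun n => ?_⟩
  induction n with
  | zero => rfl
  | succ n ih =>
    rw [Function.iterate_succ_apply']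
    have := F.iterate_transfer_congr ha1 (F.integrable_iterate_transfer ha1 hmd.1 n) ih 1
    exact this.trans h1

end LasotaYorke

namespace SpectralGap

variable {A ε C r D ρ : ℝ} (H : F.SpectralGap A ε C r D ρ)
include H

lemma D_pos : 0 < D := zero_lt_one.trans_le H.one_le_D

/-- Exponential decay of correlations. -/
lemma uniformDecay : F.UniformDecay A ε ρ := by
  obtain ⟨R, hR, hden⟩ := H.exists_density_bound
  have hA := H.A_pos
  have hα := F.α_pos
  have hS := supConst_pos hA
  have hD := H.D_pos
  refine ⟨max 1 (supConst A * D * (1 + R)), le_max_left _ _, ?_⟩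
  intro a ha f ψ hf hψ n _
  have ha1 := H.mem_unit ha
  obtain ⟨hdm, hdR, hd1, hdinv⟩ := hden a ha
  set I := ∫ x in Icc (0 : ℝ) 1, f x with hI
  have hIf : |I| ≤ nrm α A f := (abs_setIntegral_le_l1 hf.1 Subset.rfl).trans (l1_le_nrm hf)
  have hIi : Integrable ψ leb := hψ
  have hψn := F.integrable_comp_iterate ha1 hψ n
  have hint : IntegrableOn (fun x => f x * ψ ((F.T a)^[n] x)) (Icc 0 1) := by
    have := Integrable.bdd_mul (c := supConst A * nrm α A f) hψn hf.1.aestronglyMeasurable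
      (hf.ae_abs_le hA hα.le)
    exact this
  obtain ⟨hi1, he1⟩ := F.iterate_dual ha1 n hint
  obtain ⟨hum, hun⟩ := hf.lin hdm 1 (-I)
  set u : ℝ → ℝ := fun x => 1 * f x + -I * F.density a x with hu
  have hu0 : ∫ x in Icc (0 : ℝ) 1, u x = 0 := by
    have e := integral_add (Integrable.const_mul hf.1 1) (Integrable.const_mul hdm.1 (-I))
    rw [integral_const_mul, integral_const_mul, hd1] at e
    rw [hu, e]; ring
  have hgap := H.gap a ha u hum hu0 n
  have hmem := H.mem ha hum n
  have hbd := hmem.ae_abs_le hA hα.le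
  have hi2 : IntegrableOn (fun x => F.density a x * ψ x) (Icc 0 1) := by
    have := Integrable.bdd_mul (c := supConst A * nrm α A (F.density a)) hψ
      hdm.1.aestronglyMeasurable (hdm.ae_abs_le hA hα.le)
    exact this
  have heq : (∫ x in Icc (0 : ℝ) 1, f x * ψ ((F.T a)^[n] x)) - I * ∫ x, ψ x ∂(F.μ a) =
      ∫ x in Icc (0 : ℝ) 1, ψ x * (F.transfer a)^[n] u x := by
    rw [F.integral_μ ha1, ← he1, ← integral_const_mul,
      ← integral_sub hi1 (Integrable.const_mul hi2 I)]
    refine integral_congr_ae ?_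
    filter_upwards [hdinv n] with x hx
    rw [hu, F.iterate_transfer_lin ha1]
    simp only [hx]; ring
  rw [heq]
  refine (abs_integral_mul_le hψ hbd).trans ?_
  rw [l1Norm_eq hψ, ENNReal.toReal_ofReal (l1_nonneg ψ)]
  have hfn := nrm_nonneg (α := α) (A := A) f
  have h1 : nrm α A u ≤ (1 + R) * nrm α A f := by
    refine hun.trans ?_
    rw [abs_one, abs_neg]
    have : |I| * nrm α A (F.density a) ≤ nrm α A f * R :=
      mul_le_mul hIf hdR (nrm_nonneg _) hfn
    linarith
  have hl := l1_nonneg ψ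
  have hρ := H.ρ_pos
  calc supConst A * nrm α A ((F.transfer a)^[n] u) * l1 ψ
      ≤ supConst A * (D * ρ ^ n * ((1 + R) * nrm α A f)) * l1 ψ := by
        gcongr
        exact hgap.trans (by gcongr)
    _ = supConst A * D * (1 + R) * nrm α A f * l1 ψ * ρ ^ n := by ring
    _ ≤ max 1 (supConst A * D * (1 + R)) * nrm α A f * l1 ψ * ρ ^ n := by
        gcongr
        exact le_max_right _ _

/-- Hölder dependence of the invariant density on the parameter. -/
lemma exists_l1_density_sub_le : ∃ c > 0, ∀ a ∈ Icc 0 ε, ∀ a' ∈ Icc 0 ε,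
    l1 (fun x => F.density a x - F.density a' x) ≤ c * |a - a'| ^ (α / 4) := by
  obtain ⟨R, hR, hden⟩ := H.exists_density_bound
  obtain ⟨D', hD', hDle⟩ := H.exists_l1_iterate_sub_le
  have hD := H.D_pos
  have hρ := H.ρ_pos
  obtain ⟨c, hc, hcle⟩ := exists_bound_of_exp_poly H.ρ_pos H.ρ_lt_one (half_pos F.α_pos)
  refine ⟨(2 * D * R + D' * R) * c, by positivity, fun a ha a' ha' => ?_⟩
  have ha1 := H.mem_unit ha
  have ha1' := H.mem_unit ha'
  have hs : |a - a'| ∈ Icc (0 : ℝ) 1 :=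
    ⟨abs_nonneg _, abs_le.2 ⟨by linarith [ha1.1, ha1'.2], by linarith [ha1.2, ha1'.1]⟩⟩
  obtain ⟨hm, hn, h1, hinv⟩ := hden a ha
  obtain ⟨hm', hn', h1', hinv'⟩ := hden a' ha'
  have e4 : α / 4 = α / 2 / 2 := by ring
  rw [mul_assoc, e4]
  refine hcle _ hs _ _ (by positivity) fun n hn1 => ?_
  have hgap := H.gap a ha _ (hm.sub hm')
    (by rw [integral_sub hm.1 hm'.1, h1, h1', sub_self]) n
  have hpert := hDle a ha a' ha' _ hm' n
  have hLm := H.mem ha (hm.sub hm') n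
  have hi1 := F.integrable_iterate_transfer ha1 hm'.1 n
  have hi2 := F.integrable_iterate_transfer ha1' hm'.1 n
  have e : (fun x => F.density a x - F.density a' x) =ᵐ[leb] fun x =>
      (F.transfer a)^[n] (fun x => F.density a x - F.density a' x) x +
        ((F.transfer a)^[n] (F.density a') x - (F.transfer a')^[n] (F.density a') x) := by
    filter_upwards [hinv n, hinv' n] with x h2 h3
    rw [F.iterate_transfer_sub ha1]
    simp only [h2, h3]; ring
  rw [l1_congr e]
  have h4 := (l1_le_nrm hLm).trans hgap
  have hdn := nrm_nonneg (α := α) (A := A) (F.density a')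
  refine (l1_add_le hLm.1 (Integrable.sub hi1 hi2)).trans ((add_le_add h4 hpert).trans ?_)
  have h5 := nrm_sub_le hm hm'
  have hs0 : 0 ≤ |a - a'| ^ (α / 2) := by positivity
  have hn1' : (1 : ℝ) ≤ n := by exact_mod_cast hn1
  have h6 : (n : ℝ) * (D' * |a - a'| ^ (α / 2) * nrm α A (F.density a')) ≤
      n ^ 2 * (D' * |a - a'| ^ (α / 2) * R) := by
    gcongr
    nlinarith
  have h7 : D * ρ ^ n * nrm α A (fun x => F.density a x - F.density a' x) ≤
      D * ρ ^ n * (2 * R) := by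
    gcongr; linarith
  have h8 : 0 ≤ 2 * D * R * (n ^ 2 * |a - a'| ^ (α / 2)) := by positivity
  have h9 : 0 ≤ D' * R * ρ ^ n := by positivity
  linarith

end SpectralGap

end ExpandingFamily

lemma l1_mul_le {f ψ : ℝ → ℝ} {c : ℝ} (hf : IntegrableOn f (Icc 0 1))
    (hψ : AEStronglyMeasurable ψ leb) (hc : ∀ᵐ x ∂leb, |ψ x| ≤ c) :
    l1 (fun x => f x * ψ x) ≤ c * l1 f := by
  rw [l1, l1, ← integral_const_mul]
  refine integral_mono_ae (Integrable.mul_bdd (c := c) hf hψ hc).abs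
    (Integrable.const_mul (Integrable.abs hf) c) ?_
  filter_upwards [hc] with x hx
  rw [abs_mul, mul_comm]
  exact mul_le_mul_of_nonneg_right hx (abs_nonneg _)

namespace ExpandingFamily

variable {α lam Lam : ℝ} {p₀ p₁ : ℕ} {F : ExpandingFamily α lam Lam p₀ p₁} {a : ℝ}

/-- The observable `φ` centred with respect to `μ_a`. -/
noncomputable def ctr (F : ExpandingFamily α lam Lam p₀ p₁) (φ : ℝ → ℝ) (a x : ℝ) : ℝ :=
  φ x - F.mean φ a

/-- The autocovariances of `φ` with respect to `μ_a`. -/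
noncomputable def cov (F : ExpandingFamily α lam Lam p₀ p₁) (φ : ℝ → ℝ) (i : ℕ) (a : ℝ) : ℝ :=
  ∫ x, F.ctr φ a x * F.ctr φ a ((F.T a)^[i] x) ∂(F.μ a)

lemma sigma_eq (φ : ℝ → ℝ) (a : ℝ) :
    F.sigma φ a = √(F.cov φ 0 a + 2 * ∑' i : ℕ, F.cov φ (i + 1) a) := by
  simp only [sigma, cov, ctr, Function.iterate_zero, id, sq]

lemma ae_abs_ctr_le (ha : a ∈ Icc (0 : ℝ) 1) {φ : ℝ → ℝ} {M : ℝ}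
    (hM : ∀ᵐ x ∂leb, |φ x| ≤ M) : ∀ᵐ x ∂leb, |F.ctr φ a x| ≤ 2 * M := by
  have h := F.abs_mean_le ha hM
  filter_upwards [hM] with x hx
  rw [ctr]
  linarith [abs_sub (φ x) (F.mean φ a)]

namespace SpectralGap

variable {A ε C r D ρ : ℝ} (H : F.SpectralGap A ε C r D ρ)
include H

/-- Exponential decay and parameter dependence of means and autocovariances. -/
lemma exists_cov_bound {φ : ℝ → ℝ} (hφ : MemGBV α A φ) : ∃ K > 0,
    (∀ a ∈ Icc 0 ε, ∀ i, |F.cov φ i a| ≤ K * ρ ^ i) ∧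
    ∀ a ∈ Icc 0 ε, ∀ a' ∈ Icc 0 ε,
      |F.mean φ a - F.mean φ a'| ≤ K * |a - a'| ^ (α / 4) ∧
      ∀ i : ℕ, |F.cov φ i a - F.cov φ i a'| ≤ K * (i + 1) * |a - a'| ^ (α / 4) := by
  obtain ⟨R, hR, hden⟩ := H.exists_density_bound
  obtain ⟨D', hD', hDle⟩ := H.exists_l1_iterate_sub_le
  obtain ⟨c, hc, hcle⟩ := H.exists_l1_density_sub_le
  have hα := F.α_pos
  have hα1 := F.α_le_one
  have hA := H.A_pos
  have hS := supConst_pos hA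
  have hD := H.D_pos
  have hρ := H.ρ_pos
  have hφn := nrm_nonneg (α := α) (A := A) φ
  have hun := nrm_nonneg (α := α) (A := A) unitFn
  set M := supConst A * nrm α A φ with hMdef
  have hM0 : 0 ≤ M := by positivity
  have hM : ∀ᵐ x ∂leb, |φ x| ≤ M := hφ.ae_abs_le hA hα.le
  set U := 2 * M * R + supConst A * R * (nrm α A φ + M * nrm α A unitFn) with hU
  have hU0 : 0 ≤ U := by positivity
  have hctr : ∀ a ∈ Icc 0 ε, MemGBV α A (F.ctr φ a) ∧
      nrm α A (F.ctr φ a) ≤ nrm α A φ + M * nrm α A unitFn := by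
    intro a ha
    have h1 := hφ.sub_const hα hα1 hA (F.mean φ a)
    refine ⟨h1.1, h1.2.trans ?_⟩
    have := F.abs_mean_le (H.mem_unit ha) hM
    gcongr
  set u : ℝ → ℝ → ℝ := fun a x => F.density a x * F.ctr φ a x with hudef
  have hu : ∀ a ∈ Icc 0 ε, MemGBV α A (u a) ∧ nrm α A (u a) ≤ U ∧
      ∫ x in Icc (0 : ℝ) 1, u a x = 0 := by
    intro a ha
    have ha1 := H.mem_unit ha
    obtain ⟨hm, hn, h1, -⟩ := hden a ha
    obtain ⟨hcm, hcn⟩ := hctr a ha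
    have hdn := nrm_nonneg (α := α) (A := A) (F.density a)
    have hcnn := nrm_nonneg (α := α) (A := A) (F.ctr φ a)
    have h2 := hm.mul_bdd hcm (c := 2 * M) (d := supConst A * nrm α A (F.density a))
      (by positivity) (by positivity) (F.ae_abs_ctr_le ha1 hM) (hm.ae_abs_le hA hα.le)
    refine ⟨h2.1, h2.2.trans ?_, ?_⟩
    · rw [hU]; gcongr
    · have hi : IntegrableOn (fun x => F.density a x * φ x) (Icc 0 1) :=
        Integrable.mul_bdd (c := M) hm.1 hφ.1.aestronglyMeasurable hM
      have e : u a = fun x => F.density a x * φ x - F.mean φ a * F.density a x := by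
        funext x; simp only [hudef, ctr]; ring
      rw [e, integral_sub hi (Integrable.const_mul hm.1 _), integral_const_mul, h1,
        ← F.integral_μ ha1, mean]
      ring
  have hcov : ∀ a ∈ Icc 0 ε, ∀ i, F.cov φ i a =
      ∫ x in Icc (0 : ℝ) 1, (F.transfer a)^[i] (u a) x * F.ctr φ a x := by
    intro a ha i
    have ha1 := H.mem_unit ha
    rw [F.iterate_dual_of_bdd ha1 i (hu a ha).1.1 (hctr a ha).1.1.aestronglyMeasurable
      (F.ae_abs_ctr_le ha1 hM), cov, F.integral_μ ha1]
    congr 1; funext x; simp only [hudef]; ring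
  have hmean : ∀ a ∈ Icc 0 ε, ∀ a' ∈ Icc 0 ε,
      |F.mean φ a - F.mean φ a'| ≤ M * (c * |a - a'| ^ (α / 4)) := by
    intro a ha a' ha'
    obtain ⟨hm, -⟩ := hden a ha
    obtain ⟨hm', -⟩ := hden a' ha'
    have e : F.mean φ a - F.mean φ a' =
        ∫ x in Icc (0 : ℝ) 1, (F.density a x - F.density a' x) * φ x := by
      rw [mean, mean, F.integral_μ (H.mem_unit ha), F.integral_μ (H.mem_unit ha'),
        ← integral_sub (Integrable.mul_bdd (c := M) hm.1 hφ.1.aestronglyMeasurable hM)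
          (Integrable.mul_bdd (c := M) hm'.1 hφ.1.aestronglyMeasurable hM)]
      congr 1; funext x; ring
    rw [e]
    exact (abs_integral_mul_le (hm.sub hm').1 hM).trans
      (mul_le_mul_of_nonneg_left (hcle a ha a' ha') hM0)
  have hud : ∀ a ∈ Icc 0 ε, ∀ a' ∈ Icc 0 ε,
      l1 (fun x => u a x - u a' x) ≤ 3 * M * c * |a - a'| ^ (α / 4) := by
    intro a ha a' ha'
    obtain ⟨hm, -, -, -⟩ := hden a ha
    obtain ⟨hm', -, h1', -⟩ := hden a' ha'
    have hcb := F.ae_abs_ctr_le (H.mem_unit ha) hM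
    have hcm := (hctr a ha).1.1.aestronglyMeasurable
    have e : (fun x => u a x - u a' x) = fun x =>
        (F.density a x - F.density a' x) * F.ctr φ a x +
          F.density a' x * (F.mean φ a' - F.mean φ a) := by
      funext x; simp only [hudef, ctr]; ring
    rw [e]
    have hi1 : IntegrableOn (fun x => (F.density a x - F.density a' x) * F.ctr φ a x) (Icc 0 1) :=
      Integrable.mul_bdd (c := 2 * M) (hm.sub hm').1 hcm hcb
    refine (l1_add_le hi1 (Integrable.mul_const hm'.1 _)).trans ?_
    have h2 := (l1_mul_le (hm.sub hm').1 hcm hcb).trans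
      (mul_le_mul_of_nonneg_left (hcle a ha a' ha') (by positivity : 0 ≤ 2 * M))
    have h3 : l1 (fun x => F.density a' x * (F.mean φ a' - F.mean φ a)) =
        |F.mean φ a - F.mean φ a'| := by
      rw [l1]
      simp only [abs_mul, abs_of_nonneg (F.density_nonneg a' _)]
      rw [integral_mul_const, h1', one_mul, abs_sub_comm]
    rw [h3]
    have h4 := hmean a ha a' ha'
    linarith
  refine ⟨2 * M * D * U + 2 * M * (3 * M * c + D' * U) + M * c + 1, by positivity, ?_, ?_⟩
  · intro a ha i
    obtain ⟨hum, hun, hu0⟩ := hu a ha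
    have hgap := H.gap a ha _ hum hu0 i
    rw [hcov a ha]
    have h1 := abs_integral_mul_le (H.mem ha hum i).1 (F.ae_abs_ctr_le (H.mem_unit ha) hM)
    have h2 : l1 ((F.transfer a)^[i] (u a)) ≤ D * ρ ^ i * U :=
      (l1_le_nrm (H.mem ha hum i)).trans (hgap.trans (by gcongr))
    calc _ ≤ 2 * M * (D * ρ ^ i * U) := h1.trans (by gcongr)
      _ = 2 * M * D * U * ρ ^ i := by ring
      _ ≤ _ := by
        gcongr
        have : 0 ≤ 2 * M * (3 * M * c + D' * U) + M * c := by positivity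
        linarith
  · intro a ha a' ha'
    have ha1 := H.mem_unit ha
    have ha1' := H.mem_unit ha'
    set s := |a - a'| with hs
    have hs1 : s ≤ 1 := abs_le.2 ⟨by linarith [ha1.1, ha1'.2], by linarith [ha1.2, ha1'.1]⟩
    have hs0 : 0 ≤ s := abs_nonneg _
    have hsp : 0 ≤ s ^ (α / 4) := by positivity
    constructor
    · refine (hmean a ha a' ha').trans ?_
      rw [← mul_assoc]
      gcongr
      have : 0 ≤ 2 * M * D * U + 2 * M * (3 * M * c + D' * U) := by positivity
      linarith
    intro i
    obtain ⟨hum, hun, hu0⟩ := hu a ha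
    obtain ⟨hum', hun', hu0'⟩ := hu a' ha'
    have hLm := H.mem ha hum i
    have hLm' := H.mem ha' hum' i
    have hcm := (hctr a ha).1.1.aestronglyMeasurable
    have hcb := F.ae_abs_ctr_le ha1 hM
    have hcm' := (hctr a' ha').1.1.aestronglyMeasurable
    have hcb' := F.ae_abs_ctr_le ha1' hM
    have hint0 : ∫ x in Icc (0 : ℝ) 1, (F.transfer a')^[i] (u a') x = 0 := by
      rw [F.integral_iterate_transfer ha1' hum'.1, hu0']
    have e : F.cov φ i a - F.cov φ i a' = ∫ x in Icc (0 : ℝ) 1,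
        ((F.transfer a)^[i] (u a) x - (F.transfer a')^[i] (u a') x) * F.ctr φ a x := by
      have e1 : ∫ x in Icc (0 : ℝ) 1, (F.transfer a')^[i] (u a') x * F.ctr φ a' x =
          ∫ x in Icc (0 : ℝ) 1, (F.transfer a')^[i] (u a') x * F.ctr φ a x := by
        have e2 : (fun x => (F.transfer a')^[i] (u a') x * F.ctr φ a' x) = fun x =>
            (F.transfer a')^[i] (u a') x * F.ctr φ a x +
              (F.transfer a')^[i] (u a') x * (F.mean φ a - F.mean φ a') := by
          funext x; simp only [ctr]; ring
        rw [e2, integral_add (Integrable.mul_bdd (c := 2 * M) hLm'.1 hcm hcb)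
          (Integrable.mul_const hLm'.1 _), integral_mul_const, hint0, zero_mul, add_zero]
      rw [hcov a ha, hcov a' ha', e1,
        ← integral_sub (Integrable.mul_bdd (c := 2 * M) hLm.1 hcm hcb)
          (Integrable.mul_bdd (c := 2 * M) hLm'.1 hcm hcb)]
      congr 1; funext x; ring
    have hl : l1 (fun x => (F.transfer a)^[i] (u a) x - (F.transfer a')^[i] (u a') x) ≤
        (3 * M * c + i * (D' * U)) * s ^ (α / 4) := by
      have e3 : (fun x => (F.transfer a)^[i] (u a) x - (F.transfer a')^[i] (u a') x) = fun x =>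
          (F.transfer a)^[i] (fun x => u a x - u a' x) x +
            ((F.transfer a)^[i] (u a') x - (F.transfer a')^[i] (u a') x) := by
        funext x; rw [F.iterate_transfer_sub ha1]; ring
      rw [e3]
      have h1 := (F.l1_iterate_transfer_le ha1 (hum.sub hum').1 i).trans (hud a ha a' ha')
      have h2 := hDle a ha a' ha' _ hum' i
      refine (l1_add_le (H.mem ha (hum.sub hum') i).1
        (Integrable.sub (H.mem ha hum' i).1 hLm'.1)).trans ((add_le_add h1 h2).trans ?_)
      have h3 : s ^ (α / 2) ≤ s ^ (α / 4) :=
        Real.rpow_le_rpow_of_exponent_ge' hs0 hs1 (by positivity) (by linarith)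
      have h4 : (i : ℝ) * (D' * s ^ (α / 2) * nrm α A (u a')) ≤ i * (D' * s ^ (α / 4) * U) := by
        have := nrm_nonneg (α := α) (A := A) (u a')
        gcongr
      linarith
    rw [e]
    refine (abs_integral_mul_le (hLm.sub hLm').1 hcb).trans ?_
    have h5 := mul_le_mul_of_nonneg_left hl (by positivity : 0 ≤ 2 * M)
    refine h5.trans ?_
    rw [← mul_assoc]
    refine mul_le_mul_of_nonneg_right ?_ hsp
    have h6 : 0 ≤ 2 * M * (3 * M * c * i) := by positivity
    have h7 : 0 ≤ 2 * M * (D' * U) := by positivity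
    have h8 : 0 ≤ (2 * M * D * U + M * c + 1) * ((i : ℝ) + 1) := by positivity
    linarith

lemma summable_cov {φ : ℝ → ℝ} (hφ : MemGBV α A φ) (ha : a ∈ Icc 0 ε) (k : ℕ) :
    Summable fun i => |F.cov φ (i + k) a| := by
  obtain ⟨K, -, hK, -⟩ := H.exists_cov_bound hφ
  refine Summable.of_nonneg_of_le (fun _ => abs_nonneg _) (fun i => hK a ha (i + k)) ?_
  simp only [pow_add]
  exact ((summable_geometric_of_lt_one H.ρ_pos.le H.ρ_lt_one).mul_right _).mul_left _

/-- Hölder dependence of `σ_a(φ)` on the parameter. -/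
lemma exists_sigma_sub_le {φ : ℝ → ℝ} (hφ : MemGBV α A φ) :
    ∃ c : ℝ, 0 < c ∧ ∀ a ∈ Icc 0 ε, ∀ a' ∈ Icc 0 ε,
      |F.sigma φ a - F.sigma φ a'| ≤ c * |a - a'| ^ (α / 16) := by
  obtain ⟨K, hK0, hK, hK'⟩ := H.exists_cov_bound hφ
  have hρ := H.ρ_pos
  have hρ1 := H.ρ_lt_one
  have h1ρ : 0 < 1 - ρ := by linarith
  obtain ⟨c, hc, hcle⟩ := exists_bound_of_exp_poly H.ρ_pos H.ρ_lt_one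
    (by linarith [F.α_pos] : 0 < α / 4)
  set E := 5 * K + 4 * K / (1 - ρ) with hE
  have hE0 : 0 < E := by positivity
  refine ⟨√(E * c), by positivity, fun a ha a' ha' => ?_⟩
  have ha1 := H.mem_unit ha
  have ha1' := H.mem_unit ha'
  have hs : |a - a'| ∈ Icc (0 : ℝ) 1 :=
    ⟨abs_nonneg _, abs_le.2 ⟨by linarith [ha1.1, ha1'.2], by linarith [ha1.2, ha1'.1]⟩⟩
  rw [sigma_eq, sigma_eq]
  refine (abs_sqrt_sub_sqrt_le _ _).trans ?_
  have e16 : |a - a'| ^ (α / 16) = √(|a - a'| ^ (α / 4 / 2)) := by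
    rw [Real.sqrt_eq_rpow, ← Real.rpow_mul hs.1]; congr 1; ring
  rw [e16, ← Real.sqrt_mul (by positivity)]
  refine Real.sqrt_le_sqrt ?_
  rw [mul_assoc]
  refine hcle _ hs _ _ hE0.le fun n hn => ?_
  set s := |a - a'| ^ (α / 4) with hsdef
  have hs0 : 0 ≤ s := by have := hs.1; positivity
  have hsum := H.summable_cov hφ ha 1
  have hsum' := H.summable_cov hφ ha' 1
  have htail : ∀ a ∈ Icc 0 ε, |∑' i, F.cov φ (i + n + 1) a| ≤ K / (1 - ρ) * ρ ^ n := by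
    intro a ha
    have h1 : Summable fun i => |F.cov φ (i + n + 1) a| := H.summable_cov hφ ha (n + 1)
    have h2 := norm_tsum_le_tsum_norm (f := fun i => F.cov φ (i + n + 1) a) h1
    refine h2.trans ?_
    have h3 : ∀ i, |F.cov φ (i + n + 1) a| ≤ ρ ^ i * (K * ρ ^ n) := by
      intro i
      refine (hK a ha _).trans ?_
      calc K * ρ ^ (i + n + 1) ≤ K * ρ ^ (i + n) := by
            gcongr ?_ * ?_
            exact pow_le_pow_of_le_one hρ.le hρ1.le (Nat.le_succ _)
        _ = _ := by rw [pow_add]; ring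
    refine (h1.tsum_le_tsum h3
      ((summable_geometric_of_lt_one hρ.le hρ1).mul_right _)).trans ?_
    rw [tsum_mul_right, tsum_geometric_of_lt_one hρ.le hρ1]
    apply le_of_eq; ring
  have hhead : |(∑ i ∈ Finset.range n, F.cov φ (i + 1) a) -
      ∑ i ∈ Finset.range n, F.cov φ (i + 1) a'| ≤ 2 * K * n ^ 2 * s := by
    rw [← Finset.sum_sub_distrib]
    refine (Finset.abs_sum_le_sum_abs _ _).trans ?_
    have h1 : ∀ i ∈ Finset.range n, |F.cov φ (i + 1) a - F.cov φ (i + 1) a'| ≤ K * (2 * n) * s := by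
      intro i hi
      refine ((hK' a ha a' ha').2 (i + 1)).trans ?_
      have h2 : (i : ℝ) + 1 ≤ n := by
        have := Finset.mem_range.1 hi
        exact_mod_cast this
      have h3 : (1 : ℝ) ≤ n := by exact_mod_cast hn
      gcongr
      push_cast; linarith
    refine (Finset.sum_le_sum h1).trans (le_of_eq ?_)
    rw [Finset.sum_const, Finset.card_range, nsmul_eq_mul]; ring
  have hsplit : ∀ a ∈ Icc 0 ε, ∑' i, F.cov φ (i + 1) a =
      (∑ i ∈ Finset.range n, F.cov φ (i + 1) a) + ∑' i, F.cov φ (i + n + 1) a := fun a ha =>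
    (Summable.sum_add_tsum_nat_add n (Summable.of_abs (H.summable_cov hφ ha 1))).symm
  rw [hsplit a ha, hsplit a' ha']
  have h0 := (hK' a ha a' ha').2 0
  have ht := htail a ha
  have ht' := htail a' ha'
  have hn2 : (1 : ℝ) ≤ n ^ 2 := one_le_pow₀ (by exact_mod_cast hn)
  have h0' : |F.cov φ 0 a - F.cov φ 0 a'| ≤ K * n ^ 2 * s := by
    refine h0.trans ?_
    rw [Nat.cast_zero, zero_add]
    gcongr
  have hE1 : E * (ρ ^ n + n ^ 2 * s) = 5 * K * ρ ^ n + 4 * (K / (1 - ρ) * ρ ^ n) +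
      5 * K * n ^ 2 * s + 4 * (K / (1 - ρ)) * (n ^ 2 * s) := by rw [hE]; ring
  rw [hE1]
  have p1 : 0 ≤ 5 * K * ρ ^ n := by positivity
  have p2 : 0 ≤ 4 * (K / (1 - ρ)) * (n ^ 2 * s) := by positivity
  rw [abs_le] at h0' hhead ht ht' ⊢
  constructor <;> linarith

lemma exists_admissibleRates {φ : ℝ → ℝ} (hφ : MemGBV α A φ) :
    ∃ κ, F.AdmissibleRates A φ ε ρ κ := by
  obtain ⟨c, hc, hcle⟩ := H.exists_l1_density_sub_le
  obtain ⟨c', -, hcle'⟩ := H.exists_sigma_sub_le hφ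
  have hα := F.α_pos
  refine ⟨α / 16, H.ρ_pos, H.ρ_lt_one, by positivity, H.uniformDecay, ⟨c, fun a ha => ?_⟩,
    ⟨c', hcle'⟩⟩
  refine (hcle 0 H.zero_mem a ha).trans ?_
  rw [zero_sub, abs_neg, abs_of_nonneg ha.1]
  have := Real.rpow_le_rpow_of_exponent_ge' ha.1 (ha.2.trans H.ε_le_one)
    (by positivity : 0 ≤ α / 16) (by linarith : α / 16 ≤ α / 4)
  gcongr

lemma mono {ε' : ℝ} (h0 : 0 < ε') (h : ε' ≤ ε) : F.SpectralGap A ε' C r D ρ :=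
  ⟨H.toLasotaYorke.mono h0 h, H.one_le_D, H.ρ_pos, H.ρ_lt_one,
    fun a ha => H.gap a ⟨ha.1, ha.2.trans h⟩⟩

/-- `σ_a(φ)` stays away from zero for small `a`. -/
lemma exists_sigma_ge {φ : ℝ → ℝ} (hφ : MemGBV α A φ) (hσ : 0 < F.sigma φ 0) :
    ∃ ε' > 0, ε' ≤ ε ∧ ∀ a ∈ Icc 0 ε', F.sigma φ 0 / 2 ≤ F.sigma φ a := by
  obtain ⟨c, hc, hcle⟩ := H.exists_sigma_sub_le hφ
  obtain ⟨δ, hδ, hδs⟩ := exists_scale (α := α / 16) (R := c) (by linarith [F.α_pos]) H.ε_pos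
    (half_pos hσ)
  refine ⟨δ, hδ.1, hδ.2, fun a ha => ?_⟩
  have h1 := hcle 0 H.zero_mem a ⟨ha.1, ha.2.trans hδ.2⟩
  rw [zero_sub, abs_neg, abs_of_nonneg ha.1] at h1
  have h2 : a ^ (α / 16) ≤ δ ^ (α / 16) := Real.rpow_le_rpow ha.1 ha.2 (by linarith [F.α_pos])
  have h3 := mul_le_mul_of_nonneg_left h2 hc.le
  have h4 := (abs_le.1 h1).2
  linarith

end SpectralGap

end ExpandingFamily

namespace ExpandingFamily

variable {α lam Lam : ℝ} {p₀ p₁ : ℕ} {F : ExpandingFamily α lam Lam p₀ p₁} {a : ℝ}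
  {x₀ : ℝ → ℝ}

lemma orbit_succ (x₀ : ℝ → ℝ) (j : ℕ) (a : ℝ) :
    F.orbit x₀ (j + 1) a = F.T a (F.orbit x₀ j a) := Function.iterate_succ_apply' _ _ _

/-- The parameters for which the orbit avoids the partition points up to time `v`. -/
def free (F : ExpandingFamily α lam Lam p₀ p₁) (x₀ : ℝ → ℝ) (v : ℕ) : Set ℝ :=
  {a | ∀ i < v, F.orbit x₀ i a ∉ F.pts a}

lemma free_anti {v w : ℕ} (h : v ≤ w) : F.free x₀ w ⊆ F.free x₀ v :=
  fun _ ha i hi => ha i (hi.trans_le h)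

/-- The modulus of the space derivative of `T_a^j` along the orbit. -/
noncomputable def spaceDeriv (F : ExpandingFamily α lam Lam p₀ p₁) (x₀ : ℝ → ℝ) (j : ℕ) (a : ℝ) :
    ℝ := ∏ i ∈ Finset.range j, |deriv (F.T a) (F.orbit x₀ i a)|

lemma spaceDeriv_succ (j : ℕ) (a : ℝ) : F.spaceDeriv x₀ (j + 1) a =
    F.spaceDeriv x₀ j a * |deriv (F.T a) (F.orbit x₀ j a)| := Finset.prod_range_succ _ _

namespace IsStartingPoint

variable (hx₀ : F.IsStartingPoint x₀)
include hx₀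

lemma orbit_mem (ha : a ∈ Icc (0 : ℝ) 1) (j : ℕ) : F.orbit x₀ j a ∈ Icc (0 : ℝ) 1 :=
  (F.mapsTo a ha).iterate j (hx₀.mapsTo ha)

lemma exists_branch (ha : a ∈ Icc (0 : ℝ) 1) {j : ℕ} (hf : a ∈ F.free x₀ (j + 1)) :
    ∃ k < p₀, F.orbit x₀ j a ∈ F.branch k a :=
  F.exists_mem_branch ha (hx₀.orbit_mem ha j) (hf j (Nat.lt_succ_self j))

lemma deriv_bounds (ha : a ∈ Icc (0 : ℝ) 1) {j : ℕ} (hf : a ∈ F.free x₀ (j + 1)) :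
    lam ≤ |deriv (F.T a) (F.orbit x₀ j a)| ∧ |deriv (F.T a) (F.orbit x₀ j a)| ≤ Lam := by
  obtain ⟨k, hk, h⟩ := hx₀.exists_branch ha hf
  exact F.expanding a ha k hk _ h

lemma differentiableAt_orbit (ha : a ∈ Ioo (0 : ℝ) 1) {j : ℕ} (hf : a ∈ F.free x₀ j) :
    DifferentiableAt ℝ (F.orbit x₀ j) a := by
  induction j with
  | zero => exact hx₀.differentiable.differentiableAt (Icc_mem_nhds ha.1 ha.2)
  | succ j ih =>
    obtain ⟨k, hk, h⟩ := hx₀.exists_branch (Ioo_subset_Icc_self ha) hf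
    have h1 := F.hasDerivAt_comp_param ha hk (ih (free_anti (Nat.le_succ j) hf)).hasDerivAt h
    have e : F.orbit x₀ (j + 1) = fun t => F.T t (F.orbit x₀ j t) :=
      funext fun t => orbit_succ x₀ j t
    rw [e]
    exact h1.differentiableAt

lemma deriv_orbit_succ (ha : a ∈ Ioo (0 : ℝ) 1) {j : ℕ} (hf : a ∈ F.free x₀ (j + 1)) :
    deriv (F.orbit x₀ (j + 1)) a = F.pd (F.orbit x₀ j a) a +
      deriv (F.T a) (F.orbit x₀ j a) * deriv (F.orbit x₀ j) a := by
  obtain ⟨k, hk, h⟩ := hx₀.exists_branch (Ioo_subset_Icc_self ha) hf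
  have h1 := F.hasDerivAt_comp_param ha hk
    (hx₀.differentiableAt_orbit ha (free_anti (Nat.le_succ j) hf)).hasDerivAt h
  have e : F.orbit x₀ (j + 1) = fun t => F.T t (F.orbit x₀ j t) :=
    funext fun t => orbit_succ x₀ j t
  rw [e]
  exact h1.deriv

lemma abs_pd_le {B : ℝ} (hB : ∀ a ∈ Icc (0 : ℝ) 1, ∀ k < p₀, ∀ x ∈ F.branch k a, |F.pd x a| ≤ B)
    (ha : a ∈ Icc (0 : ℝ) 1) {j : ℕ} (hf : a ∈ F.free x₀ (j + 1)) :
    |F.pd (F.orbit x₀ j a) a| ≤ B := by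
  obtain ⟨k, hk, h⟩ := hx₀.exists_branch ha hf
  exact hB a ha k hk _ h

lemma hasDerivAt_iterate (ha : a ∈ Icc (0 : ℝ) 1) {j : ℕ} (hf : a ∈ F.free x₀ j) :
    HasDerivAt ((F.T a)^[j]) (∏ i ∈ Finset.range j, deriv (F.T a) (F.orbit x₀ i a)) (x₀ a) := by
  induction j with
  | zero => simpa using hasDerivAt_id (x₀ a)
  | succ j ih =>
    obtain ⟨k, hk, h⟩ := hx₀.exists_branch ha hf
    rw [Finset.prod_range_succ, mul_comm, Function.iterate_succ']
    exact (F.hasDerivAt_T ha hk h).comp (x₀ a) (ih (free_anti (Nat.le_succ j) hf))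

lemma abs_deriv_iterate (ha : a ∈ Icc (0 : ℝ) 1) {j : ℕ} (hf : a ∈ F.free x₀ j) :
    |deriv ((F.T a)^[j]) (x₀ a)| = F.spaceDeriv x₀ j a := by
  rw [(hx₀.hasDerivAt_iterate ha hf).deriv, Finset.abs_prod]
  rfl

lemma pow_mul_spaceDeriv_le (ha : a ∈ Icc (0 : ℝ) 1) {i j : ℕ} (hij : i ≤ j)
    (hf : a ∈ F.free x₀ j) :
    lam ^ (j - i) * F.spaceDeriv x₀ i a ≤ F.spaceDeriv x₀ j a := by
  induction j, hij using Nat.le_induction with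
  | base => simp
  | succ j hij ih =>
    have h1 := ih (free_anti (Nat.le_succ j) hf)
    have h2 := (hx₀.deriv_bounds ha hf).1
    have hlam := F.lam_pos
    rw [Nat.succ_sub hij, pow_succ, spaceDeriv_succ]
    have h3 : 0 ≤ lam ^ (j - i) * F.spaceDeriv x₀ i a :=
      mul_nonneg (by positivity) (Finset.prod_nonneg fun _ _ => abs_nonneg _)
    calc lam ^ (j - i) * lam * F.spaceDeriv x₀ i a
        = lam ^ (j - i) * F.spaceDeriv x₀ i a * lam := by ring
      _ ≤ _ := mul_le_mul h1 h2 hlam.le (h3.trans h1)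

lemma lam_pow_le_spaceDeriv (ha : a ∈ Icc (0 : ℝ) 1) {j : ℕ} (hf : a ∈ F.free x₀ j) :
    lam ^ j ≤ F.spaceDeriv x₀ j a := by
  have := hx₀.pow_mul_spaceDeriv_le ha (Nat.zero_le j) hf
  simpa [spaceDeriv] using this

lemma spaceDeriv_le (ha : a ∈ Icc (0 : ℝ) 1) {j : ℕ} (hf : a ∈ F.free x₀ j) :
    F.spaceDeriv x₀ j a ≤ Lam ^ j := by
  have h : ∀ i ∈ Finset.range j, |deriv (F.T a) (F.orbit x₀ i a)| ≤ Lam := fun i hi =>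
    (hx₀.deriv_bounds ha (free_anti (Finset.mem_range.1 hi) hf)).2
  calc F.spaceDeriv x₀ j a ≤ ∏ _i ∈ Finset.range j, Lam :=
        Finset.prod_le_prod (fun _ _ => abs_nonneg _) h
    _ = Lam ^ j := by simp

lemma exists_abs_derivWithin_le : ∃ X : ℝ, 0 < X ∧ ∀ a ∈ Ioo (0 : ℝ) 1, |deriv x₀ a| ≤ X := by
  obtain ⟨C, hC⟩ := hx₀.holder
  refine ⟨|derivWithin x₀ (Icc 0 1) 0| + |C| + 1, by positivity, fun a ha => ?_⟩
  have h1 : derivWithin x₀ (Icc 0 1) a = deriv x₀ a :=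
    derivWithin_of_mem_nhds (Icc_mem_nhds ha.1 ha.2)
  have h2 := hC a (Ioo_subset_Icc_self ha) 0 ⟨le_rfl, zero_le_one⟩
  rw [h1, sub_zero, abs_of_pos ha.1] at h2
  have h3 : a ^ α ≤ 1 := Real.rpow_le_one ha.1.le ha.2.le F.α_pos.le
  have h4 : C * a ^ α ≤ |C| := by
    calc C * a ^ α ≤ |C| * a ^ α :=
          mul_le_mul_of_nonneg_right (le_abs_self C) (Real.rpow_nonneg ha.1.le _)
      _ ≤ |C| * 1 := by gcongr
      _ = |C| := mul_one _
  have h5 := abs_sub_abs_le_abs_sub (deriv x₀ a) (derivWithin x₀ (Icc 0 1) 0)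
  linarith

/-- The parameter derivative is dominated by the space derivative. -/
lemma exists_abs_deriv_orbit_le : ∃ G : ℝ, 0 < G ∧ ∀ a ∈ Ioo (0 : ℝ) 1, ∀ j : ℕ,
    a ∈ F.free x₀ j → |deriv (F.orbit x₀ j) a| ≤ G * F.spaceDeriv x₀ j a := by
  obtain ⟨B, hB0, hB⟩ := F.exists_pd_bound
  obtain ⟨X, hX0, hX⟩ := hx₀.exists_abs_derivWithin_le
  have h1lam := F.one_lt_lam
  have hd : 0 < lam - 1 := by linarith
  refine ⟨X + B / (lam - 1), by positivity, fun a ha j hf => ?_⟩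
  suffices h : |deriv (F.orbit x₀ j) a| + B / (lam - 1) ≤
      (X + B / (lam - 1)) * F.spaceDeriv x₀ j a by
    have : 0 ≤ B / (lam - 1) := by positivity
    linarith
  induction j with
  | zero =>
    have : F.spaceDeriv x₀ 0 a = 1 := by simp [spaceDeriv]
    rw [this, mul_one]
    have := hX a ha
    gcongr
    exact this
  | succ j ih =>
    have ha1 := Ioo_subset_Icc_self ha
    have h1 := ih (free_anti (Nat.le_succ j) hf)
    have h2 := (hx₀.deriv_bounds ha1 hf).1
    have h3 := hx₀.abs_pd_le hB ha1 hf
    rw [hx₀.deriv_orbit_succ ha hf, spaceDeriv_succ, ← mul_assoc]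
    set q := |deriv (F.T a) (F.orbit x₀ j a)|
    have h4 := abs_add_le (F.pd (F.orbit x₀ j a) a)
      (deriv (F.T a) (F.orbit x₀ j a) * deriv (F.orbit x₀ j) a)
    rw [abs_mul] at h4
    have h5 : B + B / (lam - 1) = lam * (B / (lam - 1)) := by field_simp; ring
    have h6 : lam * (B / (lam - 1)) ≤ q * (B / (lam - 1)) := by gcongr
    have hq : 0 ≤ q := abs_nonneg _
    have h7 := mul_le_mul_of_nonneg_right h1 hq
    linarith

end IsStartingPoint

/-- Expansion of the parameter derivative from time `N` on, for small parameters. -/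
structure ParamExpansion (F : ExpandingFamily α lam Lam p₀ p₁) (x₀ : ℝ → ℝ) (ε G M c : ℝ) (N : ℕ) :
    Prop where
  start : F.IsStartingPoint x₀
  ε_pos : 0 < ε
  ε_le_one : ε ≤ 1
  one_le_M : 1 ≤ M
  c_pos : 0 < c
  G_pos : 0 < G
  M_gt : ∀ k ≤ p₀, ∀ a ∈ Icc (0 : ℝ) 1, ∀ a' ∈ Icc (0 : ℝ) 1, a ≠ a' →
    |F.b k a - F.b k a'| < M * |a - a'|
  free : Ioo 0 ε ⊆ F.free x₀ N
  deriv_ne : ∀ a ∈ Ioo 0 ε, ∀ j, 1 ≤ j → j ≤ N → deriv (F.orbit x₀ j) a ≠ 0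
  le_spaceDeriv : ∀ a ∈ Ioo (0 : ℝ) 1, ∀ j : ℕ,
    a ∈ F.free x₀ j → |deriv (F.orbit x₀ j) a| ≤ G * F.spaceDeriv x₀ j a
  deriv_ge : ∀ a ∈ Ioo 0 ε, ∀ j, N ≤ j → a ∈ F.free x₀ j →
    M ≤ |deriv (F.orbit x₀ j) a| ∧ c * F.spaceDeriv x₀ j a ≤ |deriv (F.orbit x₀ j) a|

/-- Transversality implies expansion in the parameter. -/
lemma Transversal.exists_paramExpansion (hI : F.Transversal x₀) (hx₀ : F.IsStartingPoint x₀) :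
    ∃ (ε G M c : ℝ) (N : ℕ), F.ParamExpansion x₀ ε G M c N := by
  obtain ⟨B, hB0, hB⟩ := F.exists_pd_bound
  obtain ⟨L, hL0, hL⟩ := F.exists_lipschitz_b
  obtain ⟨G, hG0, hG⟩ := hx₀.exists_abs_deriv_orbit_le
  obtain ⟨⟨C, hC, hlim⟩, hfree⟩ := hI
  have h1lam := F.one_lt_lam
  have hlam := F.lam_pos
  have hLam := F.Lam_pos
  have hd : 0 < lam - 1 := by linarith
  set β := B / (lam - 1) with hβ
  have hβ0 : 0 < β := by positivity
  set M := β + L + 1 with hM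
  obtain ⟨N', hN'⟩ := pow_unbounded_of_one_lt (C * (M + 1)) h1lam
  set N := N' + 1 with hN
  have hNC : C * (M + 1) < lam ^ N :=
    hN'.trans_le (pow_le_pow_right₀ h1lam.le (Nat.le_succ _))
  have hIoo : ∀ᶠ a in 𝓝[>] (0 : ℝ), a ∈ Ioo (0 : ℝ) 1 := Ioo_mem_nhdsGT zero_lt_one
  have hlow : ∀ j : ℕ, 1 ≤ j → ∃ s : ℝ, Tendsto (fun a => deriv (F.orbit x₀ j) a) (𝓝[>] 0) (𝓝 s) ∧
      lam ^ j ≤ C * |s| := by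
    intro j hj
    obtain ⟨s, t, hs, ht, h1, -⟩ := hlim j hj
    refine ⟨s, hs, ?_⟩
    have h2 : lam ^ j ≤ |t| := by
      refine ge_of_tendsto ht.abs ?_
      filter_upwards [hIoo, hfree j hj] with a ha1 ha2
      rw [hx₀.abs_deriv_iterate (Ioo_subset_Icc_self ha1) ha2]
      exact hx₀.lam_pow_le_spaceDeriv (Ioo_subset_Icc_self ha1) ha2
    have ht0 : 0 < |t| := lt_of_lt_of_le (by positivity) h2
    rw [abs_div, div_le_div_iff₀ (by linarith) ht0] at h1
    linarith
  have hev : ∀ᶠ a in 𝓝[>] (0 : ℝ), a ∈ F.free x₀ N ∧ M < |deriv (F.orbit x₀ N) a| ∧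
      ∀ j ∈ Finset.Icc 1 N, deriv (F.orbit x₀ j) a ≠ 0 := by
    refine (hfree N (Nat.succ_pos _)).and (Eventually.and ?_ ?_)
    · obtain ⟨s, hs, h1⟩ := hlow N (Nat.succ_pos _)
      refine hs.abs.eventually (lt_mem_nhds ?_)
      have h2 : C * (M + 1) < C * |s| := hNC.trans_le h1
      have := lt_of_mul_lt_mul_left h2 (by linarith)
      linarith
    · rw [Filter.eventually_all_finset]
      intro j hj
      obtain ⟨s, hs, h1⟩ := hlow j (Finset.mem_Icc.1 hj).1
      have hs0 : s ≠ 0 := by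
        rintro rfl
        rw [abs_zero, mul_zero] at h1
        have : 0 < lam ^ j := by positivity
        linarith
      exact hs.eventually_ne hs0
  obtain ⟨ε, hε, hεsub⟩ := mem_nhdsGT_iff_exists_Ioo_subset.1 hev
  have hε0 : 0 < min ε 1 := lt_min hε one_pos
  refine ⟨min ε 1, G, M, 1 / Lam ^ N, N, hx₀, hε0, min_le_right _ _, by linarith, by positivity,
    hG0, ?_, ?_, ?_, hG, ?_⟩
  · intro k hk a ha a' ha' hne
    have h1 := hL k hk a ha a' ha'
    have h2 : 0 < |a - a'| := abs_pos.2 (sub_ne_zero.2 hne)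
    nlinarith
  · exact fun a ha => (hεsub ⟨ha.1, ha.2.trans_le (min_le_left _ _)⟩).1
  · exact fun a ha j h1 h2 => (hεsub ⟨ha.1, ha.2.trans_le (min_le_left _ _)⟩).2.2 j
      (Finset.mem_Icc.2 ⟨h1, h2⟩)
  · intro a ha j hj hf
    have ha1 : a ∈ Ioo (0 : ℝ) 1 := ⟨ha.1, ha.2.trans_le (min_le_right _ _)⟩
    have ha2 := Ioo_subset_Icc_self ha1
    obtain ⟨hfN, hMN, -⟩ := hεsub (show a ∈ Ioo 0 ε from ⟨ha.1, ha.2.trans_le (min_le_left _ _)⟩)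
    suffices h : M ≤ |deriv (F.orbit x₀ j) a| ∧
        β + 1 / Lam ^ N * F.spaceDeriv x₀ j a ≤ |deriv (F.orbit x₀ j) a| from
      ⟨h.1, by linarith [h.2]⟩
    induction j, hj using Nat.le_induction with
    | base =>
      refine ⟨hMN.le, ?_⟩
      have h1 : 1 / Lam ^ N * F.spaceDeriv x₀ N a ≤ 1 := by
        rw [div_mul_eq_mul_div, one_mul, div_le_one (by positivity)]
        exact hx₀.spaceDeriv_le ha2 hf
      linarith
    | succ j hj ih =>
      obtain ⟨h1, h2⟩ := ih (free_anti (Nat.le_succ j) hf)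
      have h3 := (hx₀.deriv_bounds ha2 hf).1
      have h4 := hx₀.abs_pd_le hB ha2 hf
      rw [hx₀.deriv_orbit_succ ha1 hf, spaceDeriv_succ, ← mul_assoc]
      set q := |deriv (F.T a) (F.orbit x₀ j a)| with hq
      have h5 : q * |deriv (F.orbit x₀ j) a| - B ≤ |F.pd (F.orbit x₀ j a) a +
          deriv (F.T a) (F.orbit x₀ j a) * deriv (F.orbit x₀ j) a| := by
        rw [hq, ← abs_mul, add_comm]
        have := abs_sub_abs_le_abs_sub (deriv (F.T a) (F.orbit x₀ j a) * deriv (F.orbit x₀ j) a)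
          (-F.pd (F.orbit x₀ j a) a)
        rw [abs_neg, sub_neg_eq_add] at this
        linarith
      have h6 : B + β = lam * β := by rw [hβ]; field_simp; ring
      have h7 : (q - lam) * β ≥ 0 := mul_nonneg (by linarith) hβ0.le
      constructor
      · have h8 : q * M ≤ q * |deriv (F.orbit x₀ j) a| := by gcongr
        have h9 : lam * M ≤ q * M := by gcongr
        have h10 : lam * M = M + (lam - 1) * M := by ring
        have h11 : B ≤ (lam - 1) * M := by
          have : (lam - 1) * β = B := by rw [hβ]; field_simp
          have : (lam - 1) * β ≤ (lam - 1) * M := by gcongr; linarith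
          linarith
        linarith
      · have h8 := mul_le_mul_of_nonneg_left h2 (abs_nonneg (deriv (F.T a) (F.orbit x₀ j a)))
        rw [← hq] at h8
        linarith

end ExpandingFamily

/-- Comparison of increments from comparison of derivatives. -/
lemma abs_sub_le_of_abs_deriv_le {f g : ℝ → ℝ} {a b K : ℝ}
    (hf : ∀ t ∈ uIcc a b, DifferentiableAt ℝ f t) (hg : ∀ t ∈ uIcc a b, DifferentiableAt ℝ g t)
    (hne : ∀ t ∈ uIcc a b, deriv g t ≠ 0)
    (hK : ∀ t ∈ uIcc a b, |deriv f t| ≤ K * |deriv g t|) : |f a - f b| ≤ K * |g a - g b| := by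
  wlog hab : a ≤ b generalizing a b
  · have := this (a := b) (b := a) (by rwa [uIcc_comm]) (by rwa [uIcc_comm]) (by rwa [uIcc_comm])
      (by rwa [uIcc_comm]) (le_of_not_ge hab)
    rwa [abs_sub_comm, abs_sub_comm (g a)]
  rcases hab.eq_or_lt with rfl | hlt
  · simp
  rw [uIcc_of_le hab] at hf hg hne hK
  obtain ⟨t, ht, h⟩ := exists_ratio_hasDerivAt_eq_ratio_slope f (deriv f) hlt
    (fun x hx => (hf x hx).continuousAt.continuousWithinAt)
    (fun x hx => (hf x (Ioo_subset_Icc_self hx)).hasDerivAt) g (deriv g)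
    (fun x hx => (hg x hx).continuousAt.continuousWithinAt)
    (fun x hx => (hg x (Ioo_subset_Icc_self hx)).hasDerivAt)
  have ht' := Ioo_subset_Icc_self ht
  have h1 := congrArg abs h
  rw [abs_mul, abs_mul] at h1
  have h2 : 0 < |deriv g t| := abs_pos.2 (hne t ht')
  have h3 := mul_le_mul_of_nonneg_left (hK t ht') (abs_nonneg (g b - g a))
  rw [abs_sub_comm (f a), abs_sub_comm (g a)]
  refine le_of_mul_le_mul_right ?_ h2
  linarith

namespace ExpandingFamily

variable {α lam Lam : ℝ} {p₀ p₁ : ℕ} {F : ExpandingFamily α lam Lam p₀ p₁} {a : ℝ}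
  {x₀ : ℝ → ℝ}

namespace ParamExpansion

variable {ε G M c : ℝ} {N : ℕ} (P : F.ParamExpansion x₀ ε G M c N)
include P

lemma mem_Ioo (ha : a ∈ Ioo 0 ε) : a ∈ Ioo (0 : ℝ) 1 := ⟨ha.1, ha.2.trans_le P.ε_le_one⟩

lemma mem_Icc (ha : a ∈ Ioo 0 ε) : a ∈ Icc (0 : ℝ) 1 := Ioo_subset_Icc_self (P.mem_Ioo ha)

lemma differentiableAt (ha : a ∈ Ioo 0 ε) {j : ℕ} (hf : a ∈ F.free x₀ j) :
    DifferentiableAt ℝ (F.orbit x₀ j) a :=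
  P.start.differentiableAt_orbit (P.mem_Ioo ha) hf

lemma deriv_ne_zero (ha : a ∈ Ioo 0 ε) {j : ℕ} (hj : 1 ≤ j) (hf : a ∈ F.free x₀ j) :
    deriv (F.orbit x₀ j) a ≠ 0 := by
  rcases le_total j N with h | h
  · exact P.deriv_ne a ha j hj h
  · have h1 := (P.deriv_ge a ha j h hf).1
    have h2 := P.one_le_M
    intro h0
    rw [h0, abs_zero] at h1
    linarith

lemma injOn {ω : Set ℝ} (hω : ω.OrdConnected) (hω0 : ω ⊆ Ioo 0 ε) {j : ℕ} (hj : 1 ≤ j)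
    (hf : ω ⊆ F.free x₀ j) : InjOn (F.orbit x₀ j) ω := by
  intro a ha b hb h
  have hsub := hω.uIcc_subset ha hb
  by_contra hne
  rcases lt_or_gt_of_ne hne with hlt | hlt
  · obtain ⟨t, ht, h1⟩ := exists_deriv_eq_zero hlt (fun x hx => (P.differentiableAt
      (hω0 (hsub (by rwa [uIcc_of_le hlt.le]))) (hf (hsub (by rwa [uIcc_of_le hlt.le])))
      ).continuousAt.continuousWithinAt) h
    have ht' := hsub (show t ∈ uIcc a b by rw [uIcc_of_le hlt.le]; exact Ioo_subset_Icc_self ht)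
    exact P.deriv_ne_zero (hω0 ht') hj (hf ht') h1
  · obtain ⟨t, ht, h1⟩ := exists_deriv_eq_zero hlt (fun x hx => (P.differentiableAt
      (hω0 (hsub (by rwa [uIcc_of_ge hlt.le]))) (hf (hsub (by rwa [uIcc_of_ge hlt.le])))
      ).continuousAt.continuousWithinAt) h.symm
    have ht' := hsub (show t ∈ uIcc a b by rw [uIcc_of_ge hlt.le]; exact Ioo_subset_Icc_self ht)
    exact P.deriv_ne_zero (hω0 ht') hj (hf ht') h1

lemma abs_sub_le_orbit {a a' : ℝ} {J : ℕ} (hJ : N ≤ J) (h : uIcc a a' ⊆ Ioo 0 ε ∩ F.free x₀ J) :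
    M * |a - a'| ≤ |F.orbit x₀ J a - F.orbit x₀ J a'| := by
  have hM := zero_lt_one.trans_le P.one_le_M
  have h1 := abs_sub_le_of_abs_deriv_le (f := id) (g := F.orbit x₀ J) (K := 1 / M) (a := a)
    (b := a') (fun t _ => differentiableAt_id) (fun t ht => P.differentiableAt (h ht).1 (h ht).2)
    (fun t ht h0 => ?_) (fun t ht => ?_)
  · rw [one_div_mul_eq_div, le_div_iff₀ hM] at h1
    simp only [id] at h1
    linarith
  · have := (P.deriv_ge t (h ht).1 J hJ (h ht).2).1
    rw [h0, abs_zero] at this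
    linarith
  · have := (P.deriv_ge t (h ht).1 J hJ (h ht).2).1
    rw [deriv_id, abs_one, one_div_mul_eq_div, le_div_iff₀ hM]
    linarith

lemma lam_pow_mul_abs_sub_le {a a' : ℝ} {J : ℕ} (hJ : N ≤ J)
    (h : uIcc a a' ⊆ Ioo 0 ε ∩ F.free x₀ J) :
    c * lam ^ J * |a - a'| ≤ |F.orbit x₀ J a - F.orbit x₀ J a'| := by
  have hlam := F.lam_pos
  have hc := P.c_pos
  have hpos : 0 < c * lam ^ J := by positivity
  have hlow : ∀ t ∈ uIcc a a', c * lam ^ J ≤ |deriv (F.orbit x₀ J) t| := fun t ht => by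
    refine le_trans ?_ (P.deriv_ge t (h ht).1 J hJ (h ht).2).2
    gcongr
    exact P.start.lam_pow_le_spaceDeriv (P.mem_Icc (h ht).1) (h ht).2
  have h1 := abs_sub_le_of_abs_deriv_le (f := id) (g := F.orbit x₀ J) (K := 1 / (c * lam ^ J))
    (a := a) (b := a') (fun t _ => differentiableAt_id)
    (fun t ht => P.differentiableAt (h ht).1 (h ht).2)
    (fun t ht h0 => ?_) (fun t ht => ?_)
  · rw [one_div_mul_eq_div, le_div_iff₀ hpos] at h1
    simp only [id] at h1
    linarith
  · have := hlow t ht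
    rw [h0, abs_zero] at this
    linarith
  · have := hlow t ht
    rw [deriv_id, abs_one, one_div_mul_eq_div, le_div_iff₀ hpos]
    linarith

lemma abs_orbit_sub_le {a a' : ℝ} {i J : ℕ} (hiJ : i ≤ J) (hJ : N ≤ J)
    (h : uIcc a a' ⊆ Ioo 0 ε ∩ F.free x₀ J) :
    |F.orbit x₀ i a - F.orbit x₀ i a'| ≤
      G / c * (1 / lam) ^ (J - i) * |F.orbit x₀ J a - F.orbit x₀ J a'| := by
  have hlam := F.lam_pos
  have hc := P.c_pos
  have hG := P.G_pos
  refine abs_sub_le_of_abs_deriv_le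
    (fun t ht => P.differentiableAt (h ht).1 (free_anti hiJ (h ht).2))
    (fun t ht => P.differentiableAt (h ht).1 (h ht).2) (fun t ht h0 => ?_) (fun t ht => ?_)
  · have := (P.deriv_ge t (h ht).1 J hJ (h ht).2).1
    rw [h0, abs_zero] at this
    linarith [P.one_le_M]
  · have h1 := P.le_spaceDeriv t (P.mem_Ioo (h ht).1) i (free_anti hiJ (h ht).2)
    have h2 := (P.deriv_ge t (h ht).1 J hJ (h ht).2).2
    have h3 := P.start.pow_mul_spaceDeriv_le (P.mem_Icc (h ht).1) hiJ (h ht).2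
    have hpow : 0 < lam ^ (J - i) := by positivity
    calc |deriv (F.orbit x₀ i) t| ≤ G * F.spaceDeriv x₀ i t := h1
      _ = G / c * (1 / lam) ^ (J - i) * (c * (lam ^ (J - i) * F.spaceDeriv x₀ i t)) := by
          rw [one_div, inv_pow]; field_simp
      _ ≤ G / c * (1 / lam) ^ (J - i) * (c * F.spaceDeriv x₀ J t) := by gcongr
      _ ≤ _ := by gcongr

/-- Parameters whose orbits avoid the partition points along an interval have orbits in the same
branches. -/
lemma exists_common_branch {a a' : ℝ} {i J : ℕ} (hiJ : i < J)
    (h : uIcc a a' ⊆ Ioo 0 ε ∩ F.free x₀ J) :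
    ∃ k < p₀, ∀ t ∈ uIcc a a', F.orbit x₀ i t ∈ F.branch k t := by
  have ha := h (left_mem_uIcc (a := a) (b := a'))
  obtain ⟨k, hk, hka⟩ := P.start.exists_branch (P.mem_Icc ha.1) (free_anti hiJ ha.2)
  refine ⟨k, hk, fun t ht => ?_⟩
  exact F.mem_branch_of_path isPreconnected_uIcc (fun t ht => P.mem_Icc (h ht).1)
    (fun t ht => (P.differentiableAt (h ht).1
      (free_anti hiJ.le (h ht).2)).continuousAt.continuousWithinAt)
    (fun t ht => (h ht).2 i hiJ) left_mem_uIcc hk hka ht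

/-- Bounded distortion of the parameter derivative. -/
lemma exists_distortion : ∃ K > 0, ∀ J ≥ N, ∀ a a' : ℝ, uIcc a a' ⊆ Ioo 0 ε ∩ F.free x₀ J →
    |deriv (F.orbit x₀ J) a - deriv (F.orbit x₀ J) a'| ≤
      K * |F.orbit x₀ J a - F.orbit x₀ J a'| ^ α * |deriv (F.orbit x₀ J) a'| := by
  obtain ⟨C0, hC0, hjoint⟩ := F.exists_joint_holder
  obtain ⟨Cx, hCx⟩ := P.start.holder
  have hα := F.α_pos
  have h1lam := F.one_lt_lam
  have hlam := F.lam_pos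
  have hc := P.c_pos
  have hG := P.G_pos
  set θ := (1 / lam) ^ α with hθ
  have hθ0 : 0 < θ := by positivity
  have hθ1 : θ < 1 := Real.rpow_lt_one (by positivity) (by rw [div_lt_one hlam]; exact h1lam) hα
  have h1θ : 0 < 1 - θ := by linarith
  set C5 := (G / c) ^ α + (1 / c) ^ α with hC5
  have hC50 : 0 < C5 := by positivity
  set C6 := C5 / (1 - θ) with hC6
  have hC60 : 0 < C6 := by positivity
  refine ⟨Real.exp (C0 * C6) * (|Cx| * C5 + C0 * (1 + G) * C6) / c, by positivity, ?_⟩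
  intro J hJ a a' h
  have ha := h (left_mem_uIcc (a := a) (b := a'))
  have ha' := h (right_mem_uIcc (a := a) (b := a'))
  have ha1 := P.mem_Icc ha.1
  have ha1' := P.mem_Icc ha'.1
  set Z := |F.orbit x₀ J a - F.orbit x₀ J a'| with hZ
  set Y := Z ^ α with hY
  have hZ0 : 0 ≤ Z := abs_nonneg _
  have hZ1 : Z ≤ 1 := by
    have h1 := P.start.orbit_mem ha1 J
    have h2 := P.start.orbit_mem ha1' J
    exact abs_le.2 ⟨by linarith [h1.1, h2.2], by linarith [h1.2, h2.1]⟩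
  have hY0 : 0 ≤ Y := by positivity
  have hY1 : Y ≤ 1 := Real.rpow_le_one hZ0 hZ1 hα.le
  set δ : ℕ → ℝ := fun j => |F.orbit x₀ j a - F.orbit x₀ j a'| ^ α + |a - a'| ^ α with hδ
  have hδ0 : ∀ j, 0 ≤ δ j := fun j => by positivity
  have haa : |a - a'| ^ α ≤ (1 / c) ^ α * θ ^ J * Y := by
    have h1 := P.lam_pow_mul_abs_sub_le hJ h
    have h2 : |a - a'| ≤ 1 / c * (1 / lam) ^ J * Z := by
      rw [one_div_pow, div_mul_div_comm, one_mul, div_mul_eq_mul_div, one_mul,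
        le_div_iff₀ (by positivity)]
      linarith
    calc |a - a'| ^ α ≤ (1 / c * (1 / lam) ^ J * Z) ^ α := by gcongr
      _ = _ := by
        rw [Real.mul_rpow (by positivity) hZ0, Real.mul_rpow (by positivity) (by positivity),
          ← Real.rpow_natCast, ← Real.rpow_mul (by positivity), mul_comm (J : ℝ),
          Real.rpow_mul (by positivity), Real.rpow_natCast]
  have hδle : ∀ j ≤ J, δ j ≤ C5 * Y * θ ^ (J - j) := by
    intro j hj
    have h1 := P.abs_orbit_sub_le hj hJ h
    have h2 : |F.orbit x₀ j a - F.orbit x₀ j a'| ^ α ≤ (G / c) ^ α * θ ^ (J - j) * Y := by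
      calc _ ≤ (G / c * (1 / lam) ^ (J - j) * Z) ^ α := by gcongr
        _ = _ := by
          rw [Real.mul_rpow (by positivity) hZ0, Real.mul_rpow (by positivity) (by positivity),
            ← Real.rpow_natCast, ← Real.rpow_mul (by positivity), mul_comm ((J - j : ℕ) : ℝ),
            Real.rpow_mul (by positivity), Real.rpow_natCast]
    have h3 : θ ^ J ≤ θ ^ (J - j) := pow_le_pow_of_le_one hθ0.le hθ1.le (Nat.sub_le _ _)
    have h4 : (1 / c) ^ α * θ ^ J * Y ≤ (1 / c) ^ α * θ ^ (J - j) * Y := by gcongr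
    simp only [hδ]
    rw [hC5]
    linarith
  have hsum : ∑ j ∈ Finset.range J, δ j ≤ C6 * Y := by
    have h1 : ∑ j ∈ Finset.range J, θ ^ (J - j) ≤ 1 / (1 - θ) := by
      calc ∑ j ∈ Finset.range J, θ ^ (J - j) ≤ ∑ j ∈ Finset.range J, θ ^ (J - 1 - j) := by
            refine Finset.sum_le_sum fun j hj => ?_
            exact pow_le_pow_of_le_one hθ0.le hθ1.le (by omega)
        _ = ∑ j ∈ Finset.range J, θ ^ j := Finset.sum_range_reflect (fun j => θ ^ j) J
        _ ≤ ∑' j, θ ^ j := Summable.sum_le_tsum _ (fun _ _ => by positivity)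
            (summable_geometric_of_lt_one hθ0.le hθ1)
        _ = 1 / (1 - θ) := by rw [tsum_geometric_of_lt_one hθ0.le hθ1, one_div]
    calc ∑ j ∈ Finset.range J, δ j ≤ ∑ j ∈ Finset.range J, C5 * Y * θ ^ (J - j) :=
          Finset.sum_le_sum fun j hj => hδle j (Finset.mem_range.1 hj).le
      _ = C5 * Y * ∑ j ∈ Finset.range J, θ ^ (J - j) := by rw [Finset.mul_sum]
      _ ≤ C5 * Y * (1 / (1 - θ)) := by gcongr
      _ = C6 * Y := by rw [hC6]; ring
  set W : ℕ → ℝ := fun j => ∏ i ∈ Finset.range j, (1 + C0 * δ i) with hW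
  have hW1 : ∀ j, 1 ≤ W j := fun j => by
    have : ∀ i ∈ Finset.range j, (1 : ℝ) ≤ 1 + C0 * δ i := fun i _ => by
      have := mul_nonneg hC0.le (hδ0 i); linarith
    calc (1 : ℝ) = ∏ _i ∈ Finset.range j, (1 : ℝ) := by simp
      _ ≤ W j := Finset.prod_le_prod (fun _ _ => zero_le_one) this
  have hWJ : W J ≤ Real.exp (C0 * C6) := by
    calc W J ≤ ∏ i ∈ Finset.range J, Real.exp (C0 * δ i) := by
          refine Finset.prod_le_prod (fun i _ => ?_) fun i _ => ?_
          · have := mul_nonneg hC0.le (hδ0 i); linarith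
          · linarith [Real.add_one_le_exp (C0 * δ i)]
      _ = Real.exp (C0 * ∑ i ∈ Finset.range J, δ i) := by rw [← Real.exp_sum, Finset.mul_sum]
      _ ≤ _ := by
        refine Real.exp_le_exp.2 (mul_le_mul_of_nonneg_left (hsum.trans ?_) hC0.le)
        nlinarith
  have hmain : ∀ j ≤ J, |deriv (F.orbit x₀ j) a - deriv (F.orbit x₀ j) a'| ≤
      F.spaceDeriv x₀ j a' * W j * (|Cx| * |a - a'| ^ α +
        C0 * (1 + G) * ∑ i ∈ Finset.range j, δ i) := by
    intro j
    induction j with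
    | zero =>
      intro _
      have e : ∀ t ∈ Ioo (0 : ℝ) 1, deriv (F.orbit x₀ 0) t = derivWithin x₀ (Icc 0 1) t :=
        fun t ht => (derivWithin_of_mem_nhds (Icc_mem_nhds ht.1 ht.2)).symm
      rw [e a (P.mem_Ioo ha.1), e a' (P.mem_Ioo ha'.1)]
      refine (hCx a ha1 a' ha1').trans ?_
      simp only [spaceDeriv, hW, Finset.range_zero, Finset.prod_empty, Finset.sum_empty, one_mul,
        mul_zero, add_zero]
      gcongr
      exact le_abs_self _
    | succ j ih =>
      intro hj
      have ih' := ih (by omega)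
      have hfa := free_anti hj ha.2
      have hfa' := free_anti hj ha'.2
      obtain ⟨k, hk, hbr⟩ := P.exists_common_branch (Nat.lt_of_succ_le hj) h
      obtain ⟨h1, h2⟩ := hjoint a ha1 a' ha1' k hk _ (hbr a left_mem_uIcc) _
        (hbr a' right_mem_uIcc)
      have h3 := P.le_spaceDeriv a' (P.mem_Ioo ha'.1) j (free_anti (Nat.le_succ j) hfa')
      have h4 := (P.start.deriv_bounds ha1' hfa').1
      have h5 : 1 ≤ F.spaceDeriv x₀ j a' := (one_le_pow₀ h1lam.le).trans
        (P.start.lam_pow_le_spaceDeriv ha1' (free_anti (Nat.le_succ j) hfa'))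
      rw [P.start.deriv_orbit_succ (P.mem_Ioo ha.1) hfa,
        P.start.deriv_orbit_succ (P.mem_Ioo ha'.1) hfa', spaceDeriv_succ, Finset.sum_range_succ]
      have hWs : W (j + 1) = W j * (1 + C0 * δ j) := Finset.prod_range_succ _ _
      rw [hWs]
      have hWj := hW1 j
      have hdj := hδ0 j
      set S := ∑ i ∈ Finset.range j, δ i with hS
      have hS0 : 0 ≤ S := Finset.sum_nonneg fun i _ => hδ0 i
      set Pj := F.spaceDeriv x₀ j a'
      set qa := deriv (F.T a) (F.orbit x₀ j a)
      set qa' := deriv (F.T a') (F.orbit x₀ j a')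
      set pa := F.pd (F.orbit x₀ j a) a
      set pa' := F.pd (F.orbit x₀ j a') a'
      set ya := deriv (F.orbit x₀ j) a
      set ya' := deriv (F.orbit x₀ j) a'
      change |qa - qa'| ≤ C0 * δ j at h1
      change |pa - pa'| ≤ C0 * δ j at h2
      set Q := |qa'| with hQ
      set V := |Cx| * |a - a'| ^ α + C0 * (1 + G) * S with hV
      have hV0 : 0 ≤ V := by positivity
      have hqa : |qa| ≤ Q * (1 + C0 * δ j) := by
        have h6 := abs_sub_abs_le_abs_sub qa qa'
        have h7 : C0 * δ j ≤ Q * (C0 * δ j) := le_mul_of_one_le_left (by positivity) (by linarith)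
        linarith
      have e : pa + qa * ya - (pa' + qa' * ya') = (pa - pa') + qa * (ya - ya') + (qa - qa') * ya' := by
        ring
      rw [e]
      have t1 := abs_add_le (pa - pa' + qa * (ya - ya')) ((qa - qa') * ya')
      have t2 := abs_add_le (pa - pa') (qa * (ya - ya'))
      rw [abs_mul] at t1 t2
      have t3 : |qa| * |ya - ya'| ≤ Q * (1 + C0 * δ j) * (Pj * W j * V) := by gcongr
      have t4 : |qa - qa'| * |ya'| ≤ C0 * δ j * (G * Pj) := by gcongr
      have hQW : 1 ≤ Q * (W j * (1 + C0 * δ j)) := by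
        have : 0 ≤ C0 * δ j := by positivity
        exact one_le_mul_of_one_le_of_one_le (by linarith)
          (one_le_mul_of_one_le_of_one_le hWj (by linarith))
      have t5 : C0 * δ j + C0 * δ j * (G * Pj) ≤
          Pj * Q * (W j * (1 + C0 * δ j)) * (C0 * (1 + G) * δ j) := by
        calc C0 * δ j + C0 * δ j * (G * Pj) ≤ C0 * δ j * Pj + C0 * δ j * (G * Pj) := by
              have := le_mul_of_one_le_right (by positivity : 0 ≤ C0 * δ j) h5
              linarith
          _ = Pj * (C0 * (1 + G) * δ j) * 1 := by ring
          _ ≤ Pj * (C0 * (1 + G) * δ j) * (Q * (W j * (1 + C0 * δ j))) := by gcongr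
          _ = _ := by ring
      have t6 : Pj * Q * (W j * (1 + C0 * δ j)) * (|Cx| * |a - a'| ^ α + C0 * (1 + G) * (S + δ j)) =
          Q * (1 + C0 * δ j) * (Pj * W j * V) +
            Pj * Q * (W j * (1 + C0 * δ j)) * (C0 * (1 + G) * δ j) := by rw [hV]; ring
      rw [t6]
      linarith
  have h1 := hmain J le_rfl
  have h2 := (P.deriv_ge a' ha'.1 J hJ ha'.2).2
  have h3 : F.spaceDeriv x₀ J a' ≤ |deriv (F.orbit x₀ J) a'| / c := by
    rw [le_div_iff₀ hc]; linarith
  have hP0 : 0 ≤ F.spaceDeriv x₀ J a' := Finset.prod_nonneg fun _ _ => abs_nonneg _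
  have h4 : |a - a'| ^ α ≤ C5 * Y := by
    refine haa.trans ?_
    have : θ ^ J ≤ 1 := pow_le_one₀ hθ0.le hθ1.le
    calc (1 / c) ^ α * θ ^ J * Y ≤ (1 / c) ^ α * 1 * Y := by gcongr
      _ ≤ C5 * Y := by
        rw [mul_one, hC5]
        gcongr
        have : 0 ≤ (G / c) ^ α := by positivity
        linarith
  refine h1.trans ?_
  have hS0 : 0 ≤ ∑ i ∈ Finset.range J, δ i := Finset.sum_nonneg fun i _ => hδ0 i
  have hWJ0 := zero_le_one.trans (hW1 J)
  calc F.spaceDeriv x₀ J a' * W J * (|Cx| * |a - a'| ^ α +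
        C0 * (1 + G) * ∑ i ∈ Finset.range J, δ i)
      ≤ |deriv (F.orbit x₀ J) a'| / c * Real.exp (C0 * C6) * (|Cx| * (C5 * Y) +
        C0 * (1 + G) * (C6 * Y)) := by gcongr
    _ = _ := by ring

end ParamExpansion

end ExpandingFamily

/-- A set of reals is finite if any two of its points are separated by a point of a finite set. -/
lemma finite_of_separated {S Z : Set ℝ} (hS : S.Finite)
    (h : ∀ x ∈ Z, ∀ y ∈ Z, x < y → ∃ s ∈ S, x ≤ s ∧ s < y) : Z.Finite := by
  classical
  set g : ℝ → ℕ := fun z => (hS.toFinset.filter (· < z)).card with hg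
  have hlt : ∀ x ∈ Z, ∀ y ∈ Z, x < y → g x < g y := by
    intro x hx y hy hxy
    obtain ⟨s, hs, h1, h2⟩ := h x hx y hy hxy
    refine Finset.card_lt_card ⟨fun t ht => ?_, fun hsub => ?_⟩
    · rw [Finset.mem_filter] at ht ⊢
      exact ⟨ht.1, ht.2.trans hxy⟩
    · have h3 := hsub (Finset.mem_filter.2 ⟨hS.mem_toFinset.2 hs, h2⟩)
      exact absurd (Finset.mem_filter.1 h3).2 (not_lt.2 h1)
  refine Set.Finite.of_finite_image (f := g) ?_ ?_
  · refine (Set.finite_Iic hS.toFinset.card).subset ?_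
    rintro _ ⟨z, -, rfl⟩
    exact Finset.card_filter_le _ _
  · intro x hx y hy hxy
    by_contra hne
    rcases lt_or_gt_of_ne hne with h1 | h1
    · exact (hlt x hx y hy h1).ne hxy
    · exact (hlt y hy x hx h1).ne' hxy

namespace ExpandingFamily

variable {α lam Lam : ℝ} {p₀ p₁ : ℕ} {F : ExpandingFamily α lam Lam p₀ p₁} {a : ℝ}
  {x₀ : ℝ → ℝ}

lemma mem_partition {ε : ℝ} {v : ℕ} (hv : 1 ≤ v) {ω : Set ℝ}
    (hω : ω ∈ F.paramPartition x₀ (Icc 0 ε) v) :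
    ∃ c d : ℝ, c < d ∧ ω = Ioo c d ∧ ω ⊆ Ioo 0 ε ∧ ω ⊆ F.free x₀ v := by
  rcases hω with ⟨h0, -⟩ | ⟨-, ⟨c, d, hcd, rfl⟩, hsub, hK, -⟩
  · omega
  refine ⟨c, d, hcd, rfl, ?_, fun a ha i hi => (hK i hi a ha).2⟩
  have := interior_mono hsub
  rwa [interior_Ioo, interior_Icc] at this

lemma partition_disjoint {ε : ℝ} {v : ℕ} (hv : 1 ≤ v) :
    (F.paramPartition x₀ (Icc 0 ε) v).PairwiseDisjoint id := by
  have key : ∀ ω ∈ F.paramPartition x₀ (Icc 0 ε) v, ∀ ω' ∈ F.paramPartition x₀ (Icc 0 ε) v,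
      (ω ∩ ω').Nonempty → ω' ⊆ ω := by
    intro ω hω ω' hω' ⟨x, hx, hx'⟩
    obtain ⟨c, d, hcd, rfl, h0, hf⟩ := mem_partition hv hω
    obtain ⟨c', d', hcd', rfl, h0', hf'⟩ := mem_partition hv hω'
    have hun : Ioo c d ∪ Ioo c' d' = Ioo (min c c') (max d d') :=
      Ioo_union_Ioo' (hx'.1.trans hx.2) (hx.1.trans hx'.2)
    rcases hω with ⟨h, -⟩ | ⟨-, -, -, -, hmax⟩
    · omega
    by_contra hns
    have hss : Ioo c d ⊂ Ioo c d ∪ Ioo c' d' :=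
      ⟨subset_union_left, fun h => hns (subset_union_right.trans h)⟩
    obtain ⟨a, ha, i, hi, hp⟩ := hmax _
      ⟨min c c', max d d', (min_le_left _ _).trans_lt (hcd.trans_le (le_max_left _ _)), hun⟩
      ((union_subset h0 h0').trans Ioo_subset_Icc_self) hss
    rcases ha with ha | ha
    · exact hf ha i hi hp
    · exact hf' ha i hi hp
  intro ω hω ω' hω' hne
  rw [Function.onFun, id, id, Set.disjoint_iff_inter_eq_empty]
  by_contra h
  have h1 := nonempty_iff_ne_empty.2 h
  exact hne (Subset.antisymm (key ω' hω' ω hω (by rwa [inter_comm])) (key ω hω ω' hω' h1))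

lemma partition_countable {ε : ℝ} {v : ℕ} (hv : 1 ≤ v) :
    (F.paramPartition x₀ (Icc 0 ε) v).Countable := by
  refine (partition_disjoint hv).countable_of_isOpen (fun ω hω => ?_) fun ω hω => ?_
  · obtain ⟨c, d, hcd, rfl, -⟩ := mem_partition hv hω
    exact isOpen_Ioo
  · obtain ⟨c, d, hcd, rfl, -⟩ := mem_partition hv hω
    exact nonempty_Ioo.2 hcd

/-- Elements of the partition which do not touch the right end point do not depend on it. -/
lemma partition_mono {ε ε' : ℝ} (hεε' : ε ≤ ε') {v : ℕ} {c d : ℝ} (hcd : c < d) (hd : d < ε)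
    (hv : 1 ≤ v) (hω : Ioo c d ∈ F.paramPartition x₀ (Icc 0 ε) v) :
    Ioo c d ∈ F.paramPartition x₀ (Icc 0 ε') v := by
  rcases hω with ⟨h, -⟩ | ⟨-, hex, hsub, hK, hmax⟩
  · omega
  refine Or.inr ⟨hv, hex, hsub.trans (Icc_subset_Icc_right hεε'), hK, ?_⟩
  rintro _ ⟨c', d', hcd', rfl⟩ hsub' hss
  obtain ⟨hc, hd'⟩ := (Ioo_subset_Ioo_iff hcd).1 hss.1
  have hsub2 : Ioo c' (min d' ε) ⊆ Ioo c' d' := Ioo_subset_Ioo_right (min_le_left _ _)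
  have hlt : c' < min d' ε := hc.trans_lt (hcd.trans_le (le_min hd' hd.le))
  have hss2 : Ioo c d ⊂ Ioo c' (min d' ε) := by
    refine ⟨Ioo_subset_Ioo hc (le_min hd' hd.le), fun h => ?_⟩
    obtain ⟨h1, h2⟩ := (Ioo_subset_Ioo_iff hlt).1 h
    rcases (min_le_iff.1 h2) with h3 | h3
    · exact hss.2 (Ioo_subset_Ioo h1 h3)
    · linarith
  obtain ⟨a, ha, h⟩ := hmax (Ioo c' (min d' ε)) ⟨c', _, hlt, rfl⟩
    (fun t ht => ⟨(hsub' (hsub2 ht)).1, (ht.2.trans_le (min_le_right _ _)).le⟩) hss2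
  exact ⟨a, hsub2 ha, h⟩

lemma IsStartingPoint.orbit_mem_K (hx₀ : F.IsStartingPoint x₀) (ha : a ∈ Ioo (0 : ℝ) 1) {v : ℕ}
    (hf : a ∈ F.free x₀ v) : F.orbit x₀ v a ∈ F.K a := by
  induction v with
  | zero => exact (hx₀.mem a ha).1
  | succ v ih =>
    rw [orbit_succ]
    exact F.mapsTo_K (Ioo_subset_Icc_self ha) (ih (free_anti (Nat.le_succ v) hf))
      (hf v (Nat.lt_succ_self v))

namespace ParamExpansion

variable {ε G M c : ℝ} {N : ℕ} (P : F.ParamExpansion x₀ ε G M c N)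
include P

lemma mono {ε' : ℝ} (h0 : 0 < ε') (h : ε' ≤ ε) : F.ParamExpansion x₀ ε' G M c N where
  start := P.start
  ε_pos := h0
  ε_le_one := h.trans P.ε_le_one
  one_le_M := P.one_le_M
  c_pos := P.c_pos
  G_pos := P.G_pos
  M_gt := P.M_gt
  free := (Ioo_subset_Ioo_right h).trans P.free
  deriv_ne a ha := P.deriv_ne a (Ioo_subset_Ioo_right h ha)
  le_spaceDeriv := P.le_spaceDeriv
  deriv_ge a ha := P.deriv_ge a (Ioo_subset_Ioo_right h ha)

/-- Only finitely many parameters hit a partition point up to a given time. -/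
lemma finite_hits (v : ℕ) : (Ioo 0 ε \ F.free x₀ v).Finite := by
  induction v with
  | zero => simp [ExpandingFamily.free]
  | succ v ih =>
    rcases lt_or_ge v N with hvN | hvN
    · have : Ioo 0 ε \ F.free x₀ (v + 1) = ∅ :=
        sdiff_eq_empty.2 (P.free.trans (free_anti hvN))
      rw [this]; exact finite_empty
    have hZ : ∀ k ≤ p₀, {a | a ∈ Ioo 0 ε ∩ F.free x₀ v ∧ F.orbit x₀ v a = F.b k a}.Finite := by
      intro k hk
      refine finite_of_separated ih fun x ⟨hx, hxk⟩ y ⟨hy, hyk⟩ hxy => ?_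
      by_contra! hcon
      have hsub : uIcc x y ⊆ Ioo 0 ε ∩ F.free x₀ v := by
        rw [uIcc_of_le hxy.le]
        intro t ht
        have ht0 : t ∈ Ioo 0 ε := ⟨hx.1.1.trans_le ht.1, ht.2.trans_lt hy.1.2⟩
        refine ⟨ht0, ?_⟩
        by_contra htf
        have h1 := hcon t ⟨ht0, htf⟩ ht.1
        have h2 : t = y := le_antisymm ht.2 h1
        exact htf (h2 ▸ hy.2)
      have h1 := P.abs_sub_le_orbit hvN hsub
      rw [hxk, hyk] at h1
      exact absurd (P.M_gt k hk x (P.mem_Icc hx.1) y (P.mem_Icc hy.1) hxy.ne) (not_lt.2 h1)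
    refine (ih.union ((Set.finite_Iic p₀).biUnion fun k hk => hZ k hk)).subset ?_
    rintro a ⟨ha, hf⟩
    by_cases hv : a ∈ F.free x₀ v
    · right
      have hp : F.orbit x₀ v a ∈ F.pts a := by
        by_contra hp
        refine hf fun i hi => ?_
        rcases (Nat.lt_succ_iff.1 hi).lt_or_eq with h | rfl
        · exact hv i h
        · exact hp
      obtain ⟨k, hk, e⟩ := hp
      exact mem_biUnion (show k ∈ Set.Iic p₀ from hk) ⟨⟨ha, hv⟩, e⟩
    · exact Or.inl ⟨ha, hv⟩

lemma exists_mem_partition {v : ℕ} (hv : 1 ≤ v) (ha : a ∈ Ioo 0 ε) (hf : a ∈ F.free x₀ v) :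
    ∃ ω ∈ F.paramPartition x₀ (Icc 0 ε) v, a ∈ ω := by
  have hfin := P.finite_hits v
  set S := Ioo 0 ε \ F.free x₀ v with hS
  have hSl : (insert 0 (S ∩ Iio a)).Finite := (hfin.inter_of_left _).insert 0
  have hSr : (insert ε (S ∩ Ioi a)).Finite := (hfin.inter_of_left _).insert ε
  obtain ⟨c', ⟨hc', hcmax⟩⟩ := hSl.exists_maximal (insert_nonempty _ _)
  obtain ⟨d', ⟨hd', hdmin⟩⟩ := hSr.exists_minimal (insert_nonempty _ _)
  have hca : 0 ≤ c' ∧ c' < a := by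
    rcases hc' with rfl | h
    · exact ⟨le_rfl, ha.1⟩
    · exact ⟨h.1.1.1.le, h.2⟩
  have hda : a < d' ∧ d' ≤ ε := by
    rcases hd' with rfl | h
    · exact ⟨ha.2, le_rfl⟩
    · exact ⟨h.2, h.1.1.2.le⟩
  have hsub : Ioo c' d' ⊆ Ioo 0 ε := Ioo_subset_Ioo hca.1 hda.2
  have hfree : Ioo c' d' ⊆ F.free x₀ v := by
    intro t ht
    by_contra htf
    have htS : t ∈ S := ⟨hsub ht, htf⟩
    rcases lt_trichotomy t a with h | rfl | h
    · have := hcmax (mem_insert_of_mem _ ⟨htS, h⟩) ht.1.le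
      linarith [ht.1]
    · exact htf hf
    · have := hdmin (mem_insert_of_mem _ ⟨htS, h⟩) ht.2.le
      linarith [ht.2]
  refine ⟨Ioo c' d', Or.inr ⟨hv, ⟨c', d', hca.2.trans hda.1, rfl⟩,
    hsub.trans Ioo_subset_Icc_self, fun i hi t ht => ⟨?_, hfree ht i hi⟩, ?_⟩, hca.2, hda.1⟩
  · exact P.start.orbit_mem_K (P.mem_Ioo (hsub ht)) (free_anti hi.le (hfree ht))
  · rintro _ ⟨c2, d2, hcd2, rfl⟩ hsub2 hss
    have hsub3 : Ioo c2 d2 ⊆ Ioo 0 ε := by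
      have := interior_mono hsub2
      rwa [interior_Ioo, interior_Icc] at this
    obtain ⟨h1, h2⟩ := (Ioo_subset_Ioo_iff (hca.2.trans hda.1)).1 hss.1
    have hhit : ∀ s ∈ S, s ∈ Ioo c2 d2 → ∃ a ∈ Ioo c2 d2, ∃ i < v, F.orbit x₀ i a ∈ F.pts a := by
      intro s hs hs2
      have := hs.2
      simp only [ExpandingFamily.free, mem_ofPred_eq, not_forall, not_not] at this
      obtain ⟨i, hi, h⟩ := this
      exact ⟨s, hs2, i, hi, h⟩
    rcases h1.lt_or_eq with h3 | h3
    · refine hhit c' ?_ ⟨h3, hca.2.trans (hda.1.trans_le h2)⟩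
      rcases hc' with rfl | h
      · have := hsub3 (show (0 : ℝ) ∈ Ioo c2 d2 from ⟨h3, hca.2.trans (hda.1.trans_le h2)⟩)
        exact absurd this.1 (lt_irrefl _)
      · exact h.1
    rcases h2.lt_or_eq with h4 | h4
    · refine hhit d' ?_ ⟨h1.trans_lt (hca.2.trans hda.1), h4⟩
      rcases hd' with rfl | h
      · have := hsub3 (show d' ∈ Ioo c2 d2 from ⟨h1.trans_lt (hca.2.trans hda.1), h4⟩)
        exact absurd this.2 (lt_irrefl _)
      · exact h.1
    · subst h3; subst h4
      exact absurd hss (ssubset_irrefl _)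

/-- Almost every parameter belongs to an element of the partition. -/
lemma ae_mem_partition {v : ℕ} (hv : 1 ≤ v) : ∀ᵐ a ∂volume.restrict (Icc 0 ε),
    ∃ ω ∈ F.paramPartition x₀ (Icc 0 ε) v, a ∈ ω := by
  have h1 : ∀ᵐ a : ℝ, a ∉ Ioo 0 ε \ F.free x₀ v :=
    measure_eq_zero_iff_ae_notMem.1 ((P.finite_hits v).measure_zero volume)
  rw [Measure.restrict_congr_set (Ioo_ae_eq_Icc (a := (0 : ℝ)) (b := ε)).symm,
    ae_restrict_iff' measurableSet_Ioo]
  filter_upwards [h1] with a h2 h3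
  refine P.exists_mem_partition hv h3 ?_
  by_contra h4
  exact h2 ⟨h3, h4⟩

/-- The orbit maps `x_k`, `k ≥ 1`, are nonsingular. -/
lemma ae_comp_orbit {k : ℕ} (hk : 1 ≤ k) {p : ℝ → Prop} (h : ∀ᵐ y ∂leb, p y) :
    ∀ᵐ a ∂volume.restrict (Icc 0 ε), p (F.orbit x₀ k a) := by
  obtain ⟨Z, hZsub, hZm, hZ0⟩ := exists_measurable_superset_of_null (ae_iff.1 h)
  have hω : ∀ ω ∈ F.paramPartition x₀ (Icc 0 ε) k,
      ∀ᵐ a : ℝ, a ∈ ω → ¬ p (F.orbit x₀ k a) → False := by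
    intro ω hω
    obtain ⟨c', d', hcd, rfl, h0, hf⟩ := mem_partition hk hω
    have hcont : ContinuousOn (F.orbit x₀ k) (Ioo c' d') := fun t ht =>
      (P.differentiableAt (h0 ht) (hf ht)).continuousAt.continuousWithinAt

    set s := Ioo c' d' ∩ F.orbit x₀ k ⁻¹' Z with hs
    have hsm : MeasurableSet s := by
      have := (continuousOn_iff_continuous_domRestrict.1 hcont).measurable hZm
      have h2 := measurableSet_Ioo.subtype_image this
      convert h2 using 1
      ext t
      simp [hs, and_comm]
    have hinj : InjOn (F.orbit x₀ k) s :=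
      (P.injOn ordConnected_Ioo h0 hk hf).mono inter_subset_left
    have hd : ∀ t ∈ s, HasDerivWithinAt (F.orbit x₀ k) (deriv (F.orbit x₀ k) t) s t := fun t ht =>
      (P.differentiableAt (h0 ht.1) (hf ht.1)).hasDerivAt.hasDerivWithinAt
    have h3 := lintegral_image_eq_lintegral_abs_deriv_mul hsm hd hinj fun _ => 1
    have h4 : volume (F.orbit x₀ k '' s) = 0 := by
      refine measure_mono_null (t := Icc 0 1 ∩ Z) ?_ ?_
      · rintro _ ⟨t, ht, rfl⟩
        exact ⟨P.start.orbit_mem (P.mem_Icc (h0 ht.1)) k, ht.2⟩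
      · rw [inter_comm, ← Measure.restrict_apply hZm]; exact hZ0
    rw [setLIntegral_one, h4] at h3
    simp only [mul_one] at h3
    have h5 : AEMeasurable (fun t => ENNReal.ofReal |deriv (F.orbit x₀ k) t|)
        (volume.restrict s) := by
      have := (measurable_deriv (F.orbit x₀ k)).norm.ennreal_ofReal
      simp only [Real.norm_eq_abs] at this
      exact this.aemeasurable
    have h6 := (lintegral_eq_zero_iff' h5).1 h3.symm
    rw [Filter.EventuallyEq, ae_restrict_iff' hsm] at h6
    filter_upwards [h6] with t ht ht1 ht2
    have h7 := ht ⟨ht1, hZsub ht2⟩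
    rw [Pi.zero_apply, ENNReal.ofReal_eq_zero] at h7
    exact P.deriv_ne_zero (h0 ht1) hk (hf ht1) (abs_nonpos_iff.1 h7)
  have hall := (ae_ball_iff (partition_countable hk)).2 hω
  filter_upwards [P.ae_mem_partition hk, ae_restrict_of_ae hall] with a ⟨ω, hω1, haω⟩ h2
  by_contra hcon
  exact h2 ω hω1 haω hcon

end ParamExpansion

end ExpandingFamily

lemma continuousOn_of_abs_sub_le_rpow {f : ℝ → ℝ} {s : Set ℝ} {c β : ℝ} (hβ : 0 < β)
    (h : ∀ x ∈ s, ∀ y ∈ s, |f x - f y| ≤ c * |x - y| ^ β) : ContinuousOn f s := by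
  intro y hy
  rw [ContinuousWithinAt, tendsto_iff_dist_tendsto_zero]
  have h1 : Tendsto (fun x => c * |x - y| ^ β) (𝓝[s] y) (𝓝 (c * |y - y| ^ β)) := by
    refine Tendsto.mono_left (Continuous.tendsto ?_ y) nhdsWithin_le_nhds
    exact continuous_const.mul ((by fun_prop : Continuous fun x : ℝ => |x - y|).rpow_const
      fun _ => Or.inr hβ.le)
  rw [sub_self, abs_zero, Real.zero_rpow hβ.ne', mul_zero] at h1
  refine squeeze_zero' (Eventually.of_forall fun _ => dist_nonneg) ?_ h1
  filter_upwards [self_mem_nhdsWithin] with x hx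
  exact h x hx y hy

namespace ExpandingFamily

variable {α lam Lam : ℝ} {p₀ p₁ : ℕ} {F : ExpandingFamily α lam Lam p₀ p₁} {a : ℝ}
  {x₀ : ℝ → ℝ}

/-- `ω` is a parameter interval on which the orbit avoids the partition points up to time `v`, and
`x_v` has distortion controlled by `K` on `ω`. -/
structure IsGoodInterval (F : ExpandingFamily α lam Lam p₀ p₁) (x₀ : ℝ → ℝ) (ε K : ℝ) (v : ℕ)
    (ω : Set ℝ) : Prop where
  start : F.IsStartingPoint x₀
  eps_le_one : ε ≤ 1
  K_pos : 0 < K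
  exists_eq : ∃ c d : ℝ, c < d ∧ ω = Ioo c d
  subset : ω ⊆ Ioo 0 ε
  subset_free : ω ⊆ F.free x₀ v
  injOn : InjOn (F.orbit x₀ v) ω
  deriv_ne : ∀ a ∈ ω, deriv (F.orbit x₀ v) a ≠ 0
  distortion : ∀ a ∈ ω, ∀ a' ∈ ω,
    |deriv (F.orbit x₀ v) a - deriv (F.orbit x₀ v) a'| ≤
      K * |F.orbit x₀ v a - F.orbit x₀ v a'| ^ α * |deriv (F.orbit x₀ v) a'|
  volume_le : volume.real ω ≤ K / lam ^ v

lemma ParamExpansion.exists_isGoodInterval {ε G M c : ℝ} {N : ℕ}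
    (P : F.ParamExpansion x₀ ε G M c N) : ∃ K : ℝ, 0 < K ∧ ∀ v : ℕ, N ≤ v → 1 ≤ v →
      ∀ ω ∈ F.paramPartition x₀ (Icc 0 ε) v, F.IsGoodInterval x₀ ε K v ω := by
  obtain ⟨K, hK, hdist⟩ := P.exists_distortion
  have hlam := F.lam_pos
  refine ⟨max K (1 / c), by positivity, fun v hv hv1 ω hω => ?_⟩
  obtain ⟨c', d', hcd, rfl, h0, hf⟩ := mem_partition hv1 hω
  have hsub : ∀ a ∈ Ioo c' d', ∀ a' ∈ Ioo c' d', uIcc a a' ⊆ Ioo 0 ε ∩ F.free x₀ v :=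
    fun a ha a' ha' => (ordConnected_Ioo.uIcc_subset ha ha').trans (subset_inter h0 hf)
  refine ⟨P.start, P.ε_le_one, by positivity, ⟨c', d', hcd, rfl⟩, h0, hf,
    P.injOn ordConnected_Ioo h0 hv1 hf,
    fun a ha => P.deriv_ne_zero (h0 ha) hv1 (hf ha), fun a ha a' ha' => ?_, ?_⟩
  · refine (hdist v hv a a' (hsub a ha a' ha')).trans ?_
    gcongr
    exact le_max_left _ _
  · rw [Real.volume_real_Ioo_of_le hcd.le]
    have hc := P.c_pos
    have hle : ∀ t ∈ Ioo (0 : ℝ) ((d' - c') / 2), d' - c' - 2 * t ≤ max K (1 / c) / lam ^ v := by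
      intro t ht
      have h1 : c' + t ∈ Ioo c' d' := ⟨by linarith [ht.1], by linarith [ht.2]⟩
      have h2 : d' - t ∈ Ioo c' d' := ⟨by linarith [ht.2], by linarith [ht.1]⟩
      have h3 := P.lam_pow_mul_abs_sub_le hv (hsub _ h2 _ h1)
      have o1 := P.start.orbit_mem (P.mem_Icc (h0 h1)) v
      have o2 := P.start.orbit_mem (P.mem_Icc (h0 h2)) v
      have h4 : |F.orbit x₀ v (d' - t) - F.orbit x₀ v (c' + t)| ≤ 1 :=
        abs_le.2 ⟨by linarith [o1.2, o2.1], by linarith [o1.1, o2.2]⟩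
      have h5 : d' - c' - 2 * t ≤ |d' - t - (c' + t)| := le_trans (by linarith) (le_abs_self _)
      rw [le_div_iff₀ (by positivity)]
      have h6 : |d' - t - (c' + t)| * lam ^ v ≤ 1 / c := by
        rw [le_div_iff₀ hc]; linarith
      have h7 : (d' - c' - 2 * t) * lam ^ v ≤ |d' - t - (c' + t)| * lam ^ v := by gcongr
      exact h7.trans (h6.trans (le_max_right _ _))
    have hlim : Tendsto (fun t : ℝ => d' - c' - 2 * t) (𝓝[>] 0) (𝓝 (d' - c' - 2 * 0)) :=
      (Continuous.tendsto (by fun_prop) 0).mono_left nhdsWithin_le_nhds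
    rw [mul_zero, sub_zero] at hlim
    refine le_of_tendsto hlim ?_
    filter_upwards [Ioo_mem_nhdsGT (by linarith : (0 : ℝ) < (d' - c') / 2)] with t ht
    exact hle t ht

namespace IsGoodInterval

variable {ε K : ℝ} {v : ℕ} {ω : Set ℝ} (g : F.IsGoodInterval x₀ ε K v ω)
include g

lemma mem_Ioo (ha : a ∈ ω) : a ∈ Ioo (0 : ℝ) 1 :=
  ⟨(g.subset ha).1, (g.subset ha).2.trans_le g.eps_le_one⟩

lemma mem_Icc (ha : a ∈ ω) : a ∈ Icc (0 : ℝ) 1 := Ioo_subset_Icc_self (g.mem_Ioo ha)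

lemma measurableSet : MeasurableSet ω := by
  obtain ⟨c, d, -, rfl⟩ := g.exists_eq
  exact measurableSet_Ioo

lemma nonempty : ω.Nonempty := by
  obtain ⟨c, d, h, rfl⟩ := g.exists_eq
  exact nonempty_Ioo.2 h

lemma volume_pos : 0 < volume.real ω := by
  obtain ⟨c, d, h, rfl⟩ := g.exists_eq
  rw [Real.volume_real_Ioo_of_le h.le]; linarith

lemma volume_ne_top : volume ω ≠ ∞ := by
  obtain ⟨c, d, -, rfl⟩ := g.exists_eq
  simp

lemma abs_sub_le (ha : a ∈ ω) {a' : ℝ} (ha' : a' ∈ ω) : |a - a'| ≤ volume.real ω := by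
  obtain ⟨c, d, h, rfl⟩ := g.exists_eq
  rw [Real.volume_real_Ioo_of_le h.le]
  exact abs_le.2 ⟨by linarith [ha.1, ha'.2], by linarith [ha.2, ha'.1]⟩

lemma differentiableAt (ha : a ∈ ω) : DifferentiableAt ℝ (F.orbit x₀ v) a :=
  g.start.differentiableAt_orbit (g.mem_Ioo ha) (g.subset_free ha)

lemma hasDerivWithinAt (ha : a ∈ ω) :
    HasDerivWithinAt (F.orbit x₀ v) (deriv (F.orbit x₀ v) a) ω a :=
  (g.differentiableAt ha).hasDerivAt.hasDerivWithinAt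

lemma continuousOn : ContinuousOn (F.orbit x₀ v) ω := fun _ ha =>
  (g.differentiableAt ha).continuousAt.continuousWithinAt

lemma image_subset : F.orbit x₀ v '' ω ⊆ Icc 0 1 := by
  rintro _ ⟨a, ha, rfl⟩
  exact g.start.orbit_mem (g.mem_Icc ha) v

lemma image_ordConnected : (F.orbit x₀ v '' ω).OrdConnected := by
  obtain ⟨c, d, h, rfl⟩ := g.exists_eq
  exact (isPreconnected_Ioo.image _ g.continuousOn).ordConnected

lemma abs_deriv_le (ha : a ∈ ω) {a' : ℝ} (ha' : a' ∈ ω) :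
    |deriv (F.orbit x₀ v) a| ≤ (1 + K) * |deriv (F.orbit x₀ v) a'| := by
  have h1 := g.distortion a ha a' ha'
  have h2 : |F.orbit x₀ v a - F.orbit x₀ v a'| ^ α ≤ 1 := by
    have o1 := g.start.orbit_mem (g.mem_Icc ha) v
    have o2 := g.start.orbit_mem (g.mem_Icc ha') v
    exact Real.rpow_le_one (abs_nonneg _)
      (abs_le.2 ⟨by linarith [o1.1, o2.2], by linarith [o1.2, o2.1]⟩) F.α_pos.le
  have hK := g.K_pos
  have h3 : K * |F.orbit x₀ v a - F.orbit x₀ v a'| ^ α * |deriv (F.orbit x₀ v) a'| ≤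
      K * 1 * |deriv (F.orbit x₀ v) a'| := by gcongr
  have h4 := abs_sub_abs_le_abs_sub (deriv (F.orbit x₀ v) a) (deriv (F.orbit x₀ v) a')
  linarith

lemma volume_image : volume (F.orbit x₀ v '' ω) =
    ∫⁻ a in ω, ENNReal.ofReal |deriv (F.orbit x₀ v) a| := by
  have := lintegral_image_eq_lintegral_abs_deriv_mul g.measurableSet
    (fun a ha => g.hasDerivWithinAt ha) g.injOn fun _ => 1
  simpa using this

lemma volume_image_le (ha : a ∈ ω) : volume.real (F.orbit x₀ v '' ω) ≤
    volume.real ω * ((1 + K) * |deriv (F.orbit x₀ v) a|) := by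
  have hK := g.K_pos
  refine ENNReal.toReal_le_of_le_ofReal (by positivity) ?_
  rw [g.volume_image]
  calc _ ≤ ∫⁻ _t in ω, ENNReal.ofReal ((1 + K) * |deriv (F.orbit x₀ v) a|) :=
        setLIntegral_mono' g.measurableSet fun t ht =>
          ENNReal.ofReal_le_ofReal (g.abs_deriv_le ht ha)
    _ = _ := by
      rw [setLIntegral_const, mul_comm, ENNReal.ofReal_mul measureReal_nonneg, Measure.real,
        ENNReal.ofReal_toReal g.volume_ne_top]

lemma volume_mul_le (ha : a ∈ ω) : volume.real ω * |deriv (F.orbit x₀ v) a| ≤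
    (1 + K) * volume.real (F.orbit x₀ v '' ω) := by
  have hK := g.K_pos
  have hfin : volume (F.orbit x₀ v '' ω) ≠ ∞ :=
    ((measure_mono g.image_subset).trans_lt (by simp)).ne
  rw [Measure.real, Measure.real, mul_comm, ← div_le_iff₀' (by positivity : 0 < 1 + K)]
  have h1 : ENNReal.ofReal (|deriv (F.orbit x₀ v) a| / (1 + K)) * volume ω ≤
      volume (F.orbit x₀ v '' ω) := by
    rw [g.volume_image, ← setLIntegral_const]
    refine setLIntegral_mono' g.measurableSet fun t ht => ENNReal.ofReal_le_ofReal ?_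
    rw [div_le_iff₀' (by positivity)]
    exact g.abs_deriv_le ha ht
  have h2 := ENNReal.toReal_mono hfin h1
  rw [ENNReal.toReal_mul, ENNReal.toReal_ofReal (by positivity)] at h2
  rw [mul_div_right_comm]
  exact h2

lemma volume_image_pos : 0 < volume.real (F.orbit x₀ v '' ω) := by
  obtain ⟨a, ha⟩ := g.nonempty
  have h1 := g.volume_mul_le ha
  have h2 := mul_pos g.volume_pos (abs_pos.2 (g.deriv_ne a ha))
  have hK := g.K_pos
  exact pos_of_mul_pos_right (h2.trans_le h1) (by positivity)

/-- Change of variables for nonnegative functions. -/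
lemma lintegral_comp_orbit_le (f : ℝ → ℝ≥0∞) : ∫⁻ a in ω, f (F.orbit x₀ v a) ≤
    ENNReal.ofReal ((1 + K) * volume.real ω / volume.real (F.orbit x₀ v '' ω)) *
      ∫⁻ y in Icc (0 : ℝ) 1, f y := by
  have hK := g.K_pos
  have hI := g.volume_image_pos
  have hW := g.volume_pos
  set κ := (1 + K) * volume.real ω / volume.real (F.orbit x₀ v '' ω) with hκ
  have hκ0 : 0 < κ := by positivity
  calc ∫⁻ a in ω, f (F.orbit x₀ v a)
      ≤ ∫⁻ a in ω, ENNReal.ofReal κ *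
          (ENNReal.ofReal |deriv (F.orbit x₀ v) a| * f (F.orbit x₀ v a)) := by
        refine setLIntegral_mono' g.measurableSet fun a ha => ?_
        rw [← mul_assoc, ← ENNReal.ofReal_mul hκ0.le]
        refine le_mul_of_one_le_left zero_le ?_
        rw [← ENNReal.ofReal_one]
        refine ENNReal.ofReal_le_ofReal ?_
        rw [hκ, div_mul_eq_mul_div, le_div_iff₀ hI]
        have := g.volume_image_le ha
        linarith
    _ = ENNReal.ofReal κ * ∫⁻ y in F.orbit x₀ v '' ω, f y := by
        rw [lintegral_const_mul' _ _ ENNReal.ofReal_ne_top,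
          lintegral_image_eq_lintegral_abs_deriv_mul g.measurableSet
            (fun a ha => g.hasDerivWithinAt ha) g.injOn]
    _ ≤ _ := by gcongr; exact g.image_subset

/-- The normalised image of Lebesgue measure on `ω` under `x_v` has a density in `V_α`. -/
lemma exists_density {A : ℝ} (hA : 0 < A) : ∃ w : ℝ → ℝ, MemGBV α A w ∧
    nrm α A w ≤ (4 * A ^ (1 - α) + 5) * (1 + K) ^ 2 / volume.real (F.orbit x₀ v '' ω) ∧
    ∀ f : ℝ → ℝ, ∫ a in ω, f (F.orbit x₀ v a) =
      volume.real ω * ∫ y in Icc (0 : ℝ) 1, w y * f y := by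
  have hK := g.K_pos
  have hI0 := g.volume_image_pos
  have hW := g.volume_pos
  set I := F.orbit x₀ v '' ω with hI
  set V := volume.real I with hV
  set W := volume.real ω with hWdef
  set inv := Function.invFunOn (F.orbit x₀ v) ω with hinv
  have hmem : ∀ y ∈ I, inv y ∈ ω := fun y hy => Function.invFunOn_mem hy
  have heq : ∀ y ∈ I, F.orbit x₀ v (inv y) = y := fun y hy => Function.invFunOn_eq hy
  have hleft : ∀ a ∈ ω, inv (F.orbit x₀ v a) = a := fun a ha => g.injOn.leftInvOn_invFunOn ha
  set w0 : ℝ → ℝ := fun y => 1 / (W * |deriv (F.orbit x₀ v) (inv y)|) with hw0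
  have hw0le : ∀ y ∈ I, |w0 y| ≤ (1 + K) / V := by
    intro y hy
    have hd := abs_pos.2 (g.deriv_ne _ (hmem y hy))
    have h1 := g.volume_image_le (hmem y hy)
    rw [hw0, abs_of_pos (by positivity), div_le_div_iff₀ (by positivity) hI0]
    linarith
  have hw0h : ∀ y ∈ I, ∀ y' ∈ I, |w0 y - w0 y'| ≤ K * (1 + K) / V * |y - y'| ^ α := by
    intro y hy y' hy'
    have hd := abs_pos.2 (g.deriv_ne _ (hmem y hy))
    have hd' := abs_pos.2 (g.deriv_ne _ (hmem y' hy'))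
    have h1 := g.distortion _ (hmem y hy) _ (hmem y' hy')
    rw [heq y hy, heq y' hy'] at h1
    have h2 := abs_abs_sub_abs_le_abs_sub (deriv (F.orbit x₀ v) (inv y))
      (deriv (F.orbit x₀ v) (inv y'))
    have h3 := hw0le y hy
    have key : ∀ z z' : ℝ, 0 < z → 0 < z' →
        1 / (W * z) - 1 / (W * z') = 1 / (W * z) * ((z' - z) / z') := by
      intro z z' hz hz'
      field_simp
    have e : w0 y - w0 y' = w0 y * ((|deriv (F.orbit x₀ v) (inv y')| -
        |deriv (F.orbit x₀ v) (inv y)|) / |deriv (F.orbit x₀ v) (inv y')|) := key _ _ hd hd'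
    rw [e, abs_mul, abs_div (_ - _), abs_abs,
      abs_sub_comm |deriv (F.orbit x₀ v) (inv y')|]
    have h4 : |(|deriv (F.orbit x₀ v) (inv y)| - |deriv (F.orbit x₀ v) (inv y')|)| /
        |deriv (F.orbit x₀ v) (inv y')| ≤ K * |y - y'| ^ α := by
      rw [div_le_iff₀ hd']
      exact h2.trans h1
    calc _ ≤ (1 + K) / V * (K * |y - y'| ^ α) := by gcongr
      _ = _ := by ring
  have hIm : MeasurableSet I := g.image_ordConnected.measurableSet
  have hcont : ContinuousOn w0 I := continuousOn_of_abs_sub_le_rpow F.α_pos hw0h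
  set w := I.indicator w0 with hw
  have hwb : ∀ y, |w y| ≤ (1 + K) / V := by
    intro y
    by_cases hy : y ∈ I
    · rw [hw, indicator_of_mem hy]; exact hw0le y hy
    · rw [hw, indicator_of_notMem hy, abs_zero]; positivity
  have hwi : IntegrableOn w (Icc 0 1) := by
    have hm : AEStronglyMeasurable w volume :=
      (aestronglyMeasurable_indicator_iff hIm).2 (hcont.aestronglyMeasurable hIm)
    exact Integrable.of_bound (C := (1 + K) / V) hm.restrict (Eventually.of_forall hwb)
  obtain ⟨h1, h2⟩ := memGBV_of_holder F.α_pos F.α_le_one hA g.image_ordConnected g.image_subset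
    (fun y hy => indicator_of_notMem hy w0) hwi (H := K * (1 + K) / V) (by positivity) hwb
    (fun y hy y' hy' => by
      rw [indicator_of_mem hy, indicator_of_mem hy']; exact hw0h y hy y' hy')
  refine ⟨w, h1, h2.trans (le_of_eq (by field_simp; ring)), fun f => ?_⟩
  have h3 := integral_image_eq_integral_abs_deriv_smul g.measurableSet
    (fun a ha => g.hasDerivWithinAt ha) g.injOn fun y => w y * f y
  have h4 : ∫ y in Icc (0 : ℝ) 1, w y * f y = ∫ y in I, w y * f y := by
    have e : (fun y => w y * f y) = I.indicator fun y => w0 y * f y := by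
      funext y
      by_cases hy : y ∈ I <;> simp [hw, hy]
    rw [e, setIntegral_indicator hIm, setIntegral_indicator hIm, inter_self,
      inter_eq_right.2 g.image_subset]
  rw [h4, h3, ← integral_const_mul]
  refine setIntegral_congr_fun g.measurableSet fun a ha => ?_
  have hd := abs_pos.2 (g.deriv_ne a ha)
  have hmemI : F.orbit x₀ v a ∈ I := mem_image_of_mem _ ha
  have ew : w (F.orbit x₀ v a) = 1 / (W * |deriv (F.orbit x₀ v) a|) := by
    rw [hw, indicator_of_mem hmemI]
    show 1 / (W * |deriv (F.orbit x₀ v) (inv (F.orbit x₀ v a))|) = _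
    rw [hleft a ha]
  show _ = W * (|deriv (F.orbit x₀ v) a| • (w (F.orbit x₀ v a) * f (F.orbit x₀ v a)))
  rw [ew, smul_eq_mul]
  field_simp

end IsGoodInterval

end ExpandingFamily

namespace ExpandingFamily

variable {α lam Lam : ℝ} {p₀ p₁ : ℕ} {F : ExpandingFamily α lam Lam p₀ p₁} {a : ℝ}
  {x₀ : ℝ → ℝ}

lemma aemeasurable_iterate_T (ha : a ∈ Icc (0 : ℝ) 1) (n : ℕ) : AEMeasurable (F.T a)^[n] leb :=
  (F.aesm_comp_iterate ha (f := id) aestronglyMeasurable_id n).aemeasurable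

lemma orbit_add (v j : ℕ) (a : ℝ) :
    F.orbit x₀ (v + j) a = (F.T a)^[j] (F.orbit x₀ v a) := by
  rw [orbit, orbit, ← Function.iterate_add_apply, add_comm]

/-- The iterates of the maps distort Lebesgue measure by a bounded factor. -/
lemma LasotaYorke.exists_lintegral_iterate_le {A ε C r : ℝ} (H : F.LasotaYorke A ε C r) :
    ∃ c > 0, ∀ a ∈ Icc 0 ε, ∀ j : ℕ, ∀ g : ℝ → ℝ≥0∞, Measurable g →
      ∫⁻ y in Icc (0 : ℝ) 1, g ((F.T a)^[j] y) ≤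
        ENNReal.ofReal c * ∫⁻ y in Icc (0 : ℝ) 1, g y := by
  have hone : MemGBV α A unitFn := memGBV_unitFn F.α_pos F.α_le_one H.A_pos
  have hs := supConst_pos H.A_pos
  have hC := H.C_pos
  have hn := nrm_nonneg (α := α) (A := A) unitFn
  set c := supConst A * (2 * C * nrm α A unitFn) + 1 with hc
  have hc0 : 0 < c := by positivity
  refine ⟨c, hc0, fun a ha j g hg => ?_⟩
  have ha1 := H.mem_unit ha
  have hT := aemeasurable_iterate_T (F := F) ha1 j
  have hle : leb.map (F.T a)^[j] ≤ ENNReal.ofReal c • leb := by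
    refine Measure.le_iff.2 fun S hS => ?_
    rw [Measure.map_apply_of_aemeasurable hT hS, Measure.smul_apply, smul_eq_mul]
    have e := F.setIntegral_iterate_transfer ha1 hone.1 hS j
    have hnull : NullMeasurableSet ((F.T a)^[j] ⁻¹' S) leb := hT.nullMeasurable hS
    have e2 : ∫ x in Icc (0 : ℝ) 1, unitFn x * S.indicator 1 ((F.T a)^[j] x) =
        leb.real ((F.T a)^[j] ⁻¹' S) := by
      rw [← mul_one (leb.real _), ← smul_eq_mul, ← setIntegral_const,
        ← integral_indicator₀ hnull]
      refine integral_congr_ae ?_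
      filter_upwards [unitFn_ae_eq] with x hx
      rw [hx, one_mul]
      rfl
    have e3 : ∫ x in Icc (0 : ℝ) 1 ∩ S, (F.transfer a)^[j] unitFn x ≤
        c * volume.real (Icc (0 : ℝ) 1 ∩ S) := by
      have hb : ∀ᵐ x ∂volume.restrict (Icc (0 : ℝ) 1 ∩ S),
          (F.transfer a)^[j] unitFn x ≤ c := by
        refine ae_mono (Measure.restrict_mono inter_subset_left le_rfl) ?_
        filter_upwards [(H.mem ha hone j).ae_abs_le H.A_pos F.α_pos.le] with x hx
        have h1 := H.nrm_iterate_le ha hone j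
        have h2 : supConst A * nrm α A ((F.transfer a)^[j] unitFn) ≤
          supConst A * (2 * C * nrm α A unitFn) := by gcongr
        linarith [le_abs_self ((F.transfer a)^[j] unitFn x)]
      have hfin : volume (Icc (0 : ℝ) 1 ∩ S) < ∞ :=
        (measure_mono inter_subset_left).trans_lt (by simp)
      have := setIntegral_mono_ae_restrict
        ((F.integrable_iterate_transfer ha1 hone.1 j).mono_set inter_subset_left)
        (integrableOn_const (μ := volume) (C := c) hfin.ne) hb
      rwa [setIntegral_const, smul_eq_mul, mul_comm] at this
    rw [e, e2] at e3
    have hf1 : leb ((F.T a)^[j] ⁻¹' S) ≠ ∞ := measure_ne_top _ _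
    rw [Measure.restrict_apply hS, inter_comm S, ← ENNReal.ofReal_toReal hf1,
      ← ENNReal.ofReal_toReal (a := volume (Icc (0 : ℝ) 1 ∩ S))
        ((measure_mono inter_subset_left).trans_lt (by simp)).ne, ← ENNReal.ofReal_mul hc0.le]
    exact ENNReal.ofReal_le_ofReal e3
  calc ∫⁻ y in Icc (0 : ℝ) 1, g ((F.T a)^[j] y) = ∫⁻ y, g y ∂(leb.map (F.T a)^[j]) :=
        (lintegral_map' hg.aemeasurable hT).symm
    _ ≤ ∫⁻ y, g y ∂(ENNReal.ofReal c • leb) := lintegral_mono' hle le_rfl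
    _ = _ := by rw [lintegral_smul_measure, smul_eq_mul]

/-- Two orbits of the same point for close parameters stay close, as long as one of them stays
away from the partition points. -/
lemma abs_iterate_sub_le {B L s : ℝ} (hB0 : 0 < B) (hL0 : 0 < L)
    (hB : ∀ a ∈ Icc (0 : ℝ) 1, ∀ k < p₀, ∀ x ∈ F.branch k a, |F.pd x a| ≤ B)
    (hL : ∀ k ≤ p₀, ∀ a ∈ Icc (0 : ℝ) 1, ∀ a' ∈ Icc (0 : ℝ) 1,
      |F.b k a - F.b k a'| ≤ L * |a - a'|) {a₀ : ℝ} (ha : a ∈ Icc (0 : ℝ) 1)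
    (ha₀ : a₀ ∈ Icc (0 : ℝ) 1) (hs : |a - a₀| ≤ s) {y : ℝ} (hy : y ∈ Icc (0 : ℝ) 1) (j : ℕ)
    (h : ∀ i < j, ∀ k ≤ p₀,
      Lam ^ i * (B * s / (Lam - 1)) + L * s < |(F.T a₀)^[i] y - F.b k a₀|) :
    |(F.T a)^[j] y - (F.T a₀)^[j] y| + B * s / (Lam - 1) ≤ Lam ^ j * (B * s / (Lam - 1)) := by
  have hLam : 0 < Lam - 1 := by linarith [F.one_lt_lam, F.lam_le_Lam]
  have hs0 : 0 ≤ s := (abs_nonneg _).trans hs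
  set c := B * s / (Lam - 1) with hc
  have hc0 : 0 ≤ c := by positivity
  have hBs : B * s = (Lam - 1) * c := by rw [hc]; field_simp
  induction j with
  | zero => simp
  | succ j ih =>
    have ih := ih fun i hi => h i (hi.trans j.lt_succ_self)
    have hj := h j j.lt_succ_self
    set z := (F.T a)^[j] y with hz
    set w := (F.T a₀)^[j] y with hw
    have hwm : w ∈ Icc (0 : ℝ) 1 := (F.mapsTo a₀ ha₀).iterate j hy
    have hpos : 0 ≤ Lam ^ j * c := by have := F.Lam_pos; positivity
    have havoid : ∀ t ∈ uIcc a a₀, w ∉ F.pts t := by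
      rintro t ht ⟨k, hk, hwk⟩
      have h1 := hL k hk t (uIcc_subset_unit ha ha₀ ht) a₀ ha₀
      have h2 : |t - a₀| ≤ s := by
        rw [uIcc_comm] at ht
        have := abs_sub_le_of_mem_uIcc ht
        rw [abs_sub_comm a₀ a] at this
        exact this.trans hs
      have h3 : L * |t - a₀| ≤ L * s := by gcongr
      have h4 := hj k hk
      rw [hwk] at h4
      linarith
    obtain ⟨k, hk, hwb⟩ := F.exists_mem_branch ha hwm (havoid a left_mem_uIcc)
    have hdist : ∀ k ≤ p₀, Lam ^ j * c < |w - F.b k a| := by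
      intro k hk
      have h1 := hL k hk a ha a₀ ha₀
      have h3 : L * |a - a₀| ≤ L * s := by gcongr
      have h4 := hj k hk
      have h5 : |w - F.b k a₀| ≤ |w - F.b k a| + |F.b k a - F.b k a₀| := abs_sub_le _ _ _
      linarith
    have hzb : z ∈ F.branch k a := by
      have h1 := hdist k hk.le
      have h2 := hdist (k + 1) hk
      rw [abs_of_pos (by linarith [hwb.1])] at h1
      rw [abs_of_neg (by linarith [hwb.2])] at h2
      have h3 := abs_le.1 (le_refl |z - w|)
      exact ⟨by linarith [h3.1], by linarith [h3.2]⟩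
    have h1 := F.abs_sub_le_Lam ha hk hzb hwb
    have h2 := F.abs_T_sub_le hB ha ha₀ hwm havoid
    have h3 : B * |a - a₀| ≤ B * s := by gcongr
    rw [Function.iterate_succ_apply', Function.iterate_succ_apply', ← hz, ← hw]
    have h4 : |F.T a z - F.T a₀ w| ≤ |F.T a z - F.T a w| + |F.T a w - F.T a₀ w| :=
      abs_sub_le _ _ _
    have h5 : Lam * (|z - w| + c) ≤ Lam * (Lam ^ j * c) := by
      have := F.Lam_pos; gcongr
    rw [pow_succ]
    linarith

lemma volume_near_pts_le (a d : ℝ) :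
    volume {x | ∃ k ≤ p₀, |x - F.b k a| ≤ d} ≤ ENNReal.ofReal ((p₀ + 1) * (2 * d)) := by
  have e : {x | ∃ k ≤ p₀, |x - F.b k a| ≤ d} =
      ⋃ k ∈ Finset.range (p₀ + 1), Metric.closedBall (F.b k a) d := by
    ext x
    simp [Real.dist_eq]
  rw [e]
  refine (measure_biUnion_finset_le _ _).trans ?_
  simp only [Real.volume_closedBall, Finset.sum_const, Finset.card_range, nsmul_eq_mul]
  rw [← ENNReal.ofReal_natCast, ← ENNReal.ofReal_mul (by positivity)]
  push_cast
  exact le_rfl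

lemma measurableSet_near_pts (a d : ℝ) : MeasurableSet {x | ∃ k ≤ p₀, |x - F.b k a| ≤ d} := by
  have e : {x | ∃ k ≤ p₀, |x - F.b k a| ≤ d} =
      ⋃ k ∈ Finset.range (p₀ + 1), Metric.closedBall (F.b k a) d := by
    ext x
    simp [Real.dist_eq]
  rw [e]
  exact Finset.measurableSet_biUnion _ fun _ _ => Metric.isClosed_closedBall.measurableSet

/-- On a parameter interval, the orbit may be replaced by the orbit under one single map, with a
small error on average. -/
lemma ParamExpansion.exists_shadowing {ε G M c A C r : ℝ} {N : ℕ}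
    (P : F.ParamExpansion x₀ ε G M c N) (H : F.LasotaYorke A ε C r) {φ : ℝ → ℝ}
    (hφ : MemGBV α A φ) {K : ℝ} (hK : 0 < K) : ∃ E > 0, ∃ R > 0, ∀ v : ℕ, 1 ≤ v → ∀ ω : Set ℝ,
      F.IsGoodInterval x₀ ε K v ω → ∀ a₀ ∈ ω, ∀ q : ℕ,
      E * volume.real ω * Lam ^ q ≤ min A 1 → ∀ j ≤ q,
      ∫⁻ a in ω, ‖φ (F.orbit x₀ (v + j) a) - φ ((F.T a₀)^[j] (F.orbit x₀ v a))‖ₑ ≤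
        ENNReal.ofReal (R * (q + 1) * (E * volume.real ω * Lam ^ q) ^ α *
          (volume.real ω / volume.real (F.orbit x₀ v '' ω))) := by
  obtain ⟨B, hB0, hB⟩ := F.exists_pd_bound
  obtain ⟨L, hL0, hL⟩ := F.exists_lipschitz_b
  obtain ⟨c₁, hc₁, hmap⟩ := H.exists_lintegral_iterate_le
  have hLam : 0 < Lam - 1 := by linarith [F.one_lt_lam, F.lam_le_Lam]
  have hLam1 : 1 ≤ Lam := by linarith
  have hLam0 := F.Lam_pos
  have hS := supConst_pos H.A_pos
  have hn := nrm_nonneg (α := α) (A := A) φ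
  set E := B / (Lam - 1) + L + 1 with hE
  have hE0 : 0 < E := by positivity
  set Mφ := supConst A * nrm α A φ with hM
  have hM0 : 0 ≤ Mφ := by positivity
  have hMφ := hφ.ae_abs_le H.A_pos F.α_pos.le
  refine ⟨E, hE0, (1 + K) * c₁ * (nrm α A φ + 2 * Mφ * ((p₀ + 1) * 2) + 1), by positivity,
    fun v hv ω g a₀ ha₀ q hq j hj => ?_⟩
  have hW := g.volume_pos
  have hV := g.volume_image_pos
  set W := volume.real ω
  set V := volume.real (F.orbit x₀ v '' ω)
  set Δ := E * W * Lam ^ q with hΔ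
  have hΔ0 : 0 < Δ := by positivity
  have hΔA : Δ ∈ Ioc 0 A := ⟨hΔ0, hq.trans (min_le_left _ _)⟩
  have hΔ1 : Δ ≤ 1 := hq.trans (min_le_right _ _)
  have ha₀1 := g.mem_Icc ha₀
  have ha₀ε : a₀ ∈ Icc 0 ε := Ioo_subset_Icc_self (g.subset ha₀)
  set U : Set ℝ := {x | ∃ k ≤ p₀, |x - F.b k a₀| ≤ Δ} with hU
  have hUm : MeasurableSet U := measurableSet_near_pts a₀ Δ
  set b : ℝ → ℝ≥0∞ := fun y => oscReg φ Δ ((F.T a₀)^[j] y) +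
    ENNReal.ofReal (2 * Mφ) * ∑ i ∈ Finset.range j, U.indicator 1 ((F.T a₀)^[i] y) with hb
  have hpt : ∀ᵐ a ∂volume.restrict ω,
      ‖φ (F.orbit x₀ (v + j) a) - φ ((F.T a₀)^[j] (F.orbit x₀ v a))‖ₑ ≤
        b (F.orbit x₀ v a) := by
    have hp : ∀ᵐ y ∂leb, y ∈ regPts φ ∧ |φ y| ≤ Mφ := (ae_mem_regPts φ).and hMφ
    have hsub : volume.restrict ω ≤ volume.restrict (Icc 0 ε) :=
      Measure.restrict_mono (g.subset.trans Ioo_subset_Icc_self) le_rfl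
    filter_upwards [ae_mono hsub (P.ae_comp_orbit (by lia : 1 ≤ v + j) hp),
      ae_mono hsub (P.ae_comp_orbit hv (F.ae_comp_iterate ha₀1 hp j)),
      ae_restrict_mem g.measurableSet] with a h1 h2 ha
    have ha1 := g.mem_Icc ha
    have hy := g.start.orbit_mem ha1 v
    have hw : (F.T a₀)^[j] (F.orbit x₀ v a) ∈ Icc (0 : ℝ) 1 := (F.mapsTo a₀ ha₀1).iterate j hy
    by_cases hcase : ∃ i < j, (F.T a₀)^[i] (F.orbit x₀ v a) ∈ U
    · obtain ⟨i, hi, hiU⟩ := hcase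
      refine le_trans ?_ (le_add_left le_rfl)
      have h3 : (1 : ℝ≥0∞) ≤
          ∑ i ∈ Finset.range j, U.indicator 1 ((F.T a₀)^[i] (F.orbit x₀ v a)) := by
        refine le_trans ?_ (Finset.single_le_sum (f := fun i =>
          U.indicator (1 : ℝ → ℝ≥0∞) ((F.T a₀)^[i] (F.orbit x₀ v a))) (fun _ _ => zero_le)
          (Finset.mem_range.2 hi))
        simp only [indicator_of_mem hiU, Pi.one_apply, le_refl]
      refine le_trans ?_ (le_mul_of_one_le_right zero_le h3)
      rw [← abs_le_ofReal_enorm]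
      refine ENNReal.ofReal_le_ofReal ?_
      have h4 := abs_sub (φ (F.orbit x₀ (v + j) a)) (φ ((F.T a₀)^[j] (F.orbit x₀ v a)))
      linarith [h1.2, h2.2]
    · push Not at hcase
      refine le_trans ?_ (le_add_right le_rfl)
      rw [← osc_eq_oscReg hw hΔ0]
      have h3 := F.abs_iterate_sub_le hB0 hL0 hB hL ha1 ha₀1 (g.abs_sub_le ha ha₀) hy j ?_
      · refine enorm_sub_le_osc h1.1 h2.1 ?_ ⟨by linarith, by linarith⟩
        rw [orbit_add]
        have h4 : Lam ^ j * (B * W / (Lam - 1)) < Δ := by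
          rw [hΔ, hE]
          have h5 : Lam ^ j ≤ Lam ^ q := pow_le_pow_right₀ hLam1 hj
          calc Lam ^ j * (B * W / (Lam - 1)) ≤ Lam ^ q * (B * W / (Lam - 1)) := by gcongr
            _ = B / (Lam - 1) * W * Lam ^ q := by ring
            _ < _ := by gcongr; linarith
        have h5 : 0 ≤ B * W / (Lam - 1) := by positivity
        have h6 := abs_le.1 (le_refl |(F.T a)^[j] (F.orbit x₀ v a) -
          (F.T a₀)^[j] (F.orbit x₀ v a)|)
        exact ⟨by linarith [h6.1], by linarith [h6.2]⟩
      · intro i hi k hk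
        have h3 : ¬ |(F.T a₀)^[i] (F.orbit x₀ v a) - F.b k a₀| ≤ Δ :=
          fun h => hcase i hi ⟨k, hk, h⟩
        refine lt_of_le_of_lt ?_ (not_le.1 h3)
        have h5 : Lam ^ i ≤ Lam ^ q := pow_le_pow_right₀ hLam1 (hi.le.trans hj)
        have h6 : 1 ≤ Lam ^ q := one_le_pow₀ hLam1
        calc Lam ^ i * (B * W / (Lam - 1)) + L * W
            ≤ Lam ^ q * (B * W / (Lam - 1)) + (L * W) * Lam ^ q := by
              refine add_le_add (by gcongr) (le_mul_of_one_le_right (by positivity) h6)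
          _ = (B / (Lam - 1) + L) * W * Lam ^ q := by ring
          _ ≤ _ := by
              rw [hΔ]
              exact mul_le_mul_of_nonneg_right (mul_le_mul_of_nonneg_right (by linarith) hW.le)
                (by positivity)
  have hΔα : Δ ≤ Δ ^ α := by
    calc Δ = Δ ^ (1 : ℝ) := (Real.rpow_one _).symm
      _ ≤ Δ ^ α := Real.rpow_le_rpow_of_exponent_ge hΔ0 hΔ1 F.α_le_one
  have hosc : ∫⁻ y in Icc (0 : ℝ) 1, oscReg φ Δ ((F.T a₀)^[j] y) ≤
      ENNReal.ofReal (c₁ * (Δ ^ α * nrm α A φ)) := by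
    rw [ENNReal.ofReal_mul hc₁.le]
    refine (hmap a₀ ha₀ε j _ (measurable_oscReg φ Δ)).trans ?_
    rw [← lintegral_congr_ae (osc_ae_eq φ hΔ0)]
    gcongr
    exact lintegral_osc_le hφ hΔA
  have hind : ∀ i, ∫⁻ y in Icc (0 : ℝ) 1, U.indicator 1 ((F.T a₀)^[i] y) ≤
      ENNReal.ofReal (c₁ * ((p₀ + 1) * (2 * Δ))) := by
    intro i
    rw [ENNReal.ofReal_mul hc₁.le]
    refine (hmap a₀ ha₀ε i _ (measurable_one.indicator hUm)).trans ?_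
    gcongr
    rw [lintegral_indicator_one hUm]
    exact (Measure.restrict_apply_le _ _).trans (volume_near_pts_le a₀ Δ)
  have hbint : ∫⁻ y in Icc (0 : ℝ) 1, b y ≤ ENNReal.ofReal (c₁ * (Δ ^ α * nrm α A φ) +
      2 * Mφ * (q * (c₁ * ((p₀ + 1) * (2 * Δ))))) := by
    have hm : ∀ i, AEMeasurable (fun y => U.indicator (1 : ℝ → ℝ≥0∞) ((F.T a₀)^[i] y)) leb :=
      fun i => (measurable_one.indicator hUm).comp_aemeasurable (aemeasurable_iterate_T ha₀1 i)
    simp only [hb]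
    rw [lintegral_add_left' (f := fun y => oscReg φ Δ ((F.T a₀)^[j] y)) ((measurable_oscReg φ Δ).comp_aemeasurable
      (aemeasurable_iterate_T ha₀1 j)), lintegral_const_mul' _ _ ENNReal.ofReal_ne_top,
      lintegral_finsetSum' _ fun i _ => hm i, ENNReal.ofReal_add (by positivity) (by positivity),
      ENNReal.ofReal_mul (p := 2 * Mφ) (by positivity)]
    gcongr
    calc _ ≤ ∑ _i ∈ Finset.range j, ENNReal.ofReal (c₁ * ((p₀ + 1) * (2 * Δ))) :=
          Finset.sum_le_sum fun i _ => hind i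
      _ = j * ENNReal.ofReal (c₁ * ((p₀ + 1) * (2 * Δ))) := by simp
      _ ≤ q * ENNReal.ofReal (c₁ * ((p₀ + 1) * (2 * Δ))) := by gcongr
      _ = _ := by rw [← ENNReal.ofReal_natCast, ← ENNReal.ofReal_mul (by positivity)]
  calc _ ≤ ∫⁻ a in ω, b (F.orbit x₀ v a) := lintegral_mono_ae hpt
    _ ≤ ENNReal.ofReal ((1 + K) * W / V) * ∫⁻ y in Icc (0 : ℝ) 1, b y :=
        g.lintegral_comp_orbit_le b
    _ ≤ ENNReal.ofReal ((1 + K) * W / V) * ENNReal.ofReal (c₁ * (Δ ^ α * nrm α A φ) +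
      2 * Mφ * (q * (c₁ * ((p₀ + 1) * (2 * Δ))))) := by gcongr
    _ = ENNReal.ofReal ((1 + K) * W / V * (c₁ * (Δ ^ α * nrm α A φ) +
      2 * Mφ * (q * (c₁ * ((p₀ + 1) * (2 * Δ)))))) := (ENNReal.ofReal_mul (by positivity)).symm
    _ ≤ _ := by
      refine ENNReal.ofReal_le_ofReal ?_
      have h1 : c₁ * (Δ ^ α * nrm α A φ) + 2 * Mφ * (q * (c₁ * ((p₀ + 1) * (2 * Δ)))) ≤
          c₁ * (Δ ^ α * (nrm α A φ * (q + 1))) +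
          2 * Mφ * ((q + 1) * (c₁ * ((p₀ + 1) * (2 * Δ ^ α)))) := by
        gcongr
        · exact le_mul_of_one_le_right hn (by linarith [Nat.cast_nonneg (α := ℝ) q])
        · linarith
      have h2 : 0 ≤ (1 + K) * W / V * (c₁ * (q + 1) * Δ ^ α) := by positivity
      calc _ ≤ (1 + K) * W / V * (c₁ * (Δ ^ α * (nrm α A φ * (q + 1))) +
          2 * Mφ * ((q + 1) * (c₁ * ((p₀ + 1) * (2 * Δ ^ α))))) := by gcongr
        _ ≤ (1 + K) * W / V * (c₁ * (Δ ^ α * (nrm α A φ * (q + 1))) +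
          2 * Mφ * ((q + 1) * (c₁ * ((p₀ + 1) * (2 * Δ ^ α))))) +
          (1 + K) * W / V * (c₁ * (q + 1) * Δ ^ α) := le_add_of_nonneg_right h2
        _ = _ := by ring

end ExpandingFamily

lemma sq_sum_range (x : ℕ → ℝ) (n : ℕ) : (∑ i ∈ Finset.range n, x i) ^ 2 =
    ∑ i ∈ Finset.range n, (x i * x i + 2 * ∑ l ∈ Finset.range i, x l * x i) := by
  induction n with
  | zero => simp
  | succ n ih =>
    rw [Finset.sum_range_succ, Finset.sum_range_succ _ n, ← ih, ← Finset.sum_mul]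
    ring

/-- Double sums of nearly stationary covariances. -/
lemma abs_quadratic_sub_le {c : ℕ → ℝ} {q : ℕ → ℕ → ℝ} {K ρ e : ℝ} {n : ℕ} (hρ : 0 < ρ)
    (hρ1 : ρ < 1) (he : 0 ≤ e) (hc : ∀ i, |c i| ≤ K * ρ ^ i)
    (hq : ∀ i < n, ∀ l ≤ i, |q l i - c (i - l)| ≤ e) :
    |∑ i ∈ Finset.range n, (q i i + 2 * ∑ l ∈ Finset.range i, q l i) -
      n * (c 0 + 2 * ∑' i, c (i + 1))| ≤ 2 * n ^ 2 * e + 2 * K / (1 - ρ) ^ 2 := by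
  have hK : 0 ≤ K := by simpa using (abs_nonneg _).trans (hc 0)
  have h1ρ : 0 < 1 - ρ := by linarith
  have hgeo : Summable fun i : ℕ => ρ ^ i := summable_geometric_of_lt_one hρ.le hρ1
  have hsum : ∀ k, Summable fun i => |c (i + k)| := by
    intro k
    refine Summable.of_nonneg_of_le (fun _ => abs_nonneg _) (fun i => hc (i + k)) ?_
    simpa only [pow_add, ← mul_assoc] using (hgeo.mul_left K).mul_right (ρ ^ k)
  have htail : ∀ i, |∑' l, c (l + (i + 1))| ≤ K / (1 - ρ) * ρ ^ i := by
    intro i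
    have h2 : ∀ l, |c (l + (i + 1))| ≤ K * ρ ^ i * ρ ^ l := by
      intro l
      refine (hc _).trans ?_
      rw [mul_assoc, ← pow_add]
      gcongr K * ?_
      exact pow_le_pow_of_le_one hρ.le hρ1.le (by lia)
    have h3 : |∑' l, c (l + (i + 1))| ≤ ∑' l, |c (l + (i + 1))| := by
      have := norm_tsum_le_tsum_norm (f := fun l => c (l + (i + 1)))
        (by simpa only [Real.norm_eq_abs] using hsum (i + 1))
      simpa only [Real.norm_eq_abs] using this
    refine h3.trans ((Summable.tsum_le_tsum h2 (hsum _) (hgeo.mul_left _)).trans (le_of_eq ?_))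
    rw [tsum_mul_left, tsum_geometric_of_lt_one hρ.le hρ1]
    field_simp
  have hrefl : ∀ i, ∑ l ∈ Finset.range i, c (i - l) = ∑ l ∈ Finset.range i, c (l + 1) := by
    intro i
    rw [← Finset.sum_range_reflect (fun l => c (l + 1)) i]
    refine Finset.sum_congr rfl fun l hl => ?_
    have := Finset.mem_range.1 hl
    congr 1
    lia
  have hrow : ∀ i < n, |q i i + 2 * ∑ l ∈ Finset.range i, q l i -
      (c 0 + 2 * ∑' i, c (i + 1))| ≤ 2 * n * e + 2 * K / (1 - ρ) * ρ ^ i := by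
    intro i hi
    have h1 := hq i hi i le_rfl
    rw [Nat.sub_self] at h1
    have h2 : |∑ l ∈ Finset.range i, q l i - ∑ l ∈ Finset.range i, c (i - l)| ≤ i * e := by
      rw [← Finset.sum_sub_distrib]
      refine (Finset.abs_sum_le_sum_abs _ _).trans ?_
      refine (Finset.sum_le_sum fun l hl => hq i hi l (Finset.mem_range.1 hl).le).trans ?_
      simp
    rw [hrefl] at h2
    have h3 : ∑' i, c (i + 1) = ∑ l ∈ Finset.range i, c (l + 1) + ∑' l, c (l + (i + 1)) := by
      rw [← ((summable_abs_iff.1 (hsum 1)).sum_add_tsum_nat_add i)]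
      rfl
    have h4 := htail i
    have h5 : ((i : ℝ) + 1) * e ≤ n * e := by
      gcongr
      exact_mod_cast hi
    rw [h3]
    have e1 : q i i + 2 * ∑ l ∈ Finset.range i, q l i -
        (c 0 + 2 * (∑ l ∈ Finset.range i, c (l + 1) + ∑' l, c (l + (i + 1)))) =
        (q i i - c 0) + 2 * (∑ l ∈ Finset.range i, q l i - ∑ l ∈ Finset.range i, c (l + 1)) -
        2 * ∑' l, c (l + (i + 1)) := by ring
    rw [e1]
    refine (abs_sub _ _).trans ((add_le_add_left (abs_add_le _ _) _).trans ?_)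
    rw [abs_mul, abs_mul, abs_two]
    have h6 : 2 * K / (1 - ρ) * ρ ^ i = 2 * (K / (1 - ρ) * ρ ^ i) := by ring
    linarith
  have e2 : (n : ℝ) * (c 0 + 2 * ∑' i, c (i + 1)) =
      ∑ _i ∈ Finset.range n, (c 0 + 2 * ∑' i, c (i + 1)) := by
    rw [Finset.sum_const, Finset.card_range, nsmul_eq_mul]
  rw [e2, ← Finset.sum_sub_distrib]
  refine (Finset.abs_sum_le_sum_abs _ _).trans
    ((Finset.sum_le_sum fun i hi => hrow i (Finset.mem_range.1 hi)).trans ?_)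
  rw [Finset.sum_add_distrib, Finset.sum_const, Finset.card_range, nsmul_eq_mul, ← Finset.mul_sum]
  have h7 : ∑ i ∈ Finset.range n, ρ ^ i ≤ 1 / (1 - ρ) := by
    rw [one_div, ← tsum_geometric_of_lt_one hρ.le hρ1]
    exact hgeo.sum_le_tsum _ fun _ _ => by positivity
  have h8 : 2 * K / (1 - ρ) * ∑ i ∈ Finset.range n, ρ ^ i ≤ 2 * K / (1 - ρ) * (1 / (1 - ρ)) := by
    gcongr
  have h9 : 2 * K / (1 - ρ) * (1 / (1 - ρ)) = 2 * K / (1 - ρ) ^ 2 := by field_simp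
  have h10 : (n : ℝ) * (2 * n * e) = 2 * n ^ 2 * e := by ring
  rw [h10]
  exact add_le_add_right (h8.trans h9.le) _

lemma abs_div_sub_div_le {x y s t s₀ X : ℝ} (h0 : 0 < s₀) (hs : s₀ ≤ s) (ht : s₀ ≤ t)
    (hy : |y| ≤ X) : |x / s - y / t| ≤ |x - y| / s₀ + X * |s - t| / s₀ ^ 2 := by
  have hs0 : 0 < s := h0.trans_le hs
  have ht0 : 0 < t := h0.trans_le ht
  have e : x / s - y / t = (x - y) / s - y * (s - t) / (s * t) := by field_simp; ring
  have hX : 0 ≤ X := (abs_nonneg _).trans hy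
  rw [e]
  refine (abs_sub _ _).trans (add_le_add ?_ ?_)
  · rw [abs_div, abs_of_pos hs0]
    gcongr
  · rw [abs_div, abs_mul, abs_of_pos (mul_pos hs0 ht0), sq]
    gcongr

namespace ExpandingFamily

variable {α lam Lam : ℝ} {p₀ p₁ : ℕ} {F : ExpandingFamily α lam Lam p₀ p₁} {a : ℝ}
  {x₀ : ℝ → ℝ}

namespace ParamExpansion

variable {ε G M c : ℝ} {N : ℕ} (P : F.ParamExpansion x₀ ε G M c N)
include P

lemma aesm_comp_orbit {k : ℕ} (hk : 1 ≤ k) {f : ℝ → ℝ} (hf : AEStronglyMeasurable f leb) :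
    AEStronglyMeasurable (fun a => f (F.orbit x₀ k a)) (volume.restrict (Icc 0 ε)) := by
  set S := Ioo 0 ε \ (Ioo 0 ε \ F.free x₀ k) with hS
  have hSm : MeasurableSet S := measurableSet_Ioo.diff (P.finite_hits k).measurableSet
  have hX : AEMeasurable (F.orbit x₀ k) (volume.restrict (Icc 0 ε)) := by
    have h1 : ContinuousOn (F.orbit x₀ k) S := by
      intro a ha
      have hf : a ∈ F.free x₀ k := by
        by_contra h
        exact ha.2 ⟨ha.1, h⟩
      exact (P.differentiableAt ha.1 hf).continuousAt.continuousWithinAt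
    have h2 : volume.restrict (Icc 0 ε) = volume.restrict S := by
      refine Measure.restrict_congr_set (Ioo_ae_eq_Icc.symm.trans ?_)
      exact (sdiff_null_ae_eq_self ((P.finite_hits k).measure_zero volume)).symm
    rw [h2]
    exact h1.aemeasurable hSm
  have h3 : (fun a => f (F.orbit x₀ k a)) =ᵐ[volume.restrict (Icc 0 ε)]
      fun a => hf.mk f (F.orbit x₀ k a) := P.ae_comp_orbit hk hf.ae_eq_mk
  refine AEStronglyMeasurable.congr ?_ h3.symm
  exact (hf.stronglyMeasurable_mk.measurable.comp_aemeasurable hX).aestronglyMeasurable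

variable {A C r D ρ : ℝ} (H : F.SpectralGap A ε C r D ρ) {φ : ℝ → ℝ} (hφ : MemGBV α A φ)
  {s : ℝ} (hs : 0 < s) (hσ : ∀ a ∈ Icc 0 ε, s ≤ F.sigma φ a) {m : ℕ} (hm : 1 ≤ m)
include H hφ hs hσ hm

lemma ae_abs_xi_le : ∀ᵐ a ∂volume.restrict (Icc 0 ε),
    |F.xi x₀ φ m a| ≤ 2 * (supConst A * nrm α A φ) / s := by
  have hM := hφ.ae_abs_le H.A_pos F.α_pos.le
  filter_upwards [P.ae_comp_orbit hm hM, ae_restrict_mem measurableSet_Icc] with a h ha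
  have h1 := F.abs_mean_le (H.mem_unit ha) hM
  have h2 := hσ a ha
  have hσ0 : 0 < F.sigma φ a := hs.trans_le h2
  rw [xi, abs_div, abs_of_pos hσ0]
  have h3 := abs_sub (φ (F.orbit x₀ m a)) (F.mean φ a)
  have := supConst_pos H.A_pos
  have := nrm_nonneg (α := α) (A := A) φ
  gcongr
  linarith

lemma aesm_xi : AEStronglyMeasurable (F.xi x₀ φ m) (volume.restrict (Icc 0 ε)) := by
  obtain ⟨K, -, -, hK⟩ := H.exists_cov_bound hφ
  obtain ⟨c', -, hc'⟩ := H.exists_sigma_sub_le hφ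
  have hα := F.α_pos
  have h1 : ContinuousOn (F.mean φ) (Icc 0 ε) :=
    continuousOn_of_abs_sub_le_rpow (by positivity : 0 < α / 4) fun x hx y hy => (hK x hx y hy).1
  have h2 : ContinuousOn (F.sigma φ) (Icc 0 ε) :=
    continuousOn_of_abs_sub_le_rpow (by positivity : 0 < α / 16) hc'
  have h3 := h2.inv₀ fun x hx => (hs.trans_le (hσ x hx)).ne'
  have e : F.xi x₀ φ m = fun a => (φ (F.orbit x₀ m a) - F.mean φ a) * (F.sigma φ a)⁻¹ :=
    funext fun a => div_eq_mul_inv _ _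
  rw [e]
  exact ((P.aesm_comp_orbit hm hφ.1.aestronglyMeasurable).sub
    (h1.aestronglyMeasurable measurableSet_Icc)).mul
    (h3.aestronglyMeasurable measurableSet_Icc)

lemma ae_abs_sum_xi_le (n : ℕ) : ∀ᵐ a ∂volume.restrict (Icc 0 ε),
    |∑ k ∈ Finset.Ico m (m + n), F.xi x₀ φ k a| ≤
      n * (2 * (supConst A * nrm α A φ) / s) := by
  have h : ∀ᵐ a ∂volume.restrict (Icc 0 ε), ∀ k : ℕ, 1 ≤ k →
      |F.xi x₀ φ k a| ≤ 2 * (supConst A * nrm α A φ) / s :=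
    ae_all_iff.2 fun k => by
      by_cases hk : 1 ≤ k
      · filter_upwards [P.ae_abs_xi_le H hφ hs hσ hk] with a ha _ using ha
      · exact Eventually.of_forall fun _ h => (hk h).elim
  filter_upwards [h] with a ha
  refine (Finset.abs_sum_le_sum_abs _ _).trans ((Finset.sum_le_sum fun k hk =>
    ha k (hm.trans (Finset.mem_Ico.1 hk).1)).trans ?_)
  simp

lemma aesm_sum_xi (n : ℕ) : AEStronglyMeasurable
    (fun a => ∑ k ∈ Finset.Ico m (m + n), F.xi x₀ φ k a) (volume.restrict (Icc 0 ε)) :=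
  Finset.aestronglyMeasurable_fun_sum _ fun _ hk =>
    P.aesm_xi H hφ hs hσ (hm.trans (Finset.mem_Ico.1 hk).1)

lemma ae_sq_sum_xi_le (n : ℕ) : ∀ᵐ a ∂volume.restrict (Icc 0 ε),
    (∑ k ∈ Finset.Ico m (m + n), F.xi x₀ φ k a) ^ 2 ≤
      n ^ 2 * (2 * (supConst A * nrm α A φ) / s) ^ 2 := by
  filter_upwards [P.ae_abs_sum_xi_le H hφ hs hσ hm n] with a ha
  rw [← sq_abs, ← mul_pow]
  gcongr

lemma integrable_sq_sum_xi (n : ℕ) : IntegrableOn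
    (fun a => (∑ k ∈ Finset.Ico m (m + n), F.xi x₀ φ k a) ^ 2) (Icc 0 ε) := by
  refine Integrable.of_bound (C := n ^ 2 * (2 * (supConst A * nrm α A φ) / s) ^ 2)
    ((P.aesm_sum_xi H hφ hs hσ hm n).pow 2) ?_
  filter_upwards [P.ae_sq_sum_xi_le H hφ hs hσ hm n] with a ha
  rwa [Real.norm_eq_abs, abs_of_nonneg (sq_nonneg _)]

/-- The trivial bound of the second moment on any set of parameters. -/
lemma setIntegral_sq_sum_xi_le (n : ℕ) {ω : Set ℝ} (hω : ω ⊆ Icc 0 ε) :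
    ∫ a in ω, (∑ k ∈ Finset.Ico m (m + n), F.xi x₀ φ k a) ^ 2 ≤
      n ^ 2 * (2 * (supConst A * nrm α A φ) / s) ^ 2 * volume.real ω := by
  have h := setIntegral_mono_ae_restrict
    ((P.integrable_sq_sum_xi H hφ hs hσ hm n).mono_set hω)
    (integrableOn_const (μ := volume)
      (C := (n : ℝ) ^ 2 * (2 * (supConst A * nrm α A φ) / s) ^ 2)
      ((measure_mono hω).trans_lt (by simp)).ne)
    (ae_mono (Measure.restrict_mono hω le_rfl) (P.ae_sq_sum_xi_le H hφ hs hσ hm n))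
  rwa [setIntegral_const, smul_eq_mul, mul_comm] at h

end ParamExpansion

end ExpandingFamily

namespace ExpandingFamily

variable {α lam Lam : ℝ} {p₀ p₁ : ℕ} {F : ExpandingFamily α lam Lam p₀ p₁} {a : ℝ}
  {x₀ : ℝ → ℝ}

lemma aesm_ctr_comp (ha : a ∈ Icc (0 : ℝ) 1) {φ : ℝ → ℝ} (hφ : IntegrableOn φ (Icc 0 1))
    (k : ℕ) : AEStronglyMeasurable (fun x => F.ctr φ a ((F.T a)^[k] x)) leb :=
  F.aesm_comp_iterate ha (f := F.ctr φ a)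
    (hφ.aestronglyMeasurable.sub aestronglyMeasurable_const) k

/-- The variance of a Birkhoff sum of one map, with respect to an initial distribution with density
in `V_α`. -/
lemma SpectralGap.exists_variance {A ε C r D ρ ρ' : ℝ} (H : F.SpectralGap A ε C r D ρ)
    {φ : ℝ → ℝ} (hφ : MemGBV α A φ) (hρ' : 0 < ρ') (hρ'1 : ρ' < 1) (hdec : F.UniformDecay A ε ρ') :
    ∃ R > 0, ∀ a ∈ Icc 0 ε, 0 < F.sigma φ a → ∀ w : ℝ → ℝ, MemGBV α A w →
      ∫ y in Icc (0 : ℝ) 1, w y = 1 → ∀ u n : ℕ, 1 ≤ u →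
      |(∫ y in Icc (0 : ℝ) 1, w y * (∑ i ∈ Finset.range n, F.ctr φ a ((F.T a)^[u + i] y)) ^ 2) -
        n * F.sigma φ a ^ 2| ≤ R * (1 + n ^ 2 * (nrm α A w * ρ' ^ u)) := by
  obtain ⟨Cd, hCd, hdec⟩ := hdec
  obtain ⟨K, hK, hcov, -⟩ := H.exists_cov_bound hφ
  have hS := supConst_pos H.A_pos
  have hn := nrm_nonneg (α := α) (A := A) φ
  have hM := hφ.ae_abs_le H.A_pos F.α_pos.le
  set Mφ := supConst A * nrm α A φ
  have hM0 : 0 ≤ Mφ := by positivity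
  have h1ρ : 0 < 1 - ρ := by linarith [H.ρ_lt_one]
  refine ⟨2 * K / (1 - ρ) ^ 2 + 2 * (Cd * (2 * Mφ * (2 * Mφ))), by positivity,
    fun a ha hσ w hw hw1 u n hu => ?_⟩
  have ha1 := H.mem_unit ha
  have hctr := ae_abs_ctr_le (F := F) ha1 hM
  set g : ℕ → ℝ → ℝ := fun i y => F.ctr φ a ((F.T a)^[u + i] y) with hg
  have hgm : ∀ i, AEStronglyMeasurable (g i) leb := fun i => aesm_ctr_comp ha1 hφ.1 _
  have hgb : ∀ i, ∀ᵐ y ∂leb, |g i y| ≤ 2 * Mφ := fun i => F.ae_comp_iterate ha1 hctr _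
  have hint : ∀ l i, IntegrableOn (fun y => w y * (g l y * g i y)) (Icc 0 1) := by
    intro l i
    refine Integrable.mul_bdd (c := 2 * Mφ * (2 * Mφ)) hw.1 ((hgm l).mul (hgm i)) ?_
    filter_upwards [hgb l, hgb i] with y h1 h2
    rw [Real.norm_eq_abs, abs_mul]
    gcongr
  have hσ2 : F.sigma φ a ^ 2 = F.cov φ 0 a + 2 * ∑' i : ℕ, F.cov φ (i + 1) a := by
    have h := hσ
    rw [sigma_eq] at h ⊢
    exact Real.sq_sqrt (Real.sqrt_pos.1 h).le
  have hwn := nrm_nonneg (α := α) (A := A) w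
  have hq : ∀ i < n, ∀ l ≤ i, |(∫ y in Icc (0 : ℝ) 1, w y * (g l y * g i y)) -
      F.cov φ (i - l) a| ≤ Cd * nrm α A w * (2 * Mφ * (2 * Mφ)) * ρ' ^ u := by
    intro i _ l hl
    set Ψ : ℝ → ℝ := fun x => F.ctr φ a x * F.ctr φ a ((F.T a)^[i - l] x) with hΨ
    have hΨb : ∀ᵐ x ∂leb, |Ψ x| ≤ 2 * Mφ * (2 * Mφ) := by
      filter_upwards [hctr, F.ae_comp_iterate ha1 hctr (i - l)] with x h1 h2
      rw [hΨ, abs_mul]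
      gcongr
    have hΨm : AEStronglyMeasurable Ψ leb :=
      (aesm_ctr_comp ha1 hφ.1 0).mul (aesm_ctr_comp ha1 hφ.1 _)
    have hΨi : IntegrableOn Ψ (Icc 0 1) := Integrable.of_bound hΨm _ hΨb
    have h1 := hdec a ha w Ψ hw hΨi (u + l) (by lia)
    have e1 : ∀ y, Ψ ((F.T a)^[u + l] y) = g l y * g i y := by
      intro y
      simp only [hΨ, hg]
      rw [← Function.iterate_add_apply, show i - l + (u + l) = u + i by lia]
    simp only [e1] at h1
    rw [hw1, one_mul] at h1
    refine h1.trans ?_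
    have h2 : (l1Norm Ψ).toReal ≤ 2 * Mφ * (2 * Mφ) := by
      rw [l1Norm_eq hΨi, ENNReal.toReal_ofReal (l1_nonneg _), l1]
      have := integral_mono_ae hΨi.abs (integrable_const (μ := leb) (2 * Mφ * (2 * Mφ))) hΨb
      simpa using this
    have h3 : ρ' ^ (u + l) ≤ ρ' ^ u := pow_le_pow_of_le_one hρ'.le hρ'1.le (by lia)
    gcongr
    exact le_rfl
  have hmain := abs_quadratic_sub_le (c := fun i => F.cov φ i a)
    (q := fun l i => ∫ y in Icc (0 : ℝ) 1, w y * (g l y * g i y)) (n := n) H.ρ_pos H.ρ_lt_one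
    (e := Cd * nrm α A w * (2 * Mφ * (2 * Mφ)) * ρ' ^ u) (by positivity) (hcov a ha) hq
  have hexp : ∫ y in Icc (0 : ℝ) 1, w y * (∑ i ∈ Finset.range n, g i y) ^ 2 =
      ∑ i ∈ Finset.range n, ((∫ y in Icc (0 : ℝ) 1, w y * (g i y * g i y)) +
        2 * ∑ l ∈ Finset.range i, ∫ y in Icc (0 : ℝ) 1, w y * (g l y * g i y)) := by
    have e1 : ∀ y, w y * (∑ i ∈ Finset.range n, g i y) ^ 2 =
        ∑ i ∈ Finset.range n, (w y * (g i y * g i y) +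
          2 * ∑ l ∈ Finset.range i, w y * (g l y * g i y)) := by
      intro y
      rw [sq_sum_range, Finset.mul_sum]
      refine Finset.sum_congr rfl fun i _ => ?_
      rw [← Finset.mul_sum]
      ring
    have hI2 : ∀ i, IntegrableOn (fun y => 2 * ∑ l ∈ Finset.range i, w y * (g l y * g i y))
        (Icc 0 1) := fun i => (integrable_finsetSum _ fun l _ => hint l i).const_mul 2
    have hI : ∀ i, IntegrableOn (fun y => w y * (g i y * g i y) +
        2 * ∑ l ∈ Finset.range i, w y * (g l y * g i y)) (Icc 0 1) :=
      fun i => (hint i i).add (hI2 i)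
    simp only [e1]
    rw [integral_finsetSum _ fun i _ => hI i]
    refine Finset.sum_congr rfl fun i _ => ?_
    rw [integral_add (hint i i) (hI2 i), integral_const_mul,
      integral_finsetSum _ fun l _ => hint l i]
  rw [← hexp, ← hσ2] at hmain
  refine hmain.trans ?_
  have hp : 0 ≤ 2 * K / (1 - ρ) ^ 2 * (n ^ 2 * (nrm α A w * ρ' ^ u)) := by positivity
  have hp2 : 0 ≤ 2 * (Cd * (2 * Mφ * (2 * Mφ))) := by positivity
  calc _ = 2 * K / (1 - ρ) ^ 2 +
        2 * (Cd * (2 * Mφ * (2 * Mφ))) * (n ^ 2 * (nrm α A w * ρ' ^ u)) := by ring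
    _ ≤ 2 * K / (1 - ρ) ^ 2 +
        2 * (Cd * (2 * Mφ * (2 * Mφ))) * (n ^ 2 * (nrm α A w * ρ' ^ u)) +
        (2 * K / (1 - ρ) ^ 2 * (n ^ 2 * (nrm α A w * ρ' ^ u)) +
          2 * (Cd * (2 * Mφ * (2 * Mφ)))) := le_add_of_nonneg_right (by positivity)
    _ = _ := by ring

end ExpandingFamily

lemma weighted_sum_le {Q₁ Q₂ Q₃ c X₁ X₂ X₃ : ℝ} (q₁ : 0 ≤ Q₁) (q₂ : 0 ≤ Q₂) (q₃ : 0 ≤ Q₃)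
    (hc : 0 ≤ c) (h₁ : 0 ≤ X₁) (h₂ : 0 ≤ X₂) (h₃ : 0 ≤ X₃) :
    Q₂ * X₂ + Q₃ * X₁ + Q₁ * (1 + c * X₃) ≤
      (Q₁ * (1 + c) + Q₂ + Q₃) * (1 + (X₁ + X₂ + X₃)) := by
  have h : 0 ≤ Q₁ * (X₁ + X₂ + X₃) + Q₁ * c * (X₁ + X₂) + Q₁ * c + Q₂ * (1 + X₁ + X₃) +
      Q₃ * (1 + X₂ + X₃) := by positivity
  linarith

namespace ExpandingFamily

variable {α lam Lam : ℝ} {p₀ p₁ : ℕ} {F : ExpandingFamily α lam Lam p₀ p₁} {a : ℝ}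
  {x₀ : ℝ → ℝ}

/-- The normalised second moment on a good parameter interval. -/
lemma ParamExpansion.exists_local_variance {ε G M c A C r D ρ ρ' : ℝ} {N : ℕ}
    (P : F.ParamExpansion x₀ ε G M c N) (H : F.SpectralGap A ε C r D ρ) {φ : ℝ → ℝ}
    (hφ : MemGBV α A φ) {s : ℝ} (hs : 0 < s) (hσ : ∀ a ∈ Icc 0 ε, s ≤ F.sigma φ a)
    (hρ' : 0 < ρ') (hρ'1 : ρ' < 1) (hdec : F.UniformDecay A ε ρ') {K : ℝ} (hK : 0 < K) :
    ∃ E > 0, ∃ R > 0, ∀ v : ℕ, 1 ≤ v → ∀ ω : Set ℝ, F.IsGoodInterval x₀ ε K v ω →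
      ∀ u n : ℕ, 1 ≤ u → E * volume.real ω * Lam ^ (u + n) ≤ min A 1 →
      |(volume.real ω)⁻¹ *
          (∫ a in ω, (∑ k ∈ Finset.Ico (v + u) (v + u + n), F.xi x₀ φ k a) ^ 2) - n| ≤
        R * (1 + n ^ 2 * (volume.real ω ^ (α / 16) +
          (u + n + 1) * (E * volume.real ω * Lam ^ (u + n)) ^ α /
            volume.real (F.orbit x₀ v '' ω) + ρ' ^ u / volume.real (F.orbit x₀ v '' ω))) := by
  obtain ⟨E, hE, R₁, hR₁, hshadow⟩ := P.exists_shadowing H.toLasotaYorke hφ hK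
  obtain ⟨R₂, hR₂, hvar⟩ := H.exists_variance hφ hρ' hρ'1 hdec
  obtain ⟨c₁, hc₁, -, hmean⟩ := H.exists_cov_bound hφ
  obtain ⟨c₂, hc₂, hsig⟩ := H.exists_sigma_sub_le hφ
  have hA := H.A_pos
  have hα := F.α_pos
  have hS := supConst_pos hA
  have hn := nrm_nonneg (α := α) (A := A) φ
  have hMφ := hφ.ae_abs_le hA hα.le
  have hLam0 := F.Lam_pos
  set Mφ := supConst A * nrm α A φ with hMdef
  have hM0 : 0 ≤ Mφ := by positivity
  set M' := 2 * Mφ / s with hM'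
  have hM'0 : 0 ≤ M' := by positivity
  set c' := c₁ / s + 2 * Mφ * c₂ / s ^ 2 with hc'
  have hc'0 : 0 ≤ c' := by positivity
  set Cw := (4 * A ^ (1 - α) + 5) * (1 + K) ^ 2 with hCw
  have hCw0 : 0 < Cw := by positivity
  refine ⟨E, hE, R₂ / s ^ 2 * (1 + Cw) + 2 * M' * (R₁ / s) + 2 * M' * c', by positivity,
    fun v hv ω g u n hu hsmall => ?_⟩
  have hW := g.volume_pos
  have hV := g.volume_image_pos
  obtain ⟨w, hw, hwn, hwf⟩ := g.exists_density hA
  obtain ⟨a₀, ha₀⟩ := g.nonempty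
  have ha₀1 := g.mem_Icc ha₀
  have hωε : ω ⊆ Icc 0 ε := g.subset.trans Ioo_subset_Icc_self
  have ha₀ε := hωε ha₀
  have hW1 : volume.real ω ≤ 1 := by
    have h1 : ω ⊆ Icc 0 1 := fun a ha => g.mem_Icc ha
    have h2 := measureReal_mono (μ := volume) h1 (by simp)
    simpa using h2
  set W := volume.real ω with hWdef
  set V := volume.real (F.orbit x₀ v '' ω)
  set Δ := E * W * Lam ^ (u + n) with hΔ
  have hΔ0 : 0 < Δ := by positivity
  have hsub : volume.restrict ω ≤ volume.restrict (Icc 0 ε) := Measure.restrict_mono hωε le_rfl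
  have hσ0 : 0 < F.sigma φ a₀ := hs.trans_le (hσ a₀ ha₀ε)
  set σ₀ := F.sigma φ a₀ with hσ₀
  have : IsFiniteMeasure (volume.restrict ω) := ⟨by simpa using g.volume_ne_top.lt_top⟩
  set f : ℝ → ℝ := fun z => ∑ i ∈ Finset.range n, F.ctr φ a₀ ((F.T a₀)^[u + i] z) with hf
  set x : ℕ → ℝ → ℝ := fun i a => F.xi x₀ φ (v + u + i) a with hx
  set y : ℕ → ℝ → ℝ := fun i a => F.ctr φ a₀ ((F.T a₀)^[u + i] (F.orbit x₀ v a)) / σ₀ with hy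
  set d : ℕ → ℝ → ℝ := fun i a =>
    φ (F.orbit x₀ (v + (u + i)) a) - φ ((F.T a₀)^[u + i] (F.orbit x₀ v a)) with hd
  set S : ℝ → ℝ := fun a => ∑ k ∈ Finset.Ico (v + u) (v + u + n), F.xi x₀ φ k a with hSdef
  have hSx : ∀ a, S a = ∑ i ∈ Finset.range n, x i a := by
    intro a
    simp only [hSdef, hx]
    rw [Finset.sum_Ico_eq_sum_range, add_tsub_cancel_left]
  have hfy : ∀ a, f (F.orbit x₀ v a) / σ₀ = ∑ i ∈ Finset.range n, y i a := by
    intro a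
    simp only [hf, hy]
    rw [Finset.sum_div]
  have hφm := hφ.1.aestronglyMeasurable
  have hdm : ∀ i, AEStronglyMeasurable (d i) (volume.restrict ω) := fun i =>
    ((P.aesm_comp_orbit (by lia) hφm).sub (P.aesm_comp_orbit hv
      (F.aesm_comp_iterate ha₀1 hφm (u + i)))).mono_measure hsub
  have hctr := ae_abs_ctr_le (F := F) ha₀1 hMφ
  have hdb : ∀ᵐ a ∂volume.restrict ω, ∀ i, |φ (F.orbit x₀ (v + (u + i)) a)| ≤ Mφ ∧
      |φ ((F.T a₀)^[u + i] (F.orbit x₀ v a))| ≤ Mφ ∧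
      |F.ctr φ a₀ ((F.T a₀)^[u + i] (F.orbit x₀ v a))| ≤ 2 * Mφ := by
    refine ae_mono hsub (ae_all_iff.2 fun i => ?_)
    filter_upwards [P.ae_comp_orbit (by lia : 1 ≤ v + (u + i)) hMφ,
      P.ae_comp_orbit hv (F.ae_comp_iterate ha₀1 hMφ (u + i)),
      P.ae_comp_orbit hv (F.ae_comp_iterate ha₀1 hctr (u + i))] with a h1 h2 h3
    exact ⟨h1, h2, h3⟩
  have hdi : ∀ i, Integrable (d i) (volume.restrict ω) := by
    intro i
    refine Integrable.of_bound (C := Mφ + Mφ) (hdm i) ?_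
    filter_upwards [hdb] with a ha
    exact (abs_sub _ _).trans (add_le_add (ha i).1 (ha i).2.1)
  have hdint : ∀ i < n, ∫ a in ω, |d i a| ≤ R₁ * (u + n + 1) * Δ ^ α * (W / V) := by
    intro i hi
    have h1 := hshadow v hv ω g a₀ ha₀ (u + n) hsmall (u + i) (by lia)
    have h2 := integral_norm_eq_lintegral_enorm (hdm i)
    simp only [Real.norm_eq_abs] at h2
    rw [h2]
    have h3 := ENNReal.toReal_le_of_le_ofReal (by positivity) h1
    push_cast at h3
    exact h3
  have hWα : W ^ (α / 4) ≤ W ^ (α / 16) :=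
    Real.rpow_le_rpow_of_exponent_ge hW hW1 (by linarith)
  have hxy : ∀ᵐ a ∂volume.restrict ω, ∀ i < n,
      |x i a - y i a| ≤ |d i a| / s + c' * W ^ (α / 16) := by
    filter_upwards [hdb, ae_restrict_mem g.measurableSet] with a ha haω i _
    have h1 := abs_div_sub_div_le (x := φ (F.orbit x₀ (v + (u + i)) a) - F.mean φ a) hs
      (hσ a (hωε haω)) (hσ a₀ ha₀ε) (ha i).2.2
    have h2 : |a - a₀| ≤ W := g.abs_sub_le haω ha₀
    have h3 := (hmean a (hωε haω) a₀ ha₀ε).1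
    have h4 := hsig a (hωε haω) a₀ ha₀ε
    have h5 : |a - a₀| ^ (α / 4) ≤ W ^ (α / 16) := by
      refine le_trans ?_ hWα
      gcongr
    have h6 : |a - a₀| ^ (α / 16) ≤ W ^ (α / 16) := by gcongr
    have h7 : |φ (F.orbit x₀ (v + (u + i)) a) - F.mean φ a -
        F.ctr φ a₀ ((F.T a₀)^[u + i] (F.orbit x₀ v a))| ≤
        |d i a| + c₁ * W ^ (α / 16) := by
      have e : φ (F.orbit x₀ (v + (u + i)) a) - F.mean φ a -
          F.ctr φ a₀ ((F.T a₀)^[u + i] (F.orbit x₀ v a)) =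
          d i a - (F.mean φ a - F.mean φ a₀) := by
        simp only [ctr, hd]; ring
      rw [e]
      refine (abs_sub _ _).trans (add_le_add_right (h3.trans ?_) _)
      gcongr
    have h8 : |F.sigma φ a - F.sigma φ a₀| ≤ c₂ * W ^ (α / 16) := h4.trans (by gcongr)
    simp only [hx, hy, xi, add_assoc]
    refine h1.trans ?_
    calc _ ≤ (|d i a| + c₁ * W ^ (α / 16)) / s +
          2 * Mφ * (c₂ * W ^ (α / 16)) / s ^ 2 := by gcongr
      _ = _ := by rw [hc']; ring
  have hxb : ∀ᵐ a ∂volume.restrict ω, |S a| ≤ n * M' :=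
    ae_mono hsub (P.ae_abs_sum_xi_le H hφ hs hσ (by lia : 1 ≤ v + u) n)
  have hyb : ∀ᵐ a ∂volume.restrict ω, |f (F.orbit x₀ v a) / σ₀| ≤ n * M' := by
    filter_upwards [hdb] with a ha
    rw [hfy]
    refine (Finset.abs_sum_le_sum_abs _ _).trans ((Finset.sum_le_sum (g := fun _ => M')
      fun i _ => ?_).trans (by simp))
    rw [hy, abs_div, abs_of_pos hσ0, hM']
    have := (ha i).2.2
    have := hσ a₀ ha₀ε
    gcongr
  have hfm : AEStronglyMeasurable (fun a => f (F.orbit x₀ v a) / σ₀) (volume.restrict ω) := by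
    have h1 : AEStronglyMeasurable f leb :=
      Finset.aestronglyMeasurable_fun_sum _ fun i _ => aesm_ctr_comp ha₀1 hφ.1 (u + i)
    have h2 := (P.aesm_comp_orbit hv h1).mono_measure hsub
    simp only [div_eq_mul_inv]
    exact h2.mul aestronglyMeasurable_const
  have hSi : Integrable (fun a => S a ^ 2) (volume.restrict ω) :=
    (P.integrable_sq_sum_xi H hφ hs hσ (by lia : 1 ≤ v + u) n).mono_set hωε
  have hfi : Integrable (fun a => (f (F.orbit x₀ v a) / σ₀) ^ 2) (volume.restrict ω) := by
    refine Integrable.of_bound (C := (n * M') ^ 2) (hfm.pow 2) ?_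
    filter_upwards [hyb] with a ha
    rw [Real.norm_eq_abs, abs_pow]
    gcongr
  have hdiff : |(∫ a in ω, S a ^ 2) - ∫ a in ω, (f (F.orbit x₀ v a) / σ₀) ^ 2| ≤
      2 * (n * M') * (n * (R₁ * (u + n + 1) * Δ ^ α * (W / V) / s + c' * W ^ (α / 16) * W)) := by
    rw [← integral_sub hSi hfi]
    refine abs_integral_le_integral_abs.trans ?_
    have hdi' : ∀ i, Integrable (fun a => |d i a| / s + c' * W ^ (α / 16))
        (volume.restrict ω) := fun i => ((hdi i).abs.div_const s).add (integrable_const _)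
    have hle : ∀ᵐ a ∂volume.restrict ω, |S a ^ 2 - (f (F.orbit x₀ v a) / σ₀) ^ 2| ≤
        2 * (n * M') * ∑ i ∈ Finset.range n, (|d i a| / s + c' * W ^ (α / 16)) := by
      filter_upwards [hxy, hxb, hyb] with a h1 h2 h3
      rw [sq_sub_sq, abs_mul]
      have h4 : |S a + f (F.orbit x₀ v a) / σ₀| ≤ 2 * (n * M') :=
        (abs_add_le _ _).trans (by linarith)
      have h5 : |S a - f (F.orbit x₀ v a) / σ₀| ≤
          ∑ i ∈ Finset.range n, (|d i a| / s + c' * W ^ (α / 16)) := by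
        rw [hSx, hfy, ← Finset.sum_sub_distrib]
        exact (Finset.abs_sum_le_sum_abs _ _).trans
          (Finset.sum_le_sum fun i hi => h1 i (Finset.mem_range.1 hi))
      gcongr
    refine (integral_mono_ae (hSi.sub hfi).abs
      ((integrable_finsetSum _ fun i _ => hdi' i).const_mul _) hle).trans ?_
    rw [integral_const_mul, integral_finsetSum _ fun i _ => hdi' i]
    gcongr
    have h6 : ∀ i ∈ Finset.range n, ∫ a in ω, (|d i a| / s + c' * W ^ (α / 16)) ≤
        R₁ * (u + n + 1) * Δ ^ α * (W / V) / s + c' * W ^ (α / 16) * W := by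
      intro i hi
      rw [integral_add ((hdi i).abs.div_const s) (integrable_const _), integral_div,
        setIntegral_const, smul_eq_mul, mul_comm (volume.real ω)]
      have := hdint i (Finset.mem_range.1 hi)
      gcongr
    refine (Finset.sum_le_sum h6).trans (le_of_eq ?_)
    rw [Finset.sum_const, Finset.card_range, nsmul_eq_mul]
  have hw1 : ∫ z in Icc (0 : ℝ) 1, w z = 1 := by
    have h1 := hwf fun _ => 1
    simp only [mul_one] at h1
    rw [setIntegral_const, smul_eq_mul, mul_one] at h1
    exact (mul_left_cancel₀ hW.ne' (by rw [mul_one]; exact h1)).symm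
  have hv2 := hvar a₀ ha₀ε hσ0 w hw hw1 u n hu
  have hfint : ∫ a in ω, (f (F.orbit x₀ v a) / σ₀) ^ 2 =
      W * ((∫ z in Icc (0 : ℝ) 1, w z * f z ^ 2) / σ₀ ^ 2) := by
    rw [hwf fun z => (f z / σ₀) ^ 2, ← integral_div]
    congr 2
    funext z
    ring
  set I := ∫ z in Icc (0 : ℝ) 1, w z * f z ^ 2 with hI
  have hsσ : s ^ 2 ≤ σ₀ ^ 2 := by
    have := hσ a₀ ha₀ε
    gcongr
  have hpw : 0 ≤ ρ' ^ u / V := by positivity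
  have hmain : |I / σ₀ ^ 2 - n| ≤ R₂ / s ^ 2 * (1 + n ^ 2 * (Cw * (ρ' ^ u / V))) := by
    have e : I / σ₀ ^ 2 - n = (I - n * σ₀ ^ 2) / σ₀ ^ 2 := by field_simp
    rw [e, abs_div, abs_of_pos (by positivity : 0 < σ₀ ^ 2)]
    have h1 : nrm α A w * ρ' ^ u ≤ Cw * (ρ' ^ u / V) := by
      calc nrm α A w * ρ' ^ u ≤ Cw / V * ρ' ^ u := by gcongr
        _ = _ := by ring
    calc _ ≤ R₂ * (1 + n ^ 2 * (nrm α A w * ρ' ^ u)) / s ^ 2 := by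
          gcongr
          have := nrm_nonneg (α := α) (A := A) w
          positivity
      _ ≤ R₂ * (1 + n ^ 2 * (Cw * (ρ' ^ u / V))) / s ^ 2 := by gcongr
      _ = _ := by ring
  have hfinal : W⁻¹ * (∫ a in ω, S a ^ 2) - n =
      W⁻¹ * ((∫ a in ω, S a ^ 2) - ∫ a in ω, (f (F.orbit x₀ v a) / σ₀) ^ 2) +
        (I / σ₀ ^ 2 - n) := by
    rw [hfint]; field_simp; ring
  show |W⁻¹ * (∫ a in ω, S a ^ 2) - n| ≤ _
  rw [hfinal]
  refine (abs_add_le _ _).trans ?_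
  rw [abs_mul, abs_of_pos (inv_pos.2 hW)]
  have h1 : W⁻¹ * |(∫ a in ω, S a ^ 2) - ∫ a in ω, (f (F.orbit x₀ v a) / σ₀) ^ 2| ≤
      2 * M' * (R₁ / s) * (n ^ 2 * ((u + n + 1) * Δ ^ α / V)) +
        2 * M' * c' * (n ^ 2 * W ^ (α / 16)) := by
    calc _ ≤ W⁻¹ * (2 * (n * M') *
          (n * (R₁ * (u + n + 1) * Δ ^ α * (W / V) / s + c' * W ^ (α / 16) * W))) := by gcongr
      _ = _ := by field_simp
  refine (add_le_add h1 hmain).trans ?_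
  have t1 : 0 ≤ (n : ℝ) ^ 2 * W ^ (α / 16) := by positivity
  have t2 : 0 ≤ (n : ℝ) ^ 2 * ((u + n + 1) * Δ ^ α / V) := by positivity
  have t3 : 0 ≤ (n : ℝ) ^ 2 * (ρ' ^ u / V) := by positivity
  have q1 : 0 ≤ R₂ / s ^ 2 := by positivity
  have q2 : 0 ≤ 2 * M' * (R₁ / s) := by positivity
  have q3 : 0 ≤ 2 * M' * c' := by positivity
  have h := weighted_sum_le q1 q2 q3 hCw0.le t1 t2 t3
  rwa [← mul_add, ← mul_add, ← mul_left_comm ((n : ℝ) ^ 2) Cw] at h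

end ExpandingFamily

lemma exists_linear_sub_quartic_le {c : ℝ} (b : ℝ) (hc : 0 < c) :
    ∃ C : ℝ, ∀ x : ℝ, 0 ≤ x → b * x - c * x ^ 4 ≤ C := by
  refine ⟨|b| * max 1 (|b| / c), fun x hx => ?_⟩
  have hb : b * x ≤ |b| * x := by gcongr; exact le_abs_self b
  have h4 : 0 ≤ c * x ^ 4 := by positivity
  rcases le_or_gt x (max 1 (|b| / c)) with h | h
  · have : |b| * x ≤ |b| * max 1 (|b| / c) := by gcongr
    linarith
  · have h1 : 1 ≤ x := (le_max_left _ _).trans h.le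
    have h2 : |b| ≤ x * c := (div_le_iff₀ hc).1 ((le_max_right _ _).trans h.le)
    have h3 : x ^ 2 ≤ x ^ 4 := pow_le_pow_right₀ h1 (by norm_num)
    have h5 : |b| * x ≤ x * c * x := by gcongr
    have h6 : c * x ^ 2 ≤ c * x ^ 4 := by gcongr
    have h7 : 0 ≤ |b| * max 1 (|b| / c) := by positivity
    have h8 : x * c * x = c * x ^ 2 := by ring
    linarith

lemma pow_le_factorial_mul_exp {x : ℝ} (hx : 0 ≤ x) (k : ℕ) :
    x ^ k ≤ k.factorial * Real.exp x := by
  have := Real.pow_div_factorial_le_exp x hx k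
  rwa [div_le_iff₀' (by positivity)] at this

lemma exists_pow_mul_exp_quartic_le (k : ℕ) {c : ℝ} (b : ℝ) (hc : 0 < c) :
    ∃ C : ℝ, 0 < C ∧ ∀ x : ℝ, 0 ≤ x → x ^ k * Real.exp (b * x - c * x ^ 4) ≤ C := by
  obtain ⟨C, hC⟩ := exists_linear_sub_quartic_le (b + 1) hc
  refine ⟨k.factorial * Real.exp C, by positivity, fun x hx => ?_⟩
  calc x ^ k * Real.exp (b * x - c * x ^ 4)
      ≤ k.factorial * Real.exp x * Real.exp (b * x - c * x ^ 4) := by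
        gcongr; exact pow_le_factorial_mul_exp hx k
    _ = k.factorial * Real.exp ((b + 1) * x - c * x ^ 4) := by
        rw [mul_assoc, ← Real.exp_add]; ring_nf
    _ ≤ _ := by gcongr; exact hC x hx

lemma exists_pow_mul_exp_sqrt_le (k : ℕ) {c : ℝ} (hc : 0 < c) :
    ∃ C : ℝ, 0 < C ∧ ∀ x : ℝ, 0 ≤ x → x ^ k * Real.exp (√x - c * x) ≤ C := by
  refine ⟨(2 / c) ^ k * k.factorial * Real.exp (1 / (2 * c)), by positivity, fun x hx => ?_⟩
  have h1 := pow_le_factorial_mul_exp (by positivity : 0 ≤ c / 2 * x) k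
  have h2 : x ^ k = (2 / c) ^ k * (c / 2 * x) ^ k := by
    rw [← mul_pow]; congr 1; field_simp
  have h3 : √x - c / 2 * x ≤ 1 / (2 * c) := by
    have hs := Real.sq_sqrt hx
    have : 0 ≤ (c * √x - 1) ^ 2 / (2 * c) := by positivity
    have e : (c * √x - 1) ^ 2 / (2 * c) = c / 2 * √x ^ 2 - √x + 1 / (2 * c) := by
      field_simp; ring
    rw [e, hs] at this
    linarith
  rw [h2]
  calc (2 / c) ^ k * (c / 2 * x) ^ k * Real.exp (√x - c * x)
      ≤ (2 / c) ^ k * (k.factorial * Real.exp (c / 2 * x)) * Real.exp (√x - c * x) := by gcongr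
    _ = (2 / c) ^ k * k.factorial * Real.exp (√x - c / 2 * x) := by
        rw [mul_assoc, mul_assoc, ← Real.exp_add, mul_assoc]; ring_nf
    _ ≤ _ := by gcongr

/-- Relations between the expansion rates and the base `l` of the size of the image intervals. -/
structure RateRelations (α lam Lam η ρ l : ℝ) : Prop where
  α_pos : 0 < α
  α_le_one : α ≤ 1
  one_lt_lam : 1 < lam
  lam_le_Lam : lam ≤ Lam
  η_pos : 0 < η
  ρ_pos : 0 < ρ
  one_lt_base : 1 < l
  base_le : l ≤ lam ^ (α / 3)
  base_le_rate : l ≤ ρ ^ (-(1 / 2) : ℝ)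
  Lam_rpow_le : Lam ^ η ≤ l

namespace RateRelations

variable {α lam Lam η ρ l : ℝ} (h : RateRelations α lam Lam η ρ l)
include h

lemma log_lam_pos : 0 < Real.log lam := Real.log_pos h.one_lt_lam

lemma log_base_pos : 0 < Real.log l := Real.log_pos h.one_lt_base

lemma Lam_pos : 0 < Lam := by linarith [h.one_lt_lam, h.lam_le_Lam]

lemma log_Lam_nonneg : 0 ≤ Real.log Lam :=
  Real.log_nonneg (by linarith [h.one_lt_lam, h.lam_le_Lam])

lemma log_base_le : Real.log l ≤ α / 3 * Real.log lam := by
  have h0 : 0 < lam := by linarith [h.one_lt_lam]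
  rw [← Real.log_rpow h0]
  exact Real.log_le_log (by linarith [h.one_lt_base]) h.base_le

lemma log_base_le_rate : Real.log l ≤ -Real.log ρ / 2 := by
  have := Real.log_le_log (by linarith [h.one_lt_base]) h.base_le_rate
  rw [Real.log_rpow h.ρ_pos] at this
  linarith

lemma eta_mul_log_Lam_le : η * Real.log Lam ≤ α / 3 * Real.log lam := by
  rw [← Real.log_rpow h.Lam_pos]
  exact (Real.log_le_log (Real.rpow_pos_of_pos h.Lam_pos _) h.Lam_rpow_le).trans h.log_base_le

omit h in
lemma quarter_pow (m : ℕ) : ((m : ℝ) ^ (1 / 4 : ℝ)) ^ 4 = m := by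
  rw [← Real.rpow_natCast, ← Real.rpow_mul (by positivity)]; norm_num

lemma inv_lam_pow_le {m v : ℕ} (hv : |(v : ℝ) - (m - (m : ℝ) ^ (1 / 4 : ℝ))| < 1) :
    (lam ^ v)⁻¹ ≤ Real.exp (Real.log lam * ((m : ℝ) ^ (1 / 4 : ℝ) + 1 - m)) := by
  have h0 : 0 < lam := by linarith [h.one_lt_lam]
  rw [← Real.rpow_natCast, ← Real.rpow_neg h0.le, Real.rpow_def_of_pos h0]
  have hl := h.log_lam_pos
  gcongr
  linarith [(abs_lt.1 hv).1]

/-- The error terms in the local second moment are bounded. -/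
lemma exists_error_le {E K A' : ℝ} (hE : 0 < E) (hK : 0 < K) (hA' : 0 < A') :
    ∃ C : ℝ, 0 < C ∧ ∃ m₁ : ℕ, ∀ m ≥ m₁, 1 ≤ m → ∀ v u n : ℕ, v + u = m →
      |(v : ℝ) - (m - (m : ℝ) ^ (1 / 4 : ℝ))| < 1 → (n : ℝ) ≤ η * m / 2 → ∀ W V : ℝ, 0 < W →
      W ≤ K / lam ^ v → l ^ (-(m : ℝ) ^ (1 / 4 : ℝ)) ≤ V →
      E * W * Lam ^ (u + n) ≤ A' ∧
      (n : ℝ) ^ 2 * (W ^ (α / 16) + (u + n + 1) * (E * W * Lam ^ (u + n)) ^ α / V + ρ ^ u / V) ≤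
        C := by
  have hα := h.α_pos
  have hα1 := h.α_le_one
  have hη := h.η_pos
  have hll := h.log_lam_pos
  have hLL := h.log_Lam_nonneg
  have hl0 := h.log_base_pos
  have hρ := h.ρ_pos
  have hLam := h.Lam_pos
  have hl1 : 0 < l := by linarith [h.one_lt_base]
  have hηL := h.eta_mul_log_Lam_le
  have hlr := h.log_base_le_rate
  set a := Real.log lam
  set b := Real.log Lam
  set d := Real.log l
  set r := -Real.log ρ with hr
  have hr0 : 0 < r := by linarith
  obtain ⟨C₁, hC₁, h1⟩ := exists_pow_mul_exp_quartic_le 8 (a * (α / 16))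
    (by positivity : 0 < a * (α / 16))
  obtain ⟨C₂, hC₂, h2⟩ := exists_pow_mul_exp_quartic_le 1 (a + b) (by positivity : 0 < 5 / 6 * a)
  obtain ⟨C₃, hC₃, h3⟩ := exists_pow_mul_exp_quartic_le 12 ((a + b) * α + d)
    (by positivity : 0 < 5 / 6 * a * α)
  obtain ⟨C₄, hC₄, h4⟩ := exists_pow_mul_exp_sqrt_le 8 (by positivity : 0 < r / 2)
  set E₁ := E * (K * Real.exp (a + b)) with hE₁
  have hE₁0 : 0 < E₁ := by positivity
  obtain ⟨N, hN⟩ := exists_nat_ge (E₁ * C₂ / A')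
  refine ⟨(η / 2) ^ 2 * ((K * Real.exp a) ^ (α / 16) * C₁) +
    (η / 2) ^ 2 * ((3 + η / 2) * (E₁ ^ α * C₃)) + (η / 2) ^ 2 * (Real.exp r * C₄),
    by positivity, N ^ 4, fun m hm hm1 v u n hvu hv hn W V hW hWK hV => ?_⟩
  set X := (m : ℝ) ^ (1 / 4 : ℝ) with hX
  have hX4 : X ^ 4 = m := quarter_pow m
  have hmR : (1 : ℝ) ≤ m := by exact_mod_cast hm1
  have hX1 : 1 ≤ X := Real.one_le_rpow hmR (by norm_num)
  have hX0 : 0 ≤ X := by linarith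
  have hvuR : (v : ℝ) + u = m := by exact_mod_cast hvu
  have hv' := abs_lt.1 hv
  have hu1 : (u : ℝ) ≤ X + 1 := by linarith [hv'.1]
  have hu2 : X - 1 ≤ u := by linarith [hv'.2]
  have hNX : (N : ℝ) ≤ X := by
    have : (N : ℝ) ^ 4 ≤ X ^ 4 := by rw [hX4]; exact_mod_cast hm
    exact le_of_pow_le_pow_left₀ (by norm_num) hX0 this
  have hWle : W ≤ K * Real.exp a * Real.exp (a * X - a * X ^ 4) := by
    rw [div_eq_mul_inv] at hWK
    refine hWK.trans ?_
    rw [mul_assoc, ← Real.exp_add]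
    gcongr
    refine (h.inv_lam_pow_le hv).trans (le_of_eq ?_)
    rw [← hX, hX4]; congr 1; ring
  have hLamle : Lam ^ (u + n) ≤ Real.exp (b + b * X + a / 6 * X ^ 4) := by
    rw [← Real.rpow_natCast, Real.rpow_def_of_pos hLam]
    gcongr
    push_cast
    have e1 : b * u ≤ b * (X + 1) := by gcongr
    have e2 : b * n ≤ b * (η * m / 2) := by gcongr
    have e3 : η * b * m ≤ α / 3 * a * m := by gcongr
    have e4 : α / 3 * a * m ≤ 1 / 3 * a * m := by gcongr
    rw [hX4]
    show b * (u + n) ≤ _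
    linarith
  set Δ := E * W * Lam ^ (u + n) with hΔ
  have hΔ0 : 0 < Δ := by positivity
  have hΔle : Δ ≤ E₁ * Real.exp ((a + b) * X - 5 / 6 * a * X ^ 4) := by
    calc Δ ≤ E * (K * Real.exp a * Real.exp (a * X - a * X ^ 4)) *
          Real.exp (b + b * X + a / 6 * X ^ 4) := by rw [hΔ]; gcongr
      _ = E * K * (Real.exp a * Real.exp (a * X - a * X ^ 4) *
          Real.exp (b + b * X + a / 6 * X ^ 4)) := by ring
      _ = E * K * (Real.exp (a + b) * Real.exp ((a + b) * X - 5 / 6 * a * X ^ 4)) := by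
          rw [← Real.exp_add, ← Real.exp_add, ← Real.exp_add]; ring_nf
      _ = _ := by rw [hE₁]; ring
  have hV0 : 0 < V := (Real.rpow_pos_of_pos hl1 _).trans_le hV
  have hVinv : V⁻¹ ≤ Real.exp (d * X) := by
    rw [← Real.rpow_def_of_pos hl1, ← inv_inv (l ^ X), ← Real.rpow_neg hl1.le]
    gcongr
  have hn0 : (0 : ℝ) ≤ n := by positivity
  have hnX : (n : ℝ) ≤ η / 2 * X ^ 4 := by rw [hX4]; linarith
  have hn2 : (n : ℝ) ^ 2 ≤ (η / 2) ^ 2 * X ^ 8 := by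
    calc (n : ℝ) ^ 2 ≤ (η / 2 * X ^ 4) ^ 2 := by gcongr
      _ = _ := by ring
  constructor
  · rcases eq_or_ne N 0 with hN0 | hN0
    · rw [hN0, Nat.cast_zero] at hN
      have : 0 < E₁ * C₂ / A' := by positivity
      linarith
    have h5 := h2 X hX0
    rw [pow_one] at h5
    have h6 : E₁ * C₂ ≤ A' * X := by
      rw [div_le_iff₀ hA'] at hN
      calc E₁ * C₂ ≤ N * A' := hN
        _ ≤ X * A' := by gcongr
        _ = _ := mul_comm _ _
    have h7 : X * Δ ≤ A' * X := by
      calc X * Δ ≤ X * (E₁ * Real.exp ((a + b) * X - 5 / 6 * a * X ^ 4)) := by gcongr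
        _ = E₁ * (X * Real.exp ((a + b) * X - 5 / 6 * a * X ^ 4)) := by ring
        _ ≤ E₁ * C₂ := by gcongr
        _ ≤ _ := h6
    rw [mul_comm] at h7
    exact le_of_mul_le_mul_right h7 (by linarith)
  · have t1 : (n : ℝ) ^ 2 * W ^ (α / 16) ≤
        (η / 2) ^ 2 * ((K * Real.exp a) ^ (α / 16) * C₁) := by
      have e : W ^ (α / 16) ≤ (K * Real.exp a) ^ (α / 16) *
          Real.exp (a * (α / 16) * X - a * (α / 16) * X ^ 4) := by
        calc W ^ (α / 16) ≤ (K * Real.exp a * Real.exp (a * X - a * X ^ 4)) ^ (α / 16) := by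
              gcongr
          _ = _ := by
              rw [Real.mul_rpow (by positivity) (by positivity), ← Real.exp_mul]; ring_nf
      calc (n : ℝ) ^ 2 * W ^ (α / 16) ≤ (η / 2) ^ 2 * X ^ 8 * ((K * Real.exp a) ^ (α / 16) *
          Real.exp (a * (α / 16) * X - a * (α / 16) * X ^ 4)) := by gcongr
        _ = (η / 2) ^ 2 * ((K * Real.exp a) ^ (α / 16) * (X ^ 8 *
          Real.exp (a * (α / 16) * X - a * (α / 16) * X ^ 4))) := by ring
        _ ≤ _ := by gcongr; exact h1 X hX0
    have t2 : (n : ℝ) ^ 2 * ((u + n + 1) * Δ ^ α / V) ≤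
        (η / 2) ^ 2 * ((3 + η / 2) * (E₁ ^ α * C₃)) := by
      have e1 : (u : ℝ) + n + 1 ≤ (3 + η / 2) * X ^ 4 := by
        have : X ≤ X ^ 4 := le_self_pow₀ hX1 (by norm_num)
        have : 1 ≤ X ^ 4 := one_le_pow₀ hX1
        linarith
      have e2 : Δ ^ α ≤ E₁ ^ α * Real.exp ((a + b) * α * X - 5 / 6 * a * α * X ^ 4) := by
        calc Δ ^ α ≤ (E₁ * Real.exp ((a + b) * X - 5 / 6 * a * X ^ 4)) ^ α := by gcongr
          _ = _ := by
              rw [Real.mul_rpow (by positivity) (by positivity), ← Real.exp_mul]; ring_nf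
      calc (n : ℝ) ^ 2 * ((u + n + 1) * Δ ^ α / V)
          = (n : ℝ) ^ 2 * ((u + n + 1) * Δ ^ α * V⁻¹) := by rw [div_eq_mul_inv]
        _ ≤ (η / 2) ^ 2 * X ^ 8 * ((3 + η / 2) * X ^ 4 * (E₁ ^ α *
            Real.exp ((a + b) * α * X - 5 / 6 * a * α * X ^ 4)) * Real.exp (d * X)) := by gcongr
        _ = (η / 2) ^ 2 * ((3 + η / 2) * (E₁ ^ α * (X ^ 12 *
            (Real.exp ((a + b) * α * X - 5 / 6 * a * α * X ^ 4) * Real.exp (d * X))))) := by ring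
        _ = (η / 2) ^ 2 * ((3 + η / 2) * (E₁ ^ α * (X ^ 12 *
            Real.exp (((a + b) * α + d) * X - 5 / 6 * a * α * X ^ 4)))) := by
            rw [← Real.exp_add]; ring_nf
        _ ≤ _ := by gcongr; exact h3 X hX0
    have t3 : (n : ℝ) ^ 2 * (ρ ^ u / V) ≤ (η / 2) ^ 2 * (Real.exp r * C₄) := by
      have e1 : ρ ^ u ≤ Real.exp (r - r * X) := by
        rw [← Real.rpow_natCast, Real.rpow_def_of_pos hρ]
        gcongr
        have : r * (X - 1) ≤ r * u := by gcongr
        linarith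
      have e2 : d * X ≤ r / 2 * X := by gcongr
      calc (n : ℝ) ^ 2 * (ρ ^ u / V) = (n : ℝ) ^ 2 * (ρ ^ u * V⁻¹) := by rw [div_eq_mul_inv]
        _ ≤ (η / 2) ^ 2 * X ^ 8 * (Real.exp (r - r * X) * Real.exp (d * X)) := by gcongr
        _ ≤ (η / 2) ^ 2 * X ^ 8 * (Real.exp r * Real.exp (√X - r / 2 * X)) := by
            rw [← Real.exp_add, ← Real.exp_add]
            refine mul_le_mul_of_nonneg_left (Real.exp_le_exp.2 ?_) (by positivity)
            linarith [Real.sqrt_nonneg X]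
        _ = (η / 2) ^ 2 * (Real.exp r * (X ^ 8 * Real.exp (√X - r / 2 * X))) := by ring
        _ ≤ _ := by gcongr; exact h4 X hX0
    rw [mul_add, mul_add]
    exact add_le_add (add_le_add t1 t2) t3

/-- The exceptional parameter sets contribute a bounded amount. -/
lemma exists_exceptional_le {K : ℝ} (hK : 0 < K) :
    ∃ C : ℝ, 0 < C ∧ ∀ m v n : ℕ, 1 ≤ m → v ≤ m →
      |(v : ℝ) - (m - (m : ℝ) ^ (1 / 4 : ℝ))| < 1 → (n : ℝ) ≤ η * m / 2 →
      (n : ℝ) ^ 2 * (l ^ (-(m : ℝ) ^ (1 / 4 : ℝ)) * Real.exp ((v : ℝ) ^ (1 / 8 : ℝ))) ≤ C ∧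
      (n : ℝ) ^ 2 * (K / lam ^ v) ≤ C := by
  have hη := h.η_pos
  have hll := h.log_lam_pos
  have hl0 := h.log_base_pos
  have hl1 : 0 < l := by linarith [h.one_lt_base]
  have hlam : 0 < lam := by linarith [h.one_lt_lam]
  set a := Real.log lam
  set d := Real.log l
  obtain ⟨C₁, hC₁, h1⟩ := exists_pow_mul_exp_quartic_le 8 a hll
  obtain ⟨C₄, hC₄, h4⟩ := exists_pow_mul_exp_sqrt_le 8 hl0
  refine ⟨(η / 2) ^ 2 * C₄ + (η / 2) ^ 2 * (K * Real.exp a * C₁), by positivity,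
    fun m v n hm1 hvm hv hn => ?_⟩
  set X := (m : ℝ) ^ (1 / 4 : ℝ) with hX
  have hX4 : X ^ 4 = m := quarter_pow m
  have hX0 : 0 ≤ X := by positivity
  have hnX : (n : ℝ) ≤ η / 2 * X ^ 4 := by rw [hX4]; linarith
  have hn2 : (n : ℝ) ^ 2 ≤ (η / 2) ^ 2 * X ^ 8 := by
    calc (n : ℝ) ^ 2 ≤ (η / 2 * X ^ 4) ^ 2 := by gcongr
      _ = _ := by ring
  have p1 : 0 ≤ (η / 2) ^ 2 * C₄ := by positivity
  have p2 : 0 ≤ (η / 2) ^ 2 * (K * Real.exp a * C₁) := by positivity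
  constructor
  · have e1 : (v : ℝ) ^ (1 / 8 : ℝ) ≤ √X := by
      rw [hX, Real.sqrt_eq_rpow, ← Real.rpow_mul (by positivity)]
      norm_num
      gcongr
    have e2 : l ^ (-X) = Real.exp (-(d * X)) := by
      rw [Real.rpow_def_of_pos hl1]; congr 1; ring
    refine le_trans ?_ (le_add_of_nonneg_right p2)
    calc (n : ℝ) ^ 2 * (l ^ (-X) * Real.exp ((v : ℝ) ^ (1 / 8 : ℝ)))
        ≤ (η / 2) ^ 2 * X ^ 8 * (Real.exp (-(d * X)) * Real.exp √X) := by rw [e2]; gcongr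
      _ = (η / 2) ^ 2 * (X ^ 8 * Real.exp (√X - d * X)) := by
          rw [← Real.exp_add, mul_assoc]; ring_nf
      _ ≤ _ := by gcongr; exact h4 X hX0
  · refine le_trans ?_ (le_add_of_nonneg_left p1)
    calc (n : ℝ) ^ 2 * (K / lam ^ v)
        ≤ (η / 2) ^ 2 * X ^ 8 * (K * Real.exp (a * (X + 1 - m))) := by
          rw [div_eq_mul_inv]
          gcongr
          exact h.inv_lam_pow_le hv
      _ = (η / 2) ^ 2 * (K * Real.exp a * (X ^ 8 * Real.exp (a * X - a * X ^ 4))) := by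
          rw [← hX4, show a * (X + 1 - X ^ 4) = a + (a * X - a * X ^ 4) by ring, Real.exp_add]
          ring
      _ ≤ _ := by gcongr; exact h1 X hX0

end RateRelations

/-- An integral over a countable partition with uniform control on the average over most pieces and
a cruder control on the others. -/
lemma enorm_setIntegral_le_of_partition {Q : Set (Set ℝ)} (hQ : Q.Countable)
    (hd : Q.PairwiseDisjoint id) (hm : ∀ ω ∈ Q, MeasurableSet ω) {S : Set ℝ}
    (hS : ∀ ω ∈ Q, ω ⊆ S) (hcov : ∀ᵐ a ∂volume.restrict S, ∃ ω ∈ Q, a ∈ ω)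
    (hSm : MeasurableSet S) {f : ℝ → ℝ} (hf : IntegrableOn f S) {bad : Set (Set ℝ)} {C₀ C₁ : ℝ≥0∞}
    (h0 : ∀ ω ∈ Q, ω ∉ bad → ‖∫ a in ω, f a‖ₑ ≤ C₀ * volume ω)
    (h1 : ∀ ω ∈ Q, ‖∫ a in ω, f a‖ₑ ≤ C₁ * volume ω) :
    ‖∫ a in S, f a‖ₑ ≤ C₀ * volume S + C₁ * ∑' ω : Q, bad.indicator volume (ω : Set ℝ) := by
  have := hQ.to_subtype
  have hdis : Pairwise (Function.onFun Disjoint fun ω : Q => (ω : Set ℝ)) := fun ω ω' h =>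
    hd ω.2 ω'.2 fun e => h (Subtype.ext e)
  have hUS : (⋃ ω : Q, (ω : Set ℝ)) ⊆ S := iUnion_subset fun ω => hS ω ω.2
  have hUae : (⋃ ω : Q, (ω : Set ℝ)) =ᵐ[volume] S := by
    refine (hUS.eventuallyLE).antisymm ?_
    filter_upwards [(ae_restrict_iff' hSm).1 hcov] with a ha haS
    obtain ⟨ω, hω, haω⟩ := ha haS
    exact mem_iUnion.2 ⟨⟨ω, hω⟩, haω⟩
  rw [← setIntegral_congr_set hUae, integral_iUnion
    (s := fun ω : Q => (ω : Set ℝ)) (fun ω => hm ω ω.2) hdis (hf.mono_set hUS)]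
  refine enorm_tsum_le_tsum_enorm.trans ?_
  calc ∑' ω : Q, ‖∫ a in (ω : Set ℝ), f a‖ₑ
      ≤ ∑' ω : Q, (C₀ * volume (ω : Set ℝ) + C₁ * bad.indicator volume (ω : Set ℝ)) := by
        refine ENNReal.tsum_le_tsum fun ω => ?_
        by_cases hb : (ω : Set ℝ) ∈ bad
        · rw [indicator_of_mem hb]
          exact (h1 ω ω.2).trans (le_add_left le_rfl)
        · exact (h0 ω ω.2 hb).trans (le_add_right le_rfl)
    _ = C₀ * volume (⋃ ω : Q, (ω : Set ℝ)) +
        C₁ * ∑' ω : Q, bad.indicator volume (ω : Set ℝ) := by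
        rw [ENNReal.tsum_add, ENNReal.tsum_mul_left, ENNReal.tsum_mul_left,
          measure_iUnion hdis fun ω => hm ω ω.2]
    _ ≤ _ := by gcongr

namespace ExpandingFamily

variable {α lam Lam : ℝ} {p₀ p₁ : ℕ} {F : ExpandingFamily α lam Lam p₀ p₁} {a : ℝ}
  {x₀ : ℝ → ℝ}

/-- The total length of the partition elements with small image. -/
lemma tsum_volume_small_le {ε ε' K t : ℝ} (hε : ε ≤ ε') (ht : 0 < t) {v : ℕ} (hv : 1 ≤ v)
    (hgood : ∀ ω ∈ F.paramPartition x₀ (Icc 0 ε) v, F.IsGoodInterval x₀ ε K v ω) {B : ℝ≥0∞}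
    (hB : ∑' ω : F.paramPartition x₀ (Icc 0 ε') v,
      (⨆ a ∈ (ω : Set ℝ), ENNReal.ofReal |deriv (F.orbit x₀ v) a|)⁻¹ ≤ B) :
    ∑' ω : F.paramPartition x₀ (Icc 0 ε) v,
      {ω : Set ℝ | volume.real (F.orbit x₀ v '' ω) < t}.indicator volume (ω : Set ℝ) ≤
      ENNReal.ofReal ((1 + K) * t) * B + ENNReal.ofReal (K / lam ^ v) := by
  set Q := F.paramPartition x₀ (Icc 0 ε) v with hQ
  set Q' := F.paramPartition x₀ (Icc 0 ε') v with hQ'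
  set sup : Set ℝ → ℝ≥0∞ := fun ω => ⨆ a ∈ ω, ENNReal.ofReal |deriv (F.orbit x₀ v) a| with hsup
  set last : Set (Set ℝ) := Q ∩ {ω | ∃ c < ε, ω = Ioo c ε} with hlast
  have hsub : last.Subsingleton := by
    rintro ω ⟨hω, c, hc, rfl⟩ ω' ⟨hω', c', hc', rfl⟩
    by_contra hne
    have h1 := partition_disjoint hv hω hω' hne
    have h2 : (max c c' + ε) / 2 ∈ Ioo c ε ∩ Ioo c' ε := by
      have h3 := le_max_left c c'
      have h4 := le_max_right c c'
      have h5 : max c c' < ε := max_lt hc hc'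
      exact ⟨⟨by linarith, by linarith⟩, ⟨by linarith, by linarith⟩⟩
    exact disjoint_left.1 h1 h2.1 h2.2
  have hpt : ∀ ω ∈ Q, {ω : Set ℝ | volume.real (F.orbit x₀ v '' ω) < t}.indicator volume ω ≤
      ENNReal.ofReal ((1 + K) * t) * Q'.indicator (fun ω => (sup ω)⁻¹) ω +
        last.indicator (fun _ => ENNReal.ofReal (K / lam ^ v)) ω := by
    intro ω hω
    have g := hgood ω hω
    have hK := g.K_pos
    by_cases hb : volume.real (F.orbit x₀ v '' ω) < t
    swap
    · rw [indicator_of_notMem (by exact hb)]; exact zero_le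
    rw [indicator_of_mem (by exact hb)]
    obtain ⟨c, d, hcd, rfl, h0, -⟩ := mem_partition hv hω
    have hdε : d ≤ ε := ((Ioo_subset_Ioo_iff hcd).1 h0).2
    rcases hdε.lt_or_eq with hd | rfl
    · refine le_trans ?_ (le_add_right le_rfl)
      rw [indicator_of_mem (partition_mono hε hcd hd hv hω), ← div_eq_mul_inv,
        ENNReal.le_div_iff_mul_le (Or.inr (by simp; positivity)) (Or.inr ENNReal.ofReal_ne_top)]
      rw [hsup]
      simp only [ENNReal.mul_iSup]
      refine iSup₂_le fun a ha => ?_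
      rw [← ENNReal.ofReal_toReal g.volume_ne_top, ← ENNReal.ofReal_mul ENNReal.toReal_nonneg]
      refine ENNReal.ofReal_le_ofReal ((g.volume_mul_le ha).trans ?_)
      gcongr
    · refine le_trans ?_ (le_add_left le_rfl)
      have hl : Ioo c d ∈ last := mem_inter hω ⟨c, hcd, rfl⟩
      rw [indicator_of_mem hl,
        ← ENNReal.ofReal_toReal g.volume_ne_top]
      exact ENNReal.ofReal_le_ofReal g.volume_le
  calc _ ≤ ∑' ω : Q, (ENNReal.ofReal ((1 + K) * t) *
          Q'.indicator (fun ω => (sup ω)⁻¹) (ω : Set ℝ) +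
        last.indicator (fun _ => ENNReal.ofReal (K / lam ^ v)) (ω : Set ℝ)) :=
        ENNReal.tsum_le_tsum fun ω => hpt ω ω.2
    _ = ENNReal.ofReal ((1 + K) * t) * ∑' ω : Q, Q'.indicator (fun ω => (sup ω)⁻¹) (ω : Set ℝ) +
        ∑' ω : Q, last.indicator (fun _ => ENNReal.ofReal (K / lam ^ v)) (ω : Set ℝ) := by
        rw [ENNReal.tsum_add, ENNReal.tsum_mul_left]
    _ ≤ _ := by
        gcongr
        · refine le_trans ?_ hB
          rw [tsum_subtype Q (Q'.indicator fun ω => (sup ω)⁻¹),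
            tsum_subtype Q' fun ω => (sup ω)⁻¹]
          exact ENNReal.tsum_le_tsum fun ω => indicator_le_self _ _ _
        · rw [tsum_subtype Q (last.indicator fun _ => ENNReal.ofReal (K / lam ^ v))]
          refine (ENNReal.tsum_le_tsum fun ω => indicator_le_self _ _ _).trans ?_
          rw [← tsum_subtype last fun _ => ENNReal.ofReal (K / lam ^ v)]
          rcases hsub.eq_empty_or_singleton with h | ⟨ω, h⟩
          · rw [h]; simp
          · rw [h]; simp

end ExpandingFamily

lemma one_lt_lamZero {α lam ρ κ : ℝ} (hα : 0 < α) (hlam : 1 < lam) (hρ : 0 < ρ) (hρ1 : ρ < 1)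
    (hκ : 0 < κ) : 1 < lamZero α lam ρ κ :=
  lt_min (Real.one_lt_rpow hlam (lt_min (by positivity) (by positivity)))
    (Real.one_lt_rpow_of_pos_of_lt_one_of_neg hρ hρ1 (by norm_num))

lemma ExpandingFamily.rateRelations {α lam Lam : ℝ} {p₀ p₁ : ℕ}
    (F : ExpandingFamily α lam Lam p₀ p₁) {ρ κ η : ℝ} (hρ : 0 < ρ) (hρ1 : ρ < 1) (hκ : 0 < κ)
    (hη : 0 < η) (h : ((p₁ : ℝ) * Lam / lam) ^ η ≤ lamZero α lam ρ κ) :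
    RateRelations α lam Lam η ρ (lamZero α lam ρ κ) where
  α_pos := F.α_pos
  α_le_one := F.α_le_one
  one_lt_lam := F.one_lt_lam
  lam_le_Lam := F.lam_le_Lam
  η_pos := hη
  ρ_pos := hρ
  one_lt_base := one_lt_lamZero F.α_pos F.one_lt_lam hρ hρ1 hκ
  base_le := (min_le_left _ _).trans
    (Real.rpow_le_rpow_of_exponent_le F.one_lt_lam.le (min_le_left _ _))
  base_le_rate := min_le_right _ _
  Lam_rpow_le := by
    refine le_trans ?_ h
    have h1 := F.lam_pos
    have h2 := F.Lam_pos
    refine Real.rpow_le_rpow h2.le ?_ hη.le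
    rw [le_div_iff₀ h1, mul_comm]
    gcongr
    exact F.lam_le_card

namespace ExpandingFamily

variable {α lam Lam : ℝ} {p₀ p₁ : ℕ} {F : ExpandingFamily α lam Lam p₀ p₁} {a : ℝ}
  {x₀ : ℝ → ℝ}

lemma partition_subset {ε : ℝ} {v : ℕ} {ω : Set ℝ}
    (hω : ω ∈ F.paramPartition x₀ (Icc 0 ε) v) : ω ⊆ Icc 0 ε := by
  rcases hω with ⟨-, rfl⟩ | ⟨-, -, h, -⟩
  · exact Subset.rfl
  · exact h

lemma exists_time {m : ℕ} (hm : 1 ≤ m) :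
    ∃ v : ℕ, |(v : ℝ) - (m - (m : ℝ) ^ (1 / 4 : ℝ))| < 1 := by
  have h1 : (m : ℝ) ^ (1 / 4 : ℝ) ≤ m := by
    conv_rhs => rw [← Real.rpow_one (m : ℝ)]
    exact Real.rpow_le_rpow_of_exponent_le (by exact_mod_cast hm) (by norm_num)
  have h2 : 0 ≤ (m : ℝ) - (m : ℝ) ^ (1 / 4 : ℝ) := by linarith
  refine ⟨⌊(m : ℝ) - (m : ℝ) ^ (1 / 4 : ℝ)⌋₊, abs_lt.2 ⟨?_, ?_⟩⟩
  · linarith [Nat.lt_floor_add_one ((m : ℝ) - (m : ℝ) ^ (1 / 4 : ℝ))]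
  · linarith [Nat.floor_le h2]

lemma le_time {m v N : ℕ} (hm : (N + 2) ^ 4 ≤ m)
    (hv : |(v : ℝ) - (m - (m : ℝ) ^ (1 / 4 : ℝ))| < 1) : N + 1 ≤ v := by
  have h4 := RateRelations.quarter_pow m
  set X := (m : ℝ) ^ (1 / 4 : ℝ)
  have hX0 : 0 ≤ X := by positivity
  have hX : (N : ℝ) + 2 ≤ X := by
    have : ((N : ℝ) + 2) ^ 4 ≤ X ^ 4 := by rw [h4]; exact_mod_cast hm
    exact le_of_pow_le_pow_left₀ (by norm_num) hX0 this
  have h1 := (abs_lt.1 hv).1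
  have hX2 : 2 ≤ X := by linarith [Nat.cast_nonneg (α := ℝ) N]
  have h2 : 2 * X ≤ X ^ 4 := by
    have : (2 : ℝ) ^ 3 ≤ X ^ 3 := by gcongr
    calc 2 * X ≤ X ^ 3 * X := by gcongr; linarith
      _ = X ^ 4 := by ring
  have h3 : (N : ℝ) < v := by rw [← h4] at h1; linarith
  exact_mod_cast h3

/-- The uniform second moment bounds, globally and on partition elements with large image. -/
lemma ParamExpansion.exists_variance_bound {ε ε' G M c A C r D ρ ρ' η l s C₃ : ℝ} {N : ℕ}
    (P : F.ParamExpansion x₀ ε G M c N) (H : F.SpectralGap A ε C r D ρ) {φ : ℝ → ℝ}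
    (hφ : MemGBV α A φ) (hs : 0 < s) (hσ : ∀ a ∈ Icc 0 ε, s ≤ F.sigma φ a) (hε : ε ≤ ε')
    (hIII : ∀ n : ℕ, 1 ≤ n → ∑' ω : F.paramPartition x₀ (Icc 0 ε') n,
      (⨆ a ∈ (ω : Set ℝ), ENNReal.ofReal |deriv (F.orbit x₀ n) a|)⁻¹ ≤
        ENNReal.ofReal (C₃ * Real.exp ((n : ℝ) ^ (1 / 8 : ℝ))))
    (hρ' : 0 < ρ') (hρ'1 : ρ' < 1) (hdec : F.UniformDecay A ε ρ')
    (hrate : RateRelations α lam Lam η ρ' l) :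
    ∃ C : ℝ, ∀ m n : ℕ, 1 ≤ m → 1 ≤ n → (n : ℝ) ≤ η * m / 2 →
      IntegrableOn (fun a => (∑ k ∈ Finset.Ico m (m + n), F.xi x₀ φ k a) ^ 2) (Icc 0 ε) ∧
      |ε⁻¹ * (∫ a in Icc 0 ε, (∑ k ∈ Finset.Ico m (m + n), F.xi x₀ φ k a) ^ 2) - n| ≤ C ∧
      ∀ v : ℕ, |(v : ℝ) - (m - (m : ℝ) ^ (1 / 4 : ℝ))| < 1 →
        ∀ ω ∈ F.paramPartition x₀ (Icc 0 ε) v,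
          l ^ (-(m : ℝ) ^ (1 / 4 : ℝ)) ≤ (volume (F.orbit x₀ v '' ω)).toReal →
          (volume (F.orbit x₀ v '' ω)).toReal ≤ (n : ℝ) ^ (-3 / α) →
          |(volume ω).toReal⁻¹ *
              (∫ a in ω, (∑ k ∈ Finset.Ico m (m + n), F.xi x₀ φ k a) ^ 2) - n| ≤ C := by
  obtain ⟨K, hK, hgood⟩ := P.exists_isGoodInterval
  obtain ⟨E, hE, R, hR, hloc⟩ := P.exists_local_variance H hφ hs hσ hρ' hρ'1 hdec hK
  have hA := H.A_pos
  obtain ⟨Cn, hCn, m₁, herr⟩ := hrate.exists_error_le hE hK (lt_min hA one_pos)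
  obtain ⟨Ce, hCe, hexc⟩ := hrate.exists_exceptional_le hK
  have hε0 := P.ε_pos
  have hη := hrate.η_pos
  have hl1 : 0 < l := by linarith [hrate.one_lt_base]
  set M₁ := (2 * (supConst A * nrm α A φ) / s) ^ 2 + 1 with hM₁
  have hM₁0 : 0 < M₁ := by positivity
  set m₂ := max m₁ ((N + 2) ^ 4) with hm₂
  set Cc := (η * m₂ / 2) ^ 2 * M₁ with hCc
  have hCc0 : 0 ≤ Cc := by positivity
  set Cg := R * (1 + Cn) with hCg
  have hCg0 : 0 < Cg := by positivity
  set Cx := M₁ * (((1 + K) * |C₃| + 1) * Ce) with hCx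
  have hCx0 : 0 < Cx := by positivity
  have hcrude : ∀ m n : ℕ, 1 ≤ m → 1 ≤ n → ∀ ω ⊆ Icc 0 ε,
      |(volume.real ω)⁻¹ * (∫ a in ω, (∑ k ∈ Finset.Ico m (m + n), F.xi x₀ φ k a) ^ 2) - n| ≤
        n ^ 2 * M₁ := by
    intro m n hm hn ω hω
    have h1 := P.setIntegral_sq_sum_xi_le H hφ hs hσ hm n hω
    have h0 : 0 ≤ ∫ a in ω, (∑ k ∈ Finset.Ico m (m + n), F.xi x₀ φ k a) ^ 2 :=
      integral_nonneg fun _ => sq_nonneg _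
    have hW : 0 ≤ volume.real ω := measureReal_nonneg
    have h2 : (volume.real ω)⁻¹ *
        (∫ a in ω, (∑ k ∈ Finset.Ico m (m + n), F.xi x₀ φ k a) ^ 2) ≤
        n ^ 2 * (2 * (supConst A * nrm α A φ) / s) ^ 2 := by
      calc _ ≤ (volume.real ω)⁻¹ *
            (n ^ 2 * (2 * (supConst A * nrm α A φ) / s) ^ 2 * volume.real ω) := by gcongr
        _ = n ^ 2 * (2 * (supConst A * nrm α A φ) / s) ^ 2 *
            ((volume.real ω)⁻¹ * volume.real ω) := by ring
        _ ≤ n ^ 2 * (2 * (supConst A * nrm α A φ) / s) ^ 2 * 1 := by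
            gcongr
            exact inv_mul_le_one
        _ = _ := mul_one _
    have h3 : (n : ℝ) ≤ (n : ℝ) ^ 2 := by exact_mod_cast Nat.le_self_pow two_ne_zero n
    have h4 : 0 ≤ (volume.real ω)⁻¹ *
        (∫ a in ω, (∑ k ∈ Finset.Ico m (m + n), F.xi x₀ φ k a) ^ 2) := by positivity
    have h5 : 0 ≤ (n : ℝ) ^ 2 * (2 * (supConst A * nrm α A φ) / s) ^ 2 := by positivity
    rw [hM₁, mul_add, mul_one]
    exact abs_le.2 ⟨by linarith, by linarith [Nat.cast_nonneg (α := ℝ) n]⟩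
  have hsmallm : ∀ m n : ℕ, m < m₂ → (n : ℝ) ≤ η * m / 2 → (n : ℝ) ^ 2 * M₁ ≤ Cc := by
    intro m n hm hn
    have h1 : (n : ℝ) ≤ η * m₂ / 2 := hn.trans (by gcongr)
    rw [hCc]
    gcongr
  have htime : ∀ m v : ℕ, 1 ≤ m → m₂ ≤ m → |(v : ℝ) - (m - (m : ℝ) ^ (1 / 4 : ℝ))| < 1 →
      N ≤ v ∧ 1 ≤ v ∧ ∃ u, 1 ≤ u ∧ v + u = m := by
    intro m v hm1 hm hv
    have h1 := le_time ((le_max_right _ _).trans hm) hv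
    have h2 : (1 : ℝ) ≤ (m : ℝ) ^ (1 / 4 : ℝ) :=
      Real.one_le_rpow (by exact_mod_cast hm1) (by norm_num)
    have h3 : (v : ℝ) < m := by linarith [(abs_lt.1 hv).2]
    have h4 : v < m := by exact_mod_cast h3
    exact ⟨by lia, by lia, m - v, by lia, by lia⟩
  have hlarge : ∀ m n : ℕ, 1 ≤ m → m₂ ≤ m → (n : ℝ) ≤ η * m / 2 → ∀ v : ℕ,
      |(v : ℝ) - (m - (m : ℝ) ^ (1 / 4 : ℝ))| < 1 →
      ∀ ω ∈ F.paramPartition x₀ (Icc 0 ε) v,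
        l ^ (-(m : ℝ) ^ (1 / 4 : ℝ)) ≤ volume.real (F.orbit x₀ v '' ω) →
        |(volume.real ω)⁻¹ *
          (∫ a in ω, (∑ k ∈ Finset.Ico m (m + n), F.xi x₀ φ k a) ^ 2) - n| ≤ Cg := by
    intro m n hm1 hm hn v hv ω hω hV
    obtain ⟨hvN, hv1, u, hu, hvu⟩ := htime m v hm1 hm hv
    have g := hgood v hvN hv1 ω hω
    obtain ⟨h1, h2⟩ := herr m ((le_max_left _ _).trans hm) hm1 v u n hvu hv hn _ _ g.volume_pos
      g.volume_le hV
    have h3 := hloc v hv1 ω g u n hu h1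
    rw [hvu] at h3
    refine h3.trans ?_
    rw [hCg]
    gcongr
  refine ⟨Cc + Cg + ε⁻¹ * Cx, fun m n hm hn hnm => ⟨P.integrable_sq_sum_xi H hφ hs hσ hm n, ?_,
    fun v hv ω hω hV _ => ?_⟩⟩
  swap
  · have h0 : 0 < ε⁻¹ * Cx := by positivity
    rcases lt_or_ge m m₂ with h | h
    · exact (hcrude m n hm hn ω (partition_subset hω)).trans
        ((hsmallm m n h hnm).trans (by linarith))
    · exact (hlarge m n hm h hnm v hv ω hω hV).trans (by linarith)
  have h0 : 0 < ε⁻¹ * Cx := by positivity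
  have hvol : volume.real (Icc 0 ε) = ε := by
    rw [Real.volume_real_Icc_of_le hε0.le, sub_zero]
  rcases lt_or_ge m m₂ with h | h
  · have h1 := hcrude m n hm hn (Icc 0 ε) Subset.rfl
    rw [hvol] at h1
    exact h1.trans ((hsmallm m n h hnm).trans (by linarith))
  obtain ⟨v, hv⟩ := exists_time hm
  obtain ⟨hvN, hv1, u, hu, hvu⟩ := htime m v hm h hv
  have hg : ∀ ω ∈ F.paramPartition x₀ (Icc 0 ε) v, F.IsGoodInterval x₀ ε K v ω := hgood v hvN hv1
  set S : ℝ → ℝ := fun a => (∑ k ∈ Finset.Ico m (m + n), F.xi x₀ φ k a) ^ 2 with hS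
  have hSi : IntegrableOn S (Icc 0 ε) := P.integrable_sq_sum_xi H hφ hs hσ hm n
  set t := l ^ (-(m : ℝ) ^ (1 / 4 : ℝ)) with ht
  have ht0 : 0 < t := Real.rpow_pos_of_pos hl1 _
  have hsub : ∀ ω ∈ F.paramPartition x₀ (Icc 0 ε) v, ω ⊆ Icc 0 ε := fun ω hω => partition_subset hω
  have hint : ∀ ω ∈ F.paramPartition x₀ (Icc 0 ε) v, ∀ B : ℝ, 0 ≤ B →
      |(volume.real ω)⁻¹ * (∫ a in ω, S a) - n| ≤ B →
      ‖∫ a in ω, (S a - n)‖ₑ ≤ ENNReal.ofReal B * volume ω := by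
    intro ω hω B hB h1
    have g := hg ω hω
    have hW := g.volume_pos
    rw [integral_sub (hSi.mono_set (hsub ω hω)) (integrableOn_const g.volume_ne_top),
      setIntegral_const, smul_eq_mul, ← ENNReal.ofReal_toReal g.volume_ne_top,
      ← ENNReal.ofReal_mul hB, Real.enorm_eq_ofReal_abs]
    refine ENNReal.ofReal_le_ofReal ?_
    have e : (∫ a in ω, S a) - volume.real ω * n =
        volume.real ω * ((volume.real ω)⁻¹ * (∫ a in ω, S a) - n) := by field_simp
    rw [e, abs_mul, abs_of_pos hW, mul_comm]
    gcongr
    exact le_rfl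
  have hmain := enorm_setIntegral_le_of_partition (partition_countable hv1)
    (partition_disjoint hv1) (fun ω hω => (hg ω hω).measurableSet) hsub (P.ae_mem_partition hv1)
    measurableSet_Icc (hSi.sub (integrableOn_const (C := (n : ℝ)) (by simp)))
    (bad := {ω : Set ℝ | volume.real (F.orbit x₀ v '' ω) < t}) (C₀ := ENNReal.ofReal Cg)
    (C₁ := ENNReal.ofReal (n ^ 2 * M₁))
    (fun ω hω hb => hint ω hω _ hCg0.le (hlarge m n hm h hnm v hv ω hω (not_lt.1 hb)))
    (fun ω hω => hint ω hω _ (by positivity) (hcrude m n hm hn ω (hsub ω hω)))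
  have hC₃ : ∑' ω : F.paramPartition x₀ (Icc 0 ε') v,
      (⨆ a ∈ (ω : Set ℝ), ENNReal.ofReal |deriv (F.orbit x₀ v) a|)⁻¹ ≤
        ENNReal.ofReal (|C₃| * Real.exp ((v : ℝ) ^ (1 / 8 : ℝ))) :=
    (hIII v hv1).trans (ENNReal.ofReal_le_ofReal (by gcongr; exact le_abs_self _))
  have hbad := tsum_volume_small_le hε ht0 hv1 hg hC₃
  have hlam := F.lam_pos
  obtain ⟨hx1, hx2⟩ := hexc m v n hm (by lia) hv hnm
  have htot : |∫ a in Icc 0 ε, (S a - n)| ≤ Cg * ε + Cx := by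
    rw [← ENNReal.ofReal_le_ofReal_iff (by positivity)]
    rw [← Real.enorm_eq_ofReal_abs]
    refine hmain.trans ((add_le_add_right (mul_le_mul_right hbad _) _).trans ?_)
    rw [← ENNReal.ofReal_mul (by positivity), ← ENNReal.ofReal_add (by positivity) (by positivity),
      ← ENNReal.ofReal_mul (by positivity), Real.volume_Icc, sub_zero,
      ← ENNReal.ofReal_mul hCg0.le, ← ENNReal.ofReal_add (by positivity) (by positivity)]
    refine ENNReal.ofReal_le_ofReal (add_le_add_right ?_ _)
    calc (n : ℝ) ^ 2 * M₁ * ((1 + K) * t * (|C₃| * Real.exp ((v : ℝ) ^ (1 / 8 : ℝ))) +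
          K / lam ^ v) = M₁ * ((1 + K) * |C₃| *
          ((n : ℝ) ^ 2 * (t * Real.exp ((v : ℝ) ^ (1 / 8 : ℝ)))) +
          (n : ℝ) ^ 2 * (K / lam ^ v)) := by ring
      _ ≤ M₁ * ((1 + K) * |C₃| * Ce + Ce) := by gcongr
      _ = Cx := by rw [hCx]; ring
  have e : ε⁻¹ * (∫ a in Icc 0 ε, S a) - n = ε⁻¹ * ∫ a in Icc 0 ε, (S a - n) := by
    rw [integral_sub hSi (integrableOn_const (by simp)), setIntegral_const, smul_eq_mul, hvol]
    field_simp
  show |ε⁻¹ * (∫ a in Icc 0 ε, S a) - n| ≤ _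
  rw [e, abs_mul, abs_of_pos (inv_pos.2 hε0)]
  calc _ ≤ ε⁻¹ * (Cg * ε + Cx) := by gcongr
    _ = Cg + ε⁻¹ * Cx := by field_simp
    _ ≤ _ := by linarith

end ExpandingFamily

theorem proposition5p1 {α lam Lam : ℝ} {p₀ p₁ : ℕ}
    (F : ExpandingFamily α lam Lam p₀ p₁) (A : ℝ) (hA : 0 < A)
    (x₀ : ℝ → ℝ) (hx₀ : F.IsStartingPoint x₀)
    (hI : F.Transversal x₀) (hII : F.UniformLasotaYorke A) (hIII : F.SmallImageControl x₀)
    (φ : ℝ → ℝ) (hφ : MemGBV α A φ) (hσ : 0 < F.sigma φ 0) :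
    ∃ ε₀ : ℝ, 0 < ε₀ ∧ ε₀ ≤ 1 ∧
      (∀ a ∈ Icc 0 ε₀, 0 < F.sigma φ a) ∧
      (∃ ρ κ : ℝ, F.AdmissibleRates A φ ε₀ ρ κ) ∧
      ∀ ε : ℝ, 0 < ε → ε ≤ ε₀ → ∀ ρ κ : ℝ, F.AdmissibleRates A φ ε ρ κ →
      ∀ η : ℝ, 0 < η → ((p₁ : ℝ) * Lam / lam) ^ η ≤ lamZero α lam ρ κ →
      ∃ C : ℝ, ∀ m n : ℕ, 1 ≤ m → 1 ≤ n → (n : ℝ) ≤ η * m / 2 →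
        IntegrableOn (fun a => (∑ k ∈ Finset.Ico m (m + n), F.xi x₀ φ k a) ^ 2) (Icc 0 ε) ∧
        |ε⁻¹ * (∫ a in Icc 0 ε, (∑ k ∈ Finset.Ico m (m + n), F.xi x₀ φ k a) ^ 2) - n| ≤ C ∧
        ∀ v : ℕ, |(v : ℝ) - (m - (m : ℝ) ^ (1 / 4 : ℝ))| < 1 →
          ∀ ω ∈ F.paramPartition x₀ (Icc 0 ε) v,
            lamZero α lam ρ κ ^ (-(m : ℝ) ^ (1 / 4 : ℝ)) ≤
              (volume (F.orbit x₀ v '' ω)).toReal →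
            (volume (F.orbit x₀ v '' ω)).toReal ≤ (n : ℝ) ^ (-3 / α) →
            |(volume ω).toReal⁻¹ *
                (∫ a in ω, (∑ k ∈ Finset.Ico m (m + n), F.xi x₀ φ k a) ^ 2) - n| ≤ C := by
  obtain ⟨ε₁, C, r, H₁⟩ := hII.exists_lasotaYorke hA
  obtain ⟨ε₂, D, ρ₀, H₂⟩ := H₁.exists_spectralGap hII.1
  obtain ⟨ε₃, hε₃, hε₃₂, hσge⟩ := H₂.exists_sigma_ge hφ hσ
  obtain ⟨ε₄, G, M, c, N, P₄⟩ := hI.exists_paramExpansion hx₀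
  obtain ⟨ε₅, hε₅, -, hsmall⟩ := hIII
  obtain ⟨C₅, hC₅⟩ := hsmall (1 / 8) (by norm_num)
  have hε₀ : 0 < min ε₃ (min ε₄ ε₅) := lt_min hε₃ (lt_min P₄.ε_pos hε₅)
  have hle3 : min ε₃ (min ε₄ ε₅) ≤ ε₃ := min_le_left _ _
  have hle4 : min ε₃ (min ε₄ ε₅) ≤ ε₄ := (min_le_right _ _).trans (min_le_left _ _)
  have hle5 : min ε₃ (min ε₄ ε₅) ≤ ε₅ := (min_le_right _ _).trans (min_le_right _ _)
  refine ⟨min ε₃ (min ε₄ ε₅), hε₀, hle4.trans P₄.ε_le_one, fun a ha => ?_, ⟨ρ₀, ?_⟩,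
    fun ε hε hεle ρ κ hadm η hη hlam => ?_⟩
  · exact (half_pos hσ).trans_le (hσge a ⟨ha.1, ha.2.trans hle3⟩)
  · exact (H₂.mono hε₀ (hle3.trans hε₃₂)).exists_admissibleRates hφ
  have H := H₂.mono hε (hεle.trans (hle3.trans hε₃₂))
  have P := P₄.mono hε (hεle.trans hle4)
  exact P.exists_variance_bound H hφ (half_pos hσ)
    (fun a ha => hσge a ⟨ha.1, ha.2.trans (hεle.trans hle3)⟩) (hεle.trans hle5) hC₅ hadm.ρ_pos
    hadm.ρ_lt_one hadm.decay (F.rateRelations hadm.ρ_pos hadm.ρ_lt_one hadm.κ_pos hη hlam)
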